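/- Let $P_0$ be a locally compact group on which the multiplicative group $\mathbb R_+^*$ acts continuously by automorphisms $g\mapsto g^r$, and let $P=\mathbb R_+^*\ltimes P_0$ (so that $r g r^{-1}=g^r$). Let $T$ be a strongly continuous orthogonal or unitary representation of $P_0$ in a real or complex Hilbert space $H$ which is canonical: there are a unit cyclic vector $h\in H$ and a function $c$ on $P_0$ such that, for every $g\in P_0$, $\|T(g^r)h-h\|<c(g)\,r$ for all sufficiently small $r>0$. Fix such an $h$ and put $T_r(g)=T(g^r)$. Let $(X,m)$ be a standard Borel space with a probability measure without atoms. Let $P^X$ be the group of currents, i.e. of measurable maps $X\to P$ with relatively compact range, under pointwise multiplication (measurable meaning: the pointwise limit of a sequence of measurable maps with finitely many values; for second countable $P_0$ this is Borel measurability). *Special representation.* $\widetilde T$ is the representation of $P$ in $\mathcal H=L^2(\mathbb R_+^*,r^{-1}dr;H)$ with $(\widetilde T(g)f)(r)=T_r(g)f(r)$ for $g\in P_0$ and $(\widetilde T(r_0)f)(r)=f(r_0r)$ for $r_0\in\mathbb R_+^*$, and $b:P\to\mathcal H$ is the $1$-cocycle $b(p)=\widetilde T(p)f_0-f_0$ with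 $f_0(r)=e^{-r/2}h$ (here $f_0\notin\mathcal H$, but $b(p)\in\mathcal H$). *Integral model.* Let $l^1_+(X)$ be the cone of measures $\xi=\sum_{k=1}^\infty r_k\delta_{x_k}$ with $r_k>0$, $\sum_k r_k<\infty$ and distinct $x_k\in X$; it carries a unique $\sigma$-finite measure $\mathcal L$ such that $$\int_{l^1_+(X)}\exp\Bigl(-\sum_k r_kf(x_k)\Bigr)\,d\mathcal L(\xi)=\exp\Bigl(-\int_X\log f\,dm\Bigr)$$ for all measurable $f:X\to(0,\infty)$ with $\log f\in L^1(m)$. For $\xi=\{r_k,x_k\}$ let $H_\xi=\bigotimes_k H_{r_k}$, $H_{r_k}=H$, be the countable tensor product, over the atoms of $\xi$, with stabilizing vector $h$. The representation $U=\mathrm{INT}\,T$ of $P^X$ acts in the direct integral $\int^\oplus H_\xi\,d\mathcal L(\xi)$ by $$(U(g)F)(\xi)=\Bigl(\bigotimes_kT_{r_k}(g(x_k))\Bigr)F(\xi)\quad(g\in P_0^X),\qquad (U(r_0)F)(\xi)=e^{\frac12\int_X\log r_0\,dm}\,F(r_0\xi)\quad(r_0\in(\mathbb R_+^*)^X),$$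 where $r_0\xi=\{r_0(x_k)r_k,x_k\}$. *Fock representation.* Let $\mathcal H^X=L^2(X,m;\mathcal H)$, $(\widetilde T^X(p)v)(x)=\widetilde T(p(x))v(x)$, $b^X(p)(x)=b(p(x))$, $\mathrm{EXP}\,\mathcal H^X=\bigoplus_{k\ge0}S^k\mathcal H^X$ and $\mathrm{EXP}\,v=\bigoplus_k (k!)^{-1/2}v^{\otimes k}$. The Fock representation $W$ of $P^X$ associated with $\widetilde T$ and $b$ acts in $\mathrm{EXP}\,\mathcal H^X$ by $$W(p)\,\mathrm{EXP}\,v=\exp\Bigl(-\tfrac12\|b^X(p)\|^2-(\widetilde T^X(p)v,b^X(p))\Bigr)\,\mathrm{EXP}\bigl(\widetilde T^X(p)v+b^X(p)\bigr),$$ the inner product being linear in the first argument. **Theorem.** All these objects are well defined: $\mathcal L$ exists and is unique, $b(p)\in\mathcal H$ and $b^X(p)\in\mathcal H^X$, the formulas above define orthogonal (respectively unitary) representations $\widetilde T$, $\widetilde T^X$, $U$ and orthogonal (unitary) operators $W(p)$. Moreover, the integral model $U=\mathrm{INT}\,T$ of $P^X$ is projectively equivalent to the Fock representation $W$: there are an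 isometric isomorphism $J$ of $\int^\oplus H_\xi\,d\mathcal L(\xi)$ onto $\mathrm{EXP}\,\mathcal H^X$ and scalars $c(p)$ with $|c(p)|=1$ such that $J\,U(p)=c(p)\,W(p)\,J$ for all $p\in P^X$. -/

import Mathlib

open MeasureTheory Filter Topology
open scoped ENNReal NNReal ComplexOrder

noncomputable section

/-! ### Hilbert spaces spanned by vectors with prescribed inner products -/

section KernelSpace

variable {𝕜 : Type*} [RCLike 𝕜] {E E' E'' : Type*}

/-- The sesquilinear form on formal linear combinations of elements of `E` with
`⟪e, e'⟫ = K e e'`. -/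
def kernelForm (K : Matrix E E 𝕜) (f g : E →₀ 𝕜) : 𝕜 :=
  f.sum fun i a => g.sum fun j b => star a * K i j * b

theorem kernelForm_single (K : Matrix E E 𝕜) (i j : E) (a b : 𝕜) :
    kernelForm K (Finsupp.single i a) (Finsupp.single j b) = star a * K i j * b := by
  simp [kernelForm]

theorem kernelForm_conj {K : Matrix E E 𝕜} (hK : K.PosSemidef) (f g : E →₀ 𝕜) :
    (starRingEnd 𝕜) (kernelForm K g f) = kernelForm K f g := by
  unfold kernelForm
  rw [Finsupp.sum_comm]
  simp only [map_finsuppSum]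
  refine Finsupp.sum_congr fun i _ => Finsupp.sum_congr fun j _ => ?_
  rw [← hK.isHermitian.apply i j]
  simp only [map_mul, RCLike.star_def, RCLike.conj_conj]
  ring

theorem kernelForm_add (K : Matrix E E 𝕜) (f g k : E →₀ 𝕜) :
    kernelForm K (f + g) k = kernelForm K f k + kernelForm K g k := by
  unfold kernelForm
  rw [Finsupp.sum_add_index'] <;> simp [← Finsupp.sum_add, add_mul]

theorem kernelForm_smul (K : Matrix E E 𝕜) (f g : E →₀ 𝕜) (c : 𝕜) :
    kernelForm K (c • f) g = (starRingEnd 𝕜) c * kernelForm K f g := by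
  unfold kernelForm
  rw [Finsupp.sum_smul_index] <;> simp [Finsupp.mul_sum, mul_assoc]

theorem kernelForm_mapDomain {K : Matrix E E 𝕜} {K' : Matrix E' E' 𝕜} (σ : E → E')
    (hσ : ∀ e e', K' (σ e) (σ e') = K e e') (f g : E →₀ 𝕜) :
    kernelForm K' (f.mapDomain σ) (g.mapDomain σ) = kernelForm K f g := by
  unfold kernelForm
  rw [Finsupp.sum_mapDomain_index (by simp) (by simp [add_mul, Finsupp.sum_add])]
  refine Finsupp.sum_congr fun i _ => ?_
  rw [Finsupp.sum_mapDomain_index (by simp) (by simp [mul_add])]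
  simp [hσ]

/-- Formal finite linear combinations of the elements of `E`, endowed with the
semi-inner product determined by `⟪e, e'⟫ = K e e'`. -/
def PreKernelSpace (K : Matrix E E 𝕜) (_ : K.PosSemidef) : Type _ := E →₀ 𝕜

namespace PreKernelSpace

variable (K : Matrix E E 𝕜) (hK : K.PosSemidef)

instance : AddCommGroup (PreKernelSpace K hK) := inferInstanceAs (AddCommGroup (E →₀ 𝕜))

instance : Module 𝕜 (PreKernelSpace K hK) := inferInstanceAs (Module 𝕜 (E →₀ 𝕜))

instance core : PreInnerProductSpace.Core 𝕜 (PreKernelSpace K hK) where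
  inner f g := kernelForm K f g
  conj_inner_symm f g := kernelForm_conj hK f g
  re_inner_nonneg f := (RCLike.nonneg_iff.mp (hK.2 f)).1
  add_left f g k := kernelForm_add K f g k
  smul_left f g c := kernelForm_smul K f g c

instance : SeminormedAddCommGroup (PreKernelSpace K hK) :=
  InnerProductSpace.Core.toSeminormedAddCommGroup (𝕜 := 𝕜)

instance : InnerProductSpace 𝕜 (PreKernelSpace K hK) := .ofCore _

theorem inner_def (f g : PreKernelSpace K hK) : inner 𝕜 f g = kernelForm K f g := rfl

variable {K}

/-- The formal linear combination consisting of the single element `e`. -/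
def single (e : E) : PreKernelSpace K hK := Finsupp.single e (1 : 𝕜)

theorem inner_single (e e' : E) : inner 𝕜 (single hK e) (single hK e') = K e e' := by
  rw [inner_def, single, single]
  exact (kernelForm_single K e e' 1 1).trans (by simp)

theorem span_single : Submodule.span 𝕜 (Set.range (single hK)) = ⊤ := by
  rw [eq_top_iff]
  rintro f -
  induction f using Finsupp.induction_linear with
  | zero => exact zero_mem _
  | add f g hf hg => exact add_mem hf hg
  | single e a =>
    have h1 : (Finsupp.single e a : E →₀ 𝕜) = a • (Finsupp.single e (1 : 𝕜) : E →₀ 𝕜) := by simp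
    rw [h1]
    exact Submodule.smul_mem _ _ (Submodule.subset_span ⟨e, rfl⟩)

/-- A map of index sets that preserves the Gram matrices induces a linear isometry. -/
def map {K' : Matrix E' E' 𝕜} (hK' : K'.PosSemidef) (σ : E → E')
    (hσ : ∀ e e', K' (σ e) (σ e') = K e e') :
    PreKernelSpace K hK →ₗᵢ[𝕜] PreKernelSpace K' hK' where
  toLinearMap := (Finsupp.lmapDomain 𝕜 𝕜 σ : (E →₀ 𝕜) →ₗ[𝕜] (E' →₀ 𝕜))
  norm_map' f := by
    have h2 := congrArg RCLike.re (kernelForm_mapDomain σ hσ f f)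
    have h3 := norm_sq_eq_re_inner (𝕜 := 𝕜) f
    have h4 := norm_sq_eq_re_inner (𝕜 := 𝕜) (E := PreKernelSpace K' hK') (f.mapDomain σ)
    exact (sq_eq_sq₀ (norm_nonneg _) (norm_nonneg _)).mp ((h4.trans h2).trans h3.symm)

end PreKernelSpace

/-- The Hilbert space generated by a total family of vectors indexed by `E` with Gram matrix `K`:
the (Hausdorff) completion of the space of formal linear combinations. -/
abbrev KernelSpace (K : Matrix E E 𝕜) (hK : K.PosSemidef) : Type _ :=
  UniformSpace.Completion (PreKernelSpace K hK)

namespace KernelSpace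

variable {K : Matrix E E 𝕜} (hK : K.PosSemidef) {K' : Matrix E' E' 𝕜} (hK' : K'.PosSemidef)

/-- The generating vector with index `e`. -/
def vec (e : E) : KernelSpace K hK := UniformSpace.Completion.coe' (PreKernelSpace.single hK e)

theorem inner_vec (e e' : E) : inner 𝕜 (vec hK e) (vec hK e') = K e e' := by
  rw [vec, vec, UniformSpace.Completion.inner_coe, PreKernelSpace.inner_single]

/-- A map of index sets that preserves the Gram matrices induces a linear isometry. -/
def map (σ : E → E') (hσ : ∀ e e', K' (σ e) (σ e') = K e e') :
    KernelSpace K hK →ₗᵢ[𝕜] KernelSpace K' hK' where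
  toLinearMap := (((UniformSpace.Completion.toComplL (𝕜 := 𝕜)
    (E := PreKernelSpace K' hK')).comp
      (PreKernelSpace.map hK hK' σ hσ).toContinuousLinearMap).extend
        (UniformSpace.Completion.toComplL (𝕜 := 𝕜) (E := PreKernelSpace K hK))).toLinearMap
  norm_map' f := by
    have h1 := UniformSpace.Completion.denseRange_coe (α := PreKernelSpace K hK)
    have h2 := UniformSpace.Completion.isUniformInducing_coe (PreKernelSpace K hK)
    induction f using UniformSpace.Completion.induction_on with
    | hp => exact isClosed_eq (ContinuousLinearMap.continuous _).norm continuous_norm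
    | ih f =>
      refine (congrArg norm (ContinuousLinearMap.extend_eq _ h1 h2 f)).trans ?_
      simp

theorem map_vec (σ : E → E') (hσ : ∀ e e', K' (σ e) (σ e') = K e e') (e : E) :
    map hK hK' σ hσ (vec hK e) = vec hK' (σ e) := by
  have h1 := UniformSpace.Completion.denseRange_coe (α := PreKernelSpace K hK)
  have h2 := UniformSpace.Completion.isUniformInducing_coe (PreKernelSpace K hK)
  refine (ContinuousLinearMap.extend_eq _ h1 h2 (PreKernelSpace.single hK e)).trans ?_
  refine congrArg (UniformSpace.Completion.coe' (α := PreKernelSpace K' hK')) ?_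
  exact (Finsupp.mapDomain_single : Finsupp.mapDomain σ (Finsupp.single e (1 : 𝕜)) = _)

end KernelSpace

end KernelSpace

/-! ### Infinite tensor products with a stabilizing vector -/

section StabTensor

/-- Families of vectors of `H` equal to the unit vector `h` at all but finitely many indices;
they index the elementary tensors `⊗ᵢ fᵢ`. -/
structure StabFamily (ι : Type*) {H : Type*} [NormedAddCommGroup H]
    (h : Metric.sphere (0 : H) 1) where
  val : ι → H
  finite : {i | val i ≠ h}.Finite

variable (𝕜 : Type*) [RCLike 𝕜] (ι : Type*) {κ H : Type*} [NormedAddCommGroup H]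
  [InnerProductSpace 𝕜 H] (h : Metric.sphere (0 : H) 1)

/-- The inner products `∏ᵢ ⟪fᵢ, gᵢ⟫` of elementary tensors (all but finitely many factors
are `⟪h, h⟫ = 1`). -/
def stabKernel : Matrix (StabFamily ι h) (StabFamily ι h) 𝕜 :=
  Matrix.of fun f g => ∏ᶠ i, inner 𝕜 (f.val i) (g.val i)

variable {ι} in
theorem posSemidef_gram_family {E : Type*} (v : E → H) :
    (Matrix.of fun e e' : E => inner 𝕜 (v e) (v e')).PosSemidef := by
  refine ⟨?_, fun x => ?_⟩
  · ext e e'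
    exact inner_conj_symm _ _
  · have h1 : (x.sum fun i a => x.sum fun j b => star a * inner 𝕜 (v i) (v j) * b)
        = inner 𝕜 (x.sum fun i a => a • v i) (x.sum fun i a => a • v i) := by
      rw [Finsupp.sum_inner]
      refine Finsupp.sum_congr fun i _ => ?_
      rw [Finsupp.inner_sum]
      refine Finsupp.sum_congr fun j _ => ?_
      rw [inner_smul_left, inner_smul_right, RCLike.star_def]
      ring
    refine le_of_le_of_eq ?_ h1.symm
    rw [inner_self_eq_norm_sq_to_K, ← RCLike.ofReal_pow]
    exact RCLike.ofReal_nonneg.mpr (by positivity)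

variable {ι} in
theorem posSemidef_prod_gram {E : Type*} (s : Finset ι) (v : ι → E → H) :
    (Matrix.of fun e e' : E => ∏ i ∈ s, inner 𝕜 (v i e) (v i e')).PosSemidef := by
  classical
  induction s using Finset.induction_on with
  | empty =>
    have h1 := posSemidef_gram_family 𝕜 (fun _ : E => (1 : 𝕜))
    convert h1 using 1
    ext e e'
    simp
  | insert a s ha ih =>
    have h1 := (posSemidef_gram_family 𝕜 (v a)).hadamard ih
    convert h1 using 1
    ext e e'
    simp [Finset.prod_insert ha]

theorem stabKernel_posSemidef : (stabKernel 𝕜 ι h).PosSemidef := by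
  classical
  have hh : inner 𝕜 (h : H) (h : H) = 1 := by
    rw [inner_self_eq_norm_sq_to_K, norm_eq_of_mem_sphere]; simp
  refine ⟨?_, fun x => ?_⟩
  · ext f g
    rw [Matrix.conjTranspose_apply, stabKernel, Matrix.of_apply, Matrix.of_apply]
    have hf : (Function.mulSupport fun i => inner 𝕜 (g.val i) (f.val i)).Finite := by
      refine (f.finite.union g.finite).subset fun i hi => ?_
      by_contra h'
      simp only [Set.mem_union, Set.mem_ofPred_eq, not_or, not_not] at h'
      exact hi (by simp only [h'.1, h'.2, hh])
    have h2 := (starRingEnd 𝕜).toMonoidHom.map_finprod hf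
    refine h2.trans (finprod_congr fun i => ?_)
    exact inner_conj_symm _ _
  · have hfin : (⋃ f ∈ x.support, {i | f.val i ≠ (h : H)}).Finite :=
      Set.Finite.biUnion x.support.finite_toSet fun f _ => f.finite
    have h1 := (posSemidef_prod_gram 𝕜 hfin.toFinset
      (fun i (f : StabFamily ι h) => f.val i)).2 x
    refine h1.trans_eq ?_
    refine Finset.sum_congr rfl fun f hf => Finset.sum_congr rfl fun g hg => ?_
    have h2 : stabKernel 𝕜 ι h f g
        = ∏ i ∈ hfin.toFinset, inner 𝕜 (f.val i) (g.val i) := by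
      refine finprod_eq_prod_of_mulSupport_subset _ fun i hi => ?_
      by_contra h'
      simp only [Set.Finite.coe_toFinset, Set.mem_iUnion, Set.mem_ofPred_eq, not_exists,
        not_not] at h'
      exact hi (by simp only [h' f hf, h' g hg, hh])
    exact congrArg (fun z => star (x f) * z * x g) h2.symm

/-- The countable (or arbitrary) tensor product `⊗_{i ∈ ι} (H, h)` of copies of `H` with
stabilizing unit vector `h`: the completion of the space of finite linear combinations of tensors
`⊗ᵢ fᵢ` with `fᵢ = h` for all but finitely many `i`, i.e. of the inductive limit of the finite
tensor powers of `H` with respect to the embeddings `x ↦ x ⊗ h`. -/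
abbrev StabTensor : Type _ := KernelSpace (stabKernel 𝕜 ι h) (stabKernel_posSemidef 𝕜 ι h)

namespace StabTensor

variable {ι}

/-- The elementary tensor `⊗ᵢ fᵢ`. -/
def tens (f : StabFamily ι h) : StabTensor 𝕜 ι h := KernelSpace.vec _ f

/-- Relabelling of the factors: for an embedding `e : ι ↪ κ`, the isometric embedding of
`⊗_{i ∈ ι} (H, h)` into `⊗_{j ∈ κ} (H, h)` that puts the factor number `i` at the place `e i`
and `h` at all places outside the range of `e`. -/
def reindex (e : ι ↪ κ) : StabTensor 𝕜 ι h →ₗᵢ[𝕜] StabTensor 𝕜 κ h :=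
  KernelSpace.map _ _
    (fun f => ⟨Function.extend e f.val fun _ => (h : H), (f.finite.image e).subset fun j hj => by
      by_cases hje : ∃ i, e i = j
      · obtain ⟨i, rfl⟩ := hje
        rw [Set.mem_ofPred_eq, e.injective.extend_apply] at hj
        exact ⟨i, hj, rfl⟩
      · rw [Set.mem_ofPred_eq, Function.extend_apply' _ _ _ hje] at hj
        exact absurd rfl hj⟩)
    (fun f g => by
      have hh : inner 𝕜 (h : H) (h : H) = 1 := by
        rw [inner_self_eq_norm_sq_to_K, norm_eq_of_mem_sphere]; simp
      have h1 : ∀ i, inner 𝕜 (f.val i) (g.val i)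
          = (fun j => inner 𝕜 (Function.extend e f.val (fun _ => (h : H)) j)
            (Function.extend e g.val (fun _ => (h : H)) j)) (e i) := fun i => by
        simp only [e.injective.extend_apply]
      change (∏ᶠ j, inner 𝕜 (Function.extend e f.val (fun _ => (h : H)) j)
        (Function.extend e g.val (fun _ => (h : H)) j)) = ∏ᶠ i, inner 𝕜 (f.val i) (g.val i)
      rw [finprod_congr h1, ← finprod_mem_range (f := fun j =>
        inner 𝕜 (Function.extend e f.val (fun _ => (h : H)) j)
          (Function.extend e g.val (fun _ => (h : H)) j)) e.injective, ← finprod_mem_univ]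
      refine (finprod_mem_inter_mulSupport_eq' _ _ _ fun j hj => ?_).symm
      simp only [Set.mem_univ, iff_true]
      by_contra hje
      refine hj ?_
      have hje' : ¬ ∃ i, e i = j := hje
      simp only [Function.extend_apply' _ _ _ hje', hh])

/-- The operator `⊗ᵢ fᵢ ↦ (⊗_{i ∈ s} Aᵢ fᵢ) ⊗ (⊗_{i ∉ s} fᵢ)`. -/
def finMap (A : ι → H ≃ₗᵢ[𝕜] H) (s : Finset ι) : StabTensor 𝕜 ι h →ₗᵢ[𝕜] StabTensor 𝕜 ι h :=
  open scoped Classical in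
  KernelSpace.map _ _
    (fun f => ⟨fun i => if i ∈ s then A i (f.val i) else f.val i,
      (f.finite.union s.finite_toSet).subset fun i hi => by
        by_cases his : i ∈ s
        · exact Or.inr his
        · left
          simpa [his] using hi⟩)
    (fun f g => finprod_congr fun i => by
      by_cases his : i ∈ s <;> simp [his])

/-- `w = (⊗ᵢ Aᵢ) v`: the vector `w` is the value at `v` of the infinite tensor product of the
operators `Aᵢ`, i.e. the limit of `(⊗_{i ∈ s} Aᵢ) ⊗ (⊗_{i ∉ s} id) v` over the finite sets `s`. -/
def IsTensorImage (A : ι → H ≃ₗᵢ[𝕜] H) (v w : StabTensor 𝕜 ι h) : Prop :=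
  Tendsto (fun s : Finset ι => finMap 𝕜 h A s v) atTop (𝓝 w)

end StabTensor

end StabTensor

/-! ### The Fock space -/

section Fock

variable (𝕜 : Type*) [RCLike 𝕜] (H : Type*) [NormedAddCommGroup H] [InnerProductSpace 𝕜 H]

/-- The Hilbert `k`-th tensor power: generated by the `v₁ ⊗ ⋯ ⊗ vₖ`, with inner products
`∏ᵢ ⟪vᵢ, wᵢ⟫`. -/
abbrev TensorPow (k : ℕ) : Type _ :=
  KernelSpace (Matrix.of fun v w : Fin k → H => ∏ i, inner 𝕜 (v i) (w i))
    (posSemidef_prod_gram 𝕜 Finset.univ fun (i : Fin k) (v : Fin k → H) => v i)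

/-- `v ⊗ ⋯ ⊗ v`. -/
def diagTens (k : ℕ) (v : H) : TensorPow 𝕜 H k := KernelSpace.vec _ fun _ => v

/-- The `k`-th symmetric tensor power, as the closed subspace of the tensor power spanned by the
vectors `v ⊗ ⋯ ⊗ v`. -/
def SymPow (k : ℕ) : Submodule 𝕜 (TensorPow 𝕜 H k) :=
  (Submodule.span 𝕜 (Set.range (diagTens 𝕜 H k))).topologicalClosure

/-- The Fock space `EXP H = ⨁ₖ Sᵏ H` (Hilbert sum). -/
abbrev Fock : Type _ := lp (fun k => SymPow 𝕜 H k) 2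

variable {H}

theorem norm_diagTens (k : ℕ) (v : H) : ‖diagTens 𝕜 H k v‖ = ‖v‖ ^ k := by
  have h1 := norm_sq_eq_re_inner (𝕜 := 𝕜) (diagTens 𝕜 H k v)
  rw [diagTens, KernelSpace.inner_vec] at h1
  simp only [Matrix.of_apply, Finset.prod_const, Finset.card_univ, Fintype.card_fin,
    inner_self_eq_norm_sq_to_K] at h1
  rw [← RCLike.ofReal_pow, ← RCLike.ofReal_pow, RCLike.ofReal_re, ← pow_mul, mul_comm,
    pow_mul] at h1
  exact (sq_eq_sq₀ (norm_nonneg _) (by positivity)).mp h1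

/-- The exponential vector `EXP v = 1 ⊕ v ⊕ (2!)^{-1/2} v ⊗ v ⊕ (3!)^{-1/2} v ⊗ v ⊗ v ⊕ ⋯`. -/
def expVec (v : H) : Fock 𝕜 H :=
  ⟨fun k => (((Real.sqrt k.factorial)⁻¹ : ℝ) : 𝕜) • ⟨diagTens 𝕜 H k v,
    Submodule.le_topologicalClosure _ (Submodule.subset_span ⟨v, rfl⟩)⟩, by
    refine memℓp_gen ?_
    refine (Real.summable_pow_div_factorial (‖v‖ ^ 2)).congr fun k => ?_
    have h1 : ‖(((Real.sqrt k.factorial)⁻¹ : ℝ) : 𝕜) • diagTens 𝕜 H k v‖ ^ 2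
        = (‖v‖ ^ 2) ^ k / k.factorial := by
      rw [norm_smul, norm_diagTens, RCLike.norm_ofReal, mul_pow, sq_abs, inv_pow,
        Real.sq_sqrt (by positivity), ← pow_mul, ← pow_mul, mul_comm 2 k]
      ring
    rw [← h1]
    norm_num⟩

end Fock

/-! ### The group `P = ℝ₊* ⋉ P₀` and its special representation -/

/-- The multiplicative group `ℝ₊*` of positive real numbers. -/
abbrev PosReal : Type := {r : ℝ // 0 < r}

/-- The multiplicative Haar measure `r⁻¹ dr` on `ℝ₊*`. -/
def posHaar : Measure PosReal :=
  (Measure.comap (Subtype.val : PosReal → ℝ) volume).withDensity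
    fun r => ENNReal.ofReal (r : ℝ)⁻¹

/-- `φ` is a continuous action of `ℝ₊*` on `P₀` by automorphisms `g ↦ g^r = φ r g`. -/
class IsContinuousAction {P₀ : Type*} [Group P₀] [TopologicalSpace P₀]
    (φ : PosReal →* MulAut P₀) : Prop where
  continuous_action : Continuous fun q : PosReal × P₀ => φ q.1 q.2

section Representations

variable {𝕜 : Type*} [RCLike 𝕜] {P₀ : Type*} [Group P₀] (φ : PosReal →* MulAut P₀)
  {H : Type*} [NormedAddCommGroup H] [InnerProductSpace 𝕜 H] (T : P₀ →* (H ≃ₗᵢ[𝕜] H))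
  (h : Metric.sphere (0 : H) 1)

/-- The orthogonal or unitary representation `T` of `P₀` is canonical with respect to `ℝ₊*`, and
`h` is a unit cyclic vector almost invariant with respect to `T`. -/
structure IsCanonical : Prop where
  cyclic : (Submodule.span 𝕜 (Set.range fun g : P₀ => T g (h : H))).topologicalClosure = ⊤
  almost_invariant : ∃ c : P₀ → ℝ, ∀ g : P₀, ∃ ε : ℝ, 0 < ε ∧
    ∀ r : PosReal, (r : ℝ) < ε → ‖T (φ r g) (h : H) - h‖ < c g * r

/-- The action of `p = (g₀, r₀) ∈ P = ℝ₊* ⋉ P₀` on functions `f : ℝ₊* → H`: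
`(p f)(r) = T_r(g₀) f(r₀ r)`, where `T_r(g) = T(g^r)`. -/
def specialAct (p : P₀ ⋊[φ] PosReal) (f : PosReal → H) : PosReal → H :=
  fun r => T (φ r p.left) (f (p.right * r))

/-- The function `f₀(r) = e^{-r/2} h`. -/
def expSection : PosReal → H := fun r => ((Real.exp (-(r : ℝ) / 2) : ℝ) : 𝕜) • (h : H)

variable (H) in
/-- The space `∫^⊕ H_r r⁻¹ dr`, `H_r = H`, of the special representation. -/
abbrev SpecialSpace : Type _ := Lp H 2 posHaar

/-- `T'` is the representation of `P` in the space `∫^⊕ H_r r⁻¹ dr` associated with `T`. -/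
def IsSpecialRep (T' : (P₀ ⋊[φ] PosReal) →* (SpecialSpace H ≃ₗᵢ[𝕜] SpecialSpace H)) : Prop :=
  ∀ (p : P₀ ⋊[φ] PosReal) (f : SpecialSpace H), T' p f =ᵐ[posHaar] specialAct φ T p f

/-- `b` is the `1`-cocycle `b(p) = p f₀ - f₀` with `f₀(r) = e^{-r/2} h`. -/
def IsExpCocycle (b : P₀ ⋊[φ] PosReal → SpecialSpace H) : Prop :=
  ∀ p : P₀ ⋊[φ] PosReal, b p =ᵐ[posHaar] fun r =>
    specialAct φ T p (expSection (𝕜 := 𝕜) h) r - expSection (𝕜 := 𝕜) h r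

end Representations

/-! ### Current groups -/

section Currents

variable {P₀ : Type*} [Group P₀] [TopologicalSpace P₀] [IsTopologicalGroup P₀]
  (φ : PosReal →* MulAut P₀) [IsContinuousAction φ] (X : Type*) [MeasurableSpace X]

/-- The current group `P^X`, `P = ℝ₊* ⋉ P₀`: all bounded (i.e. with values in a compact set)
measurable maps `X → P`, with pointwise multiplication. Measurability is understood in the strong
sense (pointwise limits of measurable maps with finitely many values), which is the usual one if
`P₀` is metrizable and separable. -/
def CurrentGroup : Subgroup (X → P₀ ⋊[φ] PosReal) where
  carrier := {p | StronglyMeasurable (fun x => (p x).left) ∧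
    StronglyMeasurable (fun x => (p x).right) ∧
    ∃ K : Set P₀, ∃ L : Set PosReal, IsCompact K ∧ IsCompact L ∧
      ∀ x, (p x).left ∈ K ∧ (p x).right ∈ L}
  one_mem' := ⟨stronglyMeasurable_const, stronglyMeasurable_const, {1}, {1},
    isCompact_singleton, isCompact_singleton, fun _ => ⟨rfl, rfl⟩⟩
  mul_mem' := by
    rintro p q ⟨hp, hp', K, L, hK, hL, hKL⟩ ⟨hq, hq', K', L', hK', hL', hKL'⟩
    have hc : Continuous fun z : P₀ × (PosReal × P₀) => z.1 * φ z.2.1 z.2.2 :=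
      continuous_fst.mul (IsContinuousAction.continuous_action.comp continuous_snd)
    have hc' : Continuous fun z : PosReal × PosReal => z.1 * z.2 :=
      ((continuous_subtype_val.comp continuous_fst).mul
        (continuous_subtype_val.comp continuous_snd)).subtype_mk _
    refine ⟨hc.comp_stronglyMeasurable (hp.prodMk (hp'.prodMk hq)),
      hc'.comp_stronglyMeasurable (hp'.prodMk hq'), _, _,
      (hK.prod (hL.prod hK')).image hc, (hL.prod hL').image hc', fun x => ⟨?_, ?_⟩⟩
    · exact ⟨((p x).left, (p x).right, (q x).left), ⟨(hKL x).1, (hKL x).2, (hKL' x).1⟩, rfl⟩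
    · exact ⟨((p x).right, (q x).right), ⟨(hKL x).2, (hKL' x).2⟩, rfl⟩
  inv_mem' := by
    rintro p ⟨hp, hp', K, L, hK, hL, hKL⟩
    have hi : Continuous fun r : PosReal => r⁻¹ :=
      (continuous_subtype_val.inv₀ fun r => r.2.ne').subtype_mk _
    have hc : Continuous fun z : PosReal × P₀ => φ z.1⁻¹ z.2⁻¹ :=
      IsContinuousAction.continuous_action.comp
        ((hi.comp continuous_fst).prodMk continuous_snd.inv)
    refine ⟨hc.comp_stronglyMeasurable (hp'.prodMk hp),
      hi.comp_stronglyMeasurable hp', _, _,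
      (hL.prod hK).image hc, hL.image hi, fun x => ⟨?_, ?_⟩⟩
    · exact ⟨((p x).right, (p x).left), ⟨(hKL x).2, (hKL x).1⟩, rfl⟩
    · exact ⟨(p x).right, (hKL x).2, rfl⟩

variable {φ X}

theorem CurrentGroup.right_bounded (p : CurrentGroup φ X) :
    ∃ C : ℝ, ∀ x, ((p.1 x).right : ℝ) ≤ C := by
  obtain ⟨-, -, K, L, -, hL, hKL⟩ := p.2
  obtain ⟨C, hC⟩ := (hL.image continuous_subtype_val).bddAbove
  exact ⟨C, fun x => hC ⟨_, (hKL x).2, rfl⟩⟩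

end Currents

/-! ### The cone of atomic measures and the infinite-dimensional Lebesgue measure -/

section Cone

variable (X : Type*) [MeasurableSpace X]

/-- The cone `l¹₊(X)` of the measures `ξ = ∑ₖ rₖ δ_{xₖ}`, `k = 1, 2, …`, with `rₖ > 0`,
`∑ₖ rₖ < ∞` and distinct points `xₖ ∈ X`. -/
def AtomicCone : Type _ :=
  {ξ : Measure X // ∃ (r : ℕ → ℝ) (x : ℕ ↪ X), (∀ k, 0 < r k) ∧ Summable r ∧
    ξ = Measure.sum fun k => ENNReal.ofReal (r k) • Measure.dirac (x k)}

instance : MeasurableSpace (AtomicCone X) := inferInstanceAs (MeasurableSpace (Subtype _))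

variable {X}

/-- `𝓛` is the infinite-dimensional Lebesgue measure on `l¹₊(X)` associated with the measure `m`
on `X`: the `σ`-finite measure with Laplace transform
`∫ exp (-∑ₖ rₖ f(xₖ)) d𝓛(ξ) = exp (-∫ log f dm)`. -/
structure IsInfDimLebesgue (m : Measure X) (𝓛 : Measure (AtomicCone X)) : Prop where
  sigmaFinite : SigmaFinite 𝓛
  laplace : ∀ f : X → ℝ, Measurable f → (∀ x, 0 < f x) →
    Integrable (fun x => Real.log (f x)) m →
    ∫⁻ ξ, EReal.exp (-((∫⁻ x, ENNReal.ofReal (f x) ∂ξ.1 : ℝ≥0∞) : EReal)) ∂𝓛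
      = ENNReal.ofReal (Real.exp (-∫ x, Real.log (f x) ∂m))

namespace AtomicCone

/-- The mass `r` of the atom of `ξ` at the point `x` (`0` if there is none). -/
def mass (ξ : AtomicCone X) (x : X) : ℝ := (ξ.1 {x}).toReal

theorem nonempty_embedding (ξ : AtomicCone X) : Nonempty (ℕ ↪ X) :=
  let ⟨_, x, _⟩ := ξ.2; ⟨x⟩

/-- The points `x₁, x₂, …` of `ξ = {rₖ, xₖ}`, numbered so that `r₁ ≥ r₂ ≥ ⋯`
(in an arbitrary admissible way if some of the `rₖ` coincide). -/
def points (ξ : AtomicCone X) : ℕ ↪ X :=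
  @Classical.epsilon (ℕ ↪ X) ξ.nonempty_embedding fun e =>
    Set.range e = {x | 0 < ξ.mass x} ∧ Antitone fun k => ξ.mass (e k)

/-- The multiplicator `M_a : {rₖ, xₖ} ↦ {a(xₖ) rₖ, xₖ}` for a bounded function `a`. -/
def scale [MeasurableSingletonClass X] (a : X → PosReal) (ha : ∃ C : ℝ, ∀ x, (a x : ℝ) ≤ C)
    (ξ : AtomicCone X) : AtomicCone X :=
  ⟨ξ.1.withDensity fun x => ENNReal.ofReal (a x), by
    obtain ⟨ξ, r, x, hr, hs, rfl⟩ := ξ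
    obtain ⟨C, hC⟩ := ha
    refine ⟨fun k => a (x k) * r k, x, fun k => mul_pos (a (x k)).2 (hr k),
      Summable.of_nonneg_of_le (fun k => (mul_pos (a (x k)).2 (hr k)).le)
        (fun k => mul_le_mul_of_nonneg_right (hC (x k)) (hr k).le) (hs.mul_left C), ?_⟩
    rw [withDensity_sum]
    congr 1
    ext1 k
    rw [withDensity_smul_measure, dirac_withDensity, smul_smul,
      ENNReal.ofReal_mul (a (x k)).2.le, mul_comm]⟩

end AtomicCone

end Cone

/-! ### The integral model -/

section IntegralModel

variable {𝕜 : Type*} [RCLike 𝕜] {P₀ : Type*} [Group P₀] (φ : PosReal →* MulAut P₀)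
  {H : Type*} [NormedAddCommGroup H] [InnerProductSpace 𝕜 H] (T : P₀ →* (H ≃ₗᵢ[𝕜] H))
  (h : Metric.sphere (0 : H) 1) {X : Type*} [MeasurableSpace X]

open scoped Classical in
/-- The operators `T_{rₖ}(g(xₖ))` acting in the factors of `H_ξ`, `ξ = {rₖ, xₖ}`, indexed by the
points `xₖ`; at the points of `X` that are not atoms of `ξ`, the identity. -/
def fibreOp (ξ : AtomicCone X) (g : X → P₀) (x : X) : H ≃ₗᵢ[𝕜] H :=
  if hx : 0 < ξ.mass x then T (φ ⟨ξ.mass x, hx⟩ (g x)) else LinearIsometryEquiv.refl 𝕜 H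

variable (𝕜) in
/-- The space `INT (H, h) = ∫^⊕ H_ξ d𝓛(ξ)`, where `H_ξ = ⊗ₖ H_{rₖ}` is the countable tensor
product of copies of `H` over the atoms `xₖ` of `ξ`, with stabilizing vector `h`. The spaces `H_ξ`
are identified with `⊗_{k ∈ ℕ} (H, h)` by numbering the atoms in the decreasing order of masses,
so that the sections become functions with values in the latter space. -/
abbrev IntSpace (𝓛 : Measure (AtomicCone X)) : Type _ := Lp (StabTensor 𝕜 ℕ h) 2 𝓛

variable (𝕜) in
/-- The value at `ξ` of a section of the bundle of the spaces `H_ξ`, as an element of `H_ξ`. Here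
`H_ξ` is realized as the subspace of `⊗_{x ∈ X} (H, h)` spanned by the tensors having the factor
`h` at all points `x` that are not atoms of `ξ`; thus `H_ξ` depends only on the set of atoms. -/
def sectionValue (F : AtomicCone X → StabTensor 𝕜 ℕ h) (ξ : AtomicCone X) : StabTensor 𝕜 X h :=
  StabTensor.reindex 𝕜 h ξ.points (F ξ)

variable [TopologicalSpace P₀] [IsTopologicalGroup P₀] [IsContinuousAction φ]
  [MeasurableSingletonClass X]

/-- `U` is the integral model `INT T` of a representation of `P^X`: for the current
`p = (g, r₀)`, i.e. `p = g r₀` with `g ∈ P₀^X`, `r₀ ∈ (ℝ₊*)^X`,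
`(U(p) F)(ξ) = e^{½ ∫ log r₀ dm} T_ξ(g) F(r₀ ξ)`, where `T_ξ(g) = ⊗ₖ T_{rₖ}(g(xₖ))`. -/
def IsIntegralModel (m : Measure X) (𝓛 : Measure (AtomicCone X))
    (U : CurrentGroup φ X →* (IntSpace 𝕜 h 𝓛 ≃ₗᵢ[𝕜] IntSpace 𝕜 h 𝓛)) : Prop :=
  ∀ (p : CurrentGroup φ X) (F : IntSpace 𝕜 h 𝓛), ∀ᵐ ξ ∂𝓛,
    StabTensor.IsTensorImage 𝕜 h (fibreOp φ T ξ fun x => (p.1 x).left)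
      (((Real.exp ((1 / 2) * ∫ x, Real.log ((p.1 x).right : ℝ) ∂m) : ℝ) : 𝕜) •
        sectionValue 𝕜 h F (ξ.scale (fun x => (p.1 x).right) (CurrentGroup.right_bounded p)))
      (sectionValue 𝕜 h (U p F) ξ)

end IntegralModel

/-! ### The Fock representation -/

section FockModel

variable {𝕜 : Type*} [RCLike 𝕜] {P₀ : Type*} [Group P₀] [TopologicalSpace P₀]
  [IsTopologicalGroup P₀] {φ : PosReal →* MulAut P₀} [IsContinuousAction φ]
  {V : Type*} [NormedAddCommGroup V] [InnerProductSpace 𝕜 V]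
  {X : Type*} [MeasurableSpace X] (m : Measure X)

/-- `TX` is the representation of `P^X` in `∫^⊕ V_x dm(x)`, `V_x = V`, generated by the
representation `T'` of `P` in `V`. -/
def IsCurrentRep (T' : (P₀ ⋊[φ] PosReal) →* (V ≃ₗᵢ[𝕜] V))
    (TX : CurrentGroup φ X →* (Lp V 2 m ≃ₗᵢ[𝕜] Lp V 2 m)) : Prop :=
  ∀ (p : CurrentGroup φ X) (v : Lp V 2 m), TX p v =ᵐ[m] fun x => T' (p.1 x) (v x)

/-- `bX` is the `1`-cocycle of `P^X` generated by the `1`-cocycle `b` of `P`. -/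
def IsCurrentCocycle (b : P₀ ⋊[φ] PosReal → V) (bX : CurrentGroup φ X → Lp V 2 m) : Prop :=
  ∀ p : CurrentGroup φ X, bX p =ᵐ[m] fun x => b (p.1 x)

variable {m}

/-- `W` is the Fock representation (in general, projective) of `P^X` in `EXP (∫^⊕ V_x dm(x))`
associated with `TX` and `bX`:
`W(p) EXP v = exp (-½ ‖bX(p)‖² - (TX(p) v, bX(p))) EXP (TX(p) v + bX(p))`,
where the inner product `(·, ·)` is linear in the first argument. -/
def IsFockRep (TX : CurrentGroup φ X →* (Lp V 2 m ≃ₗᵢ[𝕜] Lp V 2 m))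
    (bX : CurrentGroup φ X → Lp V 2 m)
    (W : CurrentGroup φ X → (Fock 𝕜 (Lp V 2 m) ≃ₗᵢ[𝕜] Fock 𝕜 (Lp V 2 m))) : Prop :=
  ∀ (p : CurrentGroup φ X) (v : Lp V 2 m),
    W p (expVec 𝕜 v) =
      NormedSpace.exp (-(((1 / 2) * ‖bX p‖ ^ 2 : ℝ) : 𝕜) - inner 𝕜 (bX p) (TX p v)) •
        expVec 𝕜 (TX p v + bX p)

end FockModel

/-- Two families of unitary (orthogonal) operators indexed by a group, such as projective
representations, are projectively equivalent: a unitary operator intertwines them up to scalars of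
modulus `1`. -/
def ProjectivelyEquivalent (𝕜 : Type*) [RCLike 𝕜] {G E F : Type*} [NormedAddCommGroup E]
    [InnerProductSpace 𝕜 E] [NormedAddCommGroup F] [InnerProductSpace 𝕜 F]
    (U : G → (E ≃ₗᵢ[𝕜] E)) (W : G → (F ≃ₗᵢ[𝕜] F)) : Prop :=
  ∃ (J : E ≃ₗᵢ[𝕜] F) (c : G → 𝕜), (∀ g, ‖c g‖ = 1) ∧ ∀ g v, J (U g v) = c g • W g (J v)

end

/-!
The intertwining operator is written down on a total family of vectors of the integral model, the
*coherent sections* `ξ ↦ ⊗ₖ u(xₖ, rₖ)`, `ξ = {rₖ, xₖ}`, where `u = f₀ + v` and `v` represents an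
element `V` of `L²(X; L²(ℝ₊*; H))` that is moreover integrable for `m ⊗ dr / (r (1 + r))`.

**The measure `𝓛`.** The points of a Poisson process on `X × ℝ₊*` of intensity
`m ⊗ dr / (r (1 + r))` are listed in the decreasing order of the masses, by a change of time in the
marked Poisson process of unit rate. Its exponential formula `E ∏ₖ (1 + φ(xₖ, rₖ)) = exp (∫ φ)`
(`poissonLaw_integral_tprod`) is the constancy of the mean of a martingale. The measure `𝓛` has the
density `C ∏ₖ (1 + rₖ)` with respect to this process, so that
`∫ ∏ₖ w(xₖ, rₖ) d𝓛 = exp (∫ (w - e^{-r}) r⁻¹ dr dm)` (`coneMeasure_integral_tprod`). With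
`w = e^{-f(x) r}` Frullani's integral gives the Laplace transform (`coneMeasure_laplace`). A measure
on the cone is determined by its Laplace transform (`AtomicCone.ext_of_laplace`), which yields the
uniqueness of `𝓛` and its behaviour under the multiplicators (`coneMeasure_map_scale`).

**The isomorphism.** By the same formula the Gram matrix of the coherent sections is
`exp (⟨V, V'⟩ + ⟨f₀, v'⟩ + ⟨v, f₀⟩)`, with inner products linear in the second argument
(`IsAdmissible.inner_coherentLp`). This is also the Gram matrix of the vectors
`exp ⟨f₀, v⟩ • EXP V`. Both families are total: the second one because exponential vectors of a
dense set are (`span_expVec`), the first one because the admissible functions may be multiplied by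
`e^{-a(x) r}`, which localizes an orthogonality relation in `ξ` by the injectivity of the Laplace
transform, and may be given arbitrary values at the largest atoms of `ξ`
(`eq_zero_of_inner_coherentLp`). Hence there is an isometric isomorphism `J` taking one family to
the other (`exists_intertwiner`).

**The group.** A current `p` moves `u` to `p u`, and `V` to `T̃(p) V + b(p)`. Up to a scalar, `W(p)`
moves `EXP V` in the same way, so `c(p) J⁻¹ W(p) J` takes the coherent section of `u` to
`exp (½ ∫ log r₀ dm)` times that of `p u`, where
`c(p) = exp (½ ∫ log r₀ dm + ⟨f₀, b(p)⟩ + ½ ‖b(p)‖²)`. This scalar has modulus one, again by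
Frullani's integral (`norm_exp_phaseExponent`). The operators `c(p) J⁻¹ W(p) J` therefore form a
representation (`exists_integralOperators`), and the formula that defines the integral model, which
is checked on coherent sections, extends to all sections by continuity
(`satisfiesModel_of_coherentLp`).

**Integrability of the cocycle.** The total displacement `∫ ‖T_r(g) h - h‖ dr / (r (1 + r))` is
finite for a canonical representation. It is subadditive and lower semicontinuous in `g`, so it is
bounded on compact sets by Baire's theorem (`exists_totalDisp_le`). It controls `b(p)` both in
`L²(dr / r)` and in `L¹(dr / (r (1 + r)))`.
-/

noncomputable section

/-! ### The exponential function of a real or complex scalar -/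

section ScalarExp

variable {𝕜 : Type*} [RCLike 𝕜]

theorem RCLike.exp_ofReal (x : ℝ) :
    NormedSpace.exp ((x : ℝ) : 𝕜) = ((Real.exp x : ℝ) : 𝕜) := by
  rw [Real.exp_eq_exp_ℝ]
  exact (NormedSpace.algebraMap_exp_comm (𝔸 := 𝕜) x).symm

theorem RCLike.conj_exp (z : 𝕜) :
    (starRingEnd 𝕜) (NormedSpace.exp z) = NormedSpace.exp ((starRingEnd 𝕜) z) :=
  NormedSpace.map_exp (starRingEnd 𝕜) RCLike.continuous_conj z

theorem RCLike.norm_exp (z : 𝕜) : ‖NormedSpace.exp z‖ = Real.exp (RCLike.re z) := by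
  have h1 : ((‖NormedSpace.exp z‖ ^ 2 : ℝ) : 𝕜) = ((Real.exp (RCLike.re z) ^ 2 : ℝ) : 𝕜) := by
    rw [RCLike.ofReal_pow, ← RCLike.conj_mul, RCLike.conj_exp, ← NormedSpace.exp_add,
      add_comm, RCLike.add_conj, ← Real.exp_nat_mul, ← RCLike.exp_ofReal]
    push_cast
    rfl
  have h2 : ‖NormedSpace.exp z‖ ^ 2 = Real.exp (RCLike.re z) ^ 2 := RCLike.ofReal_injective h1
  exact (sq_eq_sq₀ (norm_nonneg _) (Real.exp_pos _).le).mp h2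

theorem RCLike.norm_exp_le (z : 𝕜) : ‖NormedSpace.exp z‖ ≤ Real.exp ‖z‖ := by
  rw [RCLike.norm_exp]
  exact Real.exp_le_exp.mpr ((le_abs_self _).trans (RCLike.abs_re_le_norm z))

theorem RCLike.continuous_exp : Continuous fun z : 𝕜 => NormedSpace.exp z :=
  continuous_iff_continuousAt.mpr fun _ => hasDerivAt_exp.continuousAt

end ScalarExp

/-! ### The renewal equation -/

section Volterra

open Set

variable {𝕜 : Type*} [RCLike 𝕜]

/-- The function `s ↦ exp (∫ₛ^∞ φ)`. -/
def tailExp (φ : ℝ → 𝕜) (s : ℝ) : 𝕜 := NormedSpace.exp (∫ t in Ioi s, φ t)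

theorem norm_integral_Ioi_le {φ : ℝ → 𝕜} (hφ : Integrable φ) (s : ℝ) :
    ‖∫ t in Ioi s, φ t‖ ≤ ∫ t, ‖φ t‖ :=
  (norm_integral_le_integral_norm _).trans
    (setIntegral_le_integral hφ.norm (Eventually.of_forall fun _ => norm_nonneg _))

theorem norm_tailExp_le {φ : ℝ → 𝕜} (hφ : Integrable φ) (s : ℝ) :
    ‖tailExp φ s‖ ≤ Real.exp (∫ t, ‖φ t‖) :=
  (RCLike.norm_exp_le _).trans (Real.exp_le_exp.mpr (norm_integral_Ioi_le hφ s))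

theorem continuous_integral_Ioi {φ : ℝ → 𝕜} (hφ : Integrable φ) :
    Continuous fun s => ∫ t in Ioi s, φ t := by
  have h1 : (fun s => ∫ t in Ioi s, φ t) = fun s => (∫ t in Ioi 0, φ t) - ∫ t in (0)..s, φ t := by
    ext s
    rw [eq_sub_iff_add_eq, add_comm]
    exact intervalIntegral.integral_interval_add_Ioi hφ.integrableOn hφ.integrableOn
  rw [h1]
  exact continuous_const.sub
    (intervalIntegral.continuous_primitive (fun a b => hφ.intervalIntegrable) 0)

theorem continuous_tailExp {φ : ℝ → 𝕜} (hφ : Integrable φ) : Continuous (tailExp φ) :=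
  RCLike.continuous_exp.comp (continuous_integral_Ioi hφ)

theorem tendsto_tailExp {φ : ℝ → 𝕜} (hφ : Integrable φ) : Tendsto (tailExp φ) atTop (𝓝 1) := by
  have h1 : Tendsto (fun s => ∫ t in Ioi s, φ t) atTop (𝓝 0) := by
    have h2 : Tendsto (fun s => (∫ t in Ioi 0, φ t) - ∫ t in (0)..s, φ t) atTop
        (𝓝 ((∫ t in Ioi 0, φ t) - ∫ t in Ioi 0, φ t)) :=
      tendsto_const_nhds.sub
        (intervalIntegral_tendsto_integral_Ioi 0 hφ.integrableOn tendsto_id)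
    rw [sub_self] at h2
    refine h2.congr fun s => ?_
    rw [sub_eq_iff_eq_add, add_comm]
    exact (intervalIntegral.integral_interval_add_Ioi hφ.integrableOn hφ.integrableOn).symm
  have h3 := (RCLike.continuous_exp (𝕜 := 𝕜)).tendsto 0 |>.comp h1
  rw [NormedSpace.exp_zero] at h3
  exact h3

theorem integrableOn_exp_neg_mul_tailExp {φ ψ : ℝ → 𝕜} (hφ : Integrable φ) (hψ : Integrable ψ)
    (s : ℝ) : IntegrableOn (fun t => ((Real.exp (-t) : ℝ) : 𝕜) * ((1 + φ t) * tailExp ψ t))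
      (Ioi s) := by
  have h1 : IntegrableOn (fun t => ((Real.exp (-t) : ℝ) : 𝕜)) (Ioi s) :=
    (integrableOn_exp_neg_Ioi s).ofReal
  have h2 : IntegrableOn (fun t => ((Real.exp (-t) : ℝ) : 𝕜) * φ t) (Ioi s) := by
    refine hφ.integrableOn.bdd_mul (c := Real.exp (-s)) ?_ ?_
    · exact (RCLike.continuous_ofReal.comp
        (Real.continuous_exp.comp continuous_neg)).aestronglyMeasurable
    · refine (ae_restrict_mem measurableSet_Ioi).mono fun t ht => ?_
      rw [RCLike.norm_ofReal, abs_of_pos (Real.exp_pos _)]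
      exact Real.exp_le_exp.mpr (neg_le_neg (le_of_lt ht))
  have h3 := (h1.add h2).mul_bdd (g := tailExp ψ) (c := Real.exp (∫ t, ‖ψ t‖))
    (continuous_tailExp hψ).aestronglyMeasurable
    (Eventually.of_forall fun t => norm_tailExp_le hψ t)
  refine h3.congr (Eventually.of_forall fun t => ?_)
  simp only [Pi.add_apply]
  ring

/-- The renewal equation for a continuous `φ`: the integrand is then the derivative of `-e^{-t} exp
(∫ₜ^∞ φ)`. -/
theorem integral_exp_neg_mul_tailExp_of_continuous {φ : ℝ → 𝕜} (hφ : Integrable φ)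
    (hc : Continuous φ) (s : ℝ) :
    ∫ t in Ioi s, ((Real.exp (-t) : ℝ) : 𝕜) * ((1 + φ t) * tailExp φ t)
      = ((Real.exp (-s) : ℝ) : 𝕜) * tailExp φ s := by
  have hF : ∀ t, HasDerivAt (fun s => ∫ t in Ioi s, φ t) (-φ t) t := by
    intro t
    have h1 : (fun s => ∫ t in Ioi s, φ t)
        = fun s => (∫ t in Ioi 0, φ t) - ∫ t in (0)..s, φ t := by
      ext s
      rw [eq_sub_iff_add_eq, add_comm]
      exact intervalIntegral.integral_interval_add_Ioi hφ.integrableOn hφ.integrableOn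
    rw [h1]
    have h2 := (intervalIntegral.integral_hasDerivAt_right (a := 0) (b := t)
      hφ.intervalIntegrable (hc.stronglyMeasurableAtFilter _ _) hc.continuousAt)
    exact h2.const_sub _
  have hQ : ∀ t, HasDerivAt (tailExp φ) (tailExp φ t * -φ t) t := fun t =>
    HasDerivAt.comp (𝕜 := ℝ) (𝕜' := 𝕜) t hasDerivAt_exp (hF t)
  have hE : ∀ t : ℝ, HasDerivAt (fun t => ((Real.exp (-t) : ℝ) : 𝕜))
      (((Real.exp (-t) * (-1) : ℝ) : 𝕜)) t := fun t => by
    have h1 : HasDerivAt (fun t : ℝ => Real.exp (-t)) (Real.exp (-t) * (-1)) t :=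
      (hasDerivAt_id t).neg.exp
    exact (RCLike.ofRealCLM (K := 𝕜)).hasFDerivAt.comp_hasDerivAt t h1
  have hD : ∀ t, HasDerivAt (fun t => -(((Real.exp (-t) : ℝ) : 𝕜) * tailExp φ t))
      (((Real.exp (-t) : ℝ) : 𝕜) * ((1 + φ t) * tailExp φ t)) t := fun t => by
    have := ((hE t).mul (hQ t)).neg
    convert! this using 1
    push_cast
    ring
  have h0 : Tendsto (fun t => -(((Real.exp (-t) : ℝ) : 𝕜) * tailExp φ t)) atTop (𝓝 0) := by
    have h1 : Tendsto (fun t => ((Real.exp (-t) : ℝ) : 𝕜)) atTop (𝓝 ((0 : ℝ) : 𝕜)) :=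
      (RCLike.continuous_ofReal.tendsto 0).comp Real.tendsto_exp_neg_atTop_nhds_zero
    have h2 := (h1.mul (tendsto_tailExp hφ)).neg
    simpa using h2
  rw [integral_Ioi_of_hasDerivAt_of_tendsto (hD s).continuousAt.continuousWithinAt
    (fun t _ => hD t) (integrableOn_exp_neg_mul_tailExp hφ hφ s) h0]
  ring

/-- The renewal equation for `s ↦ exp (∫ₛ^∞ φ)`. An integrable `φ` is approximated in `L¹` by
continuous functions. -/
theorem integral_exp_neg_mul_tailExp {φ : ℝ → 𝕜} (hφ : Integrable φ) (s : ℝ) :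
    ∫ t in Ioi s, ((Real.exp (-t) : ℝ) : 𝕜) * ((1 + φ t) * tailExp φ t)
      = ((Real.exp (-s) : ℝ) : 𝕜) * tailExp φ s := by
  have hex : ∀ n : ℕ, ∃ g : ℝ → 𝕜, HasCompactSupport g ∧
      ∫ x, ‖φ x - g x‖ ≤ 1 / ((n : ℝ) + 1) ∧ Continuous g ∧ Integrable g := fun n =>
    hφ.exists_hasCompactSupport_integral_sub_le (by positivity)
  choose g _ hg hgc hgi using hex
  have hg0 : Tendsto (fun n => ∫ x, ‖φ x - g n x‖) atTop (𝓝 0) :=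
    squeeze_zero (fun n => integral_nonneg fun _ => norm_nonneg _) hg
      tendsto_one_div_add_atTop_nhds_zero_nat
  have hI : ∀ t, Tendsto (fun n => ∫ x in Ioi t, g n x) atTop (𝓝 (∫ x in Ioi t, φ x)) := by
    intro t
    rw [tendsto_iff_norm_sub_tendsto_zero]
    refine squeeze_zero (fun _ => norm_nonneg _) (fun n => ?_) hg0
    rw [norm_sub_rev, ← integral_sub hφ.integrableOn (hgi n).integrableOn]
    exact norm_integral_Ioi_le (hφ.sub (hgi n)) t
  have hQ : ∀ t, Tendsto (fun n => tailExp (g n) t) atTop (𝓝 (tailExp φ t)) := fun t =>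
    (RCLike.continuous_exp.tendsto _).comp (hI t)
  set M : ℝ := (∫ x, ‖φ x‖) + 1 with hM
  have hgM : ∀ n t, ‖tailExp (g n) t‖ ≤ Real.exp M := by
    intro n t
    refine (norm_tailExp_le (hgi n) t).trans (Real.exp_le_exp.mpr ?_)
    have h1 : ∫ x, ‖g n x‖ ≤ ∫ x, (‖φ x‖ + ‖φ x - g n x‖) := by
      refine integral_mono (hgi n).norm (hφ.norm.add (hφ.sub (hgi n)).norm) fun x => ?_
      have := norm_sub_le (φ x) (φ x - g n x)
      simpa using this
    have h3 := integral_add hφ.norm (hφ.sub (hgi n)).norm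
    simp only [Pi.sub_apply] at h3
    rw [h3] at h1
    have h2 : 1 / ((n : ℝ) + 1) ≤ 1 := by
      rw [div_le_one (by positivity)]; linarith [n.cast_nonneg (α := ℝ)]
    linarith [hg n]
  -- the two parts of the error made by replacing `φ` by `g n`
  have hA : Tendsto (fun n => ∫ t in Ioi s, ((Real.exp (-t) : ℝ) : 𝕜)
      * ((1 + φ t) * tailExp (g n) t)) atTop
      (𝓝 (∫ t in Ioi s, ((Real.exp (-t) : ℝ) : 𝕜) * ((1 + φ t) * tailExp φ t))) := by
    have hb := (integrableOn_exp_neg_mul_tailExp hφ (integrable_zero ℝ 𝕜 volume) s).norm.mul_const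
      (Real.exp M)
    refine tendsto_integral_of_dominated_convergence _
      (fun n => (integrableOn_exp_neg_mul_tailExp hφ (hgi n) s).aestronglyMeasurable) hb
      (fun n => Eventually.of_forall fun t => ?_) (Eventually.of_forall fun t => ?_)
    · have : tailExp (0 : ℝ → 𝕜) t = 1 := by simp [tailExp]
      rw [this, mul_one, ← mul_assoc, norm_mul]
      exact mul_le_mul_of_nonneg_left (hgM n t) (norm_nonneg _)
    · exact ((hQ t).const_mul _).const_mul _
  have hB : Tendsto (fun n => ∫ t in Ioi s, ((Real.exp (-t) : ℝ) : 𝕜)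
      * ((1 + g n t) * tailExp (g n) t)) atTop
      (𝓝 (∫ t in Ioi s, ((Real.exp (-t) : ℝ) : 𝕜) * ((1 + φ t) * tailExp φ t))) := by
    refine tendsto_of_tendsto_of_dist hA ?_
    refine squeeze_zero (fun _ => dist_nonneg) (fun n => ?_)
      (by simpa using hg0.const_mul (Real.exp (-s) * Real.exp M))
    rw [dist_eq_norm, ← integral_sub (integrableOn_exp_neg_mul_tailExp hφ (hgi n) s)
      (integrableOn_exp_neg_mul_tailExp (hgi n) (hgi n) s)]
    refine (norm_integral_le_integral_norm _).trans ?_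
    rw [← integral_const_mul]
    have hd := ((hφ.sub (hgi n)).norm.const_mul (Real.exp (-s) * Real.exp M))
    refine (setIntegral_mono_on (((integrableOn_exp_neg_mul_tailExp hφ (hgi n) s).sub
      (integrableOn_exp_neg_mul_tailExp (hgi n) (hgi n) s)).norm) hd.integrableOn
      measurableSet_Ioi fun t ht => ?_).trans
      (setIntegral_le_integral hd (Eventually.of_forall fun _ => by
        simp only [Pi.zero_apply]; positivity))
    have h1 : ((Real.exp (-t) : ℝ) : 𝕜) * ((1 + φ t) * tailExp (g n) t)
        - ((Real.exp (-t) : ℝ) : 𝕜) * ((1 + g n t) * tailExp (g n) t)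
        = ((Real.exp (-t) : ℝ) : 𝕜) * tailExp (g n) t * (φ t - g n t) := by ring
    simp only [Pi.sub_apply]
    rw [h1, norm_mul, norm_mul, RCLike.norm_ofReal, abs_of_pos (Real.exp_pos _)]
    exact mul_le_mul_of_nonneg_right (mul_le_mul (Real.exp_le_exp.mpr (neg_le_neg (le_of_lt ht)))
      (hgM n t) (norm_nonneg _) (Real.exp_pos _).le) (norm_nonneg _)
  refine tendsto_nhds_unique hB ?_
  simp only [integral_exp_neg_mul_tailExp_of_continuous (hgi _) (hgc _)]
  exact (hQ s).const_mul _

end Volterra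

/-! ### Resampling one coordinate of an independent sequence -/

section Resample

variable {ι : Type*} {Y : ι → Type*} [∀ i, MeasurableSpace (Y i)]

/-- Replacing one coordinate of an independent sequence by a fresh independent copy does not change
its law. -/
theorem measurePreserving_update_infinitePi [DecidableEq ι] (μ : ∀ i, Measure (Y i))
    [∀ i, IsProbabilityMeasure (μ i)] (n : ι) :
    MeasurePreserving (fun p : (∀ i, Y i) × Y n => Function.update p.1 n p.2)
      ((Measure.infinitePi μ).prod (μ n)) (Measure.infinitePi μ) := by
  have hm : Measurable (fun p : (∀ i, Y i) × Y n => Function.update p.1 n p.2) := by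
    refine measurable_pi_iff.mpr fun i => ?_
    by_cases hi : i = n
    · subst hi
      simpa using measurable_snd
    · simp only [Function.update_of_ne hi]
      exact (measurable_pi_apply i).comp measurable_fst
  refine ⟨hm, Measure.eq_infinitePi μ fun s t ht => ?_⟩
  rw [Measure.map_apply hm (MeasurableSet.pi s.countable_toSet fun i _ => ht i)]
  by_cases hn : n ∈ s
  · have h1 : (fun p : (∀ i, Y i) × Y n => Function.update p.1 n p.2) ⁻¹' (Set.pi s t)
        = (Set.pi (s.erase n : Finset ι) t) ×ˢ (t n) := by
      ext p
      simp only [Set.mem_preimage, Set.mem_pi, Set.mem_prod, Finset.coe_erase, Set.mem_sdiff,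
        Set.mem_singleton_iff, Finset.mem_coe]
      constructor
      · intro h
        refine ⟨fun i hi => ?_, ?_⟩
        · have := h i hi.1
          rwa [Function.update_of_ne hi.2] at this
        · have := h n hn
          rwa [Function.update_self] at this
      · rintro ⟨h2, h3⟩ i hi
        by_cases hin : i = n
        · subst hin; rwa [Function.update_self]
        · rw [Function.update_of_ne hin]; exact h2 i ⟨hi, hin⟩
    rw [h1, Measure.prod_prod, Measure.infinitePi_pi μ fun i _ => ht i,
      ← Finset.prod_erase_mul s _ hn]
  · have h1 : (fun p : (∀ i, Y i) × Y n => Function.update p.1 n p.2) ⁻¹' (Set.pi s t)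
        = (Set.pi s t) ×ˢ Set.univ := by
      ext p
      simp only [Set.mem_preimage, Set.mem_pi, Set.mem_prod, Set.mem_univ, and_true,
        Finset.mem_coe]
      refine forall₂_congr fun i hi => ?_
      rw [Function.update_of_ne (fun h : i = n => hn (by rwa [← h]))]
    rw [h1, Measure.prod_prod, Measure.infinitePi_pi μ fun i _ => ht i, measure_univ, mul_one]

end Resample

/-! ### The marked Poisson process of unit rate -/

section Poisson

open Set

/-- The exponential law, with density `e^{-t}` on `(0, ∞)`. -/
def expGap : Measure ℝ :=
  (volume.restrict (Ioi 0)).withDensity fun t => ENNReal.ofReal (Real.exp (-t))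

instance : IsProbabilityMeasure expGap := by
  refine ⟨?_⟩
  rw [expGap, withDensity_apply _ MeasurableSet.univ, Measure.restrict_univ,
    ← ofReal_integral_eq_lintegral_ofReal (integrableOn_exp_neg_Ioi 0)
      (Eventually.of_forall fun _ => (Real.exp_pos _).le), integral_exp_neg_Ioi_zero]
  simp

theorem expGap_le : expGap ≤ (volume : Measure ℝ) := by
  refine Measure.le_iff.mpr fun s hs => ?_
  rw [expGap, withDensity_apply _ hs, Measure.restrict_restrict hs]
  calc ∫⁻ t in s ∩ Ioi 0, ENNReal.ofReal (Real.exp (-t))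
      ≤ ∫⁻ t in s ∩ Ioi 0, 1 := by
        refine setLIntegral_mono' (hs.inter measurableSet_Ioi) fun t ht => ?_
        rw [← ENNReal.ofReal_one]
        refine ENNReal.ofReal_le_ofReal (Real.exp_le_one_iff.mpr ?_)
        have : 0 < t := ht.2
        linarith
    _ ≤ volume s := by
        rw [setLIntegral_one]
        exact measure_mono inter_subset_left

theorem expGap_ae_pos : ∀ᵐ t ∂expGap, 0 < t :=
  (withDensity_absolutelyContinuous _ _).ae_le (ae_restrict_mem measurableSet_Ioi)

variable {𝕜 : Type*} [RCLike 𝕜]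

theorem integral_expGap (g : ℝ → 𝕜) :
    ∫ t, g t ∂expGap = ∫ t in Ioi 0, ((Real.exp (-t) : ℝ) : 𝕜) * g t := by
  rw [expGap, integral_withDensity_eq_integral_toReal_smul (by fun_prop) (by simp)]
  refine integral_congr_ae (Eventually.of_forall fun t => ?_)
  simp only [ENNReal.toReal_ofReal (Real.exp_pos _).le]
  rw [RCLike.real_smul_eq_coe_mul]

variable {X : Type*} [MeasurableSpace X] (m : Measure X) [IsProbabilityMeasure m]

/-- The law of the sequence of the independent gaps and marks of a marked Poisson process of unit
rate. -/
def gapLaw : Measure (ℕ → ℝ × X) := Measure.infinitePi fun _ => expGap.prod m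

instance : IsProbabilityMeasure (gapLaw m) := by unfold gapLaw; infer_instance

/-- The sum of the first `n` gaps. -/
def arrival (n : ℕ) (y : ℕ → ℝ × X) : ℝ := ∑ i ∈ Finset.range n, (y i).1

@[fun_prop]
theorem measurable_arrival (n : ℕ) : Measurable (arrival n : (ℕ → ℝ × X) → ℝ) := by
  unfold arrival
  fun_prop

variable {m} {φ : ℝ × X → 𝕜}

theorem integrable_translate (hφ : Integrable φ (volume.prod m)) (s : ℝ) :
    Integrable (fun z : ℝ × X => φ (s + z.1, z.2)) (expGap.prod m) := by
  have h1 : MeasurePreserving (fun z : ℝ × X => (s + z.1, z.2)) (volume.prod m)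
      (volume.prod m) := (measurePreserving_add_left volume s).prod (MeasurePreserving.id m)
  have h2 : Integrable (fun z : ℝ × X => φ (s + z.1, z.2)) (volume.prod m) :=
    h1.integrable_comp_of_integrable hφ
  exact h2.mono_measure (Measure.prod_mono expGap_le le_rfl)

theorem integrable_renewal (hφ : Integrable φ (volume.prod m)) {ψ : ℝ → 𝕜} (hψ : Integrable ψ)
    (s : ℝ) : Integrable (fun z : ℝ × X => (1 + φ (s + z.1, z.2)) * tailExp ψ (s + z.1))
      (expGap.prod m) := by
  refine ((integrable_const (1 : 𝕜)).add (integrable_translate hφ s)).mul_bdd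
    (c := Real.exp (∫ t, ‖ψ t‖)) ?_ (Eventually.of_forall fun z => norm_tailExp_le hψ _)
  exact ((continuous_tailExp hψ).comp (by fun_prop : Continuous fun t : ℝ => s + t))
    |>.stronglyMeasurable.comp_measurable measurable_fst |>.aestronglyMeasurable

/-- Averaging over the first arrival after the time `s`: the one-step form of the martingale
property of `prodMart`. -/
theorem integral_renewal (hφ : Integrable φ (volume.prod m)) (s : ℝ) :
    ∫ z, (1 + φ (s + z.1, z.2)) * tailExp (fun t => ∫ x, φ (t, x) ∂m) (s + z.1)
      ∂(expGap.prod m) = tailExp (fun t => ∫ x, φ (t, x) ∂m) s := by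
  set ψ : ℝ → 𝕜 := fun t => ∫ x, φ (t, x) ∂m with hψd
  have hψ : Integrable ψ := hφ.integral_prod_left
  have hsec : ∀ᵐ t ∂(volume : Measure ℝ), Integrable (fun x => φ (t, x)) m := hφ.prod_right_ae
  have hsec' : ∀ᵐ τ ∂expGap, Integrable (fun x => φ (s + τ, x)) m :=
    (integrable_translate hφ s).prod_right_ae
  rw [integral_prod _ (integrable_renewal hφ hψ s)]
  have h1 : ∫ τ, ∫ x, (1 + φ (s + τ, x)) * tailExp ψ (s + τ) ∂m ∂expGap
      = ∫ τ, (1 + ψ (s + τ)) * tailExp ψ (s + τ) ∂expGap := by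
    refine integral_congr_ae (hsec'.mono fun τ hτ => ?_)
    simp only
    rw [integral_mul_const, integral_add (integrable_const _) hτ]
    simp [hψd]
  rw [h1, integral_expGap]
  have h2 := (measurePreserving_add_left (volume : Measure ℝ) s).setIntegral_preimage_emb
    (MeasurableEquiv.addLeft s).measurableEmbedding
    (fun t => ((Real.exp (-(t - s)) : ℝ) : 𝕜) * ((1 + ψ t) * tailExp ψ t)) (Ioi s)
  have h3 : (fun x => s + x) ⁻¹' Ioi s = Ioi 0 := by
    ext x; simp
  rw [h3] at h2
  simp only [add_sub_cancel_left] at h2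
  refine h2.trans ?_
  have h4 : ∀ t : ℝ, ((Real.exp (-(t - s)) : ℝ) : 𝕜) * ((1 + ψ t) * tailExp ψ t)
      = ((Real.exp s : ℝ) : 𝕜) * (((Real.exp (-t) : ℝ) : 𝕜) * ((1 + ψ t) * tailExp ψ t)) := by
    intro t
    rw [neg_sub, sub_eq_add_neg, Real.exp_add]
    push_cast
    ring
  simp only [h4]
  rw [integral_const_mul, integral_exp_neg_mul_tailExp hψ, ← mul_assoc, ← RCLike.ofReal_mul,
    ← Real.exp_add]
  simp

/-- The martingale of the marked Poisson process that interpolates between the constant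
`exp (∫ φ)` and the product `∏ₖ (1 + φ(tₖ, xₖ))`. -/
def prodMart (φ : ℝ × X → 𝕜) (ψ : ℝ → 𝕜) (n : ℕ) (y : ℕ → ℝ × X) : 𝕜 :=
  (∏ i ∈ Finset.range n, (1 + φ (arrival (i + 1) y, (y i).2))) * tailExp ψ (arrival n y)

theorem arrival_update (n : ℕ) (y : ℕ → ℝ × X) (z : ℝ × X) {k : ℕ} (hk : k ≤ n) :
    arrival k (Function.update y n z) = arrival k y := by
  refine Finset.sum_congr rfl fun i hi => ?_
  rw [Function.update_of_ne]
  have := Finset.mem_range.mp hi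
  omega

theorem prodMart_succ_update (φ : ℝ × X → 𝕜) (ψ : ℝ → 𝕜) (n : ℕ) (y : ℕ → ℝ × X) (z : ℝ × X) :
    prodMart φ ψ (n + 1) (Function.update y n z)
      = (∏ i ∈ Finset.range n, (1 + φ (arrival (i + 1) y, (y i).2)))
        * ((1 + φ (arrival n y + z.1, z.2)) * tailExp ψ (arrival n y + z.1)) := by
  have h1 : arrival (n + 1) (Function.update y n z) = arrival n y + z.1 := by
    rw [arrival, Finset.sum_range_succ, Function.update_self]
    congr 1
    exact arrival_update n y z le_rfl
  rw [prodMart, Finset.prod_range_succ, h1, Function.update_self, mul_assoc]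
  congr 1
  refine Finset.prod_congr rfl fun i hi => ?_
  have hi' := Finset.mem_range.mp hi
  rw [arrival_update n y z (by omega), Function.update_of_ne (by omega)]

theorem measurable_prodMart (hφm : Measurable φ) {ψ : ℝ → 𝕜} (hψ : Integrable ψ) (n : ℕ) :
    Measurable (prodMart φ ψ n : (ℕ → ℝ × X) → 𝕜) := by
  have h1 := (continuous_tailExp hψ).measurable
  unfold prodMart
  fun_prop

/-- The martingale has constant mean, for nonnegative `φ`. This comes before `integral_prodMart`
because it yields the integrability of the finite products. -/
theorem lintegral_prodMart {φ : ℝ × X → ℝ} (hφ : Integrable φ (volume.prod m))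
    (hφm : Measurable φ) (h0 : ∀ z, 0 ≤ φ z) (n : ℕ) :
    ∫⁻ y, ENNReal.ofReal (prodMart φ (fun t => ∫ x, φ (t, x) ∂m) n y) ∂gapLaw m
      = ENNReal.ofReal (tailExp (fun t => ∫ x, φ (t, x) ∂m) 0) := by
  have hψ : Integrable (fun t => ∫ x, φ (t, x) ∂m) := hφ.integral_prod_left
  have hpos : ∀ s, 0 ≤ tailExp (fun t => ∫ x, φ (t, x) ∂m) s := fun s => by
    rw [tailExp, ← Real.exp_eq_exp_ℝ]; exact (Real.exp_pos _).le
  induction n with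
  | zero => simp [prodMart, arrival]
  | succ n ih =>
    have hmp := measurePreserving_update_infinitePi (fun _ : ℕ => expGap.prod m) n
    have hmeas := (measurable_prodMart hφm hψ (n + 1)).ennreal_ofReal
    rw [gapLaw, ← hmp.lintegral_comp hmeas, lintegral_prod _ (by
        simpa only [Function.comp_def] using (hmeas.comp hmp.measurable).aemeasurable),
      ← ih, gapLaw]
    refine lintegral_congr fun y => ?_
    have hA : 0 ≤ ∏ i ∈ Finset.range n, (1 + φ (arrival (i + 1) y, (y i).2)) :=
      Finset.prod_nonneg fun i _ => add_nonneg zero_le_one (h0 _)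
    simp only [prodMart_succ_update, ENNReal.ofReal_mul hA]
    rw [lintegral_const_mul _ (by
        have h1 := (continuous_tailExp hψ).measurable
        fun_prop), ← ofReal_integral_eq_lintegral_ofReal (integrable_renewal hφ hψ _)
        (Eventually.of_forall fun z => mul_nonneg (add_nonneg zero_le_one (h0 _)) (hpos _)),
      integral_renewal hφ, ← ENNReal.ofReal_mul hA]
    rfl

theorem norm_prodMart_le {ψ : ℝ → 𝕜} (hψ : Integrable ψ) (n : ℕ) (y : ℕ → ℝ × X) :
    ‖prodMart φ ψ n y‖ ≤ (∏ i ∈ Finset.range n, (1 + ‖φ (arrival (i + 1) y, (y i).2)‖))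
      * Real.exp (∫ t, ‖ψ t‖) := by
  rw [prodMart, norm_mul, norm_prod]
  refine mul_le_mul (Finset.prod_le_prod (fun _ _ => norm_nonneg _) fun i _ => ?_)
    (norm_tailExp_le hψ _) (norm_nonneg _) (Finset.prod_nonneg fun i _ => by positivity)
  exact (norm_add_le _ _).trans (by simp)

theorem lintegral_prod_norm_le (hφ : Integrable φ (volume.prod m)) (hφm : Measurable φ) (n : ℕ) :
    ∫⁻ y, ENNReal.ofReal (∏ i ∈ Finset.range n, (1 + ‖φ (arrival (i + 1) y, (y i).2)‖)) ∂gapLaw m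
      ≤ ENNReal.ofReal (tailExp (fun t => ∫ x, ‖φ (t, x)‖ ∂m) 0) := by
  rw [← lintegral_prodMart hφ.norm hφm.norm (fun _ => norm_nonneg _) n]
  refine lintegral_mono fun y => ENNReal.ofReal_le_ofReal ?_
  rw [prodMart]
  refine le_mul_of_one_le_right (Finset.prod_nonneg fun i _ => by positivity) ?_
  rw [tailExp, ← Real.exp_eq_exp_ℝ]
  exact Real.one_le_exp (integral_nonneg fun t => integral_nonneg fun x => norm_nonneg _)

/-- The martingale has constant mean: the `n`-th gap and mark are resampled, and the renewal
equation is applied to them. -/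
theorem integral_prodMart (hφ : Integrable φ (volume.prod m)) (hφm : Measurable φ) (n : ℕ) :
    ∫ y, prodMart φ (fun t => ∫ x, φ (t, x) ∂m) n y ∂gapLaw m
      = tailExp (fun t => ∫ x, φ (t, x) ∂m) 0 := by
  have hψ : Integrable (fun t => ∫ x, φ (t, x) ∂m) := hφ.integral_prod_left
  have hint : ∀ n, Integrable (prodMart φ (fun t => ∫ x, φ (t, x) ∂m) n) (gapLaw m) := by
    intro n
    have h1 : Integrable (fun y : ℕ → ℝ × X =>
        ∏ i ∈ Finset.range n, (1 + ‖φ (arrival (i + 1) y, (y i).2)‖)) (gapLaw m) := by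
      refine ⟨Measurable.aestronglyMeasurable (by fun_prop), ?_⟩
      rw [hasFiniteIntegral_iff_ofReal (Eventually.of_forall fun y =>
        Finset.prod_nonneg fun i _ => by positivity)]
      exact (lintegral_prod_norm_le hφ hφm n).trans_lt ENNReal.ofReal_lt_top
    exact (h1.mul_const _).mono' (measurable_prodMart hφm hψ n).aestronglyMeasurable
      (Eventually.of_forall fun y => norm_prodMart_le hψ n y)
  induction n with
  | zero => simp [prodMart, arrival]
  | succ n ih =>
    have hmp := measurePreserving_update_infinitePi (fun _ : ℕ => expGap.prod m) n
    have h2 : Integrable (fun p : (ℕ → ℝ × X) × (ℝ × X) =>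
        prodMart φ (fun t => ∫ x, φ (t, x) ∂m) (n + 1) (Function.update p.1 n p.2))
        ((Measure.infinitePi fun _ : ℕ => expGap.prod m).prod (expGap.prod m)) :=
      hmp.integrable_comp_of_integrable (hint (n + 1))
    have h3 := integral_map (μ := (Measure.infinitePi fun _ : ℕ => expGap.prod m).prod
      (expGap.prod m)) hmp.measurable.aemeasurable
      (f := prodMart φ (fun t => ∫ x, φ (t, x) ∂m) (n + 1))
      (by rw [hmp.map_eq]; exact (measurable_prodMart hφm hψ _).aestronglyMeasurable)
    rw [hmp.map_eq] at h3
    rw [gapLaw, h3, integral_prod _ h2, ← ih, gapLaw]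
    refine integral_congr_ae (Eventually.of_forall fun y => ?_)
    simp only [prodMart_succ_update]
    rw [integral_const_mul, integral_renewal hφ]
    rfl

/-- The finite products have an integrable majorant. -/
theorem ae_exists_bound_prod (hφ : Integrable φ (volume.prod m)) (hφm : Measurable φ) :
    ∃ B : (ℕ → ℝ × X) → ℝ, Integrable B (gapLaw m) ∧ ∀ᵐ y ∂gapLaw m, ∀ n,
      ∏ i ∈ Finset.range n, (1 + ‖φ (arrival (i + 1) y, (y i).2)‖) ≤ B y := by
  set P : ℕ → (ℕ → ℝ × X) → ℝ := fun n y =>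
    ∏ i ∈ Finset.range n, (1 + ‖φ (arrival (i + 1) y, (y i).2)‖) with hP
  have hPm : ∀ n, Measurable (P n) := fun n => by simp only [hP]; fun_prop
  have hmono : ∀ y, Monotone fun n => ENNReal.ofReal (P n y) := fun y =>
    monotone_nat_of_le_succ fun n => ENNReal.ofReal_le_ofReal (by
      simp only [hP]
      rw [Finset.prod_range_succ]
      exact le_mul_of_one_le_right (Finset.prod_nonneg fun i _ => by positivity)
        (by simp))
  have hfin : ∫⁻ y, ⨆ n, ENNReal.ofReal (P n y) ∂gapLaw m < ∞ := by
    rw [lintegral_iSup (fun n => (hPm n).ennreal_ofReal) fun a b hab y => hmono y hab]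
    exact (iSup_le fun n => lintegral_prod_norm_le hφ hφm n).trans_lt ENNReal.ofReal_lt_top
  have hsm : Measurable fun y => ⨆ n, ENNReal.ofReal (P n y) :=
    Measurable.iSup fun n => (hPm n).ennreal_ofReal
  refine ⟨fun y => (⨆ n, ENNReal.ofReal (P n y)).toReal,
    integrable_toReal_of_lintegral_ne_top hsm.aemeasurable hfin.ne, ?_⟩
  filter_upwards [ae_lt_top hsm hfin.ne] with y hy n
  rw [← ENNReal.ofReal_le_iff_le_toReal hy.ne]
  exact le_iSup (fun n => ENNReal.ofReal (P n y)) n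

theorem sum_add_one_le_prod_one_add (a : ℕ → ℝ) (ha : ∀ k, 0 ≤ a k) (n : ℕ) :
    ∑ i ∈ Finset.range n, a i + 1 ≤ ∏ i ∈ Finset.range n, (1 + a i) := by
  induction n with
  | zero => simp
  | succ n ih =>
    rw [Finset.sum_range_succ, Finset.prod_range_succ]
    have h1 : 0 ≤ ∑ i ∈ Finset.range n, a i := Finset.sum_nonneg fun i _ => ha i
    nlinarith [ha n]

theorem ae_summable_arrival (hφ : Integrable φ (volume.prod m)) (hφm : Measurable φ) :
    ∀ᵐ y ∂gapLaw m, Summable fun k => ‖φ (arrival (k + 1) y, (y k).2)‖ := by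
  obtain ⟨B, -, hB⟩ := ae_exists_bound_prod hφ hφm
  filter_upwards [hB] with y hy
  refine summable_of_sum_range_le (c := B y) (fun _ => norm_nonneg _) fun n => ?_
  refine le_trans ?_ (hy n)
  exact (lt_add_one _).le.trans (sum_add_one_le_prod_one_add _ (fun _ => norm_nonneg _) n)

theorem ae_gap_pos : ∀ᵐ y ∂gapLaw m, ∀ k, 0 < (y k).1 := by
  refine ae_all_iff.mpr fun k => ?_
  have h1 : MeasurePreserving (fun y : ℕ → ℝ × X => y k) (gapLaw m) (expGap.prod m) :=
    measurePreserving_eval_infinitePi _ k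
  have h2 : ∀ᵐ z ∂(expGap.prod m), 0 < z.1 :=
    Measure.quasiMeasurePreserving_fst.ae expGap_ae_pos
  exact h1.quasiMeasurePreserving.ae h2

/-- The arrival times are unbounded, since only finitely many of them lie in a bounded interval. -/
theorem ae_tendsto_arrival : ∀ᵐ y ∂gapLaw m, Tendsto (fun n => arrival n y) atTop atTop := by
  have h1 : ∀ N : ℕ, ∀ᵐ y ∂gapLaw m, Summable fun k =>
      ‖(Ioc (0 : ℝ) N).indicator (fun _ => (1 : ℝ)) (arrival (k + 1) y)‖ := fun N => by
    refine ae_summable_arrival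
      (φ := fun z : ℝ × X => (Ioc (0 : ℝ) N).indicator (fun _ => (1 : ℝ)) z.1)
      ?_ ?_
    · have : Integrable ((Ioc (0 : ℝ) N).indicator fun _ => (1 : ℝ)) volume :=
        (integrable_indicator_iff measurableSet_Ioc).mpr (integrableOn_const (by simp))
      exact this.comp_fst m
    · exact (measurable_const.indicator measurableSet_Ioc).comp measurable_fst
  filter_upwards [ae_all_iff.mpr h1, ae_gap_pos (m := m)] with y hy hpos
  have hmono : StrictMono fun n => arrival n y := strictMono_nat_of_lt_succ fun n => by
    rw [arrival, arrival, Finset.sum_range_succ]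
    linarith [hpos n]
  refine (tendsto_atTop_atTop_of_monotone hmono.monotone fun b => ?_)
  obtain ⟨N, hN⟩ := exists_nat_ge b
  have h2 := (hy N).tendsto_atTop_zero.eventually (gt_mem_nhds one_pos)
  obtain ⟨k, hk⟩ := h2.exists
  refine ⟨k + 1, ?_⟩
  by_contra hlt
  have h0 : arrival 0 y < arrival (k + 1) y := hmono (Nat.succ_pos k)
  have h00 : arrival 0 y = 0 := by simp [arrival]
  rw [indicator_of_mem] at hk
  · simp at hk
  · exact ⟨h00 ▸ h0, by linarith⟩

/-- The exponential formula for the marked Poisson process of unit rate. -/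
theorem integral_tprod_arrival (hφ : Integrable φ (volume.prod m)) (hφm : Measurable φ) :
    Integrable (fun y => ∏' k, (1 + φ (arrival (k + 1) y, (y k).2))) (gapLaw m) ∧
    ∫ y, ∏' k, (1 + φ (arrival (k + 1) y, (y k).2)) ∂gapLaw m
      = NormedSpace.exp (∫ t in Ioi 0, ∫ x, φ (t, x) ∂m) := by
  have hψ : Integrable (fun t => ∫ x, φ (t, x) ∂m) := hφ.integral_prod_left
  obtain ⟨B, hB, hle⟩ := ae_exists_bound_prod hφ hφm
  have hlim : ∀ᵐ y ∂gapLaw m, Tendsto (fun n => prodMart φ (fun t => ∫ x, φ (t, x) ∂m) n y) atTop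
      (𝓝 (∏' k, (1 + φ (arrival (k + 1) y, (y k).2)))) := by
    filter_upwards [ae_summable_arrival hφ hφm, ae_tendsto_arrival (m := m)] with y hy ht
    have h1 := (multipliable_one_add_of_summable hy).hasProd.tendsto_prod_nat
    have h2 := h1.mul ((tendsto_tailExp hψ).comp ht)
    rw [mul_one] at h2
    exact h2
  have hbd : ∀ n, ∀ᵐ y ∂gapLaw m, ‖prodMart φ (fun t => ∫ x, φ (t, x) ∂m) n y‖
      ≤ B y * Real.exp (∫ t, ‖∫ x, φ (t, x) ∂m‖) := fun n => hle.mono fun y hy =>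
    (norm_prodMart_le hψ n y).trans (mul_le_mul_of_nonneg_right (hy n) (Real.exp_pos _).le)
  have hmeas := fun n => (measurable_prodMart hφm hψ n).aestronglyMeasurable (μ := gapLaw m)
  constructor
  · refine (hB.mul_const (Real.exp (∫ t, ‖∫ x, φ (t, x) ∂m‖))).mono'
      (aestronglyMeasurable_of_tendsto_ae atTop hmeas hlim) ?_
    filter_upwards [hlim, ae_all_iff.mpr hbd] with y h1 h2
    exact le_of_tendsto h1.norm (Eventually.of_forall h2)
  · have h1 := tendsto_integral_of_dominated_convergence _ hmeas (hB.mul_const _) hbd hlim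
    simp only [integral_prodMart hφ hφm] at h1
    exact tendsto_nhds_unique h1 tendsto_const_nhds

end Poisson

/-! ### The Haar measure of `ℝ₊*` and the time change of the masses -/

section PosHaar

open Set

theorem lintegral_posHaar (G : ℝ → ℝ≥0∞) (hG : Measurable G) :
    ∫⁻ r : PosReal, G r ∂posHaar = ∫⁻ r in Ioi 0, ENNReal.ofReal r⁻¹ * G r := by
  rw [posHaar, lintegral_withDensity_eq_lintegral_mul _ (by fun_prop) (by fun_prop)]
  exact lintegral_subtype_comap measurableSet_Ioi (fun r => ENNReal.ofReal r⁻¹ * G r)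

theorem integral_posHaar {E : Type*} [NormedAddCommGroup E] [NormedSpace ℝ E] (G : ℝ → E) :
    ∫ r : PosReal, G r ∂posHaar = ∫ r in Ioi 0, r⁻¹ • G r := by
  rw [posHaar, integral_withDensity_eq_integral_toReal_smul (by fun_prop) (by simp),
    ← integral_subtype_comap measurableSet_Ioi (fun r => r⁻¹ • G r)]
  refine integral_congr_ae (Eventually.of_forall fun r => ?_)
  simp only
  rw [ENNReal.toReal_ofReal (inv_nonneg.mpr r.2.le)]

theorem integrable_posHaar_iff {E : Type*} [NormedAddCommGroup E] [NormedSpace ℝ E] (G : ℝ → E) :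
    Integrable (fun r : PosReal => G r) posHaar ↔ IntegrableOn (fun r => r⁻¹ • G r) (Ioi 0) := by
  rw [posHaar, integrable_withDensity_iff_integrable_smul' (by fun_prop) (by simp),
    IntegrableOn, ← map_comap_subtype_coe measurableSet_Ioi,
    (MeasurableEmbedding.subtype_coe measurableSet_Ioi).integrable_map_iff]
  refine integrable_congr (Eventually.of_forall fun r => ?_)
  simp only
  rw [ENNReal.toReal_ofReal (inv_nonneg.mpr r.2.le)]
  rfl

instance : SigmaFinite (posHaar : Measure PosReal) := by
  have : SigmaFinite (Measure.comap (Subtype.val : PosReal → ℝ) volume) := by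
    refine SigmaFinite.of_map _ (f := (Subtype.val : PosReal → ℝ)) (by fun_prop) ?_
    have h1 := map_comap_subtype_coe (measurableSet_Ioi (a := (0 : ℝ))) (volume : Measure ℝ)
    exact h1 ▸ (inferInstance : SigmaFinite ((volume : Measure ℝ).restrict (Ioi 0)))
  unfold posHaar
  exact SigmaFinite.withDensity_of_ne_top (Eventually.of_forall fun r => by simp)

theorem measurable_posReal_mul (a : PosReal) : Measurable fun r : PosReal => a * r :=
  Measurable.subtype_mk (f := fun r : PosReal => (a : ℝ) * r) (by fun_prop)

/-- The measure `r⁻¹ dr` is invariant under multiplication. -/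
theorem measurePreserving_posReal_mul (a : PosReal) :
    MeasurePreserving (fun r : PosReal => a * r) posHaar posHaar := by
  refine ⟨measurable_posReal_mul a, ?_⟩
  ext s hs
  obtain ⟨S, hS, rfl⟩ := hs
  have hS' : MeasurableSet ((fun r : ℝ => (a : ℝ) * r) ⁻¹' S) := by
    exact (measurable_const_mul (a : ℝ)) hS
  rw [Measure.map_apply (measurable_posReal_mul a) (measurable_subtype_coe hS)]
  have h1 : ∀ S : Set ℝ, MeasurableSet S → posHaar (Subtype.val ⁻¹' S : Set PosReal)
      = ∫⁻ r in Ioi 0, ENNReal.ofReal r⁻¹ * S.indicator 1 r := fun S hS => by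
    rw [← lintegral_posHaar _ (measurable_one.indicator hS),
      ← lintegral_indicator_one (measurable_subtype_coe hS)]
    rfl
  have h2 : (fun r : PosReal => a * r) ⁻¹' (Subtype.val ⁻¹' S)
      = Subtype.val ⁻¹' ((fun r : ℝ => (a : ℝ) * r) ⁻¹' S) := rfl
  rw [h2, h1 _ hS', h1 _ hS]
  have h3 := lintegral_image_eq_lintegral_abs_deriv_mul (s := Ioi (0 : ℝ))
    (f := fun r => (a : ℝ) * r) (f' := fun _ => (a : ℝ)) measurableSet_Ioi
    (fun r _ => by simpa using ((hasDerivAt_id r).const_mul (a : ℝ)).hasDerivWithinAt)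
    (fun r _ r' _ h => mul_left_cancel₀ a.2.ne' h)
    (fun r => ENNReal.ofReal r⁻¹ * S.indicator 1 r)
  have h4 : (fun r => (a : ℝ) * r) '' Ioi 0 = Ioi 0 := by
    rw [image_mul_left_Ioi a.2, mul_zero]
  rw [h4] at h3
  rw [h3]
  refine setLIntegral_congr_fun measurableSet_Ioi fun r hr => ?_
  have hr' : (0 : ℝ) < r := hr
  rw [← mul_assoc, ← ENNReal.ofReal_mul (abs_nonneg _), abs_of_pos a.2]
  have : (a : ℝ) * ((a : ℝ) * r)⁻¹ = r⁻¹ := by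
    have := a.2.ne'
    field_simp
  rw [this]
  rfl

/-- The intensity `dr / (r (1 + r))` on `ℝ₊*`. -/
def massIntensity : Measure PosReal :=
  posHaar.withDensity fun r => ENNReal.ofReal (1 + (r : ℝ))⁻¹

instance : SigmaFinite massIntensity :=
  SigmaFinite.withDensity_of_ne_top (Eventually.of_forall fun r => by simp)

/-- The decreasing bijection `t ↦ 1 / (e^t - 1)` of `(0, ∞)`, which carries Lebesgue measure to
`dr / (r (1 + r))`. (Its value at `t ≤ 0` is irrelevant.) -/
def massOfTime (t : ℝ) : PosReal :=
  if h : 0 < t then ⟨(Real.exp t - 1)⁻¹, inv_pos.mpr (sub_pos.mpr (Real.one_lt_exp_iff.mpr h))⟩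
  else ⟨1, one_pos⟩

theorem massOfTime_of_pos {t : ℝ} (h : 0 < t) : (massOfTime t : ℝ) = (Real.exp t - 1)⁻¹ := by
  rw [massOfTime, dif_pos h]

theorem massOfTime_lt {s t : ℝ} (hs : 0 < s) (h : s < t) : massOfTime t < massOfTime s := by
  rw [← Subtype.coe_lt_coe, massOfTime_of_pos hs, massOfTime_of_pos (hs.trans h)]
  have h1 : 0 < Real.exp s - 1 := sub_pos.mpr (Real.one_lt_exp_iff.mpr hs)
  have h2 := Real.exp_lt_exp.mpr h
  exact inv_strictAnti₀ h1 (by linarith)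

@[fun_prop]
theorem measurable_massOfTime : Measurable massOfTime := by
  refine (MeasurableEmbedding.subtype_coe measurableSet_Ioi).measurable_comp_iff.mp ?_
  have h1 : (fun t => (massOfTime t : ℝ)) = fun t => if 0 < t then (Real.exp t - 1)⁻¹ else 1 := by
    ext t
    by_cases ht : 0 < t <;> simp [massOfTime, ht]
  have h2 : Measurable fun t : ℝ => if 0 < t then (Real.exp t - 1)⁻¹ else 1 :=
    Measurable.ite measurableSet_Ioi (by fun_prop) measurable_const
  rw [← h1] at h2
  exact h2

/-- The time change carries Lebesgue measure on `(0, ∞)` to `dr / (r (1 + r))`, because `t = log (1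
+ 1 / r)` has the derivative `-1 / (r (1 + r))`. -/
theorem measurePreserving_massOfTime :
    MeasurePreserving massOfTime (volume.restrict (Ioi 0)) massIntensity := by
  refine ⟨measurable_massOfTime, ?_⟩
  ext s hs
  obtain ⟨S, hS, rfl⟩ := hs
  have hpre : MeasurableSet (massOfTime ⁻¹' (Subtype.val ⁻¹' S)) :=
    measurable_massOfTime (measurable_subtype_coe hS)
  rw [Measure.map_apply measurable_massOfTime (measurable_subtype_coe hS),
    Measure.restrict_apply hpre, massIntensity,
    withDensity_apply _ (measurable_subtype_coe hS),
    ← lintegral_indicator (measurable_subtype_coe hS)]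
  have h1 := lintegral_posHaar (S.indicator fun r => ENNReal.ofReal (1 + r)⁻¹)
    (Measurable.indicator (by fun_prop) hS)
  refine Eq.trans ?_ h1.symm
  have h2 : ∀ r, ENNReal.ofReal r⁻¹ * S.indicator (fun r => ENNReal.ofReal (1 + r)⁻¹) r
      = S.indicator (fun r => ENNReal.ofReal r⁻¹ * ENNReal.ofReal (1 + r)⁻¹) r := fun r => by
    by_cases hr : r ∈ S <;> simp [hr]
  simp only [h2]
  rw [lintegral_indicator hS, Measure.restrict_restrict hS]
  set A := massOfTime ⁻¹' (Subtype.val ⁻¹' S) ∩ Ioi 0 with hA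
  have himg : (fun t : ℝ => (Real.exp t - 1)⁻¹) '' A = S ∩ Ioi 0 := by
    ext r
    constructor
    · rintro ⟨t, ⟨ht1, ht2⟩, rfl⟩
      have ht2' : 0 < t := ht2
      refine ⟨?_, ?_⟩
      · have : (massOfTime t : ℝ) ∈ S := ht1
        rwa [massOfTime_of_pos ht2'] at this
      · exact inv_pos.mpr (sub_pos.mpr (Real.one_lt_exp_iff.mpr ht2'))
    · rintro ⟨hr1, hr2⟩
      have hr2' : 0 < r := hr2
      have h3 : 1 < 1 + r⁻¹ := by linarith [inv_pos.mpr hr2']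
      have h4 : 0 < Real.log (1 + r⁻¹) := Real.log_pos h3
      have h5 : (Real.exp (Real.log (1 + r⁻¹)) - 1)⁻¹ = r := by
        rw [Real.exp_log (by linarith)]; simp
      refine ⟨Real.log (1 + r⁻¹), ⟨?_, h4⟩, h5⟩
      change (massOfTime _ : ℝ) ∈ S
      rwa [massOfTime_of_pos h4, h5]
  have h3 := lintegral_image_eq_lintegral_abs_deriv_mul (s := A)
    (f := fun t => (Real.exp t - 1)⁻¹) (f' := fun t => -Real.exp t / (Real.exp t - 1) ^ 2)
    (hpre.inter measurableSet_Ioi)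
    (fun t ht => by
      have ht' : 0 < t := ht.2
      have h1 : Real.exp t - 1 ≠ 0 := (sub_pos.mpr (Real.one_lt_exp_iff.mpr ht')).ne'
      exact (((Real.hasDerivAt_exp t).sub_const 1).inv h1).hasDerivWithinAt)
    (fun t _ t' _ h => by
      have := inv_injective h
      exact Real.exp_injective (by linarith))
    (fun r => ENNReal.ofReal r⁻¹ * ENNReal.ofReal (1 + r)⁻¹)
  rw [himg] at h3
  rw [h3, ← setLIntegral_one]
  refine setLIntegral_congr_fun (hpre.inter measurableSet_Ioi) fun t ht => ?_
  have ht' : 0 < t := ht.2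
  have h4 : 0 < Real.exp t - 1 := sub_pos.mpr (Real.one_lt_exp_iff.mpr ht')
  rw [← ENNReal.ofReal_mul (by positivity), ← ENNReal.ofReal_mul (abs_nonneg _),
    ← ENNReal.ofReal_one]
  congr 1
  rw [abs_div, abs_neg, abs_of_pos (Real.exp_pos t), abs_of_pos (by positivity), inv_inv]
  have h5 : (1 + (Real.exp t - 1)⁻¹) = Real.exp t / (Real.exp t - 1) := by field_simp; ring
  rw [h5]
  field_simp

end PosHaar

/-! ### The Poisson process with intensity `m ⊗ dr / (r (1 + r))` -/

section PoissonLaw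

open Set

variable {𝕜 : Type*} [RCLike 𝕜] {X : Type*} [MeasurableSpace X] (m : Measure X)
  [IsProbabilityMeasure m]

/-- The points `(xₖ, rₖ)` of the Poisson process with intensity `m ⊗ dr / (r (1 + r))`, listed in
the decreasing order of the masses `rₖ`. -/
def massPoints (y : ℕ → ℝ × X) (k : ℕ) : X × PosReal :=
  ((y k).2, massOfTime (arrival (k + 1) y))

@[fun_prop]
theorem measurable_massPoints : Measurable (massPoints : (ℕ → ℝ × X) → ℕ → X × PosReal) := by
  unfold massPoints
  fun_prop

/-- The law of the sequence of the points of the Poisson process with intensity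
`m ⊗ dr / (r (1 + r))`, listed in the decreasing order of the masses. -/
def poissonLaw : Measure (ℕ → X × PosReal) := (gapLaw m).map massPoints

theorem measurableSet_strictAnti :
    MeasurableSet {z : ℕ → X × PosReal | StrictAnti fun k => (z k).2} := by
  have : {z : ℕ → X × PosReal | StrictAnti fun k => (z k).2}
      = ⋂ k : ℕ, {z | (z (k + 1)).2 < (z k).2} := by
    ext z
    simp only [mem_ofPred_eq, mem_iInter]
    exact ⟨fun h k => h k.lt_succ_self, fun h => strictAnti_nat_of_succ_lt h⟩
  rw [this]
  exact MeasurableSet.iInter fun k => measurableSet_lt (by fun_prop) (by fun_prop)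

theorem poissonLaw_ae_strictAnti : ∀ᵐ z ∂poissonLaw m, StrictAnti fun k => (z k).2 := by
  rw [poissonLaw, ae_map_iff measurable_massPoints.aemeasurable measurableSet_strictAnti]
  filter_upwards [ae_gap_pos (m := m)] with y hy
  refine strictAnti_nat_of_succ_lt fun k => ?_
  have h0 : ∀ k, 0 < arrival (k + 1) y := fun k =>
    Finset.sum_pos (fun i _ => hy i) ⟨0, by simp⟩
  refine massOfTime_lt (h0 k) ?_
  rw [arrival, arrival, Finset.sum_range_succ _ (k + 1)]
  linarith [hy (k + 1)]

theorem measurableSet_injective [StandardBorelSpace X] :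
    MeasurableSet {z : ℕ → X × PosReal | Function.Injective fun k => (z k).1} := by
  have : {z : ℕ → X × PosReal | Function.Injective fun k => (z k).1}
      = ⋂ i : ℕ, ⋂ j : ℕ, {z | (z i).1 = (z j).1 → i = j} := by
    ext z
    simp [Function.Injective]
  rw [this]
  refine MeasurableSet.iInter fun i => MeasurableSet.iInter fun j => ?_
  by_cases hij : i = j
  · simp [hij]
  · simp only [hij, imp_false]
    exact (measurableSet_eq_fun (by fun_prop) (by fun_prop)).compl

/-- As `m` has no atoms, the points of the process are pairwise distinct. -/
theorem poissonLaw_ae_injective [StandardBorelSpace X] [NullSingletonClass m] :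
    ∀ᵐ z ∂poissonLaw m, Function.Injective fun k => (z k).1 := by
  rw [poissonLaw, ae_map_iff measurable_massPoints.aemeasurable measurableSet_injective]
  have h1 : ∀ i j : ℕ, ∀ᵐ y ∂gapLaw m, (y i).2 = (y j).2 → i = j := by
    intro i j
    by_cases hij : i = j
    · exact Eventually.of_forall fun _ _ => hij
    simp only [hij, imp_false]
    have h2 := Measure.infinitePi_map_eval_prod (P := fun _ : ℕ => expGap.prod m) hij
    have h3 : ∀ᵐ q ∂((expGap.prod m).prod (expGap.prod m)), q.1.2 ≠ q.2.2 := by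
      have hms : MeasurableSet {q : (ℝ × X) × (ℝ × X) | q.1.2 ≠ q.2.2} :=
        (measurableSet_eq_fun (by fun_prop) (by fun_prop)).compl
      refine (Measure.ae_prod_iff_ae_ae hms).mpr (Eventually.of_forall fun a => ?_)
      have : ∀ᵐ x ∂m, a.2 ≠ x := by
        have := measure_singleton (μ := m) a.2
        rw [ae_iff]
        simpa only [ne_eq, not_not, ofPred_eq_eq_singleton'] using this
      exact Measure.quasiMeasurePreserving_snd.ae this
    rw [← h2] at h3
    exact ae_of_ae_map (μ := gapLaw m) (f := fun y => (y i, y j))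
      (p := fun q : (ℝ × X) × (ℝ × X) => q.1.2 ≠ q.2.2) (by fun_prop) h3
  filter_upwards [ae_all_iff.mpr fun i => ae_all_iff.mpr (h1 i)] with y hy i j hij
  exact hy i j hij

/-- The intensity of the Poisson process, `m ⊗ dr / (r (1 + r))`. -/
abbrev poissonIntensity : Measure (X × PosReal) := m.prod massIntensity

variable {m} {φ : X × PosReal → 𝕜}

theorem integrable_timeChange (hφ : Integrable φ (poissonIntensity m)) :
    Integrable ((Ioi (0 : ℝ) ×ˢ (univ : Set X)).indicator fun z : ℝ × X => φ (z.2, massOfTime z.1))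
      (volume.prod m) ∧
    ∫ t in Ioi 0, ∫ x, (Ioi (0 : ℝ) ×ˢ (univ : Set X)).indicator
      (fun z : ℝ × X => φ (z.2, massOfTime z.1)) (t, x) ∂m = ∫ z, φ z ∂poissonIntensity m := by
  have hmp : MeasurePreserving (fun z : ℝ × X => (z.2, massOfTime z.1))
      ((volume.restrict (Ioi 0)).prod m) (poissonIntensity m) :=
    (Measure.measurePreserving_swap).comp
      (measurePreserving_massOfTime.prod (MeasurePreserving.id m))
  have h1 : Integrable (fun z : ℝ × X => φ (z.2, massOfTime z.1))
      ((volume.restrict (Ioi 0)).prod m) := hmp.integrable_comp_of_integrable hφ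
  constructor
  · rw [integrable_indicator_iff (measurableSet_Ioi.prod MeasurableSet.univ), IntegrableOn,
      ← Measure.prod_restrict, Measure.restrict_univ]
    exact h1
  · have h2 : ∫ z, φ z ∂poissonIntensity m
        = ∫ z : ℝ × X, φ (z.2, massOfTime z.1) ∂((volume.restrict (Ioi 0)).prod m) := by
      rw [← hmp.map_eq, integral_map hmp.measurable.aemeasurable
        (by rw [hmp.map_eq]; exact hφ.aestronglyMeasurable)]
    rw [h2, integral_prod _ h1]
    refine setIntegral_congr_fun measurableSet_Ioi fun t ht => ?_
    refine integral_congr_ae (Eventually.of_forall fun x => ?_)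
    simp only
    rw [indicator_of_mem (show (t, x) ∈ Ioi (0 : ℝ) ×ˢ (univ : Set X) from ⟨ht, trivial⟩)]

theorem poissonLaw_ae_summable (hφ : Integrable φ (poissonIntensity m)) (hφm : Measurable φ) :
    ∀ᵐ z ∂poissonLaw m, Summable fun k => ‖φ (z k)‖ := by
  have h1 : ∀ᵐ z ∂poissonLaw m, ∑' k, ‖φ (z k)‖ₑ ≠ ∞ := by
    have hms : MeasurableSet {z : ℕ → X × PosReal | ∑' k, ‖φ (z k)‖ₑ ≠ ∞} :=
      (measurableSet_eq_fun (Measurable.tsum fun k => by fun_prop) measurable_const).compl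
    rw [poissonLaw, ae_map_iff measurable_massPoints.aemeasurable hms]
    have hm : Measurable ((Ioi (0 : ℝ) ×ˢ (univ : Set X)).indicator
        fun z : ℝ × X => φ (z.2, massOfTime z.1)) :=
      Measurable.indicator (by fun_prop) (measurableSet_Ioi.prod MeasurableSet.univ)
    filter_upwards [ae_summable_arrival (integrable_timeChange hφ).1 hm, ae_gap_pos (m := m)]
      with y hy hpos
    have h0 : ∀ k, 0 < arrival (k + 1) y := fun k =>
      Finset.sum_pos (fun i _ => hpos i) ⟨0, by simp⟩
    have h2 : ∀ k, (Ioi (0 : ℝ) ×ˢ (univ : Set X)).indicator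
        (fun z : ℝ × X => φ (z.2, massOfTime z.1)) (arrival (k + 1) y, (y k).2)
        = φ (massPoints y k) := fun k => by
      rw [indicator_of_mem (show (arrival (k + 1) y, (y k).2) ∈ Ioi (0 : ℝ) ×ˢ (univ : Set X)
        from ⟨h0 k, trivial⟩)]
      rfl
    simp only [h2] at hy
    have h3 := hy.tsum_ofReal_ne_top
    simpa only [ofReal_norm] using h3
  filter_upwards [h1] with z hz
  exact ENNReal.summable_toReal hz |>.congr fun k => by simp

/-- The exponential formula: the expectation of `∏ₖ (1 + φ(xₖ, rₖ))` is `exp (∫ φ)`. -/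
theorem poissonLaw_integral_tprod (hφ : Integrable φ (poissonIntensity m)) (hφm : Measurable φ) :
    Integrable (fun z => ∏' k, (1 + φ (z k))) (poissonLaw m) ∧
    ∫ z, ∏' k, (1 + φ (z k)) ∂poissonLaw m = NormedSpace.exp (∫ z, φ z ∂poissonIntensity m) := by
  have hm : Measurable ((Ioi (0 : ℝ) ×ˢ (univ : Set X)).indicator
      fun z : ℝ × X => φ (z.2, massOfTime z.1)) :=
    Measurable.indicator (by fun_prop) (measurableSet_Ioi.prod MeasurableSet.univ)
  obtain ⟨h1, h2⟩ := integral_tprod_arrival (integrable_timeChange hφ).1 hm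
  rw [(integrable_timeChange hφ).2] at h2
  have hae : (fun y : ℕ → ℝ × X => ∏' k, (1 + (Ioi (0 : ℝ) ×ˢ (univ : Set X)).indicator
        (fun z : ℝ × X => φ (z.2, massOfTime z.1)) (arrival (k + 1) y, (y k).2)))
      =ᵐ[gapLaw m] fun y => ∏' k, (1 + φ (massPoints y k)) := by
    filter_upwards [ae_gap_pos (m := m)] with y hpos
    have h0 : ∀ k, 0 < arrival (k + 1) y := fun k =>
      Finset.sum_pos (fun i _ => hpos i) ⟨0, by simp⟩
    refine tprod_congr fun k => ?_
    rw [indicator_of_mem (show (arrival (k + 1) y, (y k).2) ∈ Ioi (0 : ℝ) ×ˢ (univ : Set X)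
      from ⟨h0 k, trivial⟩)]
    rfl
  have hasm : AEStronglyMeasurable (fun z : ℕ → X × PosReal => ∏' k, (1 + φ (z k)))
      (poissonLaw m) := by
    refine aestronglyMeasurable_of_tendsto_ae atTop
      (f := fun n z => ∏ k ∈ Finset.range n, (1 + φ (z k)))
      (fun n => Measurable.aestronglyMeasurable (by fun_prop)) ?_
    filter_upwards [poissonLaw_ae_summable hφ hφm] with z hz
    exact (multipliable_one_add_of_summable hz).hasProd.tendsto_prod_nat
  constructor
  · rw [poissonLaw, integrable_map_measure hasm measurable_massPoints.aemeasurable]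
    exact h1.congr hae
  · rw [poissonLaw, integral_map measurable_massPoints.aemeasurable hasm, ← h2]
    exact integral_congr_ae hae.symm

end PoissonLaw

/-! ### Measures on the cone are determined by their Laplace transforms -/

section ConeMeasurable

open Set

variable {X : Type*} [MeasurableSpace X]

instance AtomicCone.isFiniteMeasure (ξ : AtomicCone X) : IsFiniteMeasure ξ.1 := by
  obtain ⟨ξ, r, x, hr, hs, rfl⟩ := ξ
  refine ⟨?_⟩
  rw [Measure.sum_apply _ MeasurableSet.univ]
  simp only [Measure.smul_apply, measure_univ, smul_eq_mul, mul_one]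
  exact hs.tsum_ofReal_lt_top

theorem AtomicCone.measurable_coe {A : Set X} (hA : MeasurableSet A) :
    Measurable fun ξ : AtomicCone X => ξ.1 A :=
  (Measure.measurable_coe hA).comp measurable_subtype_coe

theorem AtomicCone.measurable_lintegral {f : X → ℝ≥0∞} (hf : Measurable f) :
    Measurable fun ξ : AtomicCone X => ∫⁻ x, f x ∂ξ.1 :=
  (Measure.measurable_lintegral hf).comp measurable_subtype_coe

variable (X) in
/-- A countable `π`-system of measurable sets that generates the `σ`-algebra and contains the
whole space. -/
theorem exists_countable_piSystem [MeasurableSpace.CountablyGenerated X] :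
    ∃ C : ℕ → Set X, IsPiSystem (range C) ∧ MeasurableSpace.generateFrom (range C) = ‹_› ∧
      univ ∈ range C := by
  set 𝒜 := generateSetAlgebra (MeasurableSpace.countableGeneratingSet X) with h𝒜
  have h1 : 𝒜.Countable :=
    countable_generateSetAlgebra MeasurableSpace.countable_countableGeneratingSet
  have halg : IsSetAlgebra 𝒜 := isSetAlgebra_generateSetAlgebra
  obtain ⟨C, hC⟩ := h1.exists_eq_range ⟨univ, halg.univ_mem⟩
  refine ⟨C, ?_, ?_, ?_⟩
  · rw [← hC]
    exact fun s hs t ht _ => halg.inter_mem hs ht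
  · rw [← hC, h𝒜, generateFrom_generateSetAlgebra_eq,
      MeasurableSpace.generateFrom_countableGeneratingSet]
  · rw [← hC]; exact halg.univ_mem

/-- The masses that a measure of the cone gives to the sets of a sequence. -/
def AtomicCone.eval (C : ℕ → Set X) (ξ : AtomicCone X) (n : ℕ) : ℝ≥0 := (ξ.1 (C n)).toNNReal

section eval

variable {C : ℕ → Set X} (hpi : IsPiSystem (range C))
  (hgen : MeasurableSpace.generateFrom (range C) = ‹_›) (huniv : univ ∈ range C)

include hgen in
theorem AtomicCone.measurable_eval : Measurable (AtomicCone.eval C) := by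
  refine measurable_pi_iff.mpr fun n => ?_
  refine ENNReal.measurable_toNNReal.comp (AtomicCone.measurable_coe ?_)
  rw [← hgen]
  exact MeasurableSpace.measurableSet_generateFrom ⟨n, rfl⟩

include hpi hgen huniv in
/-- The masses of the sets of a countable generating `π`-system generate the `σ`-algebra of the
cone. -/
theorem AtomicCone.measurableSpace_le_comap_eval :
    (inferInstance : MeasurableSpace (AtomicCone X))
      ≤ MeasurableSpace.comap (AtomicCone.eval C) inferInstance := by
  have h1 : ∀ n, Measurable[MeasurableSpace.comap (AtomicCone.eval C) inferInstance]
      fun ξ : AtomicCone X => ξ.1 (C n) := fun n => by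
    let _ : MeasurableSpace (AtomicCone X) :=
      MeasurableSpace.comap (AtomicCone.eval C) inferInstance
    have h2 : Measurable (AtomicCone.eval C) := comap_measurable _
    have h3 : (fun ξ : AtomicCone X => ξ.1 (C n))
        = fun ξ => ((AtomicCone.eval C ξ n : ℝ≥0) : ℝ≥0∞) := by
      ext ξ
      rw [AtomicCone.eval, ENNReal.coe_toNNReal (measure_ne_top _ _)]
    rw [h3]
    exact measurable_coe_nnreal_ennreal.comp ((measurable_pi_apply n).comp h2)
  have h4 : @Measurable (AtomicCone X) (Measure X)
      (MeasurableSpace.comap (AtomicCone.eval C) inferInstance) _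
      (fun ξ : AtomicCone X => ξ.1) := by
    let _ : MeasurableSpace (AtomicCone X) :=
      MeasurableSpace.comap (AtomicCone.eval C) inferInstance
    refine Measurable.measure_of_isPiSystem hgen.symm hpi ?_ ?_
    · rintro _ ⟨n, rfl⟩
      exact h1 n
    · obtain ⟨n, hn⟩ := huniv
      rw [← hn]
      exact h1 n
  exact h4.comap_le

include hpi hgen huniv in
theorem AtomicCone.eval_injective : Function.Injective (AtomicCone.eval C : AtomicCone X → _) := by
  intro ξ η h
  have h1 : ∀ n, ξ.1 (C n) = η.1 (C n) := fun n => by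
    have := congrArg ENNReal.ofNNReal (congrFun h n)
    rwa [AtomicCone.eval, AtomicCone.eval, ENNReal.coe_toNNReal (measure_ne_top _ _),
      ENNReal.coe_toNNReal (measure_ne_top _ _)] at this
  obtain ⟨n, hn⟩ := huniv
  refine Subtype.ext (ext_of_generate_finite _ hgen.symm hpi ?_ (hn ▸ h1 n))
  rintro _ ⟨n, rfl⟩
  exact h1 n

end eval

instance [MeasurableSpace.CountablyGenerated X] :
    MeasurableSpace.CountablySeparated (AtomicCone X) := by
  obtain ⟨C, hpi, hgen, huniv⟩ := exists_countable_piSystem X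
  have h1 := AtomicCone.measurable_eval hgen
  have h2 := AtomicCone.eval_injective hpi hgen huniv
  exact (MeasurableSpace.countablySeparated_def).mpr
    (by
      obtain ⟨S, hS, hSm, hsep⟩ :=
        (inferInstance : HasCountableSeparatingOn (ℕ → ℝ≥0) MeasurableSet univ)
      refine ⟨(fun B => AtomicCone.eval C ⁻¹' B) '' S, hS.image _, ?_, fun ξ _ η _ h => ?_⟩
      · rintro _ ⟨B, hB, rfl⟩
        exact h1 (hSm B hB)
      · exact h2 (hsep _ trivial _ trivial fun B hB => h _ ⟨B, hB, rfl⟩))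

/-- The function `a ↦ e^{-a}` on `[0, ∞]`. -/
def expNeg (a : ℝ≥0∞) : ℝ≥0∞ := EReal.exp (-(a : EReal))

theorem expNeg_of_ne_top {a : ℝ≥0∞} (ha : a ≠ ∞) :
    expNeg a = ENNReal.ofReal (Real.exp (-a.toReal)) := by
  lift a to ℝ≥0 using ha
  rw [expNeg]
  simp only [ENNReal.coe_toReal]
  rw [← EReal.exp_coe]
  rfl

@[fun_prop]
theorem measurable_expNeg : Measurable expNeg := by
  unfold expNeg
  fun_prop

/-- The exponential monomials in countably many nonnegative variables. -/
def expMonomial (t : ℕ →₀ ℝ≥0) : BoundedContinuousFunction (ℕ → ℝ≥0) ℝ :=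
  BoundedContinuousFunction.ofNormedAddCommGroup
    (fun y => Real.exp (-(t.sum fun n a => (a : ℝ) * y n)))
    (by
      unfold Finsupp.sum
      fun_prop) 1 (fun y => by
      rw [Real.norm_eq_abs, abs_of_pos (Real.exp_pos _), Real.exp_le_one_iff, neg_nonpos]
      exact Finsupp.sum_nonneg fun n _ => by positivity)

theorem expMonomial_apply (t : ℕ →₀ ℝ≥0) (y : ℕ → ℝ≥0) :
    expMonomial t y = Real.exp (-(t.sum fun n a => (a : ℝ) * y n)) := rfl

theorem expMonomial_add (t t' : ℕ →₀ ℝ≥0) :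
    expMonomial (t + t') = expMonomial t * expMonomial t' := by
  ext y
  rw [BoundedContinuousFunction.mul_apply, expMonomial_apply, expMonomial_apply,
    expMonomial_apply, ← Real.exp_add, Finsupp.sum_add_index' (by simp) (by simp [add_mul])]
  congr 1
  ring

theorem expMonomial_zero : expMonomial 0 = 1 := by
  ext y
  simp [expMonomial_apply]

/-- The algebra of the exponential polynomials in countably many nonnegative variables. -/
def expPolynomials : StarSubalgebra ℝ (BoundedContinuousFunction (ℕ → ℝ≥0) ℝ) where
  carrier := Submodule.span ℝ (range expMonomial)
  mul_mem' {f g} hf hg := by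
    have h1 := Submodule.mul_mem_mul hf hg
    rw [Submodule.span_mul_span] at h1
    refine Submodule.span_mono ?_ h1
    rintro _ ⟨_, ⟨t, rfl⟩, _, ⟨t', rfl⟩, rfl⟩
    exact ⟨t + t', expMonomial_add t t'⟩
  one_mem' := Submodule.subset_span ⟨0, expMonomial_zero⟩
  add_mem' hf hg := add_mem hf hg
  zero_mem' := zero_mem _
  algebraMap_mem' r := by
    rw [Algebra.algebraMap_eq_smul_one]
    exact Submodule.smul_mem _ _ (Submodule.subset_span ⟨0, expMonomial_zero⟩)
  star_mem' {f} hf := by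
    have : star f = f := by ext y; simp
    rwa [this]

theorem expPolynomials_separatesPoints :
    (expPolynomials.map (BoundedContinuousFunction.toContinuousMapStarₐ ℝ)).SeparatesPoints := by
  intro y y' hyy'
  obtain ⟨n, hn⟩ := Function.ne_iff.mp hyy'
  refine ⟨_, ⟨_, ⟨expMonomial (Finsupp.single n 1),
    Submodule.subset_span ⟨_, rfl⟩, rfl⟩, rfl⟩, ?_⟩
  change expMonomial _ y ≠ expMonomial _ y'
  rw [expMonomial_apply, expMonomial_apply, Finsupp.sum_single_index (by simp),
    Finsupp.sum_single_index (by simp)]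
  simpa using hn

/-- Finite measures on the space of nonnegative sequences are determined by their Laplace
transforms. -/
theorem ext_of_integral_expMonomial {P P' : Measure (ℕ → ℝ≥0)} [IsFiniteMeasure P]
    [IsFiniteMeasure P'] (h : ∀ t, ∫ y, expMonomial t y ∂P = ∫ y, expMonomial t y ∂P') :
    P = P' := by
  refine ext_of_forall_mem_subalgebra_integral_eq_of_polish expPolynomials_separatesPoints ?_
  intro g hg
  have hg' : g ∈ Submodule.span ℝ (range expMonomial) := hg
  clear hg
  induction hg' using Submodule.span_induction with
  | mem x hx => obtain ⟨t, rfl⟩ := hx; exact h t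
  | zero => simp
  | add f g hf hg ihf ihg =>
    simp only [BoundedContinuousFunction.coe_add, Pi.add_apply]
    rw [integral_add (f.integrable P) (g.integrable P),
      integral_add (f.integrable P') (g.integrable P'), ihf, ihg]
  | smul a f hf ih =>
    simp only [BoundedContinuousFunction.coe_smul, smul_eq_mul]
    rw [integral_const_mul, integral_const_mul, ih]

/-- A measure on the cone is determined by its Laplace transform at the bounded functions that are
bounded from below by `1`. After division by `e^{-ξ(X)}` the measures are finite, and the masses of
countably many sets embed the cone into the nonnegative sequences. -/
theorem AtomicCone.ext_of_laplace_bounded [MeasurableSpace.CountablyGenerated X]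
    {𝓛 𝓛' : Measure (AtomicCone X)}
    (h : ∀ f : X → ℝ, Measurable f → (∀ x, 1 ≤ f x) → (∃ C, ∀ x, f x ≤ C) →
      ∫⁻ ξ, expNeg (∫⁻ x, ENNReal.ofReal (f x) ∂ξ.1) ∂𝓛
        = ∫⁻ ξ, expNeg (∫⁻ x, ENNReal.ofReal (f x) ∂ξ.1) ∂𝓛')
    (hfin : ∫⁻ ξ, expNeg (ξ.1 univ) ∂𝓛 ≠ ∞) : 𝓛 = 𝓛' := by
  obtain ⟨C, hpi, hgen, huniv⟩ := exists_countable_piSystem X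
  have hC : ∀ n, MeasurableSet (C n) := fun n => by
    rw [← hgen]; exact MeasurableSpace.measurableSet_generateFrom ⟨n, rfl⟩
  set E : AtomicCone X → ℝ≥0∞ := fun ξ => expNeg (ξ.1 univ) with hE
  have hEm : Measurable E := measurable_expNeg.comp (AtomicCone.measurable_coe MeasurableSet.univ)
  have hfin' : ∫⁻ ξ, expNeg (ξ.1 univ) ∂𝓛' ≠ ∞ := by
    have := h (fun _ => 1) measurable_const (fun _ => le_rfl) ⟨1, fun _ => le_rfl⟩
    simp only [ENNReal.ofReal_one, lintegral_one] at this
    rwa [← this]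
  have hev := AtomicCone.measurable_eval hgen
  have f1 : IsFiniteMeasure (𝓛.withDensity E) := isFiniteMeasure_withDensity hfin
  have f2 : IsFiniteMeasure (𝓛'.withDensity E) := isFiniteMeasure_withDensity hfin'
  -- the Laplace transform of the image of `e^{-ξ(X)} 𝓜` is that of `𝓜` at a function `≥ 1`
  have hkey : ∀ (𝓜 : Measure (AtomicCone X)) (t : ℕ →₀ ℝ≥0),
      ∫ y, expMonomial t y ∂((𝓜.withDensity E).map (AtomicCone.eval C))
      = (∫⁻ ξ, expNeg (∫⁻ x, ENNReal.ofReal (1 + t.sum fun n a =>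
          (C n).indicator (fun _ => (a : ℝ)) x) ∂ξ.1) ∂𝓜).toReal := by
    intro 𝓜 t
    have hm : Measurable fun y => ENNReal.ofReal (expMonomial t y) :=
      (expMonomial t).continuous.measurable.ennreal_ofReal
    have hnn : 0 ≤ᵐ[(𝓜.withDensity E).map (AtomicCone.eval C)] fun y => expMonomial t y :=
      Eventually.of_forall fun y => (Real.exp_pos _).le
    rw [integral_eq_lintegral_of_nonneg_ae hnn
      (expMonomial t).continuous.aestronglyMeasurable, lintegral_map hm hev]
    refine congrArg ENNReal.toReal ((lintegral_withDensity_eq_lintegral_mul _ hEm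
      (hm.comp hev)).trans (lintegral_congr fun ξ => ?_))
    have h1 : ∫⁻ x, ENNReal.ofReal (1 + t.sum fun n a =>
        (C n).indicator (fun _ => (a : ℝ)) x) ∂ξ.1
        = ξ.1 univ + t.sum fun n a => (a : ℝ≥0∞) * ξ.1 (C n) := by
      have h2 : ∀ x, ENNReal.ofReal (1 + t.sum fun n a => (C n).indicator (fun _ => (a : ℝ)) x)
          = 1 + ∑ n ∈ t.support, (C n).indicator (fun _ => (t n : ℝ≥0∞)) x := by
        intro x
        have h3 : ∀ n, 0 ≤ (C n).indicator (fun _ => (t n : ℝ)) x := fun n =>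
          indicator_nonneg (fun _ _ => (t n).2) x
        rw [Finsupp.sum, ENNReal.ofReal_add zero_le_one (Finset.sum_nonneg fun n _ => h3 n),
          ENNReal.ofReal_one, ENNReal.ofReal_sum_of_nonneg fun n _ => h3 n]
        congr 1
        refine Finset.sum_congr rfl fun n _ => ?_
        by_cases hx : x ∈ C n <;> simp [hx]
      simp only [h2]
      rw [lintegral_add_left measurable_const,
        lintegral_finsetSum _ fun n _ => measurable_const.indicator (hC n)]
      simp [lintegral_indicator_const (hC _), Finsupp.sum]
    have hfin1 : (t.sum fun n a => (a : ℝ≥0∞) * ξ.1 (C n)) ≠ ∞ :=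
      ENNReal.sum_ne_top.mpr fun n _ => ENNReal.mul_ne_top (by simp) (measure_ne_top _ _)
    rw [h1]
    simp only [Pi.mul_apply, hE, Function.comp_apply]
    rw [expNeg_of_ne_top (measure_ne_top _ _), expNeg_of_ne_top
      (ENNReal.add_ne_top.mpr ⟨measure_ne_top _ _, hfin1⟩), expMonomial_apply,
      ← ENNReal.ofReal_mul (Real.exp_pos _).le, ← Real.exp_add,
      ENNReal.toReal_add (measure_ne_top _ _) hfin1, neg_add]
    congr 4
    rw [Finsupp.sum, Finsupp.sum, ENNReal.toReal_sum fun n _ =>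
      ENNReal.mul_ne_top (by simp) (measure_ne_top _ _)]
    refine Finset.sum_congr rfl fun n _ => ?_
    rw [ENNReal.toReal_mul]
    rfl
  have hmap : (𝓛.withDensity E).map (AtomicCone.eval C)
      = (𝓛'.withDensity E).map (AtomicCone.eval C) := by
    refine ext_of_integral_expMonomial fun t => ?_
    rw [hkey, hkey]
    congr 1
    have hind : ∀ x, 0 ≤ t.sum fun n a => (C n).indicator (fun _ => (a : ℝ)) x := fun x =>
      Finsupp.sum_nonneg fun n _ => indicator_nonneg (fun _ _ => (t n).2) x
    have hm1 : Measurable fun x => 1 + t.sum fun n a => (C n).indicator (fun _ => (a : ℝ)) x := by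
      refine measurable_const.add ?_
      exact Finset.measurable_sum _ fun n _ => measurable_const.indicator (hC n)
    refine h _ hm1 (fun x => by linarith [hind x]) ⟨1 + t.sum fun _ a => (a : ℝ), fun x => ?_⟩
    refine add_le_add_right (Finset.sum_le_sum fun n _ => ?_) 1
    exact indicator_le_self' (fun _ _ => (t n).2) x
  have hwd : 𝓛.withDensity E = 𝓛'.withDensity E := by
    ext s hs
    obtain ⟨B, hB, rfl⟩ := AtomicCone.measurableSpace_le_comap_eval hpi hgen huniv s hs
    rw [← Measure.map_apply hev hB, hmap, Measure.map_apply hev hB]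
  have hE0 : ∀ ξ, E ξ ≠ 0 := fun ξ => by
    simp only [hE]
    rw [expNeg_of_ne_top (measure_ne_top _ _)]
    simp [Real.exp_pos]
  have hEt : ∀ ξ, E ξ ≠ ∞ := fun ξ => by
    simp only [hE]
    rw [expNeg_of_ne_top (measure_ne_top _ _)]
    simp
  rw [← withDensity_inv_same (μ := 𝓛) hEm (Eventually.of_forall hE0) (Eventually.of_forall hEt),
    ← withDensity_inv_same (μ := 𝓛') hEm (Eventually.of_forall hE0) (Eventually.of_forall hEt),
    hwd]

/-- A measure on the cone is determined by its Laplace transform at the strictly positive functions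
with integrable logarithm. -/
theorem AtomicCone.ext_of_laplace [MeasurableSpace.CountablyGenerated X]
    {𝓛 𝓛' : Measure (AtomicCone X)} (m : Measure X) [IsFiniteMeasure m]
    (h : ∀ f : X → ℝ, Measurable f → (∀ x, 0 < f x) →
      Integrable (fun x => Real.log (f x)) m →
      ∫⁻ ξ, expNeg (∫⁻ x, ENNReal.ofReal (f x) ∂ξ.1) ∂𝓛
        = ∫⁻ ξ, expNeg (∫⁻ x, ENNReal.ofReal (f x) ∂ξ.1) ∂𝓛')
    (hfin : ∫⁻ ξ, expNeg (ξ.1 univ) ∂𝓛 ≠ ∞) : 𝓛 = 𝓛' := by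
  refine AtomicCone.ext_of_laplace_bounded (fun f hf h1 ⟨C, hC⟩ =>
    h f hf (fun x => one_pos.trans_le (h1 x)) ?_) hfin
  refine Integrable.mono' (g := fun _ => C) (integrable_const _)
    hf.log.aestronglyMeasurable (Eventually.of_forall fun x => ?_)
  rw [Real.norm_eq_abs, abs_of_nonneg (Real.log_nonneg (h1 x))]
  exact (Real.log_le_self (zero_le_one.trans (h1 x))).trans (hC x)

end ConeMeasurable

/-! ### The infinite-dimensional Lebesgue measure -/

section ConeMeasure

open Set

instance : StandardBorelSpace PosReal := (measurableSet_Ioi (a := (0 : ℝ))).standardBorel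

variable (X : Type*) [MeasurableSpace X]

/-- The sequences `(xₖ, rₖ)` that enumerate the atoms of a measure of the cone with pairwise
distinct masses in the decreasing order of the masses. -/
def massSeq : Set (ℕ → X × PosReal) :=
  {z | StrictAnti (fun k => (z k).2) ∧ Function.Injective (fun k => (z k).1) ∧
    Summable fun k => ((z k).2 : ℝ)}

theorem measurableSet_massSeq [StandardBorelSpace X] : MeasurableSet (massSeq X) := by
  have h1 : MeasurableSet {z : ℕ → X × PosReal | Summable fun k => ((z k).2 : ℝ)} := by
    have : {z : ℕ → X × PosReal | Summable fun k => ((z k).2 : ℝ)}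
        = {z | ∑' k, ENNReal.ofReal ((z k).2 : ℝ) = ∞}ᶜ := by
      ext z
      constructor
      · exact fun h => h.tsum_ofReal_ne_top
      · intro h
        exact (ENNReal.summable_toReal h).congr fun k => ENNReal.toReal_ofReal (z k).2.2.le
    rw [this]
    exact (measurableSet_eq_fun (Measurable.tsum fun k => by fun_prop) measurable_const).compl
  exact measurableSet_strictAnti.inter (measurableSet_injective.inter h1)

instance [StandardBorelSpace X] : StandardBorelSpace (massSeq X) :=
  (measurableSet_massSeq X).standardBorel

variable {X}

/-- The measure of the cone with the atoms `(xₖ, rₖ)`. -/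
def toCone (z : massSeq X) : AtomicCone X :=
  ⟨Measure.sum fun k => ENNReal.ofReal ((z.1 k).2 : ℝ) • Measure.dirac (z.1 k).1,
    fun k => ((z.1 k).2 : ℝ), ⟨fun k => (z.1 k).1, z.2.2.1⟩, fun k => (z.1 k).2.2, z.2.2.2, rfl⟩

theorem toCone_apply (z : massSeq X) {A : Set X} (hA : MeasurableSet A) :
    (toCone z).1 A = ∑' k, ENNReal.ofReal ((z.1 k).2 : ℝ) * A.indicator 1 (z.1 k).1 := by
  rw [toCone, Measure.sum_apply _ hA]
  simp [Measure.dirac_apply' _ hA]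

theorem lintegral_toCone (z : massSeq X) {f : X → ℝ≥0∞} (hf : Measurable f) :
    ∫⁻ x, f x ∂(toCone z).1 = ∑' k, ENNReal.ofReal ((z.1 k).2 : ℝ) * f (z.1 k).1 := by
  rw [toCone, lintegral_sum_measure]
  simp [lintegral_smul_measure, lintegral_dirac' _ hf]

theorem mass_toCone [MeasurableSingletonClass X] (z : massSeq X) (k : ℕ) :
    (toCone z).mass (z.1 k).1 = (z.1 k).2 := by
  rw [AtomicCone.mass, toCone_apply z (measurableSet_singleton _), tsum_eq_single k]
  · simp [(z.1 k).2.2.le]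
  · intro j hj
    have : (z.1 j).1 ≠ (z.1 k).1 := fun h => hj (z.2.2.1 h)
    simp [this]

theorem mass_toCone_eq_zero [MeasurableSingletonClass X] (z : massSeq X) {x : X}
    (hx : ∀ k, (z.1 k).1 ≠ x) : (toCone z).mass x = 0 := by
  rw [AtomicCone.mass, toCone_apply z (measurableSet_singleton _)]
  simp [hx]

theorem atoms_toCone [MeasurableSingletonClass X] (z : massSeq X) :
    {x | 0 < (toCone z).mass x} = range fun k => (z.1 k).1 := by
  ext x
  constructor
  · intro hx
    by_contra h
    have := mass_toCone_eq_zero z (x := x) fun k hk => h ⟨k, hk⟩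
    rw [mem_ofPred_eq, this] at hx
    exact lt_irrefl _ hx
  · rintro ⟨k, rfl⟩
    rw [mem_ofPred_eq, mass_toCone]
    exact (z.1 k).2.2

/-- The enumeration of the atoms used in the definition of the fibres recovers the sequence. -/
theorem points_toCone [MeasurableSingletonClass X] (z : massSeq X) (k : ℕ) :
    (toCone z).points k = (z.1 k).1 := by
  have hex : ∃ e : ℕ ↪ X, range e = {x | 0 < (toCone z).mass x} ∧
      Antitone fun k => (toCone z).mass (e k) := by
    refine ⟨⟨fun k => (z.1 k).1, z.2.2.1⟩, (atoms_toCone z).symm, ?_⟩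
    intro i j hij
    change (toCone z).mass (z.1 j).1 ≤ (toCone z).mass (z.1 i).1
    rw [mass_toCone, mass_toCone]
    exact z.2.1.antitone hij
  obtain ⟨h1, h2⟩ : range (toCone z).points = {x | 0 < (toCone z).mass x} ∧
      Antitone fun k => (toCone z).mass ((toCone z).points k) :=
    Classical.epsilon_spec hex
  rw [atoms_toCone] at h1
  -- the masses of the atoms in the two enumerations are strictly decreasing with the same range
  have hinj : Function.Injective fun k => (toCone z).mass ((toCone z).points k) := by
    intro i j hij
    obtain ⟨a, ha⟩ : (toCone z).points i ∈ range fun k => (z.1 k).1 := h1 ▸ ⟨i, rfl⟩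
    obtain ⟨b, hb⟩ : (toCone z).points j ∈ range fun k => (z.1 k).1 := h1 ▸ ⟨j, rfl⟩
    simp only at hij ha hb
    rw [← ha, ← hb, mass_toCone, mass_toCone] at hij
    have hab : a = b := z.2.1.injective (Subtype.ext hij)
    exact (toCone z).points.injective (by rw [← ha, ← hb, hab])
  have hs1 : StrictAnti fun k => (toCone z).mass ((toCone z).points k) :=
    h2.strictAnti_of_injective hinj
  have hs2 : StrictAnti fun k => ((z.1 k).2 : ℝ) := fun i j hij => z.2.1 hij
  have hrange : range (fun k => (toCone z).mass ((toCone z).points k))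
      = range fun k => ((z.1 k).2 : ℝ) := by
    have h3 : range (fun k => (toCone z).mass ((toCone z).points k))
        = (toCone z).mass '' range (toCone z).points := by rw [← range_comp]; rfl
    rw [h3, h1, ← range_comp]
    exact congrArg range (funext fun k => mass_toCone z k)
  have heq : (fun k => (toCone z).mass ((toCone z).points k)) = fun k => ((z.1 k).2 : ℝ) := by
    have h4 : StrictMono fun k => OrderDual.toDual ((toCone z).mass ((toCone z).points k)) :=
      fun i j hij => hs1 hij
    have h5 : StrictMono fun k => OrderDual.toDual ((z.1 k).2 : ℝ) := fun i j hij => hs2 hij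
    exact (StrictMono.range_inj h4 h5).mp hrange
  obtain ⟨a, ha⟩ : (toCone z).points k ∈ range fun k => (z.1 k).1 := h1 ▸ ⟨k, rfl⟩
  have h6 := congrFun heq k
  rw [← ha, mass_toCone] at h6
  have hak : a = k := z.2.1.injective (Subtype.ext h6)
  rw [← ha, hak]

theorem toCone_injective [MeasurableSingletonClass X] :
    Function.Injective (toCone : massSeq X → AtomicCone X) := by
  intro z z' h
  have h1 : ∀ k, (z.1 k).1 = (z'.1 k).1 := fun k => by
    rw [← points_toCone z, ← points_toCone z', h]
  refine Subtype.ext (funext fun k => Prod.ext (h1 k) (Subtype.ext ?_))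
  rw [← mass_toCone z, ← mass_toCone z', h, h1]

/-- By the Lusin–Souslin theorem the sequences are identified with a measurable set of measures. -/
theorem measurableEmbedding_toCone [StandardBorelSpace X] :
    MeasurableEmbedding (toCone : massSeq X → AtomicCone X) := by
  refine Measurable.measurableEmbedding (Measurable.subtype_mk ?_) toCone_injective
  refine Measure.measurable_of_measurable_coe _ fun A hA => ?_
  have h1 : (fun z : massSeq X => (Measure.sum fun k =>
      ENNReal.ofReal ((z.1 k).2 : ℝ) • Measure.dirac (z.1 k).1) A)
      = fun z => ∑' k, ENNReal.ofReal ((z.1 k).2 : ℝ) * A.indicator 1 (z.1 k).1 := by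
    ext z
    exact toCone_apply z hA
  rw [h1]
  have h2 : Measurable (A.indicator (1 : X → ℝ≥0∞)) := measurable_one.indicator hA
  refine Measurable.tsum fun k => ?_
  have h3 : Measurable fun z : massSeq X => z.1 k :=
    (measurable_pi_apply k).comp measurable_subtype_coe
  exact (measurable_subtype_coe.comp h3.snd).ennreal_ofReal.mul (h2.comp h3.fst)

theorem integrableOn_inv_sub_exp :
    Integrable (fun r : PosReal => (1 + (r : ℝ))⁻¹ - Real.exp (-(r : ℝ))) posHaar := by
  rw [integrable_posHaar_iff (fun r : ℝ => (1 + r)⁻¹ - Real.exp (-r))]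
  refine Integrable.mono' (integrable_inv_one_add_sq.const_mul 2).integrableOn
    (Measurable.aestronglyMeasurable (by fun_prop)) ?_
  filter_upwards [ae_restrict_mem measurableSet_Ioi] with r hr
  have hr' : (0 : ℝ) < r := hr
  have h1 : Real.exp (-r) ≤ (1 + r)⁻¹ := by
    rw [Real.exp_neg]
    exact inv_anti₀ (by linarith) (by linarith [Real.add_one_le_exp r])
  have h2 : (1 + r)⁻¹ - Real.exp (-r) ≤ (1 + r)⁻¹ := by linarith [Real.exp_pos (-r)]
  have h3 : (1 + r)⁻¹ - Real.exp (-r) ≤ r ^ 2 * (1 + r)⁻¹ := by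
    have := Real.add_one_le_exp (-r)
    have h4 : (1 + r)⁻¹ - r ^ 2 * (1 + r)⁻¹ = 1 - r := by field_simp; ring
    linarith
  rw [smul_eq_mul, Real.norm_eq_abs, abs_mul, abs_of_pos (inv_pos.mpr hr'),
    abs_of_nonneg (sub_nonneg.mpr h1)]
  rcases le_total r 1 with h | h
  · refine (mul_le_mul_of_nonneg_left h3 (inv_pos.mpr hr').le).trans ?_
    have : r⁻¹ * (r ^ 2 * (1 + r)⁻¹) = r * (1 + r)⁻¹ := by field_simp
    rw [this, ← div_eq_mul_inv, ← div_eq_mul_inv, div_le_div_iff₀ (by positivity) (by positivity)]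
    nlinarith
  · refine (mul_le_mul_of_nonneg_left h2 (inv_pos.mpr hr').le).trans ?_
    rw [← mul_inv, ← one_div, ← div_eq_mul_inv, div_le_div_iff₀ (by positivity) (by positivity)]
    nlinarith

/-- The normalizing constant `exp (∫ (1 / (1 + r) - e^{-r}) r⁻¹ dr)`. -/
def coneConst : ℝ :=
  Real.exp (∫ r : PosReal, ((1 + (r : ℝ))⁻¹ - Real.exp (-(r : ℝ))) ∂posHaar)

/-- The density, with respect to the law of the Poisson process of intensity
`m ⊗ dr / (r (1 + r))`, of the infinite-dimensional Lebesgue measure. -/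
def coneDensity (z : ℕ → X × PosReal) : ℝ := coneConst * ∏' k, (1 + ((z k).2 : ℝ))

@[fun_prop]
theorem measurable_coneDensity : Measurable (coneDensity : (ℕ → X × PosReal) → ℝ) := by
  unfold coneDensity
  fun_prop

theorem multipliable_one_add_mass (z : massSeq X) : Multipliable fun k => 1 + ((z.1 k).2 : ℝ) :=
  multipliable_one_add_of_summable z.2.2.2.norm

theorem one_le_tprod_mass (z : massSeq X) : 1 ≤ ∏' k, (1 + ((z.1 k).2 : ℝ)) := by
  refine ge_of_tendsto' (multipliable_one_add_mass z).hasProd.tendsto_prod_nat fun n => ?_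
  refine le_trans (by simp) (Finset.prod_le_prod (f := fun _ => (1 : ℝ)) (fun _ _ => zero_le_one)
    fun k _ => ?_)
  have := (z.1 k).2.2
  linarith

theorem coneDensity_pos (z : massSeq X) : 0 < coneDensity z.1 :=
  mul_pos (Real.exp_pos _) (one_pos.trans_le (one_le_tprod_mass z))

variable (m : Measure X) [IsProbabilityMeasure m]

/-- The infinite-dimensional Lebesgue measure: it has the density `coneDensity` with respect to the
law of the Poisson process, so almost all measures of the cone have pairwise distinct masses. -/
def coneMeasure : Measure (AtomicCone X) :=
  (Measure.comap (Subtype.val : massSeq X → _)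
    ((poissonLaw m).withDensity fun z => ENNReal.ofReal (coneDensity z))).map toCone

variable {m}

theorem poissonLaw_ae_summable_mass :
    ∀ᵐ z ∂poissonLaw m, Summable fun k => ((z k).2 : ℝ) := by
  have h1 : Integrable (fun z : X × PosReal => min (z.2 : ℝ) 1) (poissonIntensity m) := by
    have h2 : Integrable (fun r : PosReal => min (r : ℝ) 1) massIntensity := by
      rw [massIntensity, integrable_withDensity_iff_integrable_smul' (by fun_prop) (by simp)]
      have h3 : (fun r : PosReal => (ENNReal.ofReal (1 + (r : ℝ))⁻¹).toReal • min (r : ℝ) 1)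
          = fun r : PosReal => (fun r : ℝ => (max (1 + r)⁻¹ 0) * min r 1) r := by
        ext r
        rw [ENNReal.toReal_ofReal']
        rfl
      rw [h3]
      refine (integrable_posHaar_iff (fun r : ℝ => max (1 + r)⁻¹ 0 * min r 1)).mpr ?_
      refine Integrable.mono' (integrable_inv_one_add_sq.const_mul 2).integrableOn
        (Measurable.aestronglyMeasurable (by fun_prop)) ?_
      filter_upwards [ae_restrict_mem measurableSet_Ioi] with r hr
      have hr' : (0 : ℝ) < r := hr
      have h4 : max (1 + r)⁻¹ 0 = (1 + r)⁻¹ := max_eq_left (by positivity)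
      have h5 : 0 ≤ min r 1 := le_min hr'.le zero_le_one
      rw [h4, smul_eq_mul, Real.norm_eq_abs, abs_of_nonneg (by positivity)]
      rcases le_total r 1 with h | h
      · rw [min_eq_left h]
        have : r⁻¹ * ((1 + r)⁻¹ * r) = 1 / (1 + r) := by field_simp
        rw [this, ← div_eq_mul_inv, div_le_div_iff₀ (by positivity) (by positivity)]
        nlinarith
      · rw [min_eq_right h, mul_one, ← mul_inv, ← one_div, ← div_eq_mul_inv,
          div_le_div_iff₀ (by positivity) (by positivity)]
        nlinarith
    exact h2.comp_snd m
  filter_upwards [poissonLaw_ae_summable h1 (by fun_prop)] with z hz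
  have h2 : ∀ᶠ k in atTop, ‖min ((z k).2 : ℝ) 1‖ < 1 :=
    hz.tendsto_atTop_zero.eventually (gt_mem_nhds one_pos)
  obtain ⟨N, hN⟩ := eventually_atTop.mp h2
  rw [← summable_nat_add_iff N]
  refine ((summable_nat_add_iff N).mpr hz).congr fun k => ?_
  have h3 := hN (k + N) (Nat.le_add_left _ _)
  have h0 : (0 : ℝ) < (z (k + N)).2 := (z (k + N)).2.2
  rw [Real.norm_eq_abs, abs_of_pos (lt_min h0 one_pos)] at h3 ⊢
  rcases min_lt_iff.mp h3 with h | h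
  · exact min_eq_left h.le
  · exact absurd h (lt_irrefl _)

variable [StandardBorelSpace X] [NullSingletonClass m]

theorem poissonLaw_ae_mem_massSeq : ∀ᵐ z ∂poissonLaw m, z ∈ massSeq X := by
  filter_upwards [poissonLaw_ae_strictAnti m, poissonLaw_ae_injective m,
    poissonLaw_ae_summable_mass (m := m)] with z h1 h2 h3
  exact ⟨h1, h2, h3⟩

theorem withDensity_restrict_massSeq :
    ((poissonLaw m).withDensity fun z => ENNReal.ofReal (coneDensity z)).restrict (massSeq X)
      = (poissonLaw m).withDensity fun z => ENNReal.ofReal (coneDensity z) :=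
  Measure.restrict_eq_self_of_ae_mem
    ((withDensity_absolutelyContinuous _ _).ae_le poissonLaw_ae_mem_massSeq)

/-- Integrals over the cone are integrals over sequences. `G` is only required to agree with `G'` on
the sequences in `massSeq X`, which carry the whole mass. -/
theorem integral_coneMeasure {E : Type*} [NormedAddCommGroup E] [NormedSpace ℝ E]
    {G : AtomicCone X → E} {G' : (ℕ → X × PosReal) → E}
    (h : ∀ z : massSeq X, G (toCone z) = G' z.1) :
    ∫ ξ, G ξ ∂coneMeasure m = ∫ z, coneDensity z • G' z ∂poissonLaw m := by
  rw [coneMeasure, measurableEmbedding_toCone.integral_map]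
  simp only [h]
  rw [integral_subtype_comap (measurableSet_massSeq X) G', withDensity_restrict_massSeq,
    integral_withDensity_eq_integral_toReal_smul (by fun_prop) (by simp)]
  refine integral_congr_ae (poissonLaw_ae_mem_massSeq.mono fun z hz => ?_)
  simp only
  rw [ENNReal.toReal_ofReal (coneDensity_pos ⟨z, hz⟩).le]

theorem integrable_coneMeasure_iff {E : Type*} [NormedAddCommGroup E] [NormedSpace ℝ E]
    {G : AtomicCone X → E} {G' : (ℕ → X × PosReal) → E}
    (h : ∀ z : massSeq X, G (toCone z) = G' z.1) :
    Integrable G (coneMeasure m) ↔ Integrable (fun z => coneDensity z • G' z) (poissonLaw m) := by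
  have h1 : G ∘ toCone = G' ∘ Subtype.val := funext h
  rw [coneMeasure, measurableEmbedding_toCone.integrable_map_iff, h1,
    ← (MeasurableEmbedding.subtype_coe (measurableSet_massSeq X)).integrable_map_iff,
    map_comap_subtype_coe (measurableSet_massSeq X), withDensity_restrict_massSeq,
    integrable_withDensity_iff_integrable_smul' (by fun_prop) (by simp)]
  refine integrable_congr (poissonLaw_ae_mem_massSeq.mono fun z hz => ?_)
  simp only
  rw [ENNReal.toReal_ofReal (coneDensity_pos ⟨z, hz⟩).le]

theorem aestronglyMeasurable_coneMeasure {E : Type*} [TopologicalSpace E]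
    {G : AtomicCone X → E} {G' : (ℕ → X × PosReal) → E}
    (h : ∀ z : massSeq X, G (toCone z) = G' z.1)
    (hG' : AEStronglyMeasurable G' (poissonLaw m)) : AEStronglyMeasurable G (coneMeasure m) := by
  rw [coneMeasure, measurableEmbedding_toCone.aestronglyMeasurable_map_iff]
  have h1 : G ∘ toCone = G' ∘ Subtype.val := funext h
  rw [h1, ← (MeasurableEmbedding.subtype_coe
    (measurableSet_massSeq X)).aestronglyMeasurable_map_iff,
    map_comap_subtype_coe (measurableSet_massSeq X), withDensity_restrict_massSeq]
  exact hG'.mono_ac (withDensity_absolutelyContinuous _ _)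

theorem ae_coneMeasure_iff {p : AtomicCone X → Prop} :
    (∀ᵐ ξ ∂coneMeasure m, p ξ) ↔
      ∀ᵐ z ∂poissonLaw m, ∀ hz : z ∈ massSeq X, p (toCone ⟨z, hz⟩) := by
  have h1 : (∀ᵐ z ∂Measure.comap (Subtype.val : massSeq X → _)
      ((poissonLaw m).withDensity fun z => ENNReal.ofReal (coneDensity z)), p (toCone z)) ↔
      ∀ᵐ z ∂((poissonLaw m).withDensity fun z => ENNReal.ofReal (coneDensity z)),
        ∀ hz : z ∈ massSeq X, p (toCone ⟨z, hz⟩) := by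
    rw [← withDensity_restrict_massSeq, ← map_comap_subtype_coe (measurableSet_massSeq X),
      (MeasurableEmbedding.subtype_coe (measurableSet_massSeq X)).ae_map_iff,
      map_comap_subtype_coe (measurableSet_massSeq X), withDensity_restrict_massSeq]
    exact eventually_congr (Eventually.of_forall fun z => ⟨fun h _ => h, fun h => h z.2⟩)
  rw [coneMeasure, measurableEmbedding_toCone.ae_map_iff, h1, ae_withDensity_iff (by fun_prop)]
  refine eventually_congr (poissonLaw_ae_mem_massSeq.mono fun z hz => ?_)
  have h2 : ENNReal.ofReal (coneDensity z) ≠ 0 := by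
    simpa using coneDensity_pos ⟨z, hz⟩
  exact ⟨fun h => h h2, fun h _ => h⟩

end ConeMeasure

/-! ### Integrals of products over the atoms -/

section ConeIntegral

open Set

variable {𝕜 : Type*} [RCLike 𝕜] {X : Type*} [MeasurableSpace X] {m : Measure X}
  [IsProbabilityMeasure m]

theorem poissonIntensity_eq : poissonIntensity m
    = (m.prod posHaar).withDensity fun z => ENNReal.ofReal (1 + (z.2 : ℝ))⁻¹ := by
  rw [poissonIntensity, massIntensity, prod_withDensity_right (by fun_prop)]

theorem integrable_poissonIntensity_iff {E : Type*} [NormedAddCommGroup E] [NormedSpace ℝ E]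
    {f : X × PosReal → E} : Integrable f (poissonIntensity m)
      ↔ Integrable (fun z => (1 + (z.2 : ℝ))⁻¹ • f z) (m.prod posHaar) := by
  rw [poissonIntensity_eq, integrable_withDensity_iff_integrable_smul' (by fun_prop) (by simp)]
  refine integrable_congr (Eventually.of_forall fun z => ?_)
  have : (0 : ℝ) ≤ (1 + (z.2 : ℝ))⁻¹ := by have := z.2.2; positivity
  simp only
  rw [ENNReal.toReal_ofReal this]

theorem integral_poissonIntensity {E : Type*} [NormedAddCommGroup E] [NormedSpace ℝ E]
    (f : X × PosReal → E) : ∫ z, f z ∂poissonIntensity m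
      = ∫ z, (1 + (z.2 : ℝ))⁻¹ • f z ∂(m.prod posHaar) := by
  rw [poissonIntensity_eq, integral_withDensity_eq_integral_toReal_smul (by fun_prop) (by simp)]
  refine integral_congr_ae (Eventually.of_forall fun z => ?_)
  have : (0 : ℝ) ≤ (1 + (z.2 : ℝ))⁻¹ := by have := z.2.2; positivity
  simp only
  rw [ENNReal.toReal_ofReal this]

/-- The function `(1 + r) w - 1` is integrable with respect to `m ⊗ dr / (r (1 + r))` if `w -
e^{-r}` is so with respect to `m ⊗ dr / r`; the difference of the two integrals is the logarithm of
`coneConst`. -/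
theorem integrable_tilt {w : X × PosReal → 𝕜}
    (hw : Integrable (fun z => w z - ((Real.exp (-(z.2 : ℝ)) : ℝ) : 𝕜)) (m.prod posHaar)) :
    Integrable (fun z => ((1 + (z.2 : ℝ) : ℝ) : 𝕜) * w z - 1) (poissonIntensity m) ∧
    ∫ z, (((1 + (z.2 : ℝ) : ℝ) : 𝕜) * w z - 1) ∂poissonIntensity m
      = ∫ z, (w z - ((Real.exp (-(z.2 : ℝ)) : ℝ) : 𝕜)) ∂(m.prod posHaar)
        - ((∫ r : PosReal, ((1 + (r : ℝ))⁻¹ - Real.exp (-(r : ℝ))) ∂posHaar : ℝ) : 𝕜) := by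
  have h1 : ∀ z : X × PosReal, (1 + (z.2 : ℝ))⁻¹ • (((1 + (z.2 : ℝ) : ℝ) : 𝕜) * w z - 1)
      = (w z - ((Real.exp (-(z.2 : ℝ)) : ℝ) : 𝕜))
        - (((1 + (z.2 : ℝ))⁻¹ - Real.exp (-(z.2 : ℝ)) : ℝ) : 𝕜) := by
    intro z
    have h2 : (((1 + (z.2 : ℝ)) : ℝ) : 𝕜) ≠ 0 := by
      have := z.2.2
      exact RCLike.ofReal_ne_zero.mpr (by positivity)
    rw [RCLike.real_smul_eq_coe_mul, RCLike.ofReal_sub, RCLike.ofReal_inv]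
    field_simp
    ring
  have h3 : Integrable (fun z : X × PosReal =>
      (((1 + (z.2 : ℝ))⁻¹ - Real.exp (-(z.2 : ℝ)) : ℝ) : 𝕜)) (m.prod posHaar) :=
    (integrableOn_inv_sub_exp.comp_snd m).ofReal
  rw [integrable_poissonIntensity_iff, integral_poissonIntensity]
  simp only [h1]
  refine ⟨hw.sub h3, ?_⟩
  rw [integral_sub hw h3, integral_ofReal]
  congr 2
  have := integral_fun_snd (μ := m) (ν := posHaar)
    (f := fun r : PosReal => (1 + (r : ℝ))⁻¹ - Real.exp (-(r : ℝ)))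
  rw [this]
  simp

/-- If the product of the factors `1 + rₖ` and the product of the factors `(1 + rₖ) wₖ` converge
absolutely, so does the product of the factors `wₖ`. -/
theorem summable_untilt {r : ℕ → ℝ} {w : ℕ → 𝕜} (hr : ∀ k, 0 < r k) (hs : Summable r)
    (hw : Summable fun k => ‖((1 + r k : ℝ) : 𝕜) * w k - 1‖) : Summable fun k => ‖w k - 1‖ := by
  refine Summable.of_nonneg_of_le (fun _ => norm_nonneg _) (fun k => ?_) (hw.add hs)
  have h1 : (((1 + r k) : ℝ) : 𝕜) ≠ 0 := by
    have := hr k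
    exact RCLike.ofReal_ne_zero.mpr (by positivity)
  have h2 : w k - 1 = (((1 + r k)⁻¹ : ℝ) : 𝕜)
      * ((((1 + r k : ℝ) : 𝕜) * w k - 1) - ((r k : ℝ) : 𝕜)) := by
    rw [RCLike.ofReal_inv]
    field_simp
    push_cast
    ring
  rw [h2, norm_mul, RCLike.norm_ofReal]
  have h3 : |(1 + r k)⁻¹| ≤ 1 := by
    have := hr k
    rw [abs_of_pos (by positivity)]
    exact inv_le_one_of_one_le₀ (by linarith)
  refine (mul_le_of_le_one_left (norm_nonneg _) h3).trans ((norm_sub_le _ _).trans ?_)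
  rw [RCLike.norm_ofReal, abs_of_pos (hr k)]

theorem tprod_tilt {r : ℕ → ℝ} {w : ℕ → 𝕜} (hs : Summable r)
    (hw : Summable fun k => ‖w k - 1‖) :
    ∏' k, (1 + (((1 + r k : ℝ) : 𝕜) * w k - 1)) = ((∏' k, (1 + r k) : ℝ) : 𝕜) * ∏' k, w k := by
  have h1 : Multipliable w := by
    have := multipliable_one_add_of_summable hw
    simpa using this
  have h2 : Multipliable fun k => 1 + r k := multipliable_one_add_of_summable hs.norm
  have h3 : HasProd (fun k => ((1 + r k : ℝ) : 𝕜)) ((∏' k, (1 + r k) : ℝ) : 𝕜) :=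
    h2.hasProd.map (algebraMap ℝ 𝕜) RCLike.continuous_ofReal
  have h4 := (h3.mul h1.hasProd).tprod_eq
  rw [← h4]
  refine tprod_congr fun k => ?_
  ring

variable [StandardBorelSpace X] [NullSingletonClass m]

theorem poissonLaw_ae_summable_sub_one {w : X × PosReal → 𝕜} (hwm : Measurable w)
    (hw : Integrable (fun z => w z - ((Real.exp (-(z.2 : ℝ)) : ℝ) : 𝕜)) (m.prod posHaar)) :
    ∀ᵐ z ∂poissonLaw m, Summable fun k => ‖w (z k) - 1‖ := by
  filter_upwards [poissonLaw_ae_summable (integrable_tilt hw).1 (by fun_prop),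
    poissonLaw_ae_mem_massSeq] with z h1 h2
  exact summable_untilt (fun k => (z k).2.2) h2.2.2 h1

/-- The basic integral: `∫ ∏ₖ w(xₖ, rₖ) d𝓛 = exp (∫ (w - e^{-r}) r⁻¹ dr dm)`. -/
theorem coneMeasure_integral_tprod {w : X × PosReal → 𝕜} (hwm : Measurable w)
    (hw : Integrable (fun z => w z - ((Real.exp (-(z.2 : ℝ)) : ℝ) : 𝕜)) (m.prod posHaar))
    {G : AtomicCone X → 𝕜} (hG : ∀ z : massSeq X, (Summable fun k => ‖w (z.1 k) - 1‖) →
      G (toCone z) = ∏' k, w (z.1 k)) :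
    Integrable G (coneMeasure m) ∧ ∫ ξ, G ξ ∂coneMeasure m
      = NormedSpace.exp (∫ z, (w z - ((Real.exp (-(z.2 : ℝ)) : ℝ) : 𝕜)) ∂(m.prod posHaar)) := by
  classical
  set G' : (ℕ → X × PosReal) → 𝕜 := fun z => if hz : z ∈ massSeq X then G (toCone ⟨z, hz⟩) else 0
    with hG'
  have h1 : ∀ z : massSeq X, G (toCone z) = G' z.1 := fun z => by
    rw [hG']
    simp only [z.2, dif_pos]
  obtain ⟨h2, h3⟩ := integrable_tilt hw
  have hm : Measurable fun z : X × PosReal => ((1 + (z.2 : ℝ) : ℝ) : 𝕜) * w z - 1 := by fun_prop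
  obtain ⟨h4, h5⟩ := poissonLaw_integral_tprod h2 hm
  have hae : (fun z => coneDensity z • G' z) =ᵐ[poissonLaw m] fun z =>
      (coneConst : 𝕜) * ∏' k, (1 + (((1 + ((z k).2 : ℝ) : ℝ) : 𝕜) * w (z k) - 1)) := by
    filter_upwards [poissonLaw_ae_mem_massSeq, poissonLaw_ae_summable_sub_one hwm hw] with z hz hs
    rw [tprod_tilt hz.2.2 hs, ← hG ⟨z, hz⟩ hs, h1,
      RCLike.real_smul_eq_coe_mul, coneDensity]
    push_cast
    ring
  constructor
  · rw [integrable_coneMeasure_iff h1]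
    exact (h4.const_mul _).congr hae.symm
  · rw [integral_coneMeasure h1, integral_congr_ae hae, integral_const_mul, h5, h3, coneConst,
      ← RCLike.exp_ofReal, ← NormedSpace.exp_add]
    congr 1
    ring

/-- Frullani's integral. -/
theorem integral_exp_sub_exp (a : ℝ) (ha : 0 < a) :
    Integrable (fun r : PosReal => Real.exp (-(a * (r : ℝ))) - Real.exp (-(r : ℝ))) posHaar ∧
    ∫ r : PosReal, (Real.exp (-(a * (r : ℝ))) - Real.exp (-(r : ℝ))) ∂posHaar = -Real.log a ∧
    ∫ r : PosReal, |Real.exp (-(a * (r : ℝ))) - Real.exp (-(r : ℝ))| ∂posHaar = |Real.log a| := by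
  have hint : IntegrableOn (fun r : ℝ => r⁻¹ • (Real.exp (-(a * r)) - Real.exp (-(1 * r))))
      (Ioi 0) := by
    set c := min a 1 with hc
    have hc0 : 0 < c := lt_min ha one_pos
    refine Integrable.mono' (g := fun r => |a - 1| * Real.exp (-c * r))
      ((exp_neg_integrableOn_Ioi 0 hc0).const_mul _)
      (Measurable.aestronglyMeasurable (by fun_prop)) ?_
    filter_upwards [ae_restrict_mem measurableSet_Ioi] with r hr
    have hr' : (0 : ℝ) < r := hr
    have h1 : |Real.exp (-(a * r)) - Real.exp (-(1 * r))| ≤ |a - 1| * r * Real.exp (-c * r) := by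
      -- `|e^{-s} - e^{-t}| ≤ |s - t| e^{-min (s, t)}`
      have key : ∀ s t : ℝ, s ≤ t → Real.exp (-s) - Real.exp (-t) ≤ (t - s) * Real.exp (-s) := by
        intro s t _
        have h2 := Real.add_one_le_exp (s - t)
        have h3 : Real.exp (-t) = Real.exp (-s) * Real.exp (s - t) := by
          rw [← Real.exp_add]; ring_nf
        rw [h3]
        nlinarith [Real.exp_pos (-s)]
      rcases le_total a 1 with h | h
      · have hca : c = a := min_eq_left h
        have h4 : a * r ≤ 1 * r := mul_le_mul_of_nonneg_right h hr'.le
        rw [abs_of_nonneg (sub_nonneg.mpr (Real.exp_le_exp.mpr (neg_le_neg h4))),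
          abs_of_nonpos (by linarith), hca]
        refine (key _ _ h4).trans (le_of_eq ?_)
        rw [neg_mul]
        ring_nf
      · have hca : c = 1 := min_eq_right h
        have h4 : 1 * r ≤ a * r := mul_le_mul_of_nonneg_right h hr'.le
        rw [abs_of_nonpos (sub_nonpos.mpr (Real.exp_le_exp.mpr (neg_le_neg h4))),
          abs_of_nonneg (by linarith), hca, neg_sub]
        refine (key _ _ h4).trans (le_of_eq ?_)
        rw [neg_mul]
        ring
    rw [smul_eq_mul, Real.norm_eq_abs, abs_mul, abs_of_pos (inv_pos.mpr hr')]
    refine (mul_le_mul_of_nonneg_left h1 (inv_pos.mpr hr').le).trans (le_of_eq ?_)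
    field_simp
  have hF : Integrable (fun r : PosReal => Real.exp (-(a * (r : ℝ))) - Real.exp (-(r : ℝ)))
      posHaar := by
    refine (integrable_posHaar_iff (fun r : ℝ => Real.exp (-(a * r)) - Real.exp (-r))).mpr ?_
    simpa using hint
  have hI : ∫ r : PosReal, (Real.exp (-(a * (r : ℝ))) - Real.exp (-(r : ℝ))) ∂posHaar
      = -Real.log a := by
    rw [integral_posHaar (fun r : ℝ => Real.exp (-(a * r)) - Real.exp (-r))]
    have h1 := Frullani.integral_Ioi_eq (f := fun r : ℝ => Real.exp (-r)) (a := a) (b := 1)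
      (L := 1) (R := 0)
      ((by fun_prop :
        Continuous fun r : ℝ => Real.exp (-r)).locallyIntegrable.locallyIntegrableOn _)
      ha one_pos
      (by
        have : Tendsto (fun r : ℝ => Real.exp (-r)) (𝓝 0) (𝓝 (Real.exp (-0))) :=
          (by fun_prop : Continuous fun r : ℝ => Real.exp (-r)).tendsto 0
        rw [neg_zero, Real.exp_zero] at this
        exact this.mono_left nhdsWithin_le_nhds)
      Real.tendsto_exp_neg_atTop_nhds_zero hint
    simp only [one_mul] at h1
    rw [h1]
    simp
  refine ⟨hF, hI, ?_⟩
  rcases le_total a 1 with h | h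
  · have h1 : ∀ r : PosReal, |Real.exp (-(a * (r : ℝ))) - Real.exp (-(r : ℝ))|
        = Real.exp (-(a * (r : ℝ))) - Real.exp (-(r : ℝ)) := fun r => by
      refine abs_of_nonneg (sub_nonneg.mpr (Real.exp_le_exp.mpr (neg_le_neg ?_)))
      nlinarith [r.2]
    simp only [h1]
    rw [hI, abs_of_nonpos (Real.log_nonpos ha.le h)]
  · have h1 : ∀ r : PosReal, |Real.exp (-(a * (r : ℝ))) - Real.exp (-(r : ℝ))|
        = -(Real.exp (-(a * (r : ℝ))) - Real.exp (-(r : ℝ))) := fun r => by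
      refine abs_of_nonpos (sub_nonpos.mpr (Real.exp_le_exp.mpr (neg_le_neg ?_)))
      nlinarith [r.2]
    simp only [h1]
    rw [integral_neg, hI, neg_neg, abs_of_nonneg (Real.log_nonneg h)]

theorem integral_prod_exp_sub_exp {f : X → ℝ} (hf : Measurable f) (h0 : ∀ x, 0 < f x)
    (hlog : Integrable (fun x => Real.log (f x)) m) :
    Integrable (fun z : X × PosReal => Real.exp (-(f z.1 * (z.2 : ℝ))) - Real.exp (-(z.2 : ℝ)))
      (m.prod posHaar) ∧
    ∫ z : X × PosReal, (Real.exp (-(f z.1 * (z.2 : ℝ))) - Real.exp (-(z.2 : ℝ))) ∂(m.prod posHaar)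
      = -∫ x, Real.log (f x) ∂m := by
  have h1 : Integrable (fun z : X × PosReal => Real.exp (-(f z.1 * (z.2 : ℝ)))
      - Real.exp (-(z.2 : ℝ))) (m.prod posHaar) := by
    rw [integrable_prod_iff (Measurable.aestronglyMeasurable (by fun_prop))]
    refine ⟨Eventually.of_forall fun x => (integral_exp_sub_exp (f x) (h0 x)).1, ?_⟩
    simp only [Real.norm_eq_abs, (integral_exp_sub_exp _ (h0 _)).2.2]
    exact hlog.abs
  refine ⟨h1, ?_⟩
  rw [integral_prod _ h1, ← integral_neg]
  exact integral_congr_ae (Eventually.of_forall fun x => (integral_exp_sub_exp _ (h0 x)).2.1)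

/-- The Laplace transform of the infinite-dimensional Lebesgue measure. -/
theorem coneMeasure_laplace {f : X → ℝ} (hf : Measurable f) (h0 : ∀ x, 0 < f x)
    (hlog : Integrable (fun x => Real.log (f x)) m) :
    ∫⁻ ξ, expNeg (∫⁻ x, ENNReal.ofReal (f x) ∂ξ.1) ∂coneMeasure m
      = ENNReal.ofReal (Real.exp (-∫ x, Real.log (f x) ∂m)) := by
  obtain ⟨h1, h2⟩ := integral_prod_exp_sub_exp hf h0 hlog
  have hG : ∀ z : massSeq X,
      (Summable fun k => ‖Real.exp (-(f (z.1 k).1 * ((z.1 k).2 : ℝ))) - 1‖) →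
      (expNeg (∫⁻ x, ENNReal.ofReal (f x) ∂(toCone z).1)).toReal
        = ∏' k, Real.exp (-(f (z.1 k).1 * ((z.1 k).2 : ℝ))) := by
    intro z hz
    have hnn : ∀ k, 0 ≤ f (z.1 k).1 * ((z.1 k).2 : ℝ) := fun k =>
      mul_nonneg (h0 _).le (z.1 k).2.2.le
    -- `1 - e^{-a}` is at least `a / 2` for small `a`
    have hsum : Summable fun k => f (z.1 k).1 * ((z.1 k).2 : ℝ) := by
      have hev : ∀ᶠ k in atTop, ‖Real.exp (-(f (z.1 k).1 * ((z.1 k).2 : ℝ))) - 1‖ < 1 / 2 :=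
        hz.tendsto_atTop_zero.eventually (gt_mem_nhds (by norm_num))
      obtain ⟨N, hN⟩ := eventually_atTop.mp hev
      rw [← summable_nat_add_iff N]
      refine Summable.of_nonneg_of_le (fun k => hnn _) (fun k => ?_)
        (((summable_nat_add_iff N).mpr hz).mul_left 2)
      have h3 := hN (k + N) (Nat.le_add_left _ _)
      set a := f (z.1 (k + N)).1 * ((z.1 (k + N)).2 : ℝ)
      have ha : 0 ≤ a := hnn (k + N)
      have h4 : Real.exp (-a) ≤ 1 := Real.exp_le_one_iff.mpr (by linarith)
      rw [Real.norm_eq_abs, abs_of_nonpos (by linarith)] at h3 ⊢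
      have h5 : a + 1 ≤ Real.exp a := Real.add_one_le_exp a
      have h6 : Real.exp (-a) * Real.exp a = 1 := by rw [← Real.exp_add]; simp
      nlinarith
    have hlin : ∫⁻ x, ENNReal.ofReal (f x) ∂(toCone z).1
        = ENNReal.ofReal (∑' k, f (z.1 k).1 * ((z.1 k).2 : ℝ)) := by
      rw [lintegral_toCone z hf.ennreal_ofReal, ENNReal.ofReal_tsum_of_nonneg hnn hsum]
      refine tsum_congr fun k => ?_
      rw [mul_comm (f _), ENNReal.ofReal_mul (z.1 k).2.2.le]
    rw [hlin, expNeg_of_ne_top (by simp), ENNReal.toReal_ofReal (Real.exp_pos _).le,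
      ENNReal.toReal_ofReal (tsum_nonneg hnn), ← tsum_neg]
    have h7 : HasProd (fun k => Real.exp (-(f (z.1 k).1 * ((z.1 k).2 : ℝ)))) _ :=
      hsum.neg.hasSum.rexp
    exact h7.tprod_eq.symm
  obtain ⟨h3, h4⟩ := coneMeasure_integral_tprod (𝕜 := ℝ) (m := m)
    (w := fun z : X × PosReal => Real.exp (-(f z.1 * (z.2 : ℝ)))) (by fun_prop) (by simpa using h1)
    (G := fun ξ => (expNeg (∫⁻ x, ENNReal.ofReal (f x) ∂ξ.1)).toReal) hG
  have hne : ∀ a, expNeg a ≠ ∞ := by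
    intro a
    by_cases ha : a = ∞
    · subst ha
      simp [expNeg]
    · rw [expNeg_of_ne_top ha]; simp
  have h5 := ofReal_integral_eq_lintegral_ofReal h3 (Eventually.of_forall fun _ =>
    ENNReal.toReal_nonneg)
  simp only [ENNReal.ofReal_toReal (hne _)] at h5
  rw [← h5, h4]
  simp only [RCLike.ofReal_real_eq_id, id_eq]
  rw [h2, Real.exp_eq_exp_ℝ]

theorem sigmaFinite_of_laplace {𝓛 : Measure (AtomicCone X)}
    (h : ∫⁻ ξ, expNeg (ξ.1 univ) ∂𝓛 ≠ ∞) : SigmaFinite 𝓛 := by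
  have hEm : Measurable fun ξ : AtomicCone X => expNeg (ξ.1 univ) :=
    measurable_expNeg.comp (AtomicCone.measurable_coe MeasurableSet.univ)
  have f1 : IsFiniteMeasure (𝓛.withDensity fun ξ => expNeg (ξ.1 univ)) :=
    isFiniteMeasure_withDensity h
  have hE0 : ∀ ξ : AtomicCone X, expNeg (ξ.1 univ) ≠ 0 := fun ξ => by
    rw [expNeg_of_ne_top (measure_ne_top _ _)]
    simp [Real.exp_pos]
  have hEt : ∀ ξ : AtomicCone X, expNeg (ξ.1 univ) ≠ ∞ := fun ξ => by
    rw [expNeg_of_ne_top (measure_ne_top _ _)]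
    simp
  rw [← withDensity_inv_same (μ := 𝓛) hEm (Eventually.of_forall hE0) (Eventually.of_forall hEt)]
  exact SigmaFinite.withDensity_of_ne_top (Eventually.of_forall fun ξ => by
    simpa using hE0 ξ)

theorem coneMeasure_isInfDimLebesgue : IsInfDimLebesgue m (coneMeasure m) where
  sigmaFinite := by
    refine sigmaFinite_of_laplace ?_
    have := coneMeasure_laplace (m := m) (f := fun _ => 1) measurable_const (fun _ => one_pos)
      (by simp)
    simp only [ENNReal.ofReal_one, lintegral_one] at this
    rw [this]
    simp
  laplace _ hf h0 hlog := coneMeasure_laplace hf h0 hlog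

omit [NullSingletonClass m] in
theorem IsInfDimLebesgue.unique {𝓛 𝓛' : Measure (AtomicCone X)} (h : IsInfDimLebesgue m 𝓛)
    (h' : IsInfDimLebesgue m 𝓛') : 𝓛 = 𝓛' := by
  refine AtomicCone.ext_of_laplace m (fun f hf h0 hlog =>
    (h.laplace f hf h0 hlog).trans (h'.laplace f hf h0 hlog).symm) ?_
  have := h.laplace (fun _ => 1) measurable_const (fun _ => one_pos) (by simp)
  simp only [ENNReal.ofReal_one, lintegral_one] at this
  change ∫⁻ ξ, EReal.exp (-((ξ.1 univ : ℝ≥0∞) : EReal)) ∂𝓛 ≠ ∞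
  rw [this]
  simp

theorem AtomicCone.measurable_scale (a : X → PosReal) (ha : ∃ C : ℝ, ∀ x, (a x : ℝ) ≤ C)
    (hm : Measurable a) : Measurable (AtomicCone.scale a ha) := by
  refine Measurable.subtype_mk (Measure.measurable_of_measurable_coe _ fun A hA => ?_)
  have h1 : (fun ξ : AtomicCone X => (ξ.1.withDensity fun x => ENNReal.ofReal (a x)) A)
      = fun ξ => ∫⁻ x, A.indicator (fun x => ENNReal.ofReal (a x)) x ∂ξ.1 := by
    ext ξ
    rw [withDensity_apply _ hA, lintegral_indicator hA]
  rw [h1]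
  exact AtomicCone.measurable_lintegral (Measurable.indicator (by fun_prop) hA)

/-- The multiplicators `M_a` preserve the infinite-dimensional Lebesgue measure up to a factor: the
Laplace transform of the image at `f` is that of the measure at `a f`. -/
theorem coneMeasure_map_scale (a : X → PosReal) (ha : ∃ C : ℝ, ∀ x, (a x : ℝ) ≤ C)
    (hm : Measurable a) (hlog : Integrable (fun x => Real.log (a x)) m) :
    (coneMeasure m).map (AtomicCone.scale a ha)
      = ENNReal.ofReal (Real.exp (-∫ x, Real.log (a x) ∂m)) • coneMeasure m := by
  have hsc := AtomicCone.measurable_scale a ha hm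
  have key : ∀ f : X → ℝ, Measurable f → (∀ x, 0 < f x) →
      Integrable (fun x => Real.log (f x)) m →
      ∫⁻ ξ, expNeg (∫⁻ x, ENNReal.ofReal (f x) ∂ξ.1) ∂((coneMeasure m).map (AtomicCone.scale a ha))
        = ∫⁻ ξ, expNeg (∫⁻ x, ENNReal.ofReal (f x) ∂ξ.1)
          ∂(ENNReal.ofReal (Real.exp (-∫ x, Real.log (a x) ∂m)) • coneMeasure m) := by
    intro f hf h0 hl
    have h1 : ∀ ξ : AtomicCone X, ∫⁻ x, ENNReal.ofReal (f x) ∂(ξ.scale a ha).1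
        = ∫⁻ x, ENNReal.ofReal (a x * f x) ∂ξ.1 := by
      intro ξ
      change ∫⁻ x, ENNReal.ofReal (f x) ∂(ξ.1.withDensity fun x => ENNReal.ofReal (a x)) = _
      rw [lintegral_withDensity_eq_lintegral_mul _ (by fun_prop) (by fun_prop)]
      refine lintegral_congr fun x => ?_
      rw [Pi.mul_apply, ENNReal.ofReal_mul (a x).2.le]
    have h2 : ∀ x, Real.log (a x * f x) = Real.log (a x) + Real.log (f x) := fun x =>
      Real.log_mul (a x).2.ne' (h0 x).ne'
    have hm2 : Measurable fun ξ : AtomicCone X => expNeg (∫⁻ x, ENNReal.ofReal (f x) ∂ξ.1) :=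
      measurable_expNeg.comp (AtomicCone.measurable_lintegral (by fun_prop))
    refine (lintegral_map hm2 hsc).trans ?_
    simp only [h1]
    rw [lintegral_smul_measure, coneMeasure_laplace (by fun_prop)
      (fun x => mul_pos (a x).2 (h0 x)) (by simp only [h2]; exact hlog.add hl),
      coneMeasure_laplace hf h0 hl, smul_eq_mul, ← ENNReal.ofReal_mul (Real.exp_pos _).le,
      ← Real.exp_add]
    simp only [h2]
    rw [integral_add hlog hl, neg_add]
  refine AtomicCone.ext_of_laplace m key ?_
  have h3 := key (fun _ => 1) measurable_const (fun _ => one_pos) (by simp)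
  have h4 := coneMeasure_laplace (m := m) (f := fun _ => 1) measurable_const (fun _ => one_pos)
    (by simp)
  simp only [ENNReal.ofReal_one, lintegral_one] at h3 h4
  rw [h3, lintegral_smul_measure, h4]
  exact ENNReal.mul_ne_top (by simp) (by simp)

theorem quasiMeasurePreserving_scale (a : X → PosReal) (ha : ∃ C : ℝ, ∀ x, (a x : ℝ) ≤ C)
    (hm : Measurable a) (hlog : Integrable (fun x => Real.log (a x)) m) :
    Measure.QuasiMeasurePreserving (AtomicCone.scale a ha) (coneMeasure m) (coneMeasure m) := by
  refine ⟨AtomicCone.measurable_scale a ha hm, ?_⟩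
  rw [coneMeasure_map_scale a ha hm hlog]
  exact Measure.smul_absolutelyContinuous

end ConeIntegral

/-! ### Families of vectors with given inner products -/

section GramTopology

variable {𝕜 : Type*} [RCLike 𝕜] {E : Type*} [NormedAddCommGroup E] [InnerProductSpace 𝕜 E]

/-- A map into an inner product space is continuous as soon as its Gram kernel is. -/
theorem continuous_of_continuous_inner {Y : Type*} [TopologicalSpace Y] {F : Y → E}
    (hF : Continuous fun p : Y × Y => inner 𝕜 (F p.1) (F p.2)) : Continuous F := by
  rw [continuous_iff_continuousAt]
  intro y
  rw [ContinuousAt, tendsto_iff_norm_sub_tendsto_zero]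
  have h1 : ∀ z, ‖F z - F y‖ = Real.sqrt (RCLike.re (inner 𝕜 (F z) (F z))
      - 2 * RCLike.re (inner 𝕜 (F z) (F y)) + RCLike.re (inner 𝕜 (F y) (F y))) := by
    intro z
    rw [← norm_sq_eq_re_inner, ← norm_sq_eq_re_inner, ← norm_sub_sq (𝕜 := 𝕜),
      Real.sqrt_sq (norm_nonneg _)]
  have h2 : Continuous fun z => Real.sqrt (RCLike.re (inner 𝕜 (F z) (F z))
      - 2 * RCLike.re (inner 𝕜 (F z) (F y)) + RCLike.re (inner 𝕜 (F y) (F y))) := by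
    have h3 : Continuous fun z => inner 𝕜 (F z) (F z) :=
      hF.comp (continuous_id.prodMk continuous_id)
    have h4 : Continuous fun z => inner 𝕜 (F z) (F y) :=
      hF.comp (continuous_id.prodMk continuous_const)
    have h5 := (RCLike.continuous_re (K := 𝕜)).comp h3
    have h6 := (RCLike.continuous_re (K := 𝕜)).comp h4
    exact Real.continuous_sqrt.comp ((h5.sub (continuous_const.mul h6)).add continuous_const)
  have h7 := h2.tendsto y
  simp only [← h1] at h7
  simpa using h7

/-- Two vectors with the same inner products with a total family are equal. -/
theorem eq_of_inner_eq_of_total {ι : Type*} {a : ι → E}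
    (ha : (Submodule.span 𝕜 (Set.range a)).topologicalClosure = ⊤) {x y : E}
    (hxy : ∀ i, inner 𝕜 (a i) x = inner 𝕜 (a i) y) : x = y := by
  rw [← sub_eq_zero]
  have h1 : x - y ∈ (Submodule.span 𝕜 (Set.range a))ᗮ := by
    rw [Submodule.mem_orthogonal]
    intro u hu
    induction hu using Submodule.span_induction with
    | mem u hu => obtain ⟨i, rfl⟩ := hu; rw [inner_sub_right, hxy, sub_self]
    | zero => simp
    | add u v _ _ hu hv => rw [inner_add_left, hu, hv, add_zero]
    | smul c u _ hu => rw [inner_smul_left, hu, mul_zero]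
  have h2 : (x - y) ∈ (Submodule.span 𝕜 (Set.range a)).topologicalClosureᗮ := by
    rwa [Submodule.orthogonal_closure]
  rw [ha, Submodule.top_orthogonal_eq_bot] at h2
  simpa using h2

theorem KernelSpace.span_vec {I : Type*} {K : Matrix I I 𝕜} (hK : K.PosSemidef) :
    (Submodule.span 𝕜 (Set.range (KernelSpace.vec hK))).topologicalClosure = ⊤ := by
  rw [eq_top_iff]
  rintro x -
  have h1 : ∀ f : PreKernelSpace K hK, UniformSpace.Completion.coe' f ∈
      Submodule.span 𝕜 (Set.range (KernelSpace.vec hK)) := by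
    intro f
    have hf : f ∈ Submodule.span 𝕜 (Set.range (PreKernelSpace.single hK)) := by
      rw [PreKernelSpace.span_single]; trivial
    have h2 := Submodule.mem_map_of_mem (f := (UniformSpace.Completion.toComplL (𝕜 := 𝕜)
      (E := PreKernelSpace K hK)).toLinearMap) hf
    rw [Submodule.map_span, ← Set.range_comp] at h2
    exact h2
  have h3 := UniformSpace.Completion.denseRange_coe (α := PreKernelSpace K hK)
  rw [← SetLike.mem_coe, Submodule.topologicalClosure_coe]
  exact closure_mono (by rintro _ ⟨f, rfl⟩; exact h1 f) (h3 x)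

end GramTopology

namespace StabTensor

/-! ### Elementary tensors with finitely many factors -/

section Basic

variable (𝕜 : Type*) [RCLike 𝕜] {ι κ H : Type*} [NormedAddCommGroup H]
  [InnerProductSpace 𝕜 H] (h : Metric.sphere (0 : H) 1)

include 𝕜 in
theorem inner_stab : inner 𝕜 (h : H) (h : H) = 1 := by
  rw [inner_self_eq_norm_sq_to_K, norm_eq_of_mem_sphere]; simp

theorem span_tens :
    (Submodule.span 𝕜 (Set.range (tens (ι := ι) 𝕜 h))).topologicalClosure = ⊤ :=
  KernelSpace.span_vec _

/-- The family equal to `w` on the finite set `s` and to `h` off `s`. -/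
def trunc (s : Finset ι) (w : ι → H) : StabFamily ι h :=
  open scoped Classical in
  ⟨fun i => if i ∈ s then w i else h, s.finite_toSet.subset fun i hi => by
    by_contra h'
    exact hi (if_neg h')⟩

variable {h} in
theorem trunc_val_of_mem {s : Finset ι} {w : ι → H} {i : ι} (hi : i ∈ s) :
    (trunc h s w).val i = w i := if_pos hi

variable {h} in
theorem trunc_val_of_notMem {s : Finset ι} {w : ι → H} {i : ι} (hi : i ∉ s) :
    (trunc h s w).val i = h := if_neg hi

/-- The elementary tensor with the factors `w i` for `i ∈ s` and `h` for `i ∉ s`. -/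
def tensOn (s : Finset ι) (w : ι → H) : StabTensor 𝕜 ι h := tens 𝕜 h (trunc h s w)

theorem inner_tens (f g : StabFamily ι h) :
    inner 𝕜 (tens 𝕜 h f) (tens 𝕜 h g) = ∏ᶠ i, inner 𝕜 (f.val i) (g.val i) :=
  KernelSpace.inner_vec _ f g

theorem inner_tens_of_subset {f g : StabFamily ι h} {s : Finset ι}
    (hf : ∀ i ∉ s, f.val i = h) (hg : ∀ i ∉ s, g.val i = h) :
    inner 𝕜 (tens 𝕜 h f) (tens 𝕜 h g) = ∏ i ∈ s, inner 𝕜 (f.val i) (g.val i) := by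
  rw [inner_tens]
  refine finprod_eq_prod_of_mulSupport_subset _ fun i hi => ?_
  by_contra h'
  rw [Finset.mem_coe] at h'
  exact hi (by simp only [hf i h', hg i h', inner_stab 𝕜 h])

theorem inner_tensOn (s : Finset ι) (w w' : ι → H) :
    inner 𝕜 (tensOn 𝕜 h s w) (tensOn 𝕜 h s w') = ∏ i ∈ s, inner 𝕜 (w i) (w' i) := by
  rw [tensOn, tensOn, inner_tens_of_subset 𝕜 h (fun i hi => trunc_val_of_notMem hi)
    (fun i hi => trunc_val_of_notMem hi)]
  exact Finset.prod_congr rfl fun i hi => by rw [trunc_val_of_mem hi, trunc_val_of_mem hi]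

theorem norm_tensOn (s : Finset ι) (w : ι → H) : ‖tensOn 𝕜 h s w‖ = ∏ i ∈ s, ‖w i‖ := by
  have h1 := norm_sq_eq_re_inner (𝕜 := 𝕜) (tensOn 𝕜 h s w)
  rw [inner_tensOn, Finset.prod_congr rfl fun i _ => inner_self_eq_norm_sq_to_K (𝕜 := 𝕜) (w i),
    Finset.prod_pow, ← RCLike.ofReal_prod, ← RCLike.ofReal_pow, RCLike.ofReal_re] at h1
  exact (sq_eq_sq₀ (norm_nonneg _) (Finset.prod_nonneg fun _ _ => norm_nonneg _)).mp h1

theorem continuous_tensOn (s : Finset ι) : Continuous fun w : ι → H => tensOn 𝕜 h s w := by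
  refine continuous_of_continuous_inner (𝕜 := 𝕜) ?_
  simp only [inner_tensOn]
  fun_prop

theorem trunc_eq_of_forall (f : StabFamily ι h) {s : Finset ι} (hf : ∀ i ∉ s, f.val i = h) :
    trunc h s f.val = f := by
  have : (trunc h s f.val).val = f.val := by
    funext i
    by_cases hi : i ∈ s
    · rw [trunc_val_of_mem hi]
    · rw [trunc_val_of_notMem hi, hf i hi]
  cases f; cases hg : trunc h s _; simp_all

theorem tensOn_eq_tens (f : StabFamily ι h) {s : Finset ι} (hf : ∀ i ∉ s, f.val i = h) :
    tensOn 𝕜 h s f.val = tens 𝕜 h f := by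
  rw [tensOn, trunc_eq_of_forall h f hf]

theorem trunc_congr {s t : Finset ι} {w w' : ι → H}
    (hw : (trunc h s w).val = (trunc h t w').val) : trunc h s w = trunc h t w' := by
  cases hg : trunc h s w; cases hg' : trunc h t w'; simp_all

theorem tensOn_congr {s : Finset ι} {w w' : ι → H} (hw : ∀ i ∈ s, w i = w' i) :
    tensOn 𝕜 h s w = tensOn 𝕜 h s w' := by
  rw [tensOn, tensOn]
  congr 1
  refine trunc_congr h (funext fun i => ?_)
  by_cases hi : i ∈ s
  · rw [trunc_val_of_mem hi, trunc_val_of_mem hi, hw i hi]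
  · rw [trunc_val_of_notMem hi, trunc_val_of_notMem hi]

/-- Enlarging the set of factors does not change the tensor if the new factors are `h`. -/
theorem tensOn_mono {s t : Finset ι} (hst : s ⊆ t) {w : ι → H} (hw : ∀ i ∈ t, i ∉ s → w i = h) :
    tensOn 𝕜 h s w = tensOn 𝕜 h t w := by
  rw [tensOn, tensOn]
  congr 1
  refine trunc_congr h (funext fun i => ?_)
  by_cases hi : i ∈ s
  · rw [trunc_val_of_mem hi, trunc_val_of_mem (hst hi)]
  · rw [trunc_val_of_notMem hi]
    by_cases hi' : i ∈ t
    · rw [trunc_val_of_mem hi', hw i hi' hi]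
    · rw [trunc_val_of_notMem hi']

/-- Vectors are determined by their inner products with the tensors over sets containing a
given finite set. -/
theorem eq_of_inner_tensOn (s : Finset ι) {x y : StabTensor 𝕜 ι h}
    (hxy : ∀ (t : Finset ι) (w : ι → H), s ⊆ t →
      inner 𝕜 (tensOn 𝕜 h t w) x = inner 𝕜 (tensOn 𝕜 h t w) y) : x = y := by
  classical
  refine eq_of_inner_eq_of_total (span_tens 𝕜 h) fun f => ?_
  have h1 : tensOn 𝕜 h (f.finite.toFinset ∪ s) f.val = tens 𝕜 h f :=
    tensOn_eq_tens 𝕜 h f fun i hi => by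
      by_contra h'
      exact hi (Finset.mem_union_left _ (f.finite.mem_toFinset.2 h'))
  rw [← h1]
  exact hxy _ _ Finset.subset_union_right

theorem inner_tensOn_of_subset {s t : Finset ι} (hst : s ⊆ t) (w w' : ι → H) :
    inner 𝕜 (tensOn 𝕜 h t w) (tensOn 𝕜 h s w')
      = (∏ i ∈ s, inner 𝕜 (w i) (w' i)) * ∏ᶠ i ∈ (t : Set ι) \ s, inner 𝕜 (w i) (h : H) := by
  classical
  rw [← Finset.coe_sdiff, finprod_mem_coe_finset]
  rw [tensOn, tensOn, inner_tens_of_subset 𝕜 h (s := t) (fun i hi => trunc_val_of_notMem hi)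
    (fun i hi => trunc_val_of_notMem fun h' => hi (hst h')), ← Finset.prod_sdiff hst, mul_comm]
  congr 1
  · exact Finset.prod_congr rfl fun i hi => by
      rw [trunc_val_of_mem (hst hi), trunc_val_of_mem hi]
  · exact Finset.prod_congr rfl fun i hi => by
      rw [trunc_val_of_mem (Finset.mem_sdiff.1 hi).1,
        trunc_val_of_notMem (Finset.mem_sdiff.1 hi).2]

theorem tensOn_smul (s : Finset ι) (c : ι → 𝕜) (w : ι → H) :
    tensOn 𝕜 h s (fun i => c i • w i) = (∏ i ∈ s, c i) • tensOn 𝕜 h s w := by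
  refine eq_of_inner_tensOn 𝕜 h s fun t w' hst => ?_
  rw [inner_smul_right, inner_tensOn_of_subset 𝕜 h hst, inner_tensOn_of_subset 𝕜 h hst]
  simp only [inner_smul_right, Finset.prod_mul_distrib]
  ring

theorem tensOn_update_sub [DecidableEq ι] {s : Finset ι} {i : ι} (hi : i ∈ s) (w : ι → H)
    (a b : H) :
    tensOn 𝕜 h s (Function.update w i (a - b))
      = tensOn 𝕜 h s (Function.update w i a) - tensOn 𝕜 h s (Function.update w i b) := by
  refine eq_of_inner_tensOn 𝕜 h s fun t w' hst => ?_
  rw [inner_sub_right, inner_tensOn_of_subset 𝕜 h hst, inner_tensOn_of_subset 𝕜 h hst,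
    inner_tensOn_of_subset 𝕜 h hst, ← sub_mul, ← Finset.mul_prod_erase _ _ hi,
    ← Finset.mul_prod_erase _ _ hi, ← Finset.mul_prod_erase _ _ hi]
  have h1 : ∀ c : H, ∏ j ∈ s.erase i, inner 𝕜 (w' j) (Function.update w i c j)
      = ∏ j ∈ s.erase i, inner 𝕜 (w' j) (w j) := fun c =>
    Finset.prod_congr rfl fun j hj => by rw [Function.update_of_ne (Finset.ne_of_mem_erase hj)]
  simp only [h1, Function.update_self, inner_sub_right]
  ring

theorem norm_tensOn_insert_sub [DecidableEq ι] {s : Finset ι} {i : ι} (hi : i ∉ s) (w : ι → H) :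
    ‖tensOn 𝕜 h (insert i s) w - tensOn 𝕜 h s w‖ = ‖w i - h‖ * ∏ j ∈ s, ‖w j‖ := by
  have h1 : tensOn 𝕜 h s w = tensOn 𝕜 h (insert i s) (Function.update w i h) := by
    rw [← tensOn_mono 𝕜 h (Finset.subset_insert i s) fun j hj hj' => by
      rw [Finset.mem_insert] at hj
      rw [hj.resolve_right hj', Function.update_self]]
    exact tensOn_congr 𝕜 h fun j hj => by
      rw [Function.update_of_ne (ne_of_mem_of_not_mem hj hi)]
  have h2 : tensOn 𝕜 h (insert i s) w
      = tensOn 𝕜 h (insert i s) (Function.update w i (w i)) := by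
    rw [Function.update_eq_self]
  rw [h1, h2, ← tensOn_update_sub 𝕜 h (Finset.mem_insert_self i s), norm_tensOn,
    Finset.prod_insert hi, Function.update_self]
  congr 1
  exact Finset.prod_congr rfl fun j hj => by
    rw [Function.update_of_ne (ne_of_mem_of_not_mem hj hi)]

end Basic

/-! ### Elementary tensors with infinitely many factors -/

section Infinite

variable (𝕜 : Type*) [RCLike 𝕜] {ι κ H : Type*} [NormedAddCommGroup H]
  [InnerProductSpace 𝕜 H] (h : Metric.sphere (0 : H) 1)

variable {h} in
theorem prod_norm_le_exp {w : ι → H} (hw : Summable fun i => ‖w i - h‖) (s : Finset ι) :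
    ∏ i ∈ s, ‖w i‖ ≤ Real.exp (∑' i, ‖w i - h‖) := by
  calc ∏ i ∈ s, ‖w i‖ ≤ ∏ i ∈ s, Real.exp ‖w i - h‖ := by
        refine Finset.prod_le_prod (fun _ _ => norm_nonneg _) fun i _ => ?_
        have h1 : ‖w i‖ ≤ ‖w i - h‖ + 1 := by
          calc ‖w i‖ = ‖(w i - h) + h‖ := by rw [sub_add_cancel]
            _ ≤ ‖w i - h‖ + ‖(h : H)‖ := norm_add_le _ _
            _ = _ := by rw [norm_eq_of_mem_sphere]
        exact h1.trans (Real.add_one_le_exp _)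
    _ = Real.exp (∑ i ∈ s, ‖w i - h‖) := (Real.exp_sum _ _).symm
    _ ≤ _ := Real.exp_le_exp.2 (hw.sum_le_tsum _ fun _ _ => norm_nonneg _)

theorem norm_tensOn_union_sub [DecidableEq ι] {w : ι → H} (hw : Summable fun i => ‖w i - h‖)
    (s t : Finset ι) (hst : Disjoint t s) :
    ‖tensOn 𝕜 h (t ∪ s) w - tensOn 𝕜 h s w‖
      ≤ Real.exp (∑' i, ‖w i - h‖) * ∑ i ∈ t, ‖w i - h‖ := by
  induction t using Finset.induction_on with
  | empty => simp
  | insert i t hi ih =>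
    rw [Finset.disjoint_insert_left] at hst
    rw [Finset.insert_union, Finset.sum_insert hi, mul_add]
    have h1 : i ∉ t ∪ s := by simp [hi, hst.1]
    calc _ ≤ ‖tensOn 𝕜 h (insert i (t ∪ s)) w - tensOn 𝕜 h (t ∪ s) w‖
          + ‖tensOn 𝕜 h (t ∪ s) w - tensOn 𝕜 h s w‖ := norm_sub_le_norm_sub_add_norm_sub _ _ _
      _ ≤ _ := by
        refine add_le_add ?_ (ih hst.2)
        rw [norm_tensOn_insert_sub 𝕜 h h1, mul_comm]
        exact mul_le_mul_of_nonneg_right (prod_norm_le_exp hw _) (norm_nonneg _)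

/-- The finite truncations form a Cauchy net, by `norm_tensOn_union_sub`. -/
theorem exists_tendsto_tensOn {w : ι → H} (hw : Summable fun i => ‖w i - h‖) :
    ∃ x, Tendsto (fun s => tensOn 𝕜 h s w) atTop (𝓝 x) := by
  classical
  refine cauchySeq_tendsto_of_complete (Metric.cauchySeq_iff'.2 fun ε hε => ?_)
  set M := Real.exp (∑' i, ‖w i - h‖)
  have hM : 0 < M := Real.exp_pos _
  obtain ⟨s, hs⟩ := summable_iff_vanishing_norm.1 hw (ε / M) (by positivity)
  refine ⟨s, fun t ht => ?_⟩
  have h1 := norm_tensOn_union_sub 𝕜 h hw s (t \ s) Finset.sdiff_disjoint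
  rw [Finset.sdiff_union_of_subset ht] at h1
  have h2 := hs (t \ s) Finset.sdiff_disjoint
  rw [dist_eq_norm]
  refine h1.trans_lt ?_
  rw [lt_div_iff₀ hM] at h2
  rw [mul_comm]
  exact (mul_le_mul_of_nonneg_right (Real.le_norm_self _) hM.le).trans_lt h2

/-- The infinite elementary tensor `⊗ᵢ wᵢ`, the limit of the tensors with finitely many factors
different from `h`. It exists if `∑ᵢ ‖wᵢ - h‖ < ∞`. -/
def tensInf (w : ι → H) : StabTensor 𝕜 ι h := limUnder atTop fun s => tensOn 𝕜 h s w

theorem tendsto_tensOn {w : ι → H} (hw : Summable fun i => ‖w i - h‖) :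
    Tendsto (fun s => tensOn 𝕜 h s w) atTop (𝓝 (tensInf 𝕜 h w)) :=
  tendsto_nhds_limUnder (exists_tendsto_tensOn 𝕜 h hw)

theorem tensInf_eq_of_tendsto {w : ι → H} {x : StabTensor 𝕜 ι h}
    (hx : Tendsto (fun s => tensOn 𝕜 h s w) atTop (𝓝 x)) : tensInf 𝕜 h w = x :=
  hx.limUnder_eq

theorem hasProd_inner_tensInf {w w' : ι → H} (hw : Summable fun i => ‖w i - h‖)
    (hw' : Summable fun i => ‖w' i - h‖) :
    HasProd (fun i => inner 𝕜 (w i) (w' i)) (inner 𝕜 (tensInf 𝕜 h w) (tensInf 𝕜 h w')) := by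
  have h1 := (tendsto_tensOn 𝕜 h hw).inner (𝕜 := 𝕜) (tendsto_tensOn 𝕜 h hw')
  simpa only [inner_tensOn, HasProd, SummationFilter.unconditional_filter] using h1

theorem inner_tensInf {w w' : ι → H} (hw : Summable fun i => ‖w i - h‖)
    (hw' : Summable fun i => ‖w' i - h‖) :
    inner 𝕜 (tensInf 𝕜 h w) (tensInf 𝕜 h w') = ∏' i, inner 𝕜 (w i) (w' i) :=
  (hasProd_inner_tensInf 𝕜 h hw hw').tprod_eq.symm

/-- Scalars whose infinite product converges can be taken out of an infinite tensor. -/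
theorem tensInf_smul {c : ι → 𝕜} {C : 𝕜} (hc : HasProd c C) {w : ι → H}
    (hw : Summable fun i => ‖w i - h‖) :
    tensInf 𝕜 h (fun i => c i • w i) = C • tensInf 𝕜 h w := by
  refine tensInf_eq_of_tendsto 𝕜 h ?_
  simp only [tensOn_smul]
  have hc' : Tendsto (fun s => ∏ i ∈ s, c i) atTop (𝓝 C) := by
    simpa only [HasProd, SummationFilter.unconditional_filter] using hc
  exact hc'.smul (tendsto_tensOn 𝕜 h hw)

theorem tensInf_val (f : StabFamily ι h) : tensInf 𝕜 h f.val = tens 𝕜 h f := by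
  refine tensInf_eq_of_tendsto 𝕜 h (tendsto_const_nhds.congr' ?_)
  filter_upwards [eventually_ge_atTop f.finite.toFinset] with s hs
  refine (tensOn_eq_tens 𝕜 h f fun i hi => ?_).symm
  by_contra h'
  exact hi (hs (f.finite.mem_toFinset.2 h'))

theorem reindex_tens (e : ι ↪ κ) (f : StabFamily ι h) (g : StabFamily κ h)
    (hg : g.val = Function.extend e f.val fun _ => (h : H)) :
    reindex 𝕜 h e (tens 𝕜 h f) = tens 𝕜 h g := by
  refine (KernelSpace.map_vec _ _ _ _ f).trans ?_
  obtain ⟨g, hg'⟩ := g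
  subst hg
  rfl

theorem reindex_tensInf (e : ι ↪ κ) {w : ι → H} (hw : Summable fun i => ‖w i - h‖) :
    reindex 𝕜 h e (tensInf 𝕜 h w) = tensInf 𝕜 h (Function.extend e w fun _ => (h : H)) := by
  symm
  have h1 : Tendsto (fun t : Finset κ => t.preimage e e.injective.injOn) atTop atTop := by
    refine tendsto_atTop.2 fun s => ?_
    filter_upwards [eventually_ge_atTop (s.map e)] with t ht
    intro i hi
    rw [Finset.mem_preimage]
    exact ht (Finset.mem_map_of_mem e hi)
  refine tensInf_eq_of_tendsto 𝕜 h ?_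
  refine (((reindex 𝕜 h e).continuous.tendsto _).comp
    ((tendsto_tensOn 𝕜 h hw).comp h1)).congr fun t => ?_
  refine reindex_tens 𝕜 h e _ _ (funext fun j => ?_)
  by_cases hj : ∃ i, e i = j
  · obtain ⟨i, rfl⟩ := hj
    rw [e.injective.extend_apply]
    by_cases hi : e i ∈ t
    · rw [trunc_val_of_mem hi, trunc_val_of_mem (Finset.mem_preimage.2 hi),
        e.injective.extend_apply]
    · rw [trunc_val_of_notMem hi, trunc_val_of_notMem fun h' => hi (Finset.mem_preimage.1 h')]
  · rw [Function.extend_apply' _ _ _ hj]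
    by_cases hi : j ∈ t
    · rw [trunc_val_of_mem hi, Function.extend_apply' _ _ _ hj]
    · rw [trunc_val_of_notMem hi]

theorem finMap_tensOn (A : ι → H ≃ₗᵢ[𝕜] H) (s : Finset ι) (w : ι → H) :
    finMap 𝕜 h A s (tensOn 𝕜 h s w) = tensOn 𝕜 h s fun i => A i (w i) := by
  refine (KernelSpace.map_vec _ _ _ _ _).trans ?_
  rw [tensOn, tens]
  congr 1
  rw [trunc, trunc]
  congr 1
  funext i
  by_cases hi : i ∈ s
  · simp [hi]
  · simp [hi]

/-- `(⊗ᵢ Aᵢ) (⊗ᵢ wᵢ) = ⊗ᵢ Aᵢ wᵢ` if both infinite tensors exist. -/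
theorem isTensorImage_tensInf (A : ι → H ≃ₗᵢ[𝕜] H) {w : ι → H}
    (hw : Summable fun i => ‖w i - h‖) (hw' : Summable fun i => ‖A i (w i) - h‖) :
    IsTensorImage 𝕜 h A (tensInf 𝕜 h w) (tensInf 𝕜 h fun i => A i (w i)) := by
  have h1 := tendsto_tensOn 𝕜 h hw
  have h2 := tendsto_tensOn 𝕜 h hw'
  rw [IsTensorImage]
  refine h2.congr_dist ?_
  have h3 : ∀ s, dist (tensOn 𝕜 h s fun i => A i (w i)) (finMap 𝕜 h A s (tensInf 𝕜 h w))
      = dist (tensOn 𝕜 h s w) (tensInf 𝕜 h w) := fun s => by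
    rw [← finMap_tensOn, LinearIsometry.dist_map]
  simp only [h3]
  exact tendsto_iff_dist_tendsto_zero.1 h1

variable {𝕜 h}

theorem IsTensorImage.add {A : ι → H ≃ₗᵢ[𝕜] H} {v v' w w' : StabTensor 𝕜 ι h}
    (hv : IsTensorImage 𝕜 h A v w) (hv' : IsTensorImage 𝕜 h A v' w') :
    IsTensorImage 𝕜 h A (v + v') (w + w') := by
  have := Tendsto.add hv hv'
  simpa only [IsTensorImage, map_add] using this

theorem IsTensorImage.smul {A : ι → H ≃ₗᵢ[𝕜] H} {v w : StabTensor 𝕜 ι h}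
    (hv : IsTensorImage 𝕜 h A v w) (c : 𝕜) : IsTensorImage 𝕜 h A (c • v) (c • w) := by
  have := Tendsto.const_smul hv c
  simpa only [IsTensorImage, map_smul] using this

theorem IsTensorImage.of_tendsto {A : ι → H ≃ₗᵢ[𝕜] H} {v w : ℕ → StabTensor 𝕜 ι h}
    {v₀ w₀ : StabTensor 𝕜 ι h} (hvw : ∀ n, IsTensorImage 𝕜 h A (v n) (w n))
    (hv : Tendsto v atTop (𝓝 v₀)) (hw : Tendsto w atTop (𝓝 w₀)) :
    IsTensorImage 𝕜 h A v₀ w₀ := by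
  rw [IsTensorImage, Metric.tendsto_nhds]
  intro ε hε
  obtain ⟨n, hn, hn'⟩ := ((Metric.tendsto_nhds.1 hv (ε / 3) (by positivity)).and
    (Metric.tendsto_nhds.1 hw (ε / 3) (by positivity))).exists
  filter_upwards [Metric.tendsto_nhds.1 (hvw n) (ε / 3) (by positivity)] with s hs
  have h1 : dist (finMap 𝕜 h A s v₀) (finMap 𝕜 h A s (v n)) < ε / 3 := by
    rw [LinearIsometry.dist_map, dist_comm]; exact hn
  have h2 := dist_triangle4 (finMap 𝕜 h A s v₀) (finMap 𝕜 h A s (v n)) (w n) w₀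
  linarith

end Infinite

end StabTensor

/-! ### Total families with the same Gram matrix -/

section GramEquivalence

variable {𝕜 : Type*} [RCLike 𝕜] {E E' : Type*} [NormedAddCommGroup E] [InnerProductSpace 𝕜 E]
  [NormedAddCommGroup E'] [InnerProductSpace 𝕜 E'] {I : Type*}

theorem inner_linearCombination (a : I → E) (f g : I →₀ 𝕜) :
    inner 𝕜 (Finsupp.linearCombination 𝕜 a f) (Finsupp.linearCombination 𝕜 a g)
      = f.sum fun i c => g.sum fun j d => (starRingEnd 𝕜) c * (d * inner 𝕜 (a i) (a j)) := by
  rw [Finsupp.linearCombination_apply, Finsupp.linearCombination_apply, Finsupp.sum_inner]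
  refine Finsupp.sum_congr fun i _ => ?_
  rw [inner_smul_left, Finsupp.inner_sum, Finsupp.mul_sum]
  exact Finsupp.sum_congr fun j _ => by rw [inner_smul_right]

theorem denseRange_linearCombination {a : I → E}
    (ha : (Submodule.span 𝕜 (Set.range a)).topologicalClosure = ⊤) :
    DenseRange (Finsupp.linearCombination 𝕜 a) := by
  rw [DenseRange, ← LinearMap.coe_range, Finsupp.range_linearCombination]
  exact Submodule.dense_iff_topologicalClosure_eq_top.2 ha

variable [CompleteSpace E] [CompleteSpace E']

/-- Two total families of vectors with the same Gram matrix are carried one onto the other by an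
isometric isomorphism of the Hilbert spaces. -/
theorem exists_linearIsometryEquiv_of_gram {a : I → E} {a' : I → E'}
    (ha : (Submodule.span 𝕜 (Set.range a)).topologicalClosure = ⊤)
    (ha' : (Submodule.span 𝕜 (Set.range a')).topologicalClosure = ⊤)
    (hG : ∀ i j, inner 𝕜 (a' i) (a' j) = inner 𝕜 (a i) (a j)) :
    ∃ J : E ≃ₗᵢ[𝕜] E', ∀ i, J (a i) = a' i := by
  have h1 : ∀ f : I →₀ 𝕜, ‖Finsupp.linearCombination 𝕜 a' (LinearEquiv.refl 𝕜 (I →₀ 𝕜) f)‖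
      = ‖Finsupp.linearCombination 𝕜 a f‖ := fun f => by
    rw [LinearEquiv.refl_apply, ← sq_eq_sq₀ (norm_nonneg _) (norm_nonneg _),
      norm_sq_eq_re_inner (𝕜 := 𝕜), norm_sq_eq_re_inner (𝕜 := 𝕜), inner_linearCombination,
      inner_linearCombination]
    simp only [hG]
  refine ⟨(LinearEquiv.refl 𝕜 (I →₀ 𝕜)).extendOfIsometry (Finsupp.linearCombination 𝕜 a)
    (Finsupp.linearCombination 𝕜 a') (denseRange_linearCombination ha)
    (denseRange_linearCombination ha') h1, fun i => ?_⟩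
  have h2 := LinearEquiv.extendOfIsometry_eq (LinearEquiv.refl 𝕜 (I →₀ 𝕜))
    (Finsupp.linearCombination 𝕜 a) (Finsupp.linearCombination 𝕜 a')
    (denseRange_linearCombination ha) (denseRange_linearCombination ha') h1 (Finsupp.single i 1)
  simpa using h2

omit [CompleteSpace E] [CompleteSpace E'] in
/-- Continuous linear maps that agree on a total family are equal. -/
theorem eq_of_eqOn_total {a : I → E}
    (ha : (Submodule.span 𝕜 (Set.range a)).topologicalClosure = ⊤) {A B : E → E'}
    (hA : Continuous A) (hB : Continuous B) (hAl : IsLinearMap 𝕜 A) (hBl : IsLinearMap 𝕜 B)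
    (hAB : ∀ i, A (a i) = B (a i)) (x : E) : A x = B x := by
  have h1 : IsClosed {y | A y = B y} := isClosed_eq hA hB
  have h2 : ((Submodule.span 𝕜 (Set.range a) : Submodule 𝕜 E) : Set E) ⊆ {y | A y = B y} := by
    intro y hy
    have := LinearMap.eqOn_span' (s := Set.range a) (f := hAl.mk' A) (g := hBl.mk' B)
      (by rintro _ ⟨i, rfl⟩; exact hAB i)
    exact this hy
  have h3 := h1.closure_subset_iff.2 h2
  rw [← Submodule.topologicalClosure_coe, ha] at h3
  exact h3 (Set.mem_univ x)

end GramEquivalence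

/-! ### Representations from multiplicative families of isometries -/

section UnitaryRep

variable {𝕜 : Type*} [RCLike 𝕜] {E : Type*} [NormedAddCommGroup E] [InnerProductSpace 𝕜 E]
  {G : Type*} [Group G]

/-- A multiplicative family of linear isometries indexed by a group is a representation by
isometric isomorphisms. -/
def isometricRep (A : G → (E →ₗᵢ[𝕜] E)) (h1 : ∀ x, A 1 x = x)
    (hmul : ∀ p q x, A (p * q) x = A p (A q x)) : G →* (E ≃ₗᵢ[𝕜] E) where
  toFun p := LinearIsometryEquiv.ofSurjective (A p) fun x =>
    ⟨A p⁻¹ x, by rw [← hmul, mul_inv_cancel, h1]⟩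
  map_one' := by ext x; exact h1 x
  map_mul' p q := by ext x; exact hmul p q x

theorem isometricRep_apply (A : G → (E →ₗᵢ[𝕜] E)) (h1 : ∀ x, A 1 x = x)
    (hmul : ∀ p q x, A (p * q) x = A p (A q x)) (p : G) (x : E) :
    isometricRep A h1 hmul p x = A p x := rfl

end UnitaryRep

/-! ### Exponential vectors -/

section FockTotality

variable {𝕜 : Type*} [RCLike 𝕜] {V : Type*} [NormedAddCommGroup V] [InnerProductSpace 𝕜 V]

instance (k : ℕ) : CompleteSpace (SymPow 𝕜 V k) :=
  (Submodule.isClosed_topologicalClosure _).completeSpace_coe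

theorem inner_diagTens (k : ℕ) (v w : V) :
    inner 𝕜 (diagTens 𝕜 V k v) (diagTens 𝕜 V k w) = inner 𝕜 v w ^ k := by
  rw [diagTens, diagTens, KernelSpace.inner_vec]
  simp

theorem diagTens_smul (k : ℕ) (c : 𝕜) (v : V) :
    diagTens 𝕜 V k (c • v) = c ^ k • diagTens 𝕜 V k v := by
  have h1 : ∀ (w : Fin k → V) (v : V), inner 𝕜 (KernelSpace.vec (posSemidef_prod_gram 𝕜
      Finset.univ fun (i : Fin k) (v : Fin k → V) => v i) w) (diagTens 𝕜 V k v)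
      = ∏ i, inner 𝕜 (w i) v := fun w v => KernelSpace.inner_vec _ _ _
  refine eq_of_inner_eq_of_total (𝕜 := 𝕜) (KernelSpace.span_vec (posSemidef_prod_gram 𝕜
      Finset.univ fun (i : Fin k) (v : Fin k → V) => v i)) fun w => ?_
  rw [inner_smul_right, h1, h1]
  simp only [inner_smul_right, Finset.prod_mul_distrib, Finset.prod_const, Finset.card_univ,
    Fintype.card_fin]

theorem expVec_apply (v : V) (k : ℕ) :
    ((expVec 𝕜 v k : SymPow 𝕜 V k) : TensorPow 𝕜 V k)
      = (((Real.sqrt k.factorial)⁻¹ : ℝ) : 𝕜) • diagTens 𝕜 V k v := rfl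

theorem inner_expVec_component (v : V) (x : Fock 𝕜 V) (k : ℕ) :
    inner 𝕜 (expVec 𝕜 v k) (x k) = (((Real.sqrt k.factorial)⁻¹ : ℝ) : 𝕜) *
      inner 𝕜 (diagTens 𝕜 V k v) (x k : TensorPow 𝕜 V k) := by
  rw [Submodule.coe_inner, expVec_apply, inner_smul_left, RCLike.conj_ofReal]

theorem inner_expVec (v w : V) :
    inner 𝕜 (expVec 𝕜 v) (expVec 𝕜 w) = NormedSpace.exp (inner 𝕜 v w) := by
  refine (lp.hasSum_inner (expVec 𝕜 v) (expVec 𝕜 w)).unique ?_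
  refine (NormedSpace.exp_series_hasSum_exp' (𝕂 := 𝕜) (inner 𝕜 v w)).congr_fun fun k => ?_
  rw [inner_expVec_component, expVec_apply, inner_smul_right, inner_diagTens, ← mul_assoc,
    ← RCLike.ofReal_mul, ← mul_inv,
    Real.mul_self_sqrt (by positivity), smul_eq_mul, RCLike.ofReal_inv, RCLike.ofReal_natCast]

theorem continuous_expVec : Continuous (expVec 𝕜 : V → Fock 𝕜 V) := by
  refine continuous_of_continuous_inner (𝕜 := 𝕜) ?_
  simp only [inner_expVec]
  exact RCLike.continuous_exp.comp (continuous_fst.inner continuous_snd)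

/-- The coefficients of a power series that vanishes identically on the real line are zero. -/
theorem eq_zero_of_forall_hasSum_pow {c : ℕ → 𝕜} (hc : Summable fun n => ‖c n‖)
    (h0 : ∀ t : ℝ, HasSum (fun n => t ^ n • c n) 0) (n : ℕ) : c n = 0 := by
  set p : FormalMultilinearSeries ℝ ℝ 𝕜 := fun n =>
    ContinuousMultilinearMap.mkPiRing ℝ (Fin n) (c n)
  have h1 : HasFPowerSeriesOnBall (0 : ℝ → 𝕜) p 0 1 := by
    refine ⟨?_, one_pos, fun {y} _ => ?_⟩
    · have := p.le_radius_of_summable (r := 1) (by simpa [p] using hc)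
      simpa using this
    · simpa [p] using h0 y
  have h2 := HasFPowerSeriesAt.apply_eq_zero ⟨1, h1⟩ n 1
  simpa [p] using h2

theorem mem_orthogonal_symPow {k : ℕ} {y : TensorPow 𝕜 V k}
    (hy : ∀ v, inner 𝕜 (diagTens 𝕜 V k v) y = 0) : y ∈ (SymPow 𝕜 V k)ᗮ := by
  have h1 : Submodule.span 𝕜 (Set.range (diagTens 𝕜 V k)) ≤ (Submodule.span 𝕜 {y})ᗮ := by
    rw [Submodule.span_le]
    rintro _ ⟨v, rfl⟩
    rw [SetLike.mem_coe, Submodule.mem_orthogonal_singleton_iff_inner_left]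
    exact hy v
  rw [SymPow, Submodule.orthogonal_closure]
  rw [Submodule.mem_orthogonal]
  intro u hu
  exact Submodule.mem_orthogonal_singleton_iff_inner_left.1 (h1 hu)

/-- The exponential vectors of a dense set of vectors are total in the Fock space: the terms of
degree `k` in `t` of `⟪EXP (t v), x⟫` are the inner products of `v ⊗ ⋯ ⊗ v` with the component of
degree `k` of `x`. -/
theorem span_expVec {I : Type*} {d : I → V} (hd : DenseRange d) :
    (Submodule.span 𝕜 (Set.range fun i => expVec 𝕜 (d i))).topologicalClosure = ⊤ := by
  rw [Submodule.topologicalClosure_eq_top_iff, Submodule.eq_bot_iff]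
  intro x hx
  rw [Submodule.mem_orthogonal] at hx
  have h1 : ∀ v, inner 𝕜 (expVec 𝕜 v) x = 0 := by
    intro v
    refine hd.induction_on (p := fun v => inner 𝕜 (expVec 𝕜 v) x = 0) v ?_ fun i => ?_
    · exact isClosed_eq (continuous_expVec.inner continuous_const) continuous_const
    · exact hx _ (Submodule.subset_span ⟨i, rfl⟩)
  ext k : 2
  have h2 : ∀ v, inner 𝕜 (diagTens 𝕜 V k v) (x k : TensorPow 𝕜 V k) = 0 := by
    intro v
    set c : ℕ → 𝕜 := fun n => (((Real.sqrt n.factorial)⁻¹ : ℝ) : 𝕜) *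
      inner 𝕜 (diagTens 𝕜 V n v) (x n : TensorPow 𝕜 V n) with hc
    -- the power series in `t` of the inner product of `EXP (t v)` with `x`
    have h3 : ∀ t : ℝ, HasSum (fun n => t ^ n • c n) 0 := by
      intro t
      have h4 := lp.hasSum_inner (𝕜 := 𝕜) (expVec 𝕜 ((t : 𝕜) • v)) x
      rw [h1] at h4
      simp only [inner_expVec_component, diagTens_smul, inner_smul_left, map_pow,
        RCLike.conj_ofReal] at h4
      refine h4.congr_fun fun n => ?_
      rw [hc, RCLike.real_smul_eq_coe_mul, RCLike.ofReal_pow]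
      ring
    have h3' : Summable c := by
      have := (lp.hasSum_inner (𝕜 := 𝕜) (expVec 𝕜 v) x).summable
      simpa only [inner_expVec_component] using this
    have h4 : Summable fun n => ‖c n‖ := h3'.norm
    have h5 : c k = 0 := eq_zero_of_forall_hasSum_pow h4 h3 k
    rw [hc] at h5
    refine (mul_eq_zero.1 h5).resolve_left ?_
    rw [RCLike.ofReal_eq_zero]
    positivity
  have h6 := mem_orthogonal_symPow h2
  exact inner_self_eq_zero.1 ((Submodule.mem_orthogonal _ _).1 h6 _ (x k).2)

end FockTotality

/-! ### Functions on `X × Y` that represent elements of `L²(X; L²(Y; H))` -/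

section Slices

variable {𝕜 : Type*} [RCLike 𝕜] {H : Type*} [NormedAddCommGroup H] [InnerProductSpace 𝕜 H]
  {X Y : Type*} [MeasurableSpace X] [MeasurableSpace Y] {m : Measure X} {μ : Measure Y}

/-- The function `v` on `X × Y` represents the element `V` of `L²(X; L²(Y; H))`. -/
structure IsSlice (v : X × Y → H) (V : Lp (Lp H 2 μ) 2 m) : Prop where
  stronglyMeasurable : StronglyMeasurable v
  ae_eq : ∀ᵐ x ∂m, V x =ᵐ[μ] fun y => v (x, y)

namespace IsSlice

variable {v v' : X × Y → H} {V V' : Lp (Lp H 2 μ) 2 m}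

theorem add (hv : IsSlice v V) (hv' : IsSlice v' V') :
    IsSlice (fun z => v z + v' z) (V + V') := by
  refine ⟨hv.1.add hv'.1, ?_⟩
  filter_upwards [hv.2, hv'.2, Lp.coeFn_add V V'] with x h1 h2 h3
  rw [h3]
  filter_upwards [h1, h2, Lp.coeFn_add (V x) (V' x)] with y h4 h5 h6
  rw [Pi.add_apply, h6, Pi.add_apply, h4, h5]

theorem smul (hv : IsSlice v V) (c : 𝕜) : IsSlice (fun z => c • v z) (c • V) := by
  refine ⟨hv.1.const_smul c, ?_⟩
  filter_upwards [hv.2, Lp.coeFn_smul c V] with x h1 h3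
  rw [h3]
  filter_upwards [h1, Lp.coeFn_smul c (V x)] with y h4 h6
  rw [Pi.smul_apply, h6, Pi.smul_apply, h4]

variable [SFinite m] [SFinite μ]

theorem memLp (hv : IsSlice v V) : MemLp v 2 (m.prod μ) := by
  refine ⟨hv.1.aestronglyMeasurable, ?_⟩
  have h2 : (2 : ℝ≥0∞) ≠ 0 := by norm_num
  rw [eLpNorm_lt_top_iff_lintegral_rpow_enorm_lt_top h2 (by norm_num)]
  have h1 := (Lp.memLp V).2
  rw [eLpNorm_lt_top_iff_lintegral_rpow_enorm_lt_top h2 (by norm_num)] at h1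
  rw [lintegral_prod _ (hv.1.enorm.pow_const _).aemeasurable]
  refine lt_of_eq_of_lt (lintegral_congr_ae ?_) h1
  filter_upwards [hv.2] with x hx
  rw [Lp.enorm_def, eLpNorm_congr_ae hx,
    eLpNorm_eq_lintegral_rpow_enorm_toReal h2 (by norm_num), ← ENNReal.rpow_mul]
  norm_num

theorem integrable_inner (hv : IsSlice v V) (hv' : IsSlice v' V') :
    Integrable (fun z => inner 𝕜 (v z) (v' z)) (m.prod μ) := by
  have h1 := L2.integrable_inner (𝕜 := 𝕜) (hv.memLp.toLp v) (hv'.memLp.toLp v')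
  refine h1.congr ?_
  filter_upwards [hv.memLp.coeFn_toLp, hv'.memLp.coeFn_toLp] with z h2 h3
  rw [h2, h3]

theorem inner_eq (hv : IsSlice v V) (hv' : IsSlice v' V') :
    inner 𝕜 V V' = ∫ z, inner 𝕜 (v z) (v' z) ∂(m.prod μ) := by
  rw [integral_prod _ (hv.integrable_inner hv'), L2.inner_def]
  refine integral_congr_ae ?_
  filter_upwards [hv.2, hv'.2] with x h1 h2
  rw [L2.inner_def]
  refine integral_congr_ae ?_
  filter_upwards [h1, h2] with y h3 h4
  rw [h3, h4]

omit [SFinite m] [SFinite μ] in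
/-- Constant functions on measurable rectangles of finite measure. -/
theorem indicator {A : Set X} (hA : MeasurableSet A) (hmA : m A ≠ ∞) {B : Set Y}
    (hB : MeasurableSet B) (hmB : μ B ≠ ∞) (c : H) :
    IsSlice ((A ×ˢ B).indicator fun _ => c)
      (indicatorConstLp 2 hA hmA (indicatorConstLp 2 hB hmB c)) := by
  refine ⟨stronglyMeasurable_const.indicator (hA.prod hB), ?_⟩
  filter_upwards [indicatorConstLp_coeFn (p := 2) (hs := hA) (hμs := hmA)
    (c := indicatorConstLp 2 hB hmB c)] with x hx
  rw [hx]
  by_cases hxA : x ∈ A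
  · rw [Set.indicator_of_mem hxA]
    filter_upwards [indicatorConstLp_coeFn (p := 2) (hs := hB) (hμs := hmB) (c := c)] with y hy
    rw [hy]
    by_cases hyB : y ∈ B <;> simp [hxA, hyB]
  · rw [Set.indicator_of_notMem hxA]
    filter_upwards [Lp.coeFn_zero H 2 μ] with y hy
    rw [hy]
    simp [hxA]

end IsSlice

theorem indicatorConstLp_smul {α E : Type*} [MeasurableSpace α] {μ : Measure α}
    [NormedAddCommGroup E] [NormedSpace 𝕜 E] {s : Set α} (hs : MeasurableSet s) (hμs : μ s ≠ ∞)
    (k : 𝕜) (c : E) : indicatorConstLp 2 hs hμs (k • c) = k • indicatorConstLp 2 hs hμs c := by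
  apply Lp.ext
  filter_upwards [indicatorConstLp_coeFn (p := 2) (hs := hs) (hμs := hμs) (c := c),
    indicatorConstLp_coeFn (p := 2) (hs := hs) (hμs := hμs) (c := k • c),
    Lp.coeFn_smul k (indicatorConstLp 2 hs hμs c)] with x h1 h2 h3
  rw [h2, h3, Pi.smul_apply, h1]
  by_cases hx : x ∈ s <;> simp [hx]

theorem continuous_indicatorConstLp {α E : Type*} [MeasurableSpace α] {μ : Measure α}
    [NormedAddCommGroup E] {s : Set α} (hs : MeasurableSet s) (hμs : μ s ≠ ∞) :
    Continuous fun c : E => indicatorConstLp 2 hs hμs c := by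
  refine LipschitzWith.continuous (K := (μ.real s ^ (1 / (2 : ℝ≥0∞).toReal)).toNNReal) ?_
  refine LipschitzWith.of_dist_le_mul fun c c' => ?_
  rw [dist_eq_norm, indicatorConstLp_sub,
    norm_indicatorConstLp (by norm_num) (by norm_num), dist_eq_norm, mul_comm,
    Real.coe_toNNReal _ (by positivity)]

/-- A closed subspace of `L²(α; E)` containing the functions `1_s c` with `c` in a dense subspace
of `E` is the whole space. -/
theorem Lp_mem_of_indicatorConstLp {α E : Type*} [MeasurableSpace α] {μ : Measure α}
    [NormedAddCommGroup E] [NormedSpace 𝕜 E] {S : Submodule 𝕜 (Lp E 2 μ)}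
    (hS : IsClosed (S : Set (Lp E 2 μ))) {D : Set E} (hD : Dense D)
    (h : ∀ (s : Set α) (hs : MeasurableSet s) (hμs : μ s ≠ ∞), ∀ c ∈ D,
      indicatorConstLp 2 hs hμs c ∈ S) (f : Lp E 2 μ) : f ∈ S := by
  refine Lp.induction (p := 2) (by norm_num) (fun f => f ∈ S) (fun c s hs hμs => ?_)
    (fun f g _ _ _ hf hg => S.add_mem hf hg) hS f
  have h2 : IsClosed {c : E | indicatorConstLp 2 hs hμs.ne c ∈ S} :=
    hS.preimage (continuous_indicatorConstLp hs hμs.ne)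
  have h3 := h2.closure_subset_iff.2 (fun c hc => h _ hs hμs.ne c hc)
  exact h3 (hD c)

end Slices

/-! ### Vectors integrable with respect to the Poisson intensity -/

section GoodVectors

variable {𝕜 : Type*} [RCLike 𝕜] {H : Type*} [NormedAddCommGroup H] [InnerProductSpace 𝕜 H]
  {X : Type*} [MeasurableSpace X] {m : Measure X}

/-- The function `v` on `X × ℝ₊*` represents the element `V` of `L²(X; L²(ℝ₊*; H))` and is
summable over almost all configurations of the Poisson process. -/
structure IsGood (v : X × PosReal → H) (V : Lp (SpecialSpace H) 2 m) : Prop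
    extends IsSlice v V where
  integrable : Integrable v (poissonIntensity m)

variable (𝕜 H m) in
/-- The elements of `L²(X; L²(ℝ₊*; H))` represented by functions integrable with respect to the
intensity of the Poisson process. -/
def goodVectors : Submodule 𝕜 (Lp (SpecialSpace H) 2 m) where
  carrier := {V | ∃ v, IsGood v V}
  zero_mem' := ⟨fun _ => 0, ⟨stronglyMeasurable_const, by
    filter_upwards [Lp.coeFn_zero (SpecialSpace H) 2 m] with x hx
    rw [hx]
    exact Lp.coeFn_zero H 2 posHaar⟩, integrable_zero _ _ _⟩
  add_mem' := by
    rintro V V' ⟨v, hv⟩ ⟨v', hv'⟩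
    exact ⟨_, hv.toIsSlice.add hv'.toIsSlice, hv.integrable.add hv'.integrable⟩
  smul_mem' := by
    rintro c V ⟨v, hv⟩
    exact ⟨_, hv.toIsSlice.smul c, hv.integrable.smul c⟩

theorem massIntensity_le (B : Set PosReal) : massIntensity B ≤ posHaar B := by
  have h1 : massIntensity ≤ posHaar := by
    rw [massIntensity]
    refine (withDensity_mono (Eventually.of_forall fun r => ?_)).trans_eq withDensity_one
    have := r.2
    rw [Pi.one_apply, ENNReal.ofReal_le_one]
    exact inv_le_one_of_one_le₀ (by linarith)
  exact h1 B

/-- The vectors `1_A ⊗ 1_B c` with `B` of finite measure are total. -/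
theorem dense_goodVectors [IsFiniteMeasure m] :
    Dense (goodVectors 𝕜 H m : Set (Lp (SpecialSpace H) 2 m)) := by
  rw [Submodule.dense_iff_topologicalClosure_eq_top, eq_top_iff]
  rintro V -
  refine Lp_mem_of_indicatorConstLp (𝕜 := 𝕜) (Submodule.isClosed_topologicalClosure _)
    dense_univ (fun A hA hmA f _ => ?_) V
  set S : Submodule 𝕜 (Lp (SpecialSpace H) 2 m) := (goodVectors 𝕜 H m).topologicalClosure with hS
  have hSc : IsClosed (S : Set (Lp (SpecialSpace H) 2 m)) :=
    Submodule.isClosed_topologicalClosure _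
  let R : Submodule 𝕜 (SpecialSpace H) :=
    { carrier := {f | indicatorConstLp 2 hA hmA f ∈ S}
      zero_mem' := by
        have := indicatorConstLp_smul (𝕜 := 𝕜) hA hmA (0 : 𝕜) (0 : SpecialSpace H)
        rw [zero_smul, zero_smul] at this
        rw [Set.mem_ofPred_eq, this]
        exact S.zero_mem
      add_mem' := fun {f g} hf hg => by
        rw [Set.mem_ofPred_eq, ← indicatorConstLp_add]
        exact S.add_mem hf hg
      smul_mem' := fun c f hf => by
        rw [Set.mem_ofPred_eq, indicatorConstLp_smul (𝕜 := 𝕜)]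
        exact S.smul_mem c hf }
  refine Lp_mem_of_indicatorConstLp (S := R)
    (hSc.preimage (continuous_indicatorConstLp hA hmA)) dense_univ (fun B hB hmB c _ => ?_) f
  refine Submodule.le_topologicalClosure _ ⟨_, IsSlice.indicator hA hmA hB hmB c, ?_⟩
  refine (integrable_indicator_iff (hA.prod hB)).2 (integrableOn_const ?_)
  rw [poissonIntensity, Measure.prod_prod]
  exact (ENNReal.mul_lt_top hmA.lt_top ((massIntensity_le B).trans_lt hmB.lt_top)).ne

end GoodVectors

/-! ### The topology of `ℝ₊*` -/

section PosRealTopology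

instance : LocallyCompactSpace PosReal := (isOpen_Ioi (a := (0 : ℝ))).locallyCompactSpace

theorem continuous_posReal_mul : Continuous fun q : PosReal × PosReal => q.1 * q.2 :=
  ((continuous_subtype_val.comp continuous_fst).mul
    (continuous_subtype_val.comp continuous_snd)).subtype_mk _

instance : IsLocallyFiniteMeasure posHaar := by
  have h1 : IsLocallyFiniteMeasure (Measure.comap (Subtype.val : PosReal → ℝ) volume) := by
    refine ⟨fun r => ⟨Subtype.val ⁻¹' Set.Icc ((r : ℝ) - 1) (r + 1), ?_, ?_⟩⟩
    · exact continuous_subtype_val.continuousAt.preimage_mem_nhds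
        (Icc_mem_nhds (by linarith) (by linarith))
    · refine ((MeasurableEmbedding.subtype_coe (measurableSet_Ioi (a := (0 : ℝ)))).comap_apply
        volume _).trans_lt ?_
      exact (measure_mono (Set.image_preimage_subset _ _)).trans_lt measure_Icc_lt_top
  refine IsLocallyFiniteMeasure.withDensity_ofReal ?_
  exact continuous_subtype_val.inv₀ fun r => r.2.ne'

end PosRealTopology

/-! ### Dominated convergence in `L²` -/

section L2Convergence

variable {α E : Type*} [MeasurableSpace α] {μ : Measure α} [NormedAddCommGroup E]

/-- Dominated convergence in `L²`. -/
theorem tendsto_Lp_two_of_dominated {F : ℕ → Lp E 2 μ} {f : Lp E 2 μ} (bound : α → ℝ)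
    (hb : Integrable (fun x => bound x ^ 2) μ)
    (hF : ∀ᶠ n in atTop, ∀ᵐ x ∂μ, ‖F n x - f x‖ ≤ bound x)
    (hlim : ∀ᵐ x ∂μ, Tendsto (fun n => F n x) atTop (𝓝 (f x))) :
    Tendsto F atTop (𝓝 f) := by
  rw [tendsto_iff_norm_sub_tendsto_zero]
  have h1 : ∀ n, ‖F n - f‖ = Real.sqrt (∫ x, ‖F n x - f x‖ ^ 2 ∂μ) := by
    intro n
    rw [Lp.norm_def, eLpNorm_congr_ae (Lp.coeFn_sub (F n) f),
      MemLp.eLpNorm_eq_integral_rpow_norm (by norm_num) (by norm_num)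
        ((Lp.memLp (F n)).sub (Lp.memLp f)), ENNReal.toReal_ofReal (by positivity)]
    simp [Real.sqrt_eq_rpow]
  simp only [h1]
  have h2 : Tendsto (fun n => ∫ x, ‖F n x - f x‖ ^ 2 ∂μ) atTop (𝓝 (∫ _, (0 : ℝ) ∂μ)) := by
    refine tendsto_integral_filter_of_dominated_convergence (fun x => bound x ^ 2)
      (Eventually.of_forall fun n => ?_) (hF.mono fun n hn => ?_) hb ?_
    · exact ((Lp.aestronglyMeasurable (F n)).sub (Lp.aestronglyMeasurable f)).norm.pow 2
    · filter_upwards [hn] with x hx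
      rw [Real.norm_of_nonneg (by positivity)]
      exact pow_le_pow_left₀ (norm_nonneg _) hx 2
    · filter_upwards [hlim] with x hx
      have := ((tendsto_iff_norm_sub_tendsto_zero.1 hx).pow 2)
      simpa using this
  have h3 := (Real.continuous_sqrt.tendsto _).comp h2
  simpa [Function.comp_def] using h3

end L2Convergence

/-! ### The special representation -/

section SpecialRep

variable {𝕜 : Type*} [RCLike 𝕜] {P₀ : Type*} [Group P₀] [TopologicalSpace P₀]
  {φ : PosReal →* MulAut P₀} [IsContinuousAction φ]
  {H : Type*} [NormedAddCommGroup H] [InnerProductSpace 𝕜 H] {T : P₀ →* (H ≃ₗᵢ[𝕜] H)}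

/-- A strongly continuous family of isometries is jointly continuous. -/
theorem continuous_rep_apply (hT : ∀ v : H, Continuous fun g => T g v) :
    Continuous fun q : P₀ × H => T q.1 q.2 := by
  rw [continuous_iff_continuousAt]
  rintro ⟨g, v⟩
  rw [ContinuousAt, tendsto_iff_dist_tendsto_zero]
  have h1 : Tendsto (fun q : P₀ × H => dist q.2 v + dist (T q.1 v) (T g v)) (𝓝 (g, v)) (𝓝 0) := by
    have h2 : Continuous fun q : P₀ × H => dist q.2 v + dist (T q.1 v) (T g v) :=
      (continuous_snd.dist continuous_const).add
        (((hT v).comp continuous_fst).dist continuous_const)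
    simpa using h2.tendsto (g, v)
  refine squeeze_zero (fun _ => dist_nonneg) (fun q => ?_) h1
  calc dist (T q.1 q.2) (T g v) ≤ dist (T q.1 q.2) (T q.1 v) + dist (T q.1 v) (T g v) :=
        dist_triangle _ _ _
    _ = _ := by rw [LinearIsometryEquiv.dist_map]

theorem continuous_rep_action (hT : ∀ v : H, Continuous fun g => T g v) :
    Continuous fun q : (PosReal × P₀) × H => T (φ q.1.1 q.1.2) q.2 :=
  (continuous_rep_apply hT).comp
    ((IsContinuousAction.continuous_action.comp continuous_fst).prodMk continuous_snd)

omit [TopologicalSpace P₀] [IsContinuousAction φ] in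
theorem specialAct_mul (p q : P₀ ⋊[φ] PosReal) (f : PosReal → H) :
    specialAct φ T (p * q) f = specialAct φ T p (specialAct φ T q f) := by
  funext r
  have h1 : φ (p.right * r) = φ r * φ p.right := by rw [mul_comm, map_mul]
  simp only [specialAct, h1, SemidirectProduct.mul_left, SemidirectProduct.mul_right, map_mul,
    LinearIsometryEquiv.coe_mul, Function.comp_apply, MulAut.mul_apply]
  rw [← mul_assoc, mul_comm q.right]

omit [TopologicalSpace P₀] [IsContinuousAction φ] in
theorem specialAct_congr (p : P₀ ⋊[φ] PosReal) {f g : PosReal → H} (hfg : f =ᵐ[posHaar] g) :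
    specialAct φ T p f =ᵐ[posHaar] specialAct φ T p g := by
  filter_upwards [(measurePreserving_posReal_mul p.right).quasiMeasurePreserving.ae_eq hfg]
    with r hr
  simp only [specialAct]
  exact congrArg _ hr

variable (hT : ∀ v : H, Continuous fun g => T g v)
include hT

theorem aestronglyMeasurable_specialAct (p : P₀ ⋊[φ] PosReal) {f : PosReal → H}
    (hf : AEStronglyMeasurable f posHaar) : AEStronglyMeasurable (specialAct φ T p f) posHaar := by
  refine (continuous_rep_action (φ := φ) hT).comp_aestronglyMeasurable
    (f := fun r : PosReal => ((r, p.left), f (p.right * r))) ?_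
  exact (stronglyMeasurable_id.prodMk stronglyMeasurable_const).aestronglyMeasurable.prodMk
    (hf.comp_measurePreserving (measurePreserving_posReal_mul p.right))

theorem memLp_specialAct (p : P₀ ⋊[φ] PosReal) {f : PosReal → H} (hf : MemLp f 2 posHaar) :
    MemLp (specialAct φ T p f) 2 posHaar := by
  refine (hf.comp_measurePreserving (measurePreserving_posReal_mul p.right)).of_le
    (aestronglyMeasurable_specialAct hT p hf.1) (Eventually.of_forall fun r => ?_)
  simp [specialAct]

/-- The operator of the special representation. -/
def specialOp (p : P₀ ⋊[φ] PosReal) : SpecialSpace H →ₗᵢ[𝕜] SpecialSpace H where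
  toFun f := (memLp_specialAct hT p (Lp.memLp f)).toLp _
  map_add' f g := by
    apply Lp.ext
    filter_upwards [(memLp_specialAct hT p (Lp.memLp (f + g))).coeFn_toLp,
      (memLp_specialAct hT p (Lp.memLp f)).coeFn_toLp,
      (memLp_specialAct hT p (Lp.memLp g)).coeFn_toLp,
      specialAct_congr (T := T) p (Lp.coeFn_add f g),
      Lp.coeFn_add ((memLp_specialAct hT p (Lp.memLp f)).toLp _)
        ((memLp_specialAct hT p (Lp.memLp g)).toLp _)] with r h1 h2 h3 h4 h5
    rw [h1, h4, h5, Pi.add_apply, h2, h3]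
    simp [specialAct]
  map_smul' c f := by
    apply Lp.ext
    filter_upwards [(memLp_specialAct hT p (Lp.memLp (c • f))).coeFn_toLp,
      (memLp_specialAct hT p (Lp.memLp f)).coeFn_toLp,
      specialAct_congr (T := T) p (Lp.coeFn_smul c f),
      Lp.coeFn_smul c ((memLp_specialAct hT p (Lp.memLp f)).toLp _)] with r h1 h2 h4 h5
    rw [h1, h4, RingHom.id_apply, h5, Pi.smul_apply, h2]
    simp [specialAct]
  norm_map' f := by
    have h1 : eLpNorm (specialAct φ T p f) 2 posHaar
        = eLpNorm (fun r => f (p.right * r)) 2 posHaar :=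
      eLpNorm_congr_norm_ae (Eventually.of_forall fun r => by simp [specialAct])
    change ‖(memLp_specialAct hT p (Lp.memLp f)).toLp _‖ = ‖f‖
    rw [Lp.norm_toLp, h1, Lp.norm_def]
    congr 1
    exact eLpNorm_comp_measurePreserving (Lp.aestronglyMeasurable f)
      (measurePreserving_posReal_mul p.right)

theorem specialOp_ae (p : P₀ ⋊[φ] PosReal) (f : SpecialSpace H) :
    specialOp hT p f =ᵐ[posHaar] specialAct φ T p f :=
  (memLp_specialAct hT p (Lp.memLp f)).coeFn_toLp

/-- The special representation of `P`. -/
def specialRep : (P₀ ⋊[φ] PosReal) →* (SpecialSpace H ≃ₗᵢ[𝕜] SpecialSpace H) :=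
  isometricRep (specialOp hT) (fun f => by
    apply Lp.ext
    filter_upwards [specialOp_ae (φ := φ) hT 1 f] with r hr
    rw [hr]
    simp [specialAct]) fun p q f => by
    apply Lp.ext
    filter_upwards [specialOp_ae hT (p * q) f, specialOp_ae hT p (specialOp hT q f),
      specialAct_congr (T := T) p (specialOp_ae hT q f)] with r h1 h2 h3
    rw [h1, h2, h3, specialAct_mul]

theorem isSpecialRep_specialRep : IsSpecialRep φ T (specialRep hT) := fun p f =>
  specialOp_ae hT p f

/-- Sequential continuity of the special representation. -/
theorem tendsto_specialRep {g : ℕ → P₀} {g₀ : P₀} {a : ℕ → PosReal} {a₀ : PosReal}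
    {f : ℕ → SpecialSpace H} {f₀ : SpecialSpace H} (hg : Tendsto g atTop (𝓝 g₀))
    (ha : Tendsto a atTop (𝓝 a₀)) (hf : Tendsto f atTop (𝓝 f₀)) :
    Tendsto (fun n => specialRep (φ := φ) hT ⟨g n, a n⟩ (f n)) atTop
      (𝓝 (specialRep (φ := φ) hT ⟨g₀, a₀⟩ f₀)) := by
  have hsplit : ∀ (g : P₀) (a : PosReal) (f : SpecialSpace H),
      specialRep (φ := φ) hT ⟨g, a⟩ f = specialRep (φ := φ) hT (SemidirectProduct.inl g)
        (Lp.compMeasurePreserving _ (measurePreserving_posReal_mul a) f) := by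
    intro g a f
    apply Lp.ext
    filter_upwards [isSpecialRep_specialRep (φ := φ) hT ⟨g, a⟩ f,
      isSpecialRep_specialRep (φ := φ) hT (SemidirectProduct.inl g)
        (Lp.compMeasurePreserving _ (measurePreserving_posReal_mul a) f),
      Lp.coeFn_compMeasurePreserving f (measurePreserving_posReal_mul a)] with r h1 h2 h3
    rw [h1, h2]
    simp only [specialAct, SemidirectProduct.left_inl, SemidirectProduct.right_inl, one_mul, h3,
      Function.comp_apply]
  refine Tendsto.congr (fun n => (hsplit _ _ _).symm) ?_
  rw [hsplit]
  set w : ℕ → SpecialSpace H := fun n =>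
    Lp.compMeasurePreserving _ (measurePreserving_posReal_mul (a n)) (f n)
  set w₀ : SpecialSpace H := Lp.compMeasurePreserving _ (measurePreserving_posReal_mul a₀) f₀
  have hw : Tendsto w atTop (𝓝 w₀) := by
    let M : C(PosReal, C(PosReal, PosReal)) :=
      (ContinuousMap.mk (fun q : PosReal × PosReal => q.1 * q.2) continuous_posReal_mul).curry
    exact Filter.Tendsto.compMeasurePreservingLp hf ((M.continuous.tendsto a₀).comp ha)
      (fun n => measurePreserving_posReal_mul (a n)) (measurePreserving_posReal_mul a₀)
      (by norm_num)
  have h1 : Tendsto (fun n => specialRep (φ := φ) hT (SemidirectProduct.inl (g n)) w₀) atTop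
      (𝓝 (specialRep (φ := φ) hT (SemidirectProduct.inl g₀) w₀)) := by
    refine tendsto_Lp_two_of_dominated (fun r => 2 * ‖w₀ r‖) ?_
      (Eventually.of_forall fun n => ?_) ?_
    · simp only [mul_pow]
      exact ((memLp_two_iff_integrable_sq_norm (Lp.aestronglyMeasurable w₀)).1
        (Lp.memLp w₀)).const_mul _
    · filter_upwards [isSpecialRep_specialRep (φ := φ) hT (SemidirectProduct.inl (g n)) w₀,
        isSpecialRep_specialRep (φ := φ) hT (SemidirectProduct.inl g₀) w₀] with r h2 h3
      rw [h2, h3]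
      refine (norm_sub_le _ _).trans_eq ?_
      simp [specialAct, two_mul]
    · have h2 : ∀ᵐ r ∂posHaar, ∀ n, specialRep (φ := φ) hT (SemidirectProduct.inl (g n)) w₀ r
          = specialAct φ T (SemidirectProduct.inl (g n)) w₀ r :=
        ae_all_iff.2 fun n => isSpecialRep_specialRep (φ := φ) hT (SemidirectProduct.inl (g n)) w₀
      filter_upwards [h2, isSpecialRep_specialRep (φ := φ) hT (SemidirectProduct.inl g₀) w₀]
        with r h3 h4
      simp only [h3, h4, specialAct, SemidirectProduct.left_inl, SemidirectProduct.right_inl,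
        one_mul]
      have h5 : Continuous fun g : P₀ => T (φ r g) (w₀ r) :=
        (continuous_rep_action (φ := φ) hT).comp
          ((continuous_const.prodMk continuous_id).prodMk continuous_const)
      exact (h5.tendsto g₀).comp hg
  rw [tendsto_iff_dist_tendsto_zero] at h1 hw ⊢
  refine squeeze_zero (fun _ => dist_nonneg) (fun n => ?_) (by simpa using hw.add h1)
  refine (dist_triangle _ (specialRep (φ := φ) hT (SemidirectProduct.inl (g n)) w₀) _).trans_eq ?_
  rw [LinearIsometryEquiv.dist_map]

/-- Sequential continuity applies to approximations by simple functions; no separability of `H` or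
`P₀` is needed. -/
theorem stronglyMeasurable_specialRep {X : Type*} [MeasurableSpace X] {g : X → P₀}
    {a : X → PosReal} {V : X → SpecialSpace H} (hg : StronglyMeasurable g)
    (ha : StronglyMeasurable a) (hV : StronglyMeasurable V) :
    StronglyMeasurable fun x => specialRep (φ := φ) hT ⟨g x, a x⟩ (V x) := by
  refine ⟨fun n => (((hg.approx n).pair (ha.approx n)).pair (hV.approx n)).map
    fun q => specialRep (φ := φ) hT ⟨q.1.1, q.1.2⟩ q.2, fun x => ?_⟩
  exact tendsto_specialRep hT (hg.tendsto_approx x) (ha.tendsto_approx x) (hV.tendsto_approx x)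

end SpecialRep

/-! ### The total displacement of the almost invariant vector -/

section Displacement

theorem massIntensity_le_posHaar : massIntensity ≤ posHaar :=
  Measure.le_intro fun B _ _ => massIntensity_le B

instance : IsLocallyFiniteMeasure massIntensity :=
  Measure.isLocallyFiniteMeasure_of_le massIntensity_le_posHaar

/-- The integral of `(1 + r)⁻²` over `(0, ∞)`. -/
theorem lintegral_mass_ratio :
    ∫⁻ r : PosReal, ENNReal.ofReal (r / (1 + r)) ∂massIntensity = 1 := by
  have hm : Measurable fun r : PosReal => ENNReal.ofReal ((r : ℝ) / (1 + r)) := by fun_prop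
  rw [← measurePreserving_massOfTime.lintegral_comp hm]
  have h1 : ∫⁻ t in Set.Ioi (0 : ℝ), ENNReal.ofReal (massOfTime t / (1 + massOfTime t))
      = ∫⁻ t in Set.Ioi (0 : ℝ), ENNReal.ofReal (Real.exp (-t)) := by
    refine setLIntegral_congr_fun measurableSet_Ioi fun t ht => ?_
    rw [massOfTime_of_pos ht]
    have h2 : 0 < Real.exp t - 1 := sub_pos.mpr (Real.one_lt_exp_iff.mpr ht)
    have h3 : Real.exp t ≠ 0 := (Real.exp_pos t).ne'
    congr 1
    rw [Real.exp_neg]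
    field_simp
    ring
  rw [h1, ← ofReal_integral_eq_lintegral_ofReal (integrableOn_exp_neg_Ioi 0)
    (Eventually.of_forall fun t => (Real.exp_pos _).le), integral_exp_neg_Ioi]
  simp

/-- Continuous cut-off functions on `ℝ₊*` with compact supports, converging to `1`. -/
def massCutoff (k : ℕ) (r : PosReal) : ℝ := max 0 (1 - |Real.log r| / (k + 1))

theorem continuous_massCutoff (k : ℕ) : Continuous (massCutoff k) := by
  have h1 : Continuous fun r : PosReal => Real.log r :=
    continuous_subtype_val.log fun r => r.2.ne'
  unfold massCutoff
  fun_prop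

theorem massCutoff_nonneg (k : ℕ) (r : PosReal) : 0 ≤ massCutoff k r := le_max_left _ _

theorem massCutoff_le_one (k : ℕ) (r : PosReal) : massCutoff k r ≤ 1 :=
  max_le zero_le_one (sub_le_self _ (by positivity))

theorem tendsto_massCutoff (r : PosReal) : Tendsto (massCutoff · r) atTop (𝓝 1) := by
  have h1 : Tendsto (fun k : ℕ => 1 - |Real.log r| / ((k : ℝ) + 1)) atTop (𝓝 (1 - 0)) :=
    tendsto_const_nhds.sub
      (tendsto_const_nhds.div_atTop (tendsto_atTop_add_const_right _ 1 tendsto_natCast_atTop_atTop))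
  have h2 := (continuous_const (y := (0 : ℝ))).max continuous_id |>.tendsto (1 - 0) |>.comp h1
  simpa [massCutoff, Function.comp_def] using h2

theorem exists_isCompact_massCutoff (k : ℕ) :
    ∃ K : Set PosReal, IsCompact K ∧ ∀ r ∉ K, massCutoff k r = 0 := by
  refine ⟨(fun t : ℝ => (⟨Real.exp t, Real.exp_pos t⟩ : PosReal)) '' Set.Icc (-(k + 1)) (k + 1),
    isCompact_Icc.image (Real.continuous_exp.subtype_mk _), fun r hr => ?_⟩
  rw [massCutoff, max_eq_left]
  by_contra! h
  refine hr ⟨Real.log r, ?_, Subtype.ext (Real.exp_log r.2)⟩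
  have h1 : |Real.log r| / (k + 1) < 1 := by linarith
  rw [div_lt_one (by positivity)] at h1
  exact abs_le.1 h1.le

variable {𝕜 : Type*} [RCLike 𝕜] {P₀ : Type*} [Group P₀]
  (φ : PosReal →* MulAut P₀)
  {H : Type*} [NormedAddCommGroup H] [InnerProductSpace 𝕜 H] (T : P₀ →* (H ≃ₗᵢ[𝕜] H))
  (h : Metric.sphere (0 : H) 1)

/-- The total displacement `∫ ‖T_r(g) h - h‖ dr / (r (1 + r))` of the vector `h`. -/
def totalDisp (g : P₀) : ℝ≥0∞ := ∫⁻ r : PosReal, ‖T (φ r g) (h : H) - h‖ₑ ∂massIntensity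

theorem totalDisp_inv (g : P₀) : totalDisp φ T h g⁻¹ = totalDisp φ T h g := by
  refine lintegral_congr fun r => ?_
  rw [← enorm_neg, neg_sub]
  have h1 : T (φ r g) (h - T (φ r g⁻¹) h) = T (φ r g) (h : H) - h := by
    rw [map_sub, map_inv, map_inv]
    exact congrArg (fun y => T (φ r g) (h : H) - y)
      ((T (φ r g)).apply_symm_apply (h : H))
  rw [← h1, LinearIsometryEquiv.enorm_map]

theorem norm_disp_le_two (g : P₀) : ‖T g (h : H) - h‖ ≤ 2 := by
  refine (norm_sub_le _ _).trans_eq ?_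
  rw [LinearIsometryEquiv.norm_map, norm_eq_of_mem_sphere]
  norm_num

variable [TopologicalSpace P₀] [IsContinuousAction φ] {φ T}
  (hT : ∀ v : H, Continuous fun g => T g v)
include hT

theorem continuous_disp : Continuous fun q : P₀ × PosReal => ‖T (φ q.2 q.1) (h : H) - h‖ :=
  (((continuous_rep_action (φ := φ) hT).comp
    ((continuous_snd.prodMk continuous_fst).prodMk continuous_const)).sub continuous_const).norm

theorem totalDisp_mul_le (g g' : P₀) :
    totalDisp φ T h (g * g') ≤ totalDisp φ T h g + totalDisp φ T h g' := by
  have h1 : Continuous fun r : PosReal => T (φ r g) (h : H) - h :=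
    ((continuous_rep_action (φ := φ) hT).comp
      ((continuous_id.prodMk continuous_const).prodMk continuous_const)).sub continuous_const
  rw [totalDisp, totalDisp, totalDisp, ← lintegral_add_left h1.enorm.measurable]
  refine lintegral_mono fun r => ?_
  have h2 : T (φ r (g * g')) (h : H) - h
      = (T (φ r g) (h : H) - h) + T (φ r g) (T (φ r g') (h : H) - h) := by
    rw [map_mul, map_mul, map_sub, LinearIsometryEquiv.coe_mul, Function.comp_apply]
    abel
  rw [h2]
  refine (enorm_add_le _ _).trans_eq ?_
  rw [LinearIsometryEquiv.enorm_map]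

/-- The displacement of an almost invariant vector is finite. -/
theorem totalDisp_lt_top (hTh : IsCanonical φ T h) (g : P₀) : totalDisp φ T h g < ∞ := by
  obtain ⟨c, hc⟩ := hTh.almost_invariant
  obtain ⟨ε, hε, hr⟩ := hc g
  set D := max (|c g|) (max (2 / ε) 2) with hD
  have hD0 : 0 ≤ D := (abs_nonneg _).trans (le_max_left _ _)
  have hD1 : |c g| ≤ D := le_max_left _ _
  have hD2 : 2 / ε ≤ D := (le_max_left _ _).trans (le_max_right _ _)
  have hD3 : 2 ≤ D := (le_max_right _ _).trans (le_max_right _ _)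
  have h1 : ∀ r : PosReal, ‖T (φ r g) (h : H) - h‖ ≤ (2 * D) * (r / (1 + r)) := by
    intro r
    have hr0 : (0 : ℝ) < r := r.2
    have h2 := norm_disp_le_two T h (φ r g)
    have h3 : ‖T (φ r g) (h : H) - h‖ ≤ D * r := by
      by_cases hrε : (r : ℝ) < ε
      · exact (hr r hrε).le.trans
          (mul_le_mul_of_nonneg_right ((le_abs_self _).trans hD1) hr0.le)
      · refine h2.trans ?_
        rw [div_le_iff₀ hε] at hD2
        exact hD2.trans (mul_le_mul_of_nonneg_left (not_lt.1 hrε) hD0)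
    rw [mul_div_assoc', le_div_iff₀ (by positivity)]
    by_cases h1r : (r : ℝ) ≤ 1
    · nlinarith [norm_nonneg (T (φ r g) (h : H) - h)]
    · nlinarith [norm_nonneg (T (φ r g) (h : H) - h)]
  calc totalDisp φ T h g
      ≤ ∫⁻ r : PosReal, ENNReal.ofReal (2 * D) * ENNReal.ofReal (r / (1 + r)) ∂massIntensity := by
        refine lintegral_mono fun r => ?_
        rw [← ENNReal.ofReal_mul (by positivity), ← ofReal_norm]
        exact ENNReal.ofReal_le_ofReal (h1 r)
    _ = ENNReal.ofReal (2 * D) := by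
        rw [lintegral_const_mul _ (by fun_prop), lintegral_mass_ratio, mul_one]
    _ < ∞ := ENNReal.ofReal_lt_top

variable [IsTopologicalGroup P₀] [LocallyCompactSpace P₀]

/-- The total displacement is bounded on compact sets: it is subadditive, so by Baire's theorem it
is enough that its sublevel sets are closed. -/
theorem exists_totalDisp_le (hTh : IsCanonical φ T h) {K : Set P₀} (hK : IsCompact K) :
    ∃ C : ℝ≥0, ∀ g ∈ K, totalDisp φ T h g ≤ C := by
  -- the truncated displacements are continuous and converge to the total one
  set I : ℕ → P₀ → ℝ := fun k g =>
    ∫ r, massCutoff k r * ‖T (φ r g) (h : H) - h‖ ∂massIntensity with hI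
  have hIc : ∀ k, Continuous (I k) := by
    intro k
    obtain ⟨K', hK', h0⟩ := exists_isCompact_massCutoff k
    rw [← continuousOn_univ]
    refine continuousOn_integral_of_compact_support hK' ?_ fun g r _ hr => ?_
    · exact (((continuous_massCutoff k).comp continuous_snd).mul
        (continuous_disp h hT)).continuousOn
    · rw [h0 r hr, zero_mul]
  have hint : ∀ k g, Integrable (fun r => massCutoff k r * ‖T (φ r g) (h : H) - h‖)
      massIntensity := by
    intro k g
    obtain ⟨K', hK', h0⟩ := exists_isCompact_massCutoff k
    refine Continuous.integrable_of_hasCompactSupport ?_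
      (HasCompactSupport.intro hK' fun r hr => by rw [h0 r hr, zero_mul])
    exact (continuous_massCutoff k).mul
      ((continuous_disp (φ := φ) h hT).comp (continuous_const.prodMk continuous_id))
  have hnn : ∀ k g r, 0 ≤ massCutoff k r * ‖T (φ r g) (h : H) - h‖ := fun k g r =>
    mul_nonneg (massCutoff_nonneg k r) (norm_nonneg _)
  have hIl : ∀ k g, ENNReal.ofReal (I k g)
      = ∫⁻ r, ENNReal.ofReal (massCutoff k r * ‖T (φ r g) (h : H) - h‖) ∂massIntensity :=
    fun k g => ofReal_integral_eq_lintegral_ofReal (hint k g) (Eventually.of_forall (hnn k g))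
  set E : ℕ → Set P₀ := fun n => {g | ∀ k, I k g ≤ n} with hE
  have hEc : ∀ n, IsClosed (E n) := fun n => by
    have : E n = ⋂ k, {g | I k g ≤ n} := by ext; simp [hE]
    rw [this]
    exact isClosed_iInter fun k => isClosed_le (hIc k) continuous_const
  have hEN : ∀ n, ∀ g ∈ E n, totalDisp φ T h g ≤ n := by
    intro n g hg
    have h1 : ∀ r, Tendsto
        (fun k => ENNReal.ofReal (massCutoff k r * ‖T (φ r g) (h : H) - h‖)) atTop
        (𝓝 ‖T (φ r g) (h : H) - h‖ₑ) := by
      intro r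
      rw [← ofReal_norm]
      refine (ENNReal.continuous_ofReal.tendsto _).comp ?_
      simpa using (tendsto_massCutoff r).mul_const ‖T (φ r g) (h : H) - h‖
    calc totalDisp φ T h g = ∫⁻ r, liminf (fun k =>
          ENNReal.ofReal (massCutoff k r * ‖T (φ r g) (h : H) - h‖)) atTop ∂massIntensity :=
          lintegral_congr fun r => (h1 r).liminf_eq.symm
      _ ≤ liminf (fun k => ∫⁻ r,
          ENNReal.ofReal (massCutoff k r * ‖T (φ r g) (h : H) - h‖) ∂massIntensity) atTop := by
          refine lintegral_liminf_le' fun k => ?_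
          exact (hint k g).aestronglyMeasurable.aemeasurable.ennreal_ofReal
      _ ≤ n := by
          refine liminf_le_of_le (by isBoundedDefault) fun b hb => ?_
          obtain ⟨k, hk⟩ := hb.exists
          refine hk.trans ?_
          rw [← hIl]
          exact (ENNReal.ofReal_le_ofReal (hg k)).trans_eq (ENNReal.ofReal_natCast n)
  have hEU : ⋃ n, E n = Set.univ := by
    rw [Set.eq_univ_iff_forall]
    intro g
    have h1 := totalDisp_lt_top h hT hTh g
    obtain ⟨n, hn⟩ := exists_nat_ge (totalDisp φ T h g).toReal
    refine Set.mem_iUnion.2 ⟨n, fun k => le_trans ?_ hn⟩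
    rw [← ENNReal.ofReal_le_iff_le_toReal h1.ne, hIl]
    refine lintegral_mono fun r => ?_
    rw [← ofReal_norm]
    exact ENNReal.ofReal_le_ofReal
      (mul_le_of_le_one_left (norm_nonneg _) (massCutoff_le_one k r))
  -- the sets `E n` are closed and exhaust the group, so one of them has an interior point `g₀`
  obtain ⟨n, g₀, hg₀⟩ := nonempty_interior_of_iUnion_of_closed hEc hEU
  refine hK.induction_on (p := fun s => ∃ C : ℝ≥0, ∀ g ∈ s, totalDisp φ T h g ≤ C)
    ⟨0, by simp⟩ (fun s t hst ⟨C, hC⟩ => ⟨C, fun g hg => hC g (hst hg)⟩)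
    (fun s t ⟨C, hC⟩ ⟨C', hC'⟩ => ⟨max C C', ?_⟩) fun g _ => ?_
  · rintro g (hg | hg)
    · exact (hC g hg).trans (ENNReal.coe_le_coe.2 (le_max_left _ _))
    · exact (hC' g hg).trans (ENNReal.coe_le_coe.2 (le_max_right _ _))
  -- the translate of the interior by `g g₀⁻¹` is a neighbourhood of `g`
  · have hcont : Continuous fun g' : P₀ => g₀ * g⁻¹ * g' := continuous_const_mul _
    refine ⟨(fun g' => g₀ * g⁻¹ * g') ⁻¹' interior (E n), mem_nhdsWithin_of_mem_nhds
      (hcont.continuousAt.preimage_mem_nhds ?_),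
      (totalDisp φ T h g + totalDisp φ T h g₀ + n).toNNReal, fun g' hg' => ?_⟩
    · rw [inv_mul_cancel_right]
      exact isOpen_interior.mem_nhds hg₀
    · have h1 := totalDisp_lt_top h hT hTh g
      have h2 := totalDisp_lt_top h hT hTh g₀
      rw [ENNReal.coe_toNNReal (by finiteness)]
      have h3 : g' = g * g₀⁻¹ * (g₀ * g⁻¹ * g') := by group
      calc totalDisp φ T h g' = totalDisp φ T h (g * g₀⁻¹ * (g₀ * g⁻¹ * g')) := by rw [← h3]
        _ ≤ totalDisp φ T h (g * g₀⁻¹) + totalDisp φ T h (g₀ * g⁻¹ * g') :=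
          totalDisp_mul_le h hT _ _
        _ ≤ totalDisp φ T h g + totalDisp φ T h g₀ + n := by
          refine add_le_add ((totalDisp_mul_le h hT _ _).trans_eq ?_)
            (hEN n _ (interior_subset hg'))
          rw [totalDisp_inv]

end Displacement

/-! ### The cocycle of the special representation -/

section Cocycle

variable {𝕜 : Type*} [RCLike 𝕜] {P₀ : Type*} [Group P₀]
  (φ : PosReal →* MulAut P₀)
  {H : Type*} [NormedAddCommGroup H] [InnerProductSpace 𝕜 H] (T : P₀ →* (H ≃ₗᵢ[𝕜] H))
  (h : Metric.sphere (0 : H) 1)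

/-- The function `p f₀ - f₀` on `ℝ₊*`. -/
def cocycleFun (p : P₀ ⋊[φ] PosReal) (r : PosReal) : H :=
  specialAct φ T p (expSection (𝕜 := 𝕜) h) r - expSection (𝕜 := 𝕜) h r

theorem norm_expSection (r : PosReal) : ‖expSection (𝕜 := 𝕜) h r‖ = Real.exp (-(r : ℝ) / 2) := by
  rw [expSection, norm_smul, norm_eq_of_mem_sphere, mul_one, RCLike.norm_ofReal,
    abs_of_pos (Real.exp_pos _)]

theorem abs_exp_neg_sub_le {β s t : ℝ} (hs : β ≤ s) (ht : β ≤ t) :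
    |Real.exp (-s) - Real.exp (-t)| ≤ Real.exp (-β) * |s - t| := by
  have key : ∀ {s t : ℝ}, β ≤ s → s ≤ t →
      |Real.exp (-s) - Real.exp (-t)| ≤ Real.exp (-β) * |s - t| := by
    intro s t hs hst
    have h1 : Real.exp (-t) = Real.exp (-s) * Real.exp (s - t) := by
      rw [← Real.exp_add]; ring_nf
    have h2 := Real.add_one_le_exp (s - t)
    have h3 : Real.exp (s - t) ≤ 1 := Real.exp_le_one_iff.2 (by linarith)
    have h4 := Real.exp_le_exp.2 (neg_le_neg hs)
    have h5 := Real.exp_pos (-s)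
    rw [h1, abs_of_nonneg (by nlinarith), abs_of_nonpos (by linarith)]
    calc Real.exp (-s) - Real.exp (-s) * Real.exp (s - t)
        = Real.exp (-s) * (1 - Real.exp (s - t)) := by ring
      _ ≤ Real.exp (-β) * -(s - t) :=
        mul_le_mul h4 (by linarith) (by linarith) (Real.exp_pos _).le
  rcases le_total s t with hst | hst
  · exact key hs hst
  · rw [abs_sub_comm, abs_sub_comm s]
    exact key ht hst

theorem exp_mul_one_add_sq_le {β r : ℝ} (hβ : 0 < β) (hr : 0 < r) :
    Real.exp (-(β * r / 2)) * (1 + r) ^ 2 ≤ 2 + 16 / β ^ 2 := by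
  have h1 := Real.quadratic_le_exp_of_nonneg (x := β * r / 2) (by positivity)
  have h2 := Real.exp_pos (β * r / 2)
  rw [Real.exp_neg, inv_mul_le_iff₀ h2]
  have h3 : (1 + r) ^ 2 ≤ 2 + 2 * r ^ 2 := by nlinarith [sq_nonneg (1 - r)]
  have h4 : 2 * r ^ 2 = 16 / β ^ 2 * ((β * r / 2) ^ 2 / 2) := by
    field_simp
    ring
  have h5 : (β * r / 2) ^ 2 / 2 ≤ Real.exp (β * r / 2) := by
    have : 0 ≤ β * r / 2 := by positivity
    linarith
  have h6 : 1 ≤ Real.exp (β * r / 2) := Real.one_le_exp (by positivity)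
  calc (1 + r) ^ 2 ≤ 2 * 1 + 16 / β ^ 2 * ((β * r / 2) ^ 2 / 2) := by rw [← h4]; linarith
    _ ≤ 2 * Real.exp (β * r / 2) + 16 / β ^ 2 * Real.exp (β * r / 2) := by gcongr
    _ = _ := by ring

/-- A bound of the cocycle in terms of the displacement of `h`, uniform on the sets where the
component in `ℝ₊*` is bounded away from `0` and `∞`. -/
theorem norm_cocycleFun_le {β C : ℝ} (hβ : 0 < β) (hβ1 : β ≤ 1) (p : P₀ ⋊[φ] PosReal)
    (hp : β ≤ p.right) (hp' : (p.right : ℝ) ≤ C) (r : PosReal) :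
    ‖cocycleFun φ T h p r‖ * (1 + r) ^ 2
      ≤ ((C + 1) * (2 + 16 / β ^ 2)) * (‖T (φ r p.left) (h : H) - h‖ + r) := by
  have hr : (0 : ℝ) < r := r.2
  have hC : 0 < C := hβ.trans_le (hp.trans hp')
  set M := 2 + 16 / β ^ 2 with hM
  have hM0 : 0 ≤ M := by positivity
  obtain ⟨a, ha⟩ : ∃ a : ℝ, a = p.right := ⟨_, rfl⟩
  rw [← ha] at hp hp'
  set y := T (φ r p.left) (h : H) - h with hy
  have h1 : cocycleFun φ T h p r = ((Real.exp (-(a * r / 2)) : ℝ) : 𝕜) • y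
      + ((Real.exp (-(a * r / 2)) - Real.exp (-(r / 2 : ℝ)) : ℝ) : 𝕜) • (h : H) := by
    have e1 : -((p.right * r : PosReal) : ℝ) / 2 = -(a * r / 2) := by
      rw [neg_div, ha]; rfl
    rw [cocycleFun, specialAct, expSection, expSection, e1, neg_div, map_smul, hy,
      RCLike.ofReal_sub]
    module
  have h2 : Real.exp (-(a * r / 2)) ≤ Real.exp (-(β * r / 2)) := by
    refine Real.exp_le_exp.2 (neg_le_neg ?_)
    gcongr
  have h3 : |Real.exp (-(a * r / 2)) - Real.exp (-(r / 2 : ℝ))|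
      ≤ Real.exp (-(β * r / 2)) * ((C + 1) * r) := by
    refine (abs_exp_neg_sub_le (β := β * r / 2) (by gcongr) (by nlinarith)).trans ?_
    refine mul_le_mul_of_nonneg_left ?_ (Real.exp_pos _).le
    have : a * r / 2 - r / 2 = (a - 1) * (r / 2) := by ring
    rw [this, abs_mul, abs_of_pos (by positivity : (0 : ℝ) < r / 2)]
    have h4 : |a - 1| ≤ C + 1 := abs_le.2 ⟨by linarith, by linarith⟩
    exact mul_le_mul h4 (by linarith) (by positivity) (by linarith)
  have h5 : ‖cocycleFun φ T h p r‖ ≤ Real.exp (-(β * r / 2)) * (‖y‖ + (C + 1) * r) := by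
    rw [h1, mul_add]
    refine (norm_add_le _ _).trans (add_le_add ?_ ?_)
    · rw [norm_smul, RCLike.norm_ofReal, abs_of_pos (Real.exp_pos _)]
      exact mul_le_mul_of_nonneg_right h2 (norm_nonneg _)
    · rw [norm_smul, RCLike.norm_ofReal, norm_eq_of_mem_sphere, mul_one]
      exact h3
  calc ‖cocycleFun φ T h p r‖ * (1 + r) ^ 2
      ≤ (Real.exp (-(β * r / 2)) * (‖y‖ + (C + 1) * r)) * (1 + r) ^ 2 := by gcongr
    _ = (Real.exp (-(β * r / 2)) * (1 + r) ^ 2) * (‖y‖ + (C + 1) * r) := by ring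
    _ ≤ M * (‖y‖ + (C + 1) * r) :=
      mul_le_mul_of_nonneg_right (exp_mul_one_add_sq_le hβ hr) (by positivity)
    _ ≤ M * ((C + 1) * (‖y‖ + r)) := by
      refine mul_le_mul_of_nonneg_left ?_ hM0
      nlinarith [norm_nonneg y]
    _ = _ := by ring

variable {φ T h} in
/-- The bound that is integrable for `dr / (r (1 + r))`. -/
theorem norm_cocycleFun_le_weight {D : ℝ} (hD : 0 ≤ D) {p : P₀ ⋊[φ] PosReal} {r : PosReal}
    (hp : ‖cocycleFun φ T h p r‖ * (1 + r) ^ 2 ≤ D * (‖T (φ r p.left) (h : H) - h‖ + r)) :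
    ‖cocycleFun φ T h p r‖ ≤ D * (‖T (φ r p.left) (h : H) - h‖ + r / (1 + r)) := by
  have hr : (0 : ℝ) < r := r.2
  set y := ‖T (φ r p.left) (h : H) - h‖
  have hy : 0 ≤ y := norm_nonneg _
  rw [← le_div_iff₀ (by positivity)] at hp
  refine hp.trans ?_
  rw [div_le_iff₀ (by positivity), mul_assoc]
  refine mul_le_mul_of_nonneg_left ?_ hD
  have : (y + r / (1 + r)) * (1 + r) ^ 2 = y * (1 + r) ^ 2 + r * (1 + r) := by field_simp
  rw [this]
  nlinarith [mul_nonneg hy hr.le, mul_nonneg hy (sq_nonneg (r : ℝ)), sq_nonneg (r : ℝ)]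

variable {φ T h} in
/-- The bound that makes the cocycle square integrable for `dr / r`. -/
theorem norm_cocycleFun_sq_le_weight {D : ℝ} {p : P₀ ⋊[φ] PosReal} {r : PosReal}
    (hp : ‖cocycleFun φ T h p r‖ * (1 + r) ^ 2 ≤ D * (‖T (φ r p.left) (h : H) - h‖ + r)) :
    ‖cocycleFun φ T h p r‖ ^ 2
      ≤ 4 * D ^ 2 * ((1 + (r : ℝ))⁻¹ * (‖T (φ r p.left) (h : H) - h‖ + r / (1 + r))) := by
  have hr : (0 : ℝ) < r := r.2
  have h2 := norm_disp_le_two T h (φ r p.left)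
  set y := ‖T (φ r p.left) (h : H) - h‖
  have hy : 0 ≤ y := norm_nonneg _
  have h1 : ‖cocycleFun φ T h p r‖ ^ 2 * (1 + r) ^ 4 ≤ D ^ 2 * (y + r) ^ 2 := by
    have := pow_le_pow_left₀ (by positivity) hp 2
    calc _ = (‖cocycleFun φ T h p r‖ * (1 + r) ^ 2) ^ 2 := by ring
      _ ≤ _ := this
      _ = _ := by ring
  rw [← le_div_iff₀ (by positivity)] at h1
  refine h1.trans ?_
  rw [div_le_iff₀ (by positivity)]
  have h3 : 4 * D ^ 2 * ((1 + (r : ℝ))⁻¹ * (y + r / (1 + r))) * (1 + r) ^ 4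
      = D ^ 2 * (4 * (y * (1 + r) ^ 3 + r * (1 + r) ^ 2)) := by
    field_simp
  rw [h3]
  refine mul_le_mul_of_nonneg_left ?_ (sq_nonneg D)
  have h4 : y ≤ y * (1 + r) ^ 3 := le_mul_of_one_le_right hy (one_le_pow₀ (by linarith))
  have h5 : (y + r) ^ 2 ≤ 2 * y ^ 2 + 2 * (r : ℝ) ^ 2 := by nlinarith [sq_nonneg (y - r)]
  have h6 : y ^ 2 ≤ 2 * y := by nlinarith
  have h7 : (r : ℝ) ^ 2 ≤ r * (1 + r) ^ 2 := by nlinarith [pow_pos hr 3]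
  nlinarith [sq_nonneg (r : ℝ)]

variable [TopologicalSpace P₀] [IsContinuousAction φ] {φ T}
  (hT : ∀ v : H, Continuous fun g => T g v)
include hT

theorem lintegral_weight (g : P₀) :
    ∫⁻ r : PosReal, ENNReal.ofReal (‖T (φ r g) (h : H) - h‖ + r / (1 + r)) ∂massIntensity
      = totalDisp φ T h g + 1 := by
  have hc : Continuous fun r : PosReal => ‖T (φ r g) (h : H) - h‖ :=
    (continuous_disp (φ := φ) h hT).comp (continuous_const.prodMk continuous_id)
  rw [← lintegral_mass_ratio, totalDisp,
    ← lintegral_add_right _ (by fun_prop : Measurable fun r : PosReal =>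
      ENNReal.ofReal ((r : ℝ) / (1 + r)))]
  refine lintegral_congr fun r => ?_
  have := r.2
  rw [ENNReal.ofReal_add (norm_nonneg _) (by positivity), ofReal_norm]

theorem lintegral_cocycleFun_le {D : ℝ} (hD : 0 ≤ D) {p : P₀ ⋊[φ] PosReal}
    (hp : ∀ r : PosReal, ‖cocycleFun φ T h p r‖ * (1 + r) ^ 2
      ≤ D * (‖T (φ r p.left) (h : H) - h‖ + r)) :
    ∫⁻ r, ‖cocycleFun φ T h p r‖ₑ ∂massIntensity
      ≤ ENNReal.ofReal D * (totalDisp φ T h p.left + 1) := by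
  have hc : Continuous fun r : PosReal => ‖T (φ r p.left) (h : H) - h‖ :=
    (continuous_disp (φ := φ) h hT).comp (continuous_const.prodMk continuous_id)
  have hm := hc.measurable
  rw [← lintegral_weight h hT, ← lintegral_const_mul _ (by fun_prop)]
  refine lintegral_mono fun r => ?_
  rw [← ENNReal.ofReal_mul hD, ← ofReal_norm]
  exact ENNReal.ofReal_le_ofReal (norm_cocycleFun_le_weight hD (hp r))

theorem lintegral_cocycleFun_sq_le {D : ℝ} {p : P₀ ⋊[φ] PosReal}
    (hp : ∀ r : PosReal, ‖cocycleFun φ T h p r‖ * (1 + r) ^ 2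
      ≤ D * (‖T (φ r p.left) (h : H) - h‖ + r)) :
    ∫⁻ r, ‖cocycleFun φ T h p r‖ₑ ^ (2 : ℝ) ∂posHaar
      ≤ ENNReal.ofReal (4 * D ^ 2) * (totalDisp φ T h p.left + 1) := by
  have hc : Continuous fun r : PosReal => ‖T (φ r p.left) (h : H) - h‖ :=
    (continuous_disp (φ := φ) h hT).comp (continuous_const.prodMk continuous_id)
  have hm := hc.measurable
  rw [← lintegral_weight h hT, massIntensity,
    lintegral_withDensity_eq_lintegral_mul _ (by fun_prop) (by fun_prop),
    ← lintegral_const_mul _ (by fun_prop)]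
  refine lintegral_mono fun r => ?_
  have hr : (0 : ℝ) < r := r.2
  rw [Pi.mul_apply, ← ENNReal.ofReal_mul (by positivity), ← ENNReal.ofReal_mul (by positivity),
    ← ofReal_norm, ENNReal.ofReal_rpow_of_nonneg (norm_nonneg _) (by norm_num)]
  refine ENNReal.ofReal_le_ofReal ?_
  have := norm_cocycleFun_sq_le_weight (hp r)
  exact_mod_cast this

theorem aestronglyMeasurable_cocycleFun {μ : Measure PosReal} (p : P₀ ⋊[φ] PosReal) :
    AEStronglyMeasurable (cocycleFun φ T h p) μ := by
  have h1 : Continuous (expSection (𝕜 := 𝕜) h) := by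
    refine Continuous.smul (RCLike.continuous_ofReal.comp ?_) continuous_const
    exact Real.continuous_exp.comp (continuous_subtype_val.neg.div_const 2)
  have h2 : Continuous (specialAct φ T p (expSection (𝕜 := 𝕜) h)) :=
    (continuous_rep_action (φ := φ) hT).comp ((continuous_id.prodMk continuous_const).prodMk
      (h1.comp (continuous_posReal_mul.comp (continuous_const.prodMk continuous_id))))
  exact (h2.sub h1).aestronglyMeasurable

theorem memLp_cocycleFun (hTh : IsCanonical φ T h) (p : P₀ ⋊[φ] PosReal) :
    MemLp (cocycleFun φ T h p) 2 posHaar := by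
  refine ⟨aestronglyMeasurable_cocycleFun h hT p, ?_⟩
  rw [eLpNorm_lt_top_iff_lintegral_rpow_enorm_lt_top (by norm_num) (by norm_num)]
  have hr := p.right.2
  refine (lintegral_cocycleFun_sq_le h hT fun r => norm_cocycleFun_le φ T h
    (β := min 1 p.right) (C := p.right) (by positivity) (min_le_left _ _) p (min_le_right _ _)
    le_rfl r).trans_lt ?_
  have := totalDisp_lt_top h hT hTh p.left
  finiteness

/-- The cocycle `b` of the special representation. -/
def specialCocycle (hTh : IsCanonical φ T h) (p : P₀ ⋊[φ] PosReal) : SpecialSpace H :=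
  (memLp_cocycleFun h hT hTh p).toLp _

theorem isExpCocycle_specialCocycle (hTh : IsCanonical φ T h) :
    IsExpCocycle φ T h (specialCocycle h hT hTh) := fun p =>
  (memLp_cocycleFun h hT hTh p).coeFn_toLp

end Cocycle

/-! ### Measurability of the cocycle along a current -/

section CocycleMeasurability

variable {𝕜 : Type*} [RCLike 𝕜] {P₀ : Type*} [Group P₀] [TopologicalSpace P₀]
  {φ : PosReal →* MulAut P₀} [IsContinuousAction φ]
  {H : Type*} [NormedAddCommGroup H] [InnerProductSpace 𝕜 H] {T : P₀ →* (H ≃ₗᵢ[𝕜] H)}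
  (h : Metric.sphere (0 : H) 1) (hT : ∀ v : H, Continuous fun g => T g v)

theorem hasCompactSupport_massCutoff (k : ℕ) : HasCompactSupport (massCutoff k) := by
  obtain ⟨K, hK, h0⟩ := exists_isCompact_massCutoff k
  exact HasCompactSupport.intro hK h0

variable (𝕜) in
theorem memLp_cutExp (k : ℕ) (a : PosReal) :
    MemLp (fun r : PosReal => ((massCutoff k r : ℝ) : 𝕜) • expSection (𝕜 := 𝕜) h (a * r))
      2 posHaar := by
  have h1 : Continuous (expSection (𝕜 := 𝕜) h) := by
    refine Continuous.smul (RCLike.continuous_ofReal.comp ?_) continuous_const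
    exact Real.continuous_exp.comp (continuous_subtype_val.neg.div_const 2)
  have h2 : Continuous fun r : PosReal =>
      ((massCutoff k r : ℝ) : 𝕜) • expSection (𝕜 := 𝕜) h (a * r) :=
    (RCLike.continuous_ofReal.comp (continuous_massCutoff k)).smul
      (h1.comp (continuous_posReal_mul.comp (continuous_const.prodMk continuous_id)))
  refine h2.memLp_of_hasCompactSupport (HasCompactSupport.smul_right ?_)
  exact (hasCompactSupport_massCutoff k).comp_left (g := fun t : ℝ => (t : 𝕜)) (by simp)

variable (𝕜) in
/-- The element `r ↦ κ_k(r) e^{-ar/2} h` of the space of the special representation, where `κ_k`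
is a cut-off function. -/
def cutExp (k : ℕ) (a : PosReal) : SpecialSpace H := (memLp_cutExp 𝕜 h k a).toLp _

theorem norm_expSection_le_one (r : PosReal) : ‖expSection (𝕜 := 𝕜) h r‖ ≤ 1 := by
  rw [norm_expSection, Real.exp_le_one_iff]
  have := r.2
  linarith

theorem continuous_cutExp (k : ℕ) : Continuous (cutExp 𝕜 h k) := by
  rw [continuous_iff_seqContinuous]
  intro a a₀ ha
  refine tendsto_Lp_two_of_dominated (fun r => 2 * massCutoff k r) ?_
    (Eventually.of_forall fun n => ?_) ?_
  · refine Continuous.integrable_of_hasCompactSupport ?_ ?_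
    · exact (continuous_const.mul (continuous_massCutoff k)).pow 2
    · exact (hasCompactSupport_massCutoff k).comp_left (g := fun t : ℝ => (2 * t) ^ 2) (by simp)
  · filter_upwards [(memLp_cutExp 𝕜 h k (a n)).coeFn_toLp,
      (memLp_cutExp 𝕜 h k a₀).coeFn_toLp] with r h1 h2
    rw [Function.comp_apply, cutExp, cutExp, h1, h2, ← smul_sub, norm_smul, RCLike.norm_ofReal,
      abs_of_nonneg (massCutoff_nonneg k r), mul_comm]
    refine mul_le_mul_of_nonneg_right ?_ (massCutoff_nonneg k r)
    refine (norm_sub_le _ _).trans ?_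
    have h3 := norm_expSection_le_one (𝕜 := 𝕜) h (a n * r)
    have h4 := norm_expSection_le_one (𝕜 := 𝕜) h (a₀ * r)
    linarith
  · have h1 : ∀ᵐ r ∂posHaar, ∀ n, cutExp 𝕜 h k (a n) r
        = ((massCutoff k r : ℝ) : 𝕜) • expSection (𝕜 := 𝕜) h (a n * r) :=
      ae_all_iff.2 fun n => (memLp_cutExp 𝕜 h k (a n)).coeFn_toLp
    filter_upwards [h1, (memLp_cutExp 𝕜 h k a₀).coeFn_toLp] with r h2 h3
    simp only [Function.comp_apply, h2]
    rw [cutExp, h3]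
    have h4 : Continuous (expSection (𝕜 := 𝕜) h) := by
      refine Continuous.smul (RCLike.continuous_ofReal.comp ?_) continuous_const
      exact Real.continuous_exp.comp (continuous_subtype_val.neg.div_const 2)
    have h5 : Continuous fun a : PosReal =>
        ((massCutoff k r : ℝ) : 𝕜) • expSection (𝕜 := 𝕜) h (a * r) :=
      (h4.comp (continuous_posReal_mul.comp (continuous_id.prodMk continuous_const))).const_smul _
    exact (h5.tendsto a₀).comp ha

theorem cutExp_sub_ae (k : ℕ) (p : P₀ ⋊[φ] PosReal) :
    specialRep (φ := φ) hT (SemidirectProduct.inl p.left) (cutExp 𝕜 h k p.right) - cutExp 𝕜 h k 1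
      =ᵐ[posHaar] fun r => ((massCutoff k r : ℝ) : 𝕜) • cocycleFun φ T h p r := by
  filter_upwards [Lp.coeFn_sub (specialRep (φ := φ) hT (SemidirectProduct.inl p.left)
      (cutExp 𝕜 h k p.right)) (cutExp 𝕜 h k 1),
    isSpecialRep_specialRep (φ := φ) hT (SemidirectProduct.inl p.left) (cutExp 𝕜 h k p.right),
    (memLp_cutExp 𝕜 h k p.right).coeFn_toLp, (memLp_cutExp 𝕜 h k 1).coeFn_toLp] with r h1 h2 h3 h4
  rw [h1, Pi.sub_apply, h2]
  simp only [specialAct, SemidirectProduct.left_inl, SemidirectProduct.right_inl, one_mul]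
  rw [cutExp, cutExp, h3, h4, one_mul, cocycleFun, map_smul, smul_sub, specialAct]

/-- The cocycle is a limit of coboundaries of the truncated vectors `κ_k f₀`, which lie in the
space. -/
theorem tendsto_cutExp_sub (hTh : IsCanonical φ T h) (p : P₀ ⋊[φ] PosReal) :
    Tendsto (fun k => specialRep (φ := φ) hT (SemidirectProduct.inl p.left)
      (cutExp 𝕜 h k p.right) - cutExp 𝕜 h k 1) atTop (𝓝 (specialCocycle h hT hTh p)) := by
  refine tendsto_Lp_two_of_dominated (fun r => ‖cocycleFun φ T h p r‖) ?_
    (Eventually.of_forall fun k => ?_) ?_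
  · exact (memLp_two_iff_integrable_sq_norm (memLp_cocycleFun h hT hTh p).1).1
      (memLp_cocycleFun h hT hTh p)
  · filter_upwards [cutExp_sub_ae h hT k p, isExpCocycle_specialCocycle h hT hTh p] with r h1 h2
    rw [h1, h2]
    have h3 : ((massCutoff k r : ℝ) : 𝕜) • cocycleFun φ T h p r
        - (specialAct φ T p (expSection (𝕜 := 𝕜) h) r - expSection (𝕜 := 𝕜) h r)
        = (-((1 - massCutoff k r : ℝ) : 𝕜)) • cocycleFun φ T h p r := by
      rw [cocycleFun, RCLike.ofReal_sub, RCLike.ofReal_one]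
      module
    have h4 := massCutoff_nonneg k r
    have h5 := massCutoff_le_one k r
    rw [h3, norm_smul, norm_neg, RCLike.norm_ofReal, abs_of_nonneg (by linarith)]
    exact mul_le_of_le_one_left (norm_nonneg _) (by linarith)
  · have h1 := ae_all_iff.2 fun k => cutExp_sub_ae (𝕜 := 𝕜) h hT k p
    filter_upwards [h1, isExpCocycle_specialCocycle h hT hTh p] with r h2 h3
    simp only [h2, h3]
    have h4 := ((RCLike.continuous_ofReal (K := 𝕜)).tendsto 1).comp (tendsto_massCutoff r)
    have h5 := h4.smul_const (cocycleFun φ T h p r)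
    simpa [Function.comp_def, cocycleFun] using h5

/-- The coboundaries that approximate the cocycle are measurable along a current. -/
theorem stronglyMeasurable_specialCocycle (hTh : IsCanonical φ T h) {X : Type*}
    [MeasurableSpace X] {p : X → P₀ ⋊[φ] PosReal} (hp : StronglyMeasurable fun x => (p x).left)
    (hp' : StronglyMeasurable fun x => (p x).right) :
    StronglyMeasurable fun x => specialCocycle h hT hTh (p x) := by
  refine stronglyMeasurable_of_tendsto atTop (f := fun k x =>
    specialRep (φ := φ) hT (SemidirectProduct.inl (p x).left) (cutExp 𝕜 h k (p x).right)
      - cutExp 𝕜 h k 1) (fun k => ?_) (tendsto_pi_nhds.2 fun x => tendsto_cutExp_sub h hT hTh (p x))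
  exact (stronglyMeasurable_specialRep (φ := φ) (a := fun _ => 1) hT hp stronglyMeasurable_const
    ((continuous_cutExp h k).comp_stronglyMeasurable hp')).sub stronglyMeasurable_const

end CocycleMeasurability

/-! ### The representation and the cocycle of the current group -/

section Currents

variable {𝕜 : Type*} [RCLike 𝕜] {P₀ : Type*} [Group P₀] [TopologicalSpace P₀]
  [IsTopologicalGroup P₀]
  {φ : PosReal →* MulAut P₀} [IsContinuousAction φ]
  {H : Type*} [NormedAddCommGroup H] [InnerProductSpace 𝕜 H] {T : P₀ →* (H ≃ₗᵢ[𝕜] H)}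
  {X : Type*} [MeasurableSpace X] {m : Measure X}

/-- A relatively compact subset of `ℝ₊*` is bounded away from `0` and `∞`. -/
theorem CurrentGroup.exists_bounds (p : CurrentGroup φ X) :
    ∃ β C : ℝ, 0 < β ∧ β ≤ 1 ∧ 0 < C ∧ ∀ x, β ≤ (p.1 x).right ∧ ((p.1 x).right : ℝ) ≤ C := by
  obtain ⟨C, hC⟩ := CurrentGroup.right_bounded p
  obtain ⟨C', hC'⟩ := CurrentGroup.right_bounded p⁻¹
  have h1 : 0 < max C' 1 := lt_max_of_lt_right one_pos
  refine ⟨(max C' 1)⁻¹, max C 1, inv_pos.2 h1, inv_le_one_of_one_le₀ (le_max_right _ _),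
    lt_max_of_lt_right one_pos, fun x => ⟨?_, (hC x).trans (le_max_left _ _)⟩⟩
  have h2 : (((p⁻¹).1 x).right : ℝ) = ((p.1 x).right : ℝ)⁻¹ := rfl
  have h3 := (hC' x).trans (le_max_left C' 1)
  rw [h2] at h3
  exact inv_le_of_inv_le₀ (p.1 x).right.2 h3

variable (T) in
/-- The action of a current on functions on `X × ℝ₊*`. -/
def currentAct (p : CurrentGroup φ X) (v : X × PosReal → H) : X × PosReal → H :=
  fun z => specialAct φ T (p.1 z.1) (fun r => v (z.1, r)) z.2

variable (hT : ∀ v : H, Continuous fun g => T g v)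
include hT

theorem stronglyMeasurable_currentAct (p : CurrentGroup φ X) {v : X × PosReal → H}
    (hv : StronglyMeasurable v) : StronglyMeasurable (currentAct T p v) := by
  have h1 : Measurable fun z : X × PosReal => (z.1, (p.1 z.1).right * z.2) :=
    measurable_fst.prodMk (continuous_posReal_mul.measurable.comp
      ((p.2.2.1.measurable.comp measurable_fst).prodMk measurable_snd))
  exact (continuous_rep_action (φ := φ) hT).comp_stronglyMeasurable
    (((stronglyMeasurable_id (α := PosReal)).comp_measurable measurable_snd |>.prodMk
      (p.2.1.comp_measurable measurable_fst)).prodMk (hv.comp_measurable h1))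

theorem memLp_currentOp (p : CurrentGroup φ X) (V : Lp (SpecialSpace H) 2 m) :
    MemLp (fun x => specialRep (φ := φ) hT (p.1 x) (V x)) 2 m :=
  (Lp.memLp V).of_le (stronglyMeasurable_specialRep hT p.2.1 p.2.2.1
    (Lp.stronglyMeasurable V)).aestronglyMeasurable
    (Eventually.of_forall fun _ => (LinearIsometryEquiv.norm_map _ _).le)

/-- The operator of the representation of the current group generated by the special
representation. -/
def currentOp (p : CurrentGroup φ X) :
    Lp (SpecialSpace H) 2 m →ₗᵢ[𝕜] Lp (SpecialSpace H) 2 m where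
  toFun V := (memLp_currentOp hT p V).toLp _
  map_add' V W := by
    apply Lp.ext
    filter_upwards [(memLp_currentOp hT p (V + W)).coeFn_toLp, (memLp_currentOp hT p V).coeFn_toLp,
      (memLp_currentOp hT p W).coeFn_toLp, Lp.coeFn_add V W,
      Lp.coeFn_add ((memLp_currentOp hT p V).toLp _) ((memLp_currentOp hT p W).toLp _)]
      with x h1 h2 h3 h4 h5
    rw [h1, h4, h5, Pi.add_apply, Pi.add_apply, h2, h3, map_add]
  map_smul' c V := by
    apply Lp.ext
    filter_upwards [(memLp_currentOp hT p (c • V)).coeFn_toLp, (memLp_currentOp hT p V).coeFn_toLp,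
      Lp.coeFn_smul c V, Lp.coeFn_smul c ((memLp_currentOp hT p V).toLp _)] with x h1 h2 h4 h5
    rw [h1, h4, RingHom.id_apply, h5, Pi.smul_apply, Pi.smul_apply, h2, map_smul]
  norm_map' V := by
    change ‖(memLp_currentOp hT p V).toLp _‖ = ‖V‖
    rw [Lp.norm_toLp, Lp.norm_def]
    congr 1
    exact eLpNorm_congr_norm_ae (Eventually.of_forall fun x => LinearIsometryEquiv.norm_map _ _)

theorem currentOp_ae (p : CurrentGroup φ X) (V : Lp (SpecialSpace H) 2 m) :
    currentOp hT p V =ᵐ[m] fun x => specialRep (φ := φ) hT (p.1 x) (V x) :=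
  (memLp_currentOp hT p V).coeFn_toLp

/-- The representation of the current group in `L²(X; L²(ℝ₊*; H))`. -/
def currentRep : CurrentGroup φ X →* (Lp (SpecialSpace H) 2 m ≃ₗᵢ[𝕜] Lp (SpecialSpace H) 2 m) :=
  isometricRep (currentOp hT) (fun V => by
    apply Lp.ext
    filter_upwards [currentOp_ae (φ := φ) hT 1 V] with x hx
    rw [hx]
    change specialRep (φ := φ) hT 1 (V x) = V x
    rw [map_one]
    rfl) fun p q V => by
    apply Lp.ext
    filter_upwards [currentOp_ae (φ := φ) hT (p * q) V,
      currentOp_ae (φ := φ) hT p (currentOp hT q V),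
      currentOp_ae (φ := φ) hT q V] with x h1 h2 h3
    rw [h1, h2, h3]
    change specialRep (φ := φ) hT (p.1 x * q.1 x) (V x) = _
    rw [map_mul]
    rfl

variable (m) in
theorem isCurrentRep_currentRep : IsCurrentRep m (specialRep (φ := φ) hT)
    (currentRep (X := X) (φ := φ) (m := m) hT) := by
  intro p V
  rw [currentRep, isometricRep_apply]
  exact currentOp_ae hT p V

theorem isSlice_currentAct (p : CurrentGroup φ X) {v : X × PosReal → H}
    {V : Lp (SpecialSpace H) 2 m} (hv : IsSlice v V) :
    IsSlice (currentAct T p v) (currentRep (𝕜 := 𝕜) hT p V) := by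
  refine ⟨stronglyMeasurable_currentAct hT p hv.1, ?_⟩
  filter_upwards [hv.2, isCurrentRep_currentRep m hT p V] with x h1 h2
  have h3 := isSpecialRep_specialRep (φ := φ) hT (p.1 x) (V x)
  have h4 := specialAct_congr (T := T) (p.1 x) h1
  rw [h2]
  exact h3.trans h4

theorem isGood_currentAct [SFinite m] (p : CurrentGroup φ X) {v : X × PosReal → H}
    {V : Lp (SpecialSpace H) 2 m} (hv : IsGood v V) :
    IsGood (currentAct T p v) (currentRep (𝕜 := 𝕜) hT p V) := by
  refine ⟨isSlice_currentAct hT p hv.toIsSlice, ⟨(stronglyMeasurable_currentAct hT p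
    hv.stronglyMeasurable).aestronglyMeasurable, ?_⟩⟩
  obtain ⟨β, C, hβ, hβ1, hC, hp⟩ := CurrentGroup.exists_bounds p
  have h1 := hv.integrable.2
  rw [HasFiniteIntegral, poissonIntensity,
    lintegral_prod _ hv.stronglyMeasurable.enorm.aemeasurable] at h1
  rw [HasFiniteIntegral, poissonIntensity,
    lintegral_prod _ (stronglyMeasurable_currentAct hT p
      hv.stronglyMeasurable).enorm.aemeasurable]
  have h2 : ∀ x, ∫⁻ r, ‖currentAct T p v (x, r)‖ₑ ∂massIntensity
      ≤ ENNReal.ofReal (max C 1) * ∫⁻ r, ‖v (x, r)‖ₑ ∂massIntensity := by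
    intro x
    have hvx : Measurable fun r => ‖v (x, r)‖ₑ :=
      (hv.stronglyMeasurable.comp_measurable measurable_prodMk_left).enorm
    set a := (p.1 x).right with ha
    have ha0 : (0 : ℝ) < a := a.2
    have haC : (a : ℝ) ≤ C := (hp x).2
    have h3 : ∀ r : PosReal, ‖currentAct T p v (x, r)‖ₑ = ‖v (x, a * r)‖ₑ := fun r =>
      LinearIsometryEquiv.enorm_map _ _
    have hva : Measurable fun r => ‖v (x, a * r)‖ₑ := hvx.comp (measurable_posReal_mul a)
    simp only [h3]
    rw [massIntensity, lintegral_withDensity_eq_lintegral_mul _ (by fun_prop) hva,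
      lintegral_withDensity_eq_lintegral_mul _ (by fun_prop) hvx,
      ← lintegral_const_mul _ (by fun_prop)]
    have hmp := measurePreserving_posReal_mul a
    rw [← hmp.lintegral_comp (f := fun r => ENNReal.ofReal (max C 1) *
      (((fun r : PosReal => ENNReal.ofReal (1 + (r : ℝ))⁻¹) * fun r => ‖v (x, r)‖ₑ) r))
      (by fun_prop)]
    refine lintegral_mono fun r => ?_
    have hr : (0 : ℝ) < r := r.2
    rw [Pi.mul_apply, Pi.mul_apply, ← mul_assoc, ← ENNReal.ofReal_mul (by positivity)]
    refine mul_le_mul_left (ENNReal.ofReal_le_ofReal ?_) _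
    have h4 : ((a * r : PosReal) : ℝ) = a * r := rfl
    rw [h4, ← div_eq_mul_inv, le_div_iff₀ (by positivity), inv_mul_le_iff₀ (by positivity)]
    have h5 : C ≤ max C 1 := le_max_left _ _
    have h6 : 1 ≤ max C 1 := le_max_right _ _
    nlinarith
  refine (lintegral_mono h2).trans_lt ?_
  rw [lintegral_const_mul' _ _ ENNReal.ofReal_ne_top]
  exact ENNReal.mul_lt_top ENNReal.ofReal_lt_top h1

variable [IsProbabilityMeasure m] [LocallyCompactSpace P₀] (h : Metric.sphere (0 : H) 1)
  (hTh : IsCanonical φ T h)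

omit hT in
/-- Bounds of the cocycle along a current. -/
theorem CurrentGroup.exists_cocycle_bound (hT : ∀ v : H, Continuous fun g => T g v)
    (hTh : IsCanonical φ T h) (p : CurrentGroup φ X) :
    ∃ C : ℝ≥0, ∀ x, ∫⁻ r, ‖cocycleFun φ T h (p.1 x) r‖ₑ ∂massIntensity ≤ C ∧
      ∫⁻ r, ‖cocycleFun φ T h (p.1 x) r‖ₑ ^ (2 : ℝ) ∂posHaar ≤ C := by
  obtain ⟨β, C, hβ, hβ1, hC, hp⟩ := CurrentGroup.exists_bounds p
  obtain ⟨-, -, K, L, hK, -, hKL⟩ := p.2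
  obtain ⟨N, hN⟩ := exists_totalDisp_le h hT hTh hK
  set D := (C + 1) * (2 + 16 / β ^ 2)
  have hD : 0 ≤ D := by positivity
  have h1 : ∀ x r, ‖cocycleFun φ T h (p.1 x) r‖ * (1 + r) ^ 2
      ≤ D * (‖T (φ r (p.1 x).left) (h : H) - h‖ + r) := fun x r =>
    norm_cocycleFun_le φ T h hβ hβ1 (p.1 x) (hp x).1 (hp x).2 r
  refine ⟨max (D.toNNReal * (N + 1)) ((4 * D ^ 2).toNNReal * (N + 1)), fun x => ⟨?_, ?_⟩⟩
  · refine (lintegral_cocycleFun_le h hT hD (h1 x)).trans ?_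
    refine le_trans ?_ (ENNReal.coe_le_coe.2 (le_max_left _ _))
    push_cast
    exact mul_le_mul_right (add_le_add_left (hN _ (hKL x).1) 1) _
  · refine (lintegral_cocycleFun_sq_le h hT (h1 x)).trans ?_
    refine le_trans ?_ (ENNReal.coe_le_coe.2 (le_max_right _ _))
    push_cast
    exact mul_le_mul_right (add_le_add_left (hN _ (hKL x).1) 1) _

theorem memLp_currentCocycle (hTh : IsCanonical φ T h) (p : CurrentGroup φ X) :
    MemLp (fun x => specialCocycle h hT hTh (p.1 x)) 2 m := by
  obtain ⟨C, hC⟩ := CurrentGroup.exists_cocycle_bound h hT hTh p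
  refine MemLp.of_bound (stronglyMeasurable_specialCocycle h hT hTh p.2.1
    p.2.2.1).aestronglyMeasurable ((C : ℝ≥0∞) ^ (1 / (2 : ℝ))).toReal
    (Eventually.of_forall fun x => ?_)
  rw [specialCocycle, Lp.norm_toLp, eLpNorm_eq_lintegral_rpow_enorm_toReal (by norm_num)
    (by norm_num)]
  exact ENNReal.toReal_mono (by finiteness) (ENNReal.rpow_le_rpow (hC x).2 (by norm_num))

/-- The cocycle of the current group. -/
def currentCocycle (hTh : IsCanonical φ T h) (p : CurrentGroup φ X) : Lp (SpecialSpace H) 2 m :=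
  (memLp_currentCocycle hT h hTh p).toLp _

variable (m) in
theorem isCurrentCocycle_currentCocycle (hTh : IsCanonical φ T h) :
    IsCurrentCocycle m (specialCocycle h hT hTh)
      (currentCocycle (X := X) (m := m) (φ := φ) hT h hTh) :=
  fun p => (memLp_currentCocycle hT h hTh p).coeFn_toLp

theorem isGood_currentCocycle (hTh : IsCanonical φ T h) (p : CurrentGroup φ X) :
    IsGood (fun z : X × PosReal => cocycleFun φ T h (p.1 z.1) z.2)
      (currentCocycle (m := m) hT h hTh p) := by
  have h1 : Continuous (expSection (𝕜 := 𝕜) h) := by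
    refine Continuous.smul (RCLike.continuous_ofReal.comp ?_) continuous_const
    exact Real.continuous_exp.comp (continuous_subtype_val.neg.div_const 2)
  have h2 : StronglyMeasurable fun z : X × PosReal => expSection (𝕜 := 𝕜) h z.2 :=
    (h1.stronglyMeasurable).comp_measurable measurable_snd
  have h3 : StronglyMeasurable fun z : X × PosReal => cocycleFun φ T h (p.1 z.1) z.2 :=
    (stronglyMeasurable_currentAct hT p h2).sub h2
  refine ⟨⟨h3, ?_⟩, h3.aestronglyMeasurable, ?_⟩
  · filter_upwards [isCurrentCocycle_currentCocycle m hT h hTh p] with x hx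
    rw [hx]
    exact isExpCocycle_specialCocycle h hT hTh (p.1 x)
  · obtain ⟨C, hC⟩ := CurrentGroup.exists_cocycle_bound h hT hTh p
    rw [HasFiniteIntegral, poissonIntensity, lintegral_prod _ h3.enorm.aemeasurable]
    refine (lintegral_mono fun x => (hC x).1).trans_lt ?_
    simp

end Currents

/-! ### Every element of `L²(X × Y; H)` is represented in `L²(X; L²(Y; H))` -/

section Currying

variable {𝕜 : Type*} [RCLike 𝕜] {H : Type*} [NormedAddCommGroup H] [InnerProductSpace 𝕜 H]
  {X Y : Type*} [MeasurableSpace X] [MeasurableSpace Y] {m : Measure X} {μ : Measure Y}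

theorem tendsto_indicatorConstLp_of_eventually {α E : Type*} [MeasurableSpace α] {ν : Measure α}
    [NormedAddCommGroup E] {s : ℕ → Set α} (hs : ∀ n, MeasurableSet (s n)) {t R : Set α}
    (ht : MeasurableSet t) (hR : MeasurableSet R) (hνR : ν R ≠ ∞) (hsR : ∀ n, s n ⊆ R)
    (htR : t ⊆ R) (hst : ∀ x, ∀ᶠ n in atTop, x ∈ s n ↔ x ∈ t) (c : E) :
    Tendsto (fun n => indicatorConstLp 2 (hs n) (measure_ne_top_of_subset (hsR n) hνR) c) atTop
      (𝓝 (indicatorConstLp 2 ht (measure_ne_top_of_subset htR hνR) c)) := by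
  have h1 := fun n => indicatorConstLp_coeFn (p := 2) (hs := hs n)
    (hμs := measure_ne_top_of_subset (hsR n) hνR) (c := c)
  have h2 := indicatorConstLp_coeFn (p := 2) (hs := ht)
    (hμs := measure_ne_top_of_subset htR hνR) (c := c)
  refine tendsto_Lp_two_of_dominated (R.indicator fun _ => ‖c‖) ?_
    (Eventually.of_forall fun n => ?_) ?_
  · have : (fun x => R.indicator (fun _ => ‖c‖) x ^ 2) = R.indicator fun _ => ‖c‖ ^ 2 := by
      funext x
      by_cases hx : x ∈ R <;> simp [hx]
    rw [this, integrable_indicator_iff hR]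
    exact integrableOn_const hνR
  · filter_upwards [h1 n, h2] with x h3 h4
    rw [h3, h4]
    by_cases hx : x ∈ R
    · by_cases hxs : x ∈ s n <;> by_cases hxt : x ∈ t <;> simp [hx, hxs, hxt]
    · have hxs : x ∉ s n := fun h => hx (hsR n h)
      have hxt : x ∉ t := fun h => hx (htR h)
      simp [hx, hxs, hxt]
  · filter_upwards [ae_all_iff.2 h1, h2] with x h3 h4
    rw [h4]
    refine tendsto_const_nhds.congr' ?_
    filter_upwards [hst x] with n hn
    rw [h3]
    by_cases hx : x ∈ t
    · simp [hx, hn.2 hx]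
    · have : x ∉ s n := fun h => hx (hn.1 h)
      simp [hx, this]

variable (𝕜 H m μ) in
/-- The elements of `L²(X × Y; H)` that have a counterpart in `L²(X; L²(Y; H))`. -/
def sliceable : Submodule 𝕜 (Lp H 2 (m.prod μ)) where
  carrier := {f | ∃ (v : X × Y → H) (V : Lp (Lp H 2 μ) 2 m), IsSlice v V ∧ f =ᵐ[m.prod μ] v}
  zero_mem' := ⟨fun _ => 0, 0, ⟨stronglyMeasurable_const, by
    filter_upwards [Lp.coeFn_zero (Lp H 2 μ) 2 m] with x hx
    rw [hx]
    exact Lp.coeFn_zero H 2 μ⟩, Lp.coeFn_zero H 2 (m.prod μ)⟩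
  add_mem' := by
    rintro f g ⟨v, V, hv, hf⟩ ⟨w, W, hw, hg⟩
    refine ⟨_, _, hv.add hw, ?_⟩
    filter_upwards [hf, hg, Lp.coeFn_add f g] with z h1 h2 h3
    rw [h3, Pi.add_apply, h1, h2]
  smul_mem' := by
    rintro c f ⟨v, V, hv, hf⟩
    refine ⟨_, _, hv.smul c, ?_⟩
    filter_upwards [hf, Lp.coeFn_smul c f] with z h1 h3
    rw [h3, Pi.smul_apply, h1]

variable (𝕜) in
include 𝕜 in
theorem IsSlice.norm_eq [SFinite m] [SFinite μ] {v : X × Y → H} {V : Lp (Lp H 2 μ) 2 m}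
    (hv : IsSlice v V) {f : Lp H 2 (m.prod μ)} (hf : f =ᵐ[m.prod μ] v) : ‖V‖ = ‖f‖ := by
  rw [← sq_eq_sq₀ (norm_nonneg _) (norm_nonneg _), norm_sq_eq_re_inner (𝕜 := 𝕜),
    norm_sq_eq_re_inner (𝕜 := 𝕜), hv.inner_eq hv, L2.inner_def]
  congr 1
  refine integral_congr_ae ?_
  filter_upwards [hf] with z hz
  rw [hz]

variable [CompleteSpace H]

theorem isClosed_sliceable [SFinite m] [SFinite μ] :
    IsClosed (sliceable 𝕜 H m μ : Set (Lp H 2 (m.prod μ))) := by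
  refine IsSeqClosed.isClosed fun f f₀ hf hlim => ?_
  choose v V hv hfv using hf
  have hcauchy : CauchySeq V := by
    have h1 : ∀ k l, dist (V k) (V l) = dist (f k) (f l) := by
      intro k l
      rw [dist_eq_norm, dist_eq_norm]
      have h2 := (hv k).add ((hv l).smul (𝕜 := 𝕜) (-1))
      have h3 : V k - V l = V k + (-1 : 𝕜) • V l := by rw [neg_one_smul, sub_eq_add_neg]
      rw [h3]
      refine h2.norm_eq 𝕜 ?_
      filter_upwards [Lp.coeFn_sub (f k) (f l), hfv k, hfv l] with z h4 h5 h6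
      rw [h4, Pi.sub_apply, h5, h6, neg_one_smul, sub_eq_add_neg]
    have h2 := hlim.cauchySeq
    rw [Metric.cauchySeq_iff] at h2 ⊢
    simpa only [h1] using h2
  obtain ⟨V₀, hV₀⟩ := cauchySeq_tendsto_of_complete hcauchy
  obtain ⟨ns, hns, hns'⟩ := (tendstoInMeasure_of_tendsto_Lp hlim).exists_seq_tendsto_ae
  obtain ⟨ks, hks, hks'⟩ := (tendstoInMeasure_of_tendsto_Lp
    (hV₀.comp hns.tendsto_atTop)).exists_seq_tendsto_ae
  refine ⟨f₀, V₀, ⟨Lp.stronglyMeasurable f₀, ?_⟩, Eventually.of_forall fun _ => rfl⟩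
  have h1 : ∀ᵐ x ∂m, ∀ᵐ y ∂μ, Tendsto (fun i => v (ns i) (x, y)) atTop (𝓝 (f₀ (x, y))) := by
    refine Measure.ae_ae_of_ae_prod (p := fun z =>
      Tendsto (fun i => v (ns i) z) atTop (𝓝 (f₀ z))) ?_
    filter_upwards [hns', ae_all_iff.2 hfv] with z h2 h3
    simpa only [h3] using h2
  filter_upwards [h1, hks', ae_all_iff.2 fun n => (hv n).2] with x h2 h3 h4
  obtain ⟨ls, hls, hls'⟩ := (tendstoInMeasure_of_tendsto_Lp h3).exists_seq_tendsto_ae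
  filter_upwards [h2, hls', ae_all_iff.2 h4] with y h5 h6 h7
  refine tendsto_nhds_unique h6 ?_
  simp only [Function.comp_apply, h7]
  exact h5.comp (hks.tendsto_atTop.comp hls.tendsto_atTop)

/-- The indicators of rectangles are sliceable; the general case follows by the `π`-`λ` theorem on
sets of finite measure and density. -/
theorem mem_sliceable [IsFiniteMeasure m] [SigmaFinite μ] (f : Lp H 2 (m.prod μ)) :
    f ∈ sliceable 𝕜 H m μ := by
  have hcl := isClosed_sliceable (𝕜 := 𝕜) (H := H) (m := m) (μ := μ)
  have hrect : ∀ {A : Set X} {B : Set Y} (hA : MeasurableSet A) (hB : MeasurableSet B)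
      (hB' : μ B ≠ ∞) (hAB : (m.prod μ) (A ×ˢ B) ≠ ∞) (c : H),
      indicatorConstLp 2 (hA.prod hB) hAB c ∈ sliceable 𝕜 H m μ := fun hA hB hB' hAB c =>
    ⟨_, _, IsSlice.indicator hA (measure_ne_top m _) hB hB' c, indicatorConstLp_coeFn⟩
  -- an exhaustion by rectangles of finite measure
  set R : ℕ → Set (X × Y) := fun n => Set.univ ×ˢ spanningSets μ n with hR
  have hRm : ∀ n, MeasurableSet (R n) := fun n =>
    MeasurableSet.univ.prod (measurableSet_spanningSets μ n)
  have hRf : ∀ n, (m.prod μ) (R n) ≠ ∞ := fun n => by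
    rw [hR, Measure.prod_prod]
    exact ENNReal.mul_ne_top (measure_ne_top _ _) (measure_spanningSets_lt_top μ n).ne
  have hRi : ∀ n (s : Set (X × Y)), (m.prod μ) (s ∩ R n) ≠ ∞ := fun n s =>
    measure_ne_top_of_subset Set.inter_subset_right (hRf n)
  have hind : ∀ (n : ℕ) (c : H) (s : Set (X × Y)) (hs : MeasurableSet s),
      indicatorConstLp 2 (hs.inter (hRm n)) (hRi n s) c ∈ sliceable 𝕜 H m μ := by
    intro n c s hs
    induction s, hs using MeasurableSpace.induction_on_inter generateFrom_prod.symm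
      isPiSystem_prod with
    | empty =>
      convert (sliceable 𝕜 H m μ).zero_mem
      apply Lp.ext
      filter_upwards [indicatorConstLp_coeFn (p := 2)
        (hs := MeasurableSet.empty.inter (hRm n)) (hμs := hRi n ∅) (c := c),
        Lp.coeFn_zero H 2 (m.prod μ)] with z h1 h2
      rw [h1, h2]
      simp
    | basic t ht =>
      obtain ⟨A, hA, B, hB, rfl⟩ := ht
      have h1 : (A ×ˢ B) ∩ R n = A ×ˢ (B ∩ spanningSets μ n) := by
        rw [hR, Set.prod_inter_prod, Set.inter_univ]
      have h2 := hrect hA (hB.inter (measurableSet_spanningSets μ n))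
        (measure_ne_top_of_subset Set.inter_subset_right (measure_spanningSets_lt_top μ n).ne)
        (by rw [← h1]; exact hRi n _) c
      simpa only [h1] using h2
    | compl t ht ih =>
      have h1 : indicatorConstLp 2 (ht.compl.inter (hRm n)) (hRi n tᶜ) c
          = indicatorConstLp 2 (hRm n) (hRf n) c
            - indicatorConstLp 2 (ht.inter (hRm n)) (hRi n t) c := by
        apply Lp.ext
        filter_upwards [indicatorConstLp_coeFn (p := 2)
          (hs := ht.compl.inter (hRm n)) (hμs := hRi n tᶜ) (c := c),
          indicatorConstLp_coeFn (p := 2) (hs := hRm n) (hμs := hRf n) (c := c),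
          indicatorConstLp_coeFn (p := 2) (hs := ht.inter (hRm n)) (hμs := hRi n t) (c := c),
          Lp.coeFn_sub (indicatorConstLp 2 (hRm n) (hRf n) c)
            (indicatorConstLp 2 (ht.inter (hRm n)) (hRi n t) c)] with z h1 h2 h3 h4
        rw [h4, Pi.sub_apply, h1, h2, h3]
        by_cases hz : z ∈ t <;> by_cases hz' : z ∈ R n <;> simp [hz, hz']
      rw [h1]
      exact (sliceable 𝕜 H m μ).sub_mem (hrect MeasurableSet.univ
        (measurableSet_spanningSets μ n) (measure_spanningSets_lt_top μ n).ne (hRf n) c) ih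
    | iUnion t hd ht ih =>
      set u : ℕ → Set (X × Y) := fun N => ⋃ i ∈ Finset.range N, t i with hu
      have hum : ∀ N, MeasurableSet (u N) := fun N =>
        Finset.measurableSet_biUnion _ fun i _ => ht i
      have huS : ∀ N, indicatorConstLp 2 ((hum N).inter (hRm n)) (hRi n (u N)) c
          ∈ sliceable 𝕜 H m μ := by
        intro N
        have h1 : indicatorConstLp 2 ((hum N).inter (hRm n)) (hRi n (u N)) c
            = ∑ i ∈ Finset.range N, indicatorConstLp 2 ((ht i).inter (hRm n)) (hRi n (t i)) c := by
          apply Lp.ext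
          filter_upwards [indicatorConstLp_coeFn (p := 2)
            (hs := (hum N).inter (hRm n)) (hμs := hRi n (u N)) (c := c),
            ae_all_iff.2 fun i => indicatorConstLp_coeFn (p := 2)
              (hs := (ht i).inter (hRm n)) (hμs := hRi n (t i)) (c := c),
            Lp.coeFn_finsetSum (Finset.range N) fun i =>
              indicatorConstLp 2 ((ht i).inter (hRm n)) (hRi n (t i)) c] with z h1 h2 h3
          rw [h1, h3, Finset.sum_apply]
          simp only [h2]
          by_cases hz' : z ∈ R n
          · by_cases hz : z ∈ u N
            · obtain ⟨i, hi, hzi⟩ := Set.mem_iUnion₂.1 hz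
              have hzu : z ∈ u N ∩ R n := ⟨hz, hz'⟩
              rw [Set.indicator_of_mem hzu, Finset.sum_eq_single_of_mem i hi]
              · have hzm : z ∈ t i ∩ R n := ⟨hzi, hz'⟩
                rw [Set.indicator_of_mem hzm]
              · intro j _ hji
                have hzj : z ∉ t j ∩ R n := fun h => Set.disjoint_left.1 (hd hji) h.1 hzi
                exact Set.indicator_of_notMem hzj _
            · have hzi : ∀ i ∈ Finset.range N, z ∉ t i ∩ R n := fun i hi h =>
                hz (Set.mem_iUnion₂.2 ⟨i, hi, h.1⟩)
              have hzu : z ∉ u N ∩ R n := fun h => hz h.1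
              rw [Set.indicator_of_notMem hzu]
              exact (Finset.sum_eq_zero fun i hi => Set.indicator_of_notMem (hzi i hi) _).symm
          · have hzs : ∀ s : Set (X × Y), z ∉ s ∩ R n := fun s h => hz' h.2
            rw [Set.indicator_of_notMem (hzs _)]
            exact (Finset.sum_eq_zero fun i _ => Set.indicator_of_notMem (hzs _) _).symm
        rw [h1]
        exact Submodule.sum_mem _ fun i _ => ih i
      refine hcl.mem_of_tendsto (tendsto_indicatorConstLp_of_eventually
        (fun N => (hum N).inter (hRm n)) ((MeasurableSet.iUnion ht).inter (hRm n)) (hRm n) (hRf n)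
        (fun N => Set.inter_subset_right) Set.inter_subset_right (fun z => ?_) c)
        (Eventually.of_forall huS)
      by_cases hz : z ∈ ⋃ i, t i
      · obtain ⟨i, hi⟩ := Set.mem_iUnion.1 hz
        filter_upwards [eventually_gt_atTop i] with N hN
        have : z ∈ u N := Set.mem_iUnion₂.2 ⟨i, Finset.mem_range.2 hN, hi⟩
        simp only [Set.mem_inter_iff, hz, this]
      · refine Eventually.of_forall fun N => ?_
        have : z ∉ u N := fun h => hz (by
          obtain ⟨i, _, hi⟩ := Set.mem_iUnion₂.1 h
          exact Set.mem_iUnion.2 ⟨i, hi⟩)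
        simp only [Set.mem_inter_iff, hz, this]
  refine Lp_mem_of_indicatorConstLp hcl dense_univ (fun s hs hμs c _ => ?_) f
  refine hcl.mem_of_tendsto (tendsto_indicatorConstLp_of_eventually
    (fun n => hs.inter (hRm n)) hs hs hμs (fun n => Set.inter_subset_left) le_rfl
    (fun z => ?_) c) (Eventually.of_forall fun n => hind n c s hs)
  have h1 : z.2 ∈ ⋃ n, spanningSets μ n := by rw [iUnion_spanningSets]; trivial
  obtain ⟨n, hn⟩ := Set.mem_iUnion.1 h1
  filter_upwards [eventually_ge_atTop n] with k hk
  have : z ∈ R k := ⟨trivial, monotone_spanningSets μ hk hn⟩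
  simp only [Set.mem_inter_iff, this, and_true]

variable (𝕜) in
include 𝕜 in
/-- Every square integrable function on `X × Y` represents an element of `L²(X; L²(Y; H))`. -/
theorem exists_isSlice [IsFiniteMeasure m] [SigmaFinite μ] {v : X × Y → H}
    (hv : StronglyMeasurable v) (hv2 : MemLp v 2 (m.prod μ)) :
    ∃ V : Lp (Lp H 2 μ) 2 m, IsSlice v V := by
  obtain ⟨w, V, hw, hfw⟩ := mem_sliceable (𝕜 := 𝕜) (hv2.toLp v)
  refine ⟨V, hv, ?_⟩
  have h1 : ∀ᵐ x ∂m, ∀ᵐ y ∂μ, v (x, y) = w (x, y) := by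
    refine Measure.ae_ae_of_ae_prod (p := fun z => v z = w z) ?_
    filter_upwards [hfw, hv2.coeFn_toLp] with z h2 h3
    rw [← h3, h2]
  filter_upwards [h1, hw.2] with x h2 h3
  filter_upwards [h2, h3] with y h4 h5
  rw [h5, h4]

end Currying

/-! ### Admissible functions -/

section SectionSpace

variable {𝕜 : Type*} [RCLike 𝕜] {H : Type*} [NormedAddCommGroup H] [InnerProductSpace 𝕜 H]
  (h : Metric.sphere (0 : H) 1) {X : Type*} [MeasurableSpace X] {m : Measure X}

theorem integrable_mass_mul_exp :
    Integrable (fun r : PosReal => (r : ℝ) * Real.exp (-(r : ℝ) / 2)) posHaar := by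
  rw [integrable_posHaar_iff fun r : ℝ => r * Real.exp (-r / 2)]
  refine (exp_neg_integrableOn_Ioi 0 (by norm_num : (0 : ℝ) < 1 / 2)).congr_fun
    (fun r hr => ?_) measurableSet_Ioi
  have hr' : (0 : ℝ) < r := hr
  simp only [smul_eq_mul, inv_mul_cancel_left₀ hr'.ne']
  congr 1
  ring

theorem mass_mul_exp_le (r : PosReal) : (r : ℝ) * Real.exp (-(r : ℝ) / 2) ≤ 2 := by
  have h1 := Real.add_one_le_exp ((r : ℝ) / 2)
  have h2 : Real.exp ((r : ℝ) / 2) * Real.exp (-(r : ℝ) / 2) = 1 := by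
    rw [← Real.exp_add]
    simp [neg_div]
  have h3 := Real.exp_pos (-(r : ℝ) / 2)
  nlinarith

theorem exp_neg_half_le (r : PosReal) : Real.exp (-(r : ℝ) / 2) ≤ 2 * (1 + (r : ℝ))⁻¹ := by
  have hr := r.2
  have h1 := Real.add_one_le_exp ((r : ℝ) / 2)
  rw [neg_div, Real.exp_neg, ← div_eq_mul_inv, inv_le_comm₀ (Real.exp_pos _) (by positivity),
    inv_div, div_le_iff₀ two_pos]
  linarith

theorem continuous_expSection : Continuous (expSection (𝕜 := 𝕜) h) := by
  refine Continuous.smul (RCLike.continuous_ofReal.comp ?_) continuous_const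
  fun_prop

theorem stronglyMeasurable_expSection :
    StronglyMeasurable fun z : X × PosReal => expSection (𝕜 := 𝕜) h z.2 :=
  (continuous_expSection h).stronglyMeasurable.comp_measurable measurable_snd

variable (𝕜) in
include 𝕜 in
/-- A majorant that vanishes like `r` at `0` and decays exponentially at `∞`, such as `r e^{-r/2}`,
is both square integrable for `dr / r` and integrable for `dr / (r (1 + r))`. -/
theorem exists_isGood_of_norm_le [IsProbabilityMeasure m] [CompleteSpace H] {v : X × PosReal → H}
    (hv : StronglyMeasurable v) {C : ℝ}
    (hC : ∀ z, ‖v z‖ ≤ C * ((z.2 : ℝ) * Real.exp (-(z.2 : ℝ) / 2))) :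
    ∃ V : Lp (SpecialSpace H) 2 m, IsGood v V := by
  have h1 : Integrable (fun z : X × PosReal => (z.2 : ℝ) * Real.exp (-(z.2 : ℝ) / 2))
      (m.prod posHaar) := integrable_mass_mul_exp.comp_snd m
  have hpos : ∀ z : X × PosReal, 0 ≤ (z.2 : ℝ) * Real.exp (-(z.2 : ℝ) / 2) := fun z =>
    mul_nonneg z.2.2.le (Real.exp_pos _).le
  have h2 : MemLp v 2 (m.prod posHaar) := by
    rw [memLp_two_iff_integrable_sq_norm hv.aestronglyMeasurable]
    refine Integrable.mono' (h1.const_mul (C ^ 2 * 2)) (hv.norm.measurable.pow_const 2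
      |>.aestronglyMeasurable) (Eventually.of_forall fun z => ?_)
    rw [Real.norm_of_nonneg (by positivity)]
    calc ‖v z‖ ^ 2 ≤ (C * ((z.2 : ℝ) * Real.exp (-(z.2 : ℝ) / 2))) ^ 2 :=
          pow_le_pow_left₀ (norm_nonneg _) (hC z) 2
      _ = C ^ 2 * ((z.2 : ℝ) * Real.exp (-(z.2 : ℝ) / 2))
          * ((z.2 : ℝ) * Real.exp (-(z.2 : ℝ) / 2)) := by ring
      _ ≤ C ^ 2 * 2 * ((z.2 : ℝ) * Real.exp (-(z.2 : ℝ) / 2)) :=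
          mul_le_mul_of_nonneg_right (mul_le_mul_of_nonneg_left (mass_mul_exp_le z.2)
            (sq_nonneg C)) (hpos z)
  obtain ⟨V, hV⟩ := exists_isSlice 𝕜 hv h2
  refine ⟨V, hV, (integrable_norm_iff hv.aestronglyMeasurable).1
    (integrable_poissonIntensity_iff.2 ?_)⟩
  have hn := hv.norm.measurable
  refine Integrable.mono' (h1.const_mul C) (Measurable.aestronglyMeasurable (by fun_prop))
    (Eventually.of_forall fun z => ?_)
  have hz := z.2.2
  rw [norm_smul, norm_norm, Real.norm_of_nonneg (by positivity)]
  refine le_trans ?_ (hC z)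
  exact mul_le_of_le_one_left (norm_nonneg _) (inv_le_one_of_one_le₀ (by linarith))

variable (𝕜) in
/-- `u = f₀ + v`, where `v` represents the element `V` of `L²(X; L²(ℝ₊*; H))` and is integrable
with respect to the intensity of the Poisson process. -/
def IsAdmissible (u : X × PosReal → H) (V : Lp (SpecialSpace H) 2 m) : Prop :=
  IsGood (fun z => u z - expSection (𝕜 := 𝕜) h z.2) V

variable {h} {u u' : X × PosReal → H} {V V' : Lp (SpecialSpace H) 2 m}

theorem IsAdmissible.stronglyMeasurable (hu : IsAdmissible 𝕜 h u V) : StronglyMeasurable u := by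
  have h1 := hu.toIsSlice.stronglyMeasurable.add (stronglyMeasurable_expSection (𝕜 := 𝕜) h)
  have h2 : ((fun z => u z - expSection (𝕜 := 𝕜) h z.2) + fun z => expSection (𝕜 := 𝕜) h z.2)
      = u := funext fun z => sub_add_cancel _ _
  rwa [h2] at h1

variable (𝕜) in
theorem norm_expSection_sub_le (r : PosReal) :
    ‖expSection (𝕜 := 𝕜) h r - h‖ ≤ 2 * ((r : ℝ) / (1 + r)) := by
  have hr := r.2
  have h1 : expSection (𝕜 := 𝕜) h r - h
      = ((Real.exp (-(r : ℝ) / 2) - 1 : ℝ) : 𝕜) • (h : H) := by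
    rw [expSection, RCLike.ofReal_sub, RCLike.ofReal_one, sub_smul, one_smul]
  have h2 : Real.exp (-(r : ℝ) / 2) ≤ 1 := Real.exp_le_one_iff.2 (by linarith)
  have h3 := Real.add_one_le_exp (-(r : ℝ) / 2)
  have h4 := Real.exp_pos (-(r : ℝ) / 2)
  rw [h1, norm_smul, norm_eq_of_mem_sphere, mul_one, RCLike.norm_ofReal,
    abs_of_nonpos (by linarith), ← mul_div_assoc, le_div_iff₀ (by positivity)]
  nlinarith

theorem IsAdmissible.integrable_sub [IsProbabilityMeasure m] (hu : IsAdmissible 𝕜 h u V) :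
    Integrable (fun z => u z - h) (poissonIntensity m) := by
  have h1 : Integrable (fun r : PosReal => (r : ℝ) / (1 + r)) massIntensity := by
    refine ⟨Measurable.aestronglyMeasurable (by fun_prop), ?_⟩
    rw [hasFiniteIntegral_iff_ofReal (Eventually.of_forall fun r => by
      have := r.2
      positivity), lintegral_mass_ratio]
    exact ENNReal.one_lt_top
  have h2 : Integrable (fun z : X × PosReal => expSection (𝕜 := 𝕜) h z.2 - h)
      (poissonIntensity m) := by
    refine Integrable.mono' ((h1.comp_snd m).const_mul 2)
      ((stronglyMeasurable_expSection h).sub stronglyMeasurable_const).aestronglyMeasurable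
      (Eventually.of_forall fun z => norm_expSection_sub_le 𝕜 z.2)
  refine (hu.integrable.add h2).congr (Eventually.of_forall fun z => ?_)
  simp

/-- For almost all `ξ` the tensor `⊗ₖ u(xₖ, rₖ)` exists. -/
theorem IsAdmissible.ae_summable [IsProbabilityMeasure m] (hu : IsAdmissible 𝕜 h u V) :
    ∀ᵐ z ∂poissonLaw m, Summable fun k => ‖u (z k) - h‖ := by
  have h1 := poissonLaw_ae_summable (𝕜 := ℝ) hu.integrable_sub.norm
    (hu.stronglyMeasurable.sub stronglyMeasurable_const).norm.measurable
  simpa only [norm_norm] using h1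

/-- The pairing of `f₀` with a function on `X × ℝ₊*` (which may be finite although `f₀` is not
square integrable). -/
def vacuumPairing (𝕜 : Type*) [RCLike 𝕜] {H : Type*} [NormedAddCommGroup H] [InnerProductSpace 𝕜 H]
    (h : Metric.sphere (0 : H) 1) {X : Type*} [MeasurableSpace X] (m : Measure X)
    (v : X × PosReal → H) : 𝕜 :=
  ∫ z, inner 𝕜 (expSection (𝕜 := 𝕜) h z.2) (v z) ∂(m.prod posHaar)

theorem IsGood.integrable_inner_expSection [IsProbabilityMeasure m] {v : X × PosReal → H}
    (hv : IsGood v V) :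
    Integrable (fun z => inner 𝕜 (expSection (𝕜 := 𝕜) h z.2) (v z)) (m.prod posHaar) := by
  have h1 := (integrable_poissonIntensity_iff.1 hv.integrable.norm).const_mul 2
  refine h1.mono' ((stronglyMeasurable_expSection h).inner
    hv.stronglyMeasurable).aestronglyMeasurable (Eventually.of_forall fun z => ?_)
  have hz := z.2.2
  refine (norm_inner_le_norm _ _).trans ?_
  rw [smul_eq_mul, ← mul_assoc, norm_expSection]
  exact mul_le_mul_of_nonneg_right (exp_neg_half_le z.2) (norm_nonneg _)

theorem inner_expSection_self (r : PosReal) :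
    inner 𝕜 (expSection (𝕜 := 𝕜) h r) (expSection (𝕜 := 𝕜) h r)
      = ((Real.exp (-(r : ℝ)) : ℝ) : 𝕜) := by
  rw [inner_self_eq_norm_sq_to_K, norm_expSection, ← RCLike.ofReal_pow, ← Real.exp_nat_mul]
  congr 2
  push_cast
  ring

/-- The exponent of the Gram matrix of the coherent sections. -/
theorem IsAdmissible.integral_inner_sub [IsProbabilityMeasure m] (hu : IsAdmissible 𝕜 h u V)
    (hu' : IsAdmissible 𝕜 h u' V') :
    Integrable (fun z => inner 𝕜 (u z) (u' z) - ((Real.exp (-(z.2 : ℝ)) : ℝ) : 𝕜))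
      (m.prod posHaar) ∧
    ∫ z, (inner 𝕜 (u z) (u' z) - ((Real.exp (-(z.2 : ℝ)) : ℝ) : 𝕜)) ∂(m.prod posHaar)
      = inner 𝕜 V V' + vacuumPairing 𝕜 h m (fun z => u' z - expSection (𝕜 := 𝕜) h z.2)
        + (starRingEnd 𝕜)
          (vacuumPairing 𝕜 h m (fun z => u z - expSection (𝕜 := 𝕜) h z.2)) := by
  have h1 : ∀ z, inner 𝕜 (u z) (u' z) - ((Real.exp (-(z.2 : ℝ)) : ℝ) : 𝕜)
      = inner 𝕜 (u z - expSection (𝕜 := 𝕜) h z.2) (u' z - expSection (𝕜 := 𝕜) h z.2)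
        + inner 𝕜 (expSection (𝕜 := 𝕜) h z.2) (u' z - expSection (𝕜 := 𝕜) h z.2)
        + (starRingEnd 𝕜)
          (inner 𝕜 (expSection (𝕜 := 𝕜) h z.2) (u z - expSection (𝕜 := 𝕜) h z.2)) := fun z => by
    rw [inner_conj_symm, ← inner_expSection_self (h := h)]
    simp only [inner_sub_left, inner_sub_right]
    ring
  have h2 := hu.toIsSlice.integrable_inner (𝕜 := 𝕜) hu'.toIsSlice
  have h3 := IsGood.integrable_inner_expSection (𝕜 := 𝕜) (h := h) hu
  have h4 := IsGood.integrable_inner_expSection (𝕜 := 𝕜) (h := h) hu'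
  have h5 : Integrable (fun z => (starRingEnd 𝕜)
      (inner 𝕜 (expSection (𝕜 := 𝕜) h z.2) (u z - expSection (𝕜 := 𝕜) h z.2)))
      (m.prod posHaar) := (RCLike.conjLIE (K := 𝕜)).integrable_comp_iff.2 h3
  simp only [h1]
  refine ⟨(h2.add h4).add h5, ?_⟩
  have e1 := integral_add (h2.add h4) h5
  have e2 := integral_add h2 h4
  simp only [Pi.add_apply] at e1 e2
  rw [e1, e2, integral_conj, hu.toIsSlice.inner_eq hu'.toIsSlice, vacuumPairing, vacuumPairing]

end SectionSpace

/-! ### Coherent sections and their Gram matrix -/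

section Coherent

variable {X : Type*} [MeasurableSpace X]

open scoped Classical in
/-- The `k`-th atom of a measure of the cone, together with its mass. -/
def AtomicCone.atom (ξ : AtomicCone X) (k : ℕ) : X × PosReal :=
  (ξ.points k, if hk : 0 < ξ.mass (ξ.points k) then ⟨ξ.mass (ξ.points k), hk⟩ else 1)

theorem AtomicCone.atom_toCone [MeasurableSingletonClass X] (z : massSeq X) (k : ℕ) :
    (toCone z).atom k = z.1 k := by
  have h1 : (toCone z).mass ((toCone z).points k) = (z.1 k).2 := by
    rw [points_toCone, mass_toCone]
  refine Prod.ext (points_toCone z k) (Subtype.ext ?_)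
  simp only [AtomicCone.atom, h1, (z.1 k).2.2, dite_true]

/-- Finitely many strongly measurable functions form a strongly measurable function with values in
the product. -/
theorem stronglyMeasurable_pi_of_finset {Ω ι E : Type*} [MeasurableSpace Ω] [TopologicalSpace E]
    [DecidableEq ι] {f : Ω → ι → E} (s : Finset ι) (c : ι → E)
    (hf : ∀ i ∈ s, StronglyMeasurable fun ω => f ω i) :
    StronglyMeasurable fun ω i => if i ∈ s then f ω i else c i := by
  induction s using Finset.induction_on with
  | empty => simpa using stronglyMeasurable_const
  | insert j s hj ih =>
    have h1 := ih fun i hi => hf i (Finset.mem_insert_of_mem hi)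
    have h2 := hf j (Finset.mem_insert_self _ _)
    have h3 : Continuous fun q : (ι → E) × E => Function.update q.1 j q.2 :=
      continuous_fst.update j continuous_snd
    refine (congrArg StronglyMeasurable (funext fun ω => funext fun i => ?_)).mp
      (h3.comp_stronglyMeasurable (h1.prodMk h2))
    by_cases hi : i = j
    · subst hi
      simp
    · simp [hi]

variable (𝕜 : Type*) [RCLike 𝕜] {H : Type*} [NormedAddCommGroup H] [InnerProductSpace 𝕜 H]
  (h : Metric.sphere (0 : H) 1)

theorem stronglyMeasurable_tensOn {Ω ι : Type*} [MeasurableSpace Ω] {f : Ω → ι → H}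
    (s : Finset ι) (hf : ∀ i ∈ s, StronglyMeasurable fun ω => f ω i) :
    StronglyMeasurable fun ω => StabTensor.tensOn 𝕜 h s (f ω) := by
  classical
  have h1 := (StabTensor.continuous_tensOn 𝕜 h s).comp_stronglyMeasurable
    (stronglyMeasurable_pi_of_finset s (fun _ => (h : H)) hf)
  refine (congrArg StronglyMeasurable (funext fun ω => ?_)).mp h1
  exact StabTensor.tensOn_congr 𝕜 h fun i hi => if_pos hi

/-- The section `ξ ↦ ⊗ₖ u(xₖ, rₖ)`, `ξ = {rₖ, xₖ}`. -/
def coherent (u : X × PosReal → H) (ξ : AtomicCone X) : StabTensor 𝕜 ℕ h :=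
  StabTensor.tensInf 𝕜 h fun k => u (ξ.atom k)

theorem coherent_toCone [MeasurableSingletonClass X] (u : X × PosReal → H) (z : massSeq X) :
    coherent 𝕜 h u (toCone z) = StabTensor.tensInf 𝕜 h fun k => u (z.1 k) := by
  simp only [coherent, AtomicCone.atom_toCone]

variable [StandardBorelSpace X] {m : Measure X} [IsProbabilityMeasure m] [NullSingletonClass m]
  {𝕜 h} {u u' : X × PosReal → H} {V V' : Lp (SpecialSpace H) 2 m}

theorem IsAdmissible.aestronglyMeasurable_coherent (hu : IsAdmissible 𝕜 h u V) :
    AEStronglyMeasurable (coherent 𝕜 h u) (coneMeasure m) := by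
  refine aestronglyMeasurable_coneMeasure
    (G' := fun z => StabTensor.tensInf 𝕜 h fun k => u (z k)) (coherent_toCone 𝕜 h u) ?_
  refine aestronglyMeasurable_of_tendsto_ae atTop
    (f := fun n (z : ℕ → X × PosReal) =>
      StabTensor.tensOn 𝕜 h (Finset.range n) fun k => u (z k)) (fun n => ?_) ?_
  · exact (stronglyMeasurable_tensOn 𝕜 h _ fun k _ =>
      hu.stronglyMeasurable.comp_measurable (measurable_pi_apply k)).aestronglyMeasurable
  · filter_upwards [hu.ae_summable] with z hz
    exact (StabTensor.tendsto_tensOn 𝕜 h hz).comp tendsto_finset_range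

theorem IsAdmissible.integral_inner_coherent (hu : IsAdmissible 𝕜 h u V)
    (hu' : IsAdmissible 𝕜 h u' V') :
    Integrable (fun ξ => inner 𝕜 (coherent 𝕜 h u ξ) (coherent 𝕜 h u' ξ)) (coneMeasure m) ∧
    ∫ ξ, inner 𝕜 (coherent 𝕜 h u ξ) (coherent 𝕜 h u' ξ) ∂coneMeasure m
      = NormedSpace.exp (inner 𝕜 V V'
        + vacuumPairing 𝕜 h m (fun z => u' z - expSection (𝕜 := 𝕜) h z.2)
        + (starRingEnd 𝕜)
          (vacuumPairing 𝕜 h m (fun z => u z - expSection (𝕜 := 𝕜) h z.2))) := by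
  obtain ⟨h1, h2⟩ := hu.integral_inner_sub hu'
  obtain ⟨h3, h4⟩ := coneMeasure_integral_tprod
    (hu.stronglyMeasurable.inner hu'.stronglyMeasurable).measurable h1
    (G := fun ξ => ∏' k, inner 𝕜 (u (ξ.atom k)) (u' (ξ.atom k)))
    fun z _ => by simp only [AtomicCone.atom_toCone]
  have h5 : ∀ᵐ ξ ∂coneMeasure m, ∏' k, inner 𝕜 (u (ξ.atom k)) (u' (ξ.atom k))
      = inner 𝕜 (coherent 𝕜 h u ξ) (coherent 𝕜 h u' ξ) := by
    rw [ae_coneMeasure_iff]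
    filter_upwards [hu.ae_summable, hu'.ae_summable] with z h6 h7 hz
    rw [coherent_toCone, coherent_toCone, StabTensor.inner_tensInf 𝕜 h h6 h7]
    simp only [AtomicCone.atom_toCone]
  exact ⟨h3.congr h5, by rw [← integral_congr_ae h5, h4, h2]⟩

theorem IsAdmissible.memLp_coherent (hu : IsAdmissible 𝕜 h u V) :
    MemLp (coherent 𝕜 h u) 2 (coneMeasure m) := by
  rw [memLp_two_iff_integrable_sq_norm hu.aestronglyMeasurable_coherent]
  refine (hu.integral_inner_coherent hu).1.re.congr (Eventually.of_forall fun ξ => ?_)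
  exact (norm_sq_eq_re_inner (𝕜 := 𝕜) _).symm

/-- The element of the space of the integral model represented by `coherent 𝕜 h u`. -/
def IsAdmissible.coherentLp (hu : IsAdmissible 𝕜 h u V) : IntSpace 𝕜 h (coneMeasure m) :=
  hu.memLp_coherent.toLp _

theorem IsAdmissible.coeFn_coherentLp (hu : IsAdmissible 𝕜 h u V) :
    hu.coherentLp =ᵐ[coneMeasure m] coherent 𝕜 h u := hu.memLp_coherent.coeFn_toLp

/-- The Gram matrix of the coherent sections. -/
theorem IsAdmissible.inner_coherentLp (hu : IsAdmissible 𝕜 h u V)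
    (hu' : IsAdmissible 𝕜 h u' V') :
    inner 𝕜 hu.coherentLp hu'.coherentLp = NormedSpace.exp (inner 𝕜 V V'
      + vacuumPairing 𝕜 h m (fun z => u' z - expSection (𝕜 := 𝕜) h z.2)
      + (starRingEnd 𝕜)
        (vacuumPairing 𝕜 h m (fun z => u z - expSection (𝕜 := 𝕜) h z.2))) := by
  rw [← (hu.integral_inner_coherent hu').2, L2.inner_def]
  refine integral_congr_ae ?_
  filter_upwards [hu.coeFn_coherentLp, hu'.coeFn_coherentLp] with ξ h1 h2
  rw [h1, h2]

end Coherent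

/-! ### Functions on the cone are determined by their Laplace transforms -/

section LaplaceInjective

variable {𝕜 : Type*} [RCLike 𝕜] {X : Type*} [MeasurableSpace X]
  [MeasurableSpace.CountablyGenerated X] {𝓛 : Measure (AtomicCone X)}

theorem expNeg_le_one (a : ℝ≥0∞) : expNeg a ≤ 1 := by
  by_cases ha : a = ∞
  · subst ha
    simp [expNeg]
  · rw [expNeg_of_ne_top ha, ENNReal.ofReal_le_one, Real.exp_le_one_iff, neg_nonpos]
    exact ENNReal.toReal_nonneg

theorem measurable_expNeg_lintegral {f : X → ℝ} (hf : Measurable f) :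
    Measurable fun ξ : AtomicCone X => expNeg (∫⁻ x, ENNReal.ofReal (f x) ∂ξ.1) :=
  measurable_expNeg.comp (AtomicCone.measurable_lintegral hf.ennreal_ofReal)

theorem expNeg_toReal_le_one (a : ℝ≥0∞) : (expNeg a).toReal ≤ 1 :=
  ENNReal.toReal_le_of_le_ofReal zero_le_one (by simpa using expNeg_le_one a)

theorem integrable_expNeg_mul {E : Type*} [NormedAddCommGroup E] [NormedSpace ℝ E]
    {k : AtomicCone X → E} (hk : Integrable k 𝓛) {f : X → ℝ} (hf : Measurable f) :
    Integrable (fun ξ => (expNeg (∫⁻ x, ENNReal.ofReal (f x) ∂ξ.1)).toReal • k ξ) 𝓛 := by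
  refine hk.norm.mono' ((measurable_expNeg_lintegral hf).ennreal_toReal.aestronglyMeasurable.smul
    hk.1) (Eventually.of_forall fun ξ => ?_)
  rw [norm_smul, Real.norm_of_nonneg ENNReal.toReal_nonneg]
  exact mul_le_of_le_one_left (norm_nonneg _) (expNeg_toReal_le_one _)

/-- An integrable real function on the cone is determined by its Laplace transform. -/
theorem ae_eq_zero_of_laplace_real {k : AtomicCone X → ℝ} (hk : Integrable k 𝓛)
    (h0 : ∀ f : X → ℝ, Measurable f → (∀ x, 1 ≤ f x) → (∃ C, ∀ x, f x ≤ C) →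
      ∫ ξ, (expNeg (∫⁻ x, ENNReal.ofReal (f x) ∂ξ.1)).toReal * k ξ ∂𝓛 = 0) : k =ᵐ[𝓛] 0 := by
  have hm := hk.1.aemeasurable.ennreal_ofReal
  have hm' : AEMeasurable (fun ξ => ENNReal.ofReal (-k ξ)) 𝓛 :=
    hk.neg.1.aemeasurable.ennreal_ofReal
  have hfin : ∀ {k : AtomicCone X → ℝ}, Integrable k 𝓛 → ∫⁻ ξ, ENNReal.ofReal (k ξ) ∂𝓛 ≠ ∞ :=
    fun hk => (lintegral_ofReal_le_lintegral_enorm _).trans_lt hk.2 |>.ne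
  have key : ∀ {f : X → ℝ} (k : AtomicCone X → ℝ), Measurable f → Integrable k 𝓛 →
      ∫⁻ ξ, expNeg (∫⁻ x, ENNReal.ofReal (f x) ∂ξ.1)
        ∂𝓛.withDensity (fun ξ => ENNReal.ofReal (k ξ))
      = ∫⁻ ξ, ENNReal.ofReal ((expNeg (∫⁻ x, ENNReal.ofReal (f x) ∂ξ.1)).toReal * k ξ) ∂𝓛 := by
    intro f k hf hk
    rw [lintegral_withDensity_eq_lintegral_mul₀ hk.1.aemeasurable.ennreal_ofReal
      (measurable_expNeg_lintegral hf).aemeasurable]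
    refine lintegral_congr fun ξ => ?_
    rw [ENNReal.ofReal_mul ENNReal.toReal_nonneg, ENNReal.ofReal_toReal
      ((expNeg_le_one _).trans_lt ENNReal.one_lt_top).ne, Pi.mul_apply, mul_comm]
  have h1 : 𝓛.withDensity (fun ξ => ENNReal.ofReal (k ξ))
      = 𝓛.withDensity (fun ξ => ENNReal.ofReal (-k ξ)) := by
    refine AtomicCone.ext_of_laplace_bounded (fun f hf h1 hC => ?_) ?_
    · rw [key k hf hk, key (fun ξ => -k ξ) hf hk.neg]
      have h2 := h0 f hf h1 hC
      have h3 := integrable_expNeg_mul hk hf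
      simp only [smul_eq_mul] at h3
      have h4 := hfin h3.neg
      simp only [Pi.neg_apply] at h4
      rw [integral_eq_lintegral_pos_part_sub_lintegral_neg_part h3, sub_eq_zero,
        ENNReal.toReal_eq_toReal_iff' (hfin h3) h4] at h2
      simp only [mul_neg]
      exact h2
    · refine ((lintegral_mono fun ξ => expNeg_le_one _).trans_lt ?_).ne
      rw [lintegral_one, withDensity_apply _ MeasurableSet.univ, Measure.restrict_univ]
      exact (hfin hk).lt_top
  rw [withDensity_eq_iff hm hm' (hfin hk)] at h1
  filter_upwards [h1] with ξ h2
  rcases le_total (k ξ) 0 with h3 | h3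
  · rw [ENNReal.ofReal_of_nonpos h3, eq_comm, ENNReal.ofReal_eq_zero] at h2
    exact le_antisymm h3 (neg_nonpos.1 h2)
  · rw [ENNReal.ofReal_of_nonpos (neg_nonpos.2 h3), ENNReal.ofReal_eq_zero] at h2
    exact le_antisymm h2 h3

theorem ae_eq_zero_of_laplace {k : AtomicCone X → 𝕜} (hk : Integrable k 𝓛)
    (h0 : ∀ f : X → ℝ, Measurable f → (∀ x, 1 ≤ f x) → (∃ C, ∀ x, f x ≤ C) →
      ∫ ξ, (expNeg (∫⁻ x, ENNReal.ofReal (f x) ∂ξ.1)).toReal • k ξ ∂𝓛 = 0) : k =ᵐ[𝓛] 0 := by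
  have h1 : ∀ L : 𝕜 →L[ℝ] ℝ, (fun ξ => L (k ξ)) =ᵐ[𝓛] 0 := fun L => by
    refine ae_eq_zero_of_laplace_real (L.integrable_comp hk) fun f hf h1 hC => ?_
    have h2 := L.integral_comp_comm (integrable_expNeg_mul hk hf)
    rw [h0 f hf h1 hC, map_zero] at h2
    simpa only [map_smul, smul_eq_mul] using h2
  filter_upwards [h1 RCLike.reCLM, h1 RCLike.imCLM] with ξ h2 h3
  exact RCLike.ext (by simpa using h2) (by simpa using h3)

end LaplaceInjective

/-! ### Totality of the coherent sections -/

section CoherentTotal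

variable {𝕜 : Type*} [RCLike 𝕜] {H : Type*} [NormedAddCommGroup H] [InnerProductSpace 𝕜 H]
  [CompleteSpace H] {h : Metric.sphere (0 : H) 1} {X : Type*} [MeasurableSpace X]
  {m : Measure X} [IsProbabilityMeasure m] {u : X × PosReal → H} {V : Lp (SpecialSpace H) 2 m}

/-- Admissible functions may be multiplied by `e^{-a(x) r}`; the coherent section is then multiplied
by `exp (-∫ a dξ)`. -/
theorem IsAdmissible.exp_smul (hu : IsAdmissible 𝕜 h u V) {a : X → ℝ} (ha : Measurable a)
    (ha0 : ∀ x, 0 ≤ a x) {C : ℝ} (haC : ∀ x, a x ≤ C) :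
    ∃ V' : Lp (SpecialSpace H) 2 m,
      IsAdmissible 𝕜 h (fun z => ((Real.exp (-(a z.1 * z.2)) : ℝ) : 𝕜) • u z) V' := by
  set e : X × PosReal → ℝ := fun z => Real.exp (-(a z.1 * z.2)) with he
  have hem : Measurable e := by fun_prop
  have hpos : ∀ z : X × PosReal, 0 ≤ a z.1 * z.2 := fun z => mul_nonneg (ha0 _) z.2.2.le
  have he1 : ∀ z, e z ≤ 1 := fun z => Real.exp_le_one_iff.2 (neg_nonpos.2 (hpos z))
  have he0 : ∀ z, 0 < e z := fun z => Real.exp_pos _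
  have hsm : StronglyMeasurable fun z => ((e z : ℝ) : 𝕜) :=
    RCLike.continuous_ofReal.comp_stronglyMeasurable hem.stronglyMeasurable
  have hv := hu.toIsSlice.stronglyMeasurable
  have hle : ∀ z, ‖((e z : ℝ) : 𝕜) • (u z - expSection (𝕜 := 𝕜) h z.2)‖
      ≤ ‖u z - expSection (𝕜 := 𝕜) h z.2‖ := fun z => by
    rw [norm_smul, RCLike.norm_ofReal, abs_of_pos (he0 z)]
    exact mul_le_of_le_one_left (norm_nonneg _) (he1 z)
  obtain ⟨V₁, hV₁⟩ := exists_isSlice 𝕜 (m := m) (μ := posHaar) (hsm.smul hv)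
    (hu.toIsSlice.memLp.of_le (hsm.smul hv).aestronglyMeasurable (Eventually.of_forall hle))
  have hV₁i : Integrable (fun z => ((e z : ℝ) : 𝕜) • (u z - expSection (𝕜 := 𝕜) h z.2))
      (poissonIntensity m) :=
    hu.integrable.norm.mono' (hsm.smul hv).aestronglyMeasurable (Eventually.of_forall hle)
  obtain ⟨V₂, hV₂⟩ := exists_isGood_of_norm_le 𝕜 (m := m)
    (v := fun z => ((e z - 1 : ℝ) : 𝕜) • expSection (𝕜 := 𝕜) h z.2) (C := C)
    ((RCLike.continuous_ofReal.comp_stronglyMeasurable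
      (hem.sub_const 1).stronglyMeasurable).smul (stronglyMeasurable_expSection h)) fun z => by
    have hz := z.2.2
    have h1 := Real.add_one_le_exp (-(a z.1 * z.2))
    rw [norm_smul, norm_expSection, RCLike.norm_ofReal,
      abs_of_nonpos (sub_nonpos.2 (he1 z)), ← mul_assoc]
    refine mul_le_mul_of_nonneg_right ?_ (Real.exp_pos _).le
    have h2 := mul_le_mul_of_nonneg_right (haC z.1) hz.le
    simp only [he]
    linarith
  refine ⟨V₁ + V₂, ?_⟩
  have h3 : IsGood (fun z => ((e z : ℝ) : 𝕜) • (u z - expSection (𝕜 := 𝕜) h z.2)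
      + ((e z - 1 : ℝ) : 𝕜) • expSection (𝕜 := 𝕜) h z.2) (V₁ + V₂) :=
    ⟨hV₁.add hV₂.toIsSlice, hV₁i.add hV₂.integrable⟩
  rw [IsAdmissible]
  convert h3 using 2 with z
  rw [smul_sub, RCLike.ofReal_sub, sub_smul, RCLike.ofReal_one, one_smul]
  abel

variable [StandardBorelSpace X] [NullSingletonClass m]

omit [InnerProductSpace 𝕜 H] [CompleteSpace H] [IsProbabilityMeasure m] [NullSingletonClass m] in
theorem hasProd_exp_neg_atom {a : X → ℝ} (ha : Measurable a) (ha0 : ∀ x, 0 ≤ a x) {C : ℝ}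
    (haC : ∀ x, a x ≤ C) (z : massSeq X) :
    HasProd (fun k => ((Real.exp (-(a (z.1 k).1 * (z.1 k).2)) : ℝ) : 𝕜))
      (((expNeg (∫⁻ x, ENNReal.ofReal (a x) ∂(toCone z).1)).toReal : ℝ) : 𝕜) := by
  have hnn : ∀ k, 0 ≤ a (z.1 k).1 * ((z.1 k).2 : ℝ) := fun k =>
    mul_nonneg (ha0 _) (z.1 k).2.2.le
  have hsum : Summable fun k => a (z.1 k).1 * ((z.1 k).2 : ℝ) :=
    Summable.of_nonneg_of_le hnn
      (fun k => mul_le_mul_of_nonneg_right (haC _) (z.1 k).2.2.le) (z.2.2.2.mul_left C)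
  have hlin : ∫⁻ x, ENNReal.ofReal (a x) ∂(toCone z).1
      = ENNReal.ofReal (∑' k, a (z.1 k).1 * ((z.1 k).2 : ℝ)) := by
    rw [lintegral_toCone z ha.ennreal_ofReal, ENNReal.ofReal_tsum_of_nonneg hnn hsum]
    refine tsum_congr fun k => ?_
    rw [mul_comm (a _), ENNReal.ofReal_mul (z.1 k).2.2.le]
  rw [hlin, expNeg_of_ne_top (by simp), ENNReal.toReal_ofReal (Real.exp_pos _).le,
    ENNReal.toReal_ofReal (tsum_nonneg hnn), ← tsum_neg]
  exact hsum.neg.hasSum.rexp.map (algebraMap ℝ 𝕜) RCLike.continuous_ofReal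

/-- If `F` is orthogonal to all coherent sections, then it is so fibrewise: the products of the
coherent section of `u` with the functions `ξ ↦ exp (-∫ a dξ)` are coherent too, so all Laplace
transforms of the inner product in the fibres vanish. -/
theorem IsAdmissible.inner_coherent_ae_eq_zero {F : IntSpace 𝕜 h (coneMeasure m)}
    (hF : ∀ (u : X × PosReal → H) (V : Lp (SpecialSpace H) 2 m) (hu : IsAdmissible 𝕜 h u V),
      inner 𝕜 hu.coherentLp F = 0) (hu : IsAdmissible 𝕜 h u V) :
    ∀ᵐ ξ ∂coneMeasure m, inner 𝕜 (coherent 𝕜 h u ξ) (F ξ) = 0 := by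
  have hk : Integrable (fun ξ => inner 𝕜 (coherent 𝕜 h u ξ) (F ξ)) (coneMeasure m) := by
    refine (L2.integrable_inner (𝕜 := 𝕜) hu.coherentLp F).congr ?_
    filter_upwards [hu.coeFn_coherentLp] with ξ h1
    rw [h1]
  refine ae_eq_zero_of_laplace hk fun f hf h1 ⟨C, hC⟩ => ?_
  have h0 : ∀ x, 0 ≤ f x := fun x => zero_le_one.trans (h1 x)
  obtain ⟨V', hV'⟩ := hu.exp_smul hf h0 hC
  rw [← hF _ _ hV', L2.inner_def]
  refine integral_congr_ae ?_
  have h2 : ∀ᵐ ξ ∂coneMeasure m,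
      coherent 𝕜 h (fun z => ((Real.exp (-(f z.1 * z.2)) : ℝ) : 𝕜) • u z) ξ
        = (((expNeg (∫⁻ x, ENNReal.ofReal (f x) ∂ξ.1)).toReal : ℝ) : 𝕜) • coherent 𝕜 h u ξ := by
    rw [ae_coneMeasure_iff]
    filter_upwards [hu.ae_summable] with z h3 hz
    rw [coherent_toCone, coherent_toCone]
    exact StabTensor.tensInf_smul 𝕜 h (hasProd_exp_neg_atom hf h0 hC ⟨z, hz⟩) h3
  filter_upwards [h2, hV'.coeFn_coherentLp] with ξ h4 h5
  rw [h5, h4, inner_smul_left, RCLike.conj_ofReal, RCLike.real_smul_eq_coe_mul]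

omit [CompleteSpace H] [MeasurableSpace X] [StandardBorelSpace X] in
/-- The bands that separate the first `n` of the decreasing masses from each other and from the
remaining ones. -/
theorem exists_bands {r : ℕ → ℝ} (hr : StrictAnti r) (h0 : ∀ k, 0 < r k) (n : ℕ) :
    ∃ q : Fin n → ℚ × ℚ, (∀ i, 0 < (q i).1) ∧
      ∀ (i : Fin n) (k : ℕ), ((q i).1 : ℝ) < r k ∧ r k < (q i).2 ↔ k = i := by
  have h1 : ∀ i : ℕ, ∃ q : ℚ × ℚ, 0 < q.1 ∧ ∀ k, ((q.1 : ℝ) < r k ∧ r k < q.2) ↔ k = i := by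
    intro i
    obtain ⟨a, ha, ha'⟩ := exists_rat_btwn (hr (Nat.lt_succ_self i))
    obtain ⟨b, hb, hb'⟩ : ∃ b : ℚ, r i < b ∧ ∀ k < i, (b : ℝ) < r k := by
      rcases Nat.eq_zero_or_pos i with rfl | hi
      · obtain ⟨b, hb⟩ := exists_rat_gt (r 0)
        exact ⟨b, hb, fun k hk => absurd hk (Nat.not_lt_zero k)⟩
      · obtain ⟨b, hb, hb'⟩ := exists_rat_btwn (hr (Nat.sub_lt hi one_pos))
        exact ⟨b, hb, fun k hk => hb'.trans_le (hr.antitone (by omega))⟩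
    refine ⟨(a, b), ?_, fun k => ⟨fun hk => ?_, ?_⟩⟩
    · exact_mod_cast (h0 _).trans ha
    · rcases lt_trichotomy k i with h2 | h2 | h2
      · exact absurd hk.2 (hb' k h2).not_gt
      · exact h2
      · exact absurd (hk.1.trans_le (hr.antitone h2)) ha.not_gt
    · rintro rfl
      exact ⟨ha', hb⟩
  choose q hq hq' using h1
  exact ⟨fun i => q i, fun i => hq i, fun i => hq' i⟩

/-- The function that is equal to `e^{-r/2} f i` on the `i`-th band and to `e^{-r/2} h` off the
bands. -/
def bandFun (𝕜 : Type*) [RCLike 𝕜] {H : Type*} [NormedAddCommGroup H] [InnerProductSpace 𝕜 H]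
    (h : Metric.sphere (0 : H) 1) (X : Type*) {n : ℕ} (f : ℕ → H) (q : Fin n → ℚ × ℚ)
    (z : X × PosReal) : H :=
  ((Real.exp (-(z.2 : ℝ) / 2) : ℝ) : 𝕜) • ((h : H) + ∑ i,
    {r : PosReal | ((q i).1 : ℝ) < r ∧ (r : ℝ) < (q i).2}.indicator (fun _ => f i - h) z.2)

omit [StandardBorelSpace X] [NullSingletonClass m] in
theorem exists_isAdmissible_bandFun {n : ℕ} (f : ℕ → H) {q : Fin n → ℚ × ℚ}
    (hq : ∀ i, 0 < (q i).1) :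
    ∃ V : Lp (SpecialSpace H) 2 m, IsAdmissible 𝕜 h (bandFun 𝕜 h X f q) V := by
  set B : Fin n → Set PosReal := fun i => {r : PosReal | ((q i).1 : ℝ) < r ∧ (r : ℝ) < (q i).2}
    with hB
  have hBm : ∀ i, MeasurableSet (B i) := fun i =>
    (measurableSet_lt measurable_const measurable_subtype_coe).inter
      (measurableSet_lt measurable_subtype_coe measurable_const)
  have h1 : ∀ z : X × PosReal, bandFun 𝕜 h X f q z - expSection (𝕜 := 𝕜) h z.2
      = ((Real.exp (-(z.2 : ℝ) / 2) : ℝ) : 𝕜) • ∑ i, (B i).indicator (fun _ => f i - h) z.2 := by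
    intro z
    rw [bandFun, expSection, smul_add, add_sub_cancel_left]
  simp only [IsAdmissible, h1]
  refine exists_isGood_of_norm_le 𝕜 (C := ∑ i, ((q i).1 : ℝ)⁻¹ * ‖f i - h‖) ?_ fun z => ?_
  · refine StronglyMeasurable.comp_measurable (g := fun z : X × PosReal => z.2)
      (f := fun r : PosReal => ((Real.exp (-(r : ℝ) / 2) : ℝ) : 𝕜) •
        ∑ i, (B i).indicator (fun _ => f i - h) r) ?_ measurable_snd
    refine StronglyMeasurable.smul (RCLike.continuous_ofReal.comp_stronglyMeasurable
      (Continuous.stronglyMeasurable (by fun_prop))) ?_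
    exact Finset.stronglyMeasurable_fun_sum _ fun i _ =>
      stronglyMeasurable_const.indicator (hBm i)
  · have hz := z.2.2
    rw [norm_smul, RCLike.norm_ofReal, abs_of_pos (Real.exp_pos _), mul_comm, ← mul_assoc]
    refine mul_le_mul_of_nonneg_right ?_ (Real.exp_pos _).le
    rw [mul_comm]
    refine (norm_sum_le _ _).trans ?_
    rw [Finset.mul_sum]
    refine Finset.sum_le_sum fun i _ => ?_
    have hqi : (0 : ℝ) < (q i).1 := by exact_mod_cast hq i
    by_cases hzi : z.2 ∈ B i
    · rw [Set.indicator_of_mem hzi, ← mul_assoc, ← div_eq_mul_inv]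
      exact le_mul_of_one_le_left (norm_nonneg _) ((one_le_div hqi).2 hzi.1.le)
    · rw [Set.indicator_of_notMem hzi, norm_zero]
      positivity

/-- For almost every `ξ` some band function with rational ends takes the value `e^{-rₖ/2} fₖ` at the
`k`-th atom for all `k`, so its coherent section is a multiple of `⊗ₖ fₖ` at `ξ`. -/
theorem inner_tens_ae_eq_zero {F : IntSpace 𝕜 h (coneMeasure m)}
    (hF : ∀ (u : X × PosReal → H) (V : Lp (SpecialSpace H) 2 m) (hu : IsAdmissible 𝕜 h u V),
      inner 𝕜 hu.coherentLp F = 0) (f : StabFamily ℕ h) :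
    ∀ᵐ ξ ∂coneMeasure m, inner 𝕜 (StabTensor.tens 𝕜 h f) (F ξ) = 0 := by
  obtain ⟨n, hn⟩ : ∃ n, ∀ i, n ≤ i → f.val i = h := by
    obtain ⟨n, hn⟩ := f.finite.bddAbove
    exact ⟨n + 1, fun i hi => by
      by_contra h'
      have := hn h'
      omega⟩
  have h1 : ∀ᵐ ξ ∂coneMeasure m, ∀ q : {q : Fin n → ℚ × ℚ // ∀ i, 0 < (q i).1},
      inner 𝕜 (coherent 𝕜 h (bandFun 𝕜 h X f.val q.1) ξ) (F ξ) = 0 := by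
    refine ae_all_iff.2 fun q => ?_
    obtain ⟨V, hV⟩ := exists_isAdmissible_bandFun (𝕜 := 𝕜) (h := h) (m := m) f.val q.2
    exact hV.inner_coherent_ae_eq_zero hF
  rw [ae_coneMeasure_iff] at h1 ⊢
  filter_upwards [h1] with z h2 hz
  obtain ⟨q, hq, hq'⟩ := exists_bands hz.1 (fun k => (z k).2.2) n
  have h3 := h2 hz ⟨q, hq⟩
  have h4 : ∀ k, bandFun 𝕜 h X f.val q (z k)
      = ((Real.exp (-((z k).2 : ℝ) / 2) : ℝ) : 𝕜) • f.val k := by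
    intro k
    rw [bandFun]
    congr 1
    have h5 : ∀ i : Fin n, {r : PosReal | ((q i).1 : ℝ) < r ∧ (r : ℝ) < (q i).2}.indicator
        (fun _ => f.val i - (h : H)) (z k).2 = if k = i then f.val k - h else 0 := fun i => by
      by_cases hki : k = i
      · rw [Set.indicator_of_mem (by exact (hq' i k).2 hki), if_pos hki, hki]
      · have h9 : (z k).2 ∉ {r : PosReal | ((q i).1 : ℝ) < r ∧ (r : ℝ) < (q i).2} := fun h' =>
          hki ((hq' i k).1 h')
        rw [Set.indicator_of_notMem h9, if_neg hki]
    simp only [h5]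
    by_cases hk : k < n
    · rw [Finset.sum_eq_single_of_mem ⟨k, hk⟩ (Finset.mem_univ _)]
      · simp
      · intro i _ hi
        have h9 : k ≠ i := fun h' => hi (Fin.ext h'.symm)
        exact if_neg h9
    · rw [Finset.sum_eq_zero, hn k (not_lt.1 hk), add_zero]
      intro i _
      have h9 : k ≠ i := fun h' => hk (h'.trans_lt i.2)
      exact if_neg h9
  have h6 : HasProd (fun k => ((Real.exp (-((z k).2 : ℝ) / 2) : ℝ) : 𝕜))
      (((Real.exp (∑' k, -((z k).2 : ℝ) / 2)) : ℝ) : 𝕜) :=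
    ((hz.2.2.neg.div_const 2).hasSum.rexp).map (algebraMap ℝ 𝕜) RCLike.continuous_ofReal
  have h7 : Summable fun k => ‖f.val k - h‖ := by
    refine summable_of_hasFiniteSupport (f.finite.subset fun k hk h' => ?_)
    exact hk (by simp [h'])
  rw [coherent_toCone] at h3
  simp only [h4] at h3
  rw [StabTensor.tensInf_smul 𝕜 h h6 h7, StabTensor.tensInf_val, inner_smul_left,
    mul_eq_zero] at h3
  refine h3.resolve_left fun h8 => ?_
  rw [RCLike.conj_ofReal, RCLike.ofReal_eq_zero] at h8
  exact (Real.exp_pos _).ne' h8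

/-- The coherent sections are total in the space of the integral model. -/
theorem eq_zero_of_inner_coherentLp {F : IntSpace 𝕜 h (coneMeasure m)}
    (hF : ∀ (u : X × PosReal → H) (V : Lp (SpecialSpace H) 2 m) (hu : IsAdmissible 𝕜 h u V),
      inner 𝕜 hu.coherentLp F = 0) : F = 0 := by
  have h1 : ∀ y : StabTensor 𝕜 ℕ h, ∀ᵐ ξ ∂coneMeasure m, inner 𝕜 y (F ξ) = 0 := by
    intro y
    have hy : y ∈ closure ((Submodule.span 𝕜 (Set.range (StabTensor.tens (ι := ℕ) 𝕜 h)) :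
        Submodule 𝕜 (StabTensor 𝕜 ℕ h)) : Set (StabTensor 𝕜 ℕ h)) := by
      rw [← Submodule.topologicalClosure_coe, StabTensor.span_tens]
      trivial
    obtain ⟨x, hx, hxy⟩ := mem_closure_iff_seq_limit.1 hy
    have h2 : ∀ w ∈ Submodule.span 𝕜 (Set.range (StabTensor.tens (ι := ℕ) 𝕜 h)),
        ∀ᵐ ξ ∂coneMeasure m, inner 𝕜 w (F ξ) = 0 := by
      intro w hw
      induction hw using Submodule.span_induction with
      | mem w hw =>
        obtain ⟨f, rfl⟩ := hw
        exact inner_tens_ae_eq_zero hF f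
      | zero => exact Eventually.of_forall fun ξ => inner_zero_left _
      | add w w' _ _ hw hw' =>
        filter_upwards [hw, hw'] with ξ h3 h4
        rw [inner_add_left, h3, h4, add_zero]
      | smul c w _ hw =>
        filter_upwards [hw] with ξ h3
        rw [inner_smul_left, h3, mul_zero]
    filter_upwards [ae_all_iff.2 fun n => h2 _ (hx n)] with ξ h3
    refine tendsto_nhds_unique (hxy.inner tendsto_const_nhds) ?_
    simp only [h3]
    exact tendsto_const_nhds
  rw [Lp.eq_zero_iff_ae_eq_zero]
  refine ae_eq_zero_of_forall_dual_of_isSeparable 𝕜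
    (Lp.stronglyMeasurable F).isSeparable_range (fun c => ?_)
    (Eventually.of_forall fun ξ => Set.mem_range_self ξ)
  filter_upwards [h1 ((InnerProductSpace.toDual 𝕜 _).symm c)] with ξ h2
  simpa using h2

end CoherentTotal

/-! ### The operators of the Fock representation -/

section FockOperator

variable {𝕜 : Type*} [RCLike 𝕜] {E : Type*} [NormedAddCommGroup E] [InnerProductSpace 𝕜 E]

theorem RCLike.exp_add (z w : 𝕜) :
    NormedSpace.exp (z + w) = NormedSpace.exp z * NormedSpace.exp w :=
  NormedSpace.exp_add_of_commute_of_mem_ball (𝕂 := 𝕜) (Commute.all z w)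
    (by rw [NormedSpace.expSeries_radius_eq_top]; simp)
    (by rw [NormedSpace.expSeries_radius_eq_top]; simp)

theorem RCLike.exp_ne_zero (z : 𝕜) : NormedSpace.exp z ≠ 0 := by
  rw [← norm_ne_zero_iff, RCLike.norm_exp]
  exact (Real.exp_pos _).ne'

theorem span_smul_eq_top {I : Type*} {a : I → E} {c : I → 𝕜} (hc : ∀ i, c i ≠ 0)
    (ha : (Submodule.span 𝕜 (Set.range a)).topologicalClosure = ⊤) :
    (Submodule.span 𝕜 (Set.range fun i => c i • a i)).topologicalClosure = ⊤ := by
  rw [eq_top_iff, ← ha]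
  refine Submodule.topologicalClosure_mono (Submodule.span_le.2 ?_)
  rintro _ ⟨i, rfl⟩
  have h1 := Submodule.smul_mem _ (c i)⁻¹
    (Submodule.subset_span (R := 𝕜) (Set.mem_range_self (f := fun i => c i • a i) i))
  rwa [smul_smul, inv_mul_cancel₀ (hc i), one_smul] at h1

variable [CompleteSpace E]

omit [CompleteSpace E] in
theorem inner_exp_smul_expVec (α β : 𝕜) (v w : E) :
    inner 𝕜 (NormedSpace.exp α • expVec 𝕜 v) (NormedSpace.exp β • expVec 𝕜 w)
      = NormedSpace.exp (inner 𝕜 v w + β + (starRingEnd 𝕜) α) := by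
  rw [inner_smul_left, inner_smul_right, inner_expVec, RCLike.conj_exp, ← RCLike.exp_add,
    ← RCLike.exp_add]
  congr 1
  ring

/-- The operator of the Fock representation that corresponds to the motion `v ↦ A v + b`. -/
theorem exists_fockOperator (A : E ≃ₗᵢ[𝕜] E) (b : E) :
    ∃ W : Fock 𝕜 E ≃ₗᵢ[𝕜] Fock 𝕜 E, ∀ v, W (expVec 𝕜 v) =
      NormedSpace.exp (-(((1 / 2) * ‖b‖ ^ 2 : ℝ) : 𝕜) - inner 𝕜 b (A v)) • expVec 𝕜 (A v + b) := by
  refine exists_linearIsometryEquiv_of_gram (span_expVec (d := id) denseRange_id)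
    (span_smul_eq_top (fun v => RCLike.exp_ne_zero _) (span_expVec ?_)) fun v w => ?_
  · exact ((Equiv.addRight b).surjective.comp A.surjective).denseRange
  · rw [inner_exp_smul_expVec, inner_expVec]
    congr 1
    rw [map_sub, map_neg, RCLike.conj_ofReal, inner_conj_symm, inner_add_left, inner_add_right,
      inner_add_right, A.inner_map_map, inner_self_eq_norm_sq_to_K]
    push_cast
    ring

end FockOperator

/-! ### The isomorphism with the Fock space -/

section Intertwiner

variable {𝕜 : Type*} [RCLike 𝕜] {H : Type*} [NormedAddCommGroup H] [InnerProductSpace 𝕜 H]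
  [CompleteSpace H] (h : Metric.sphere (0 : H) 1) {X : Type*} [MeasurableSpace X]
  (m : Measure X) [IsProbabilityMeasure m]

variable (𝕜) in
/-- The index set of the coherent sections. -/
abbrev CoherentIndex : Type _ :=
  {q : (X × PosReal → H) × Lp (SpecialSpace H) 2 m // IsAdmissible 𝕜 h q.1 q.2}

theorem denseRange_coherentIndex :
    DenseRange fun q : CoherentIndex 𝕜 h m => q.1.2 := by
  refine (dense_goodVectors (𝕜 := 𝕜) (H := H) (m := m)).mono ?_
  rintro V ⟨v, hv⟩
  refine ⟨⟨(fun z => v z + expSection (𝕜 := 𝕜) h z.2, V), ?_⟩, rfl⟩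
  simpa only [IsAdmissible, add_sub_cancel_right] using hv

variable [StandardBorelSpace X] [NullSingletonClass m]

theorem span_coherentLp : (Submodule.span 𝕜 (Set.range fun q : CoherentIndex 𝕜 h m =>
    q.2.coherentLp)).topologicalClosure = ⊤ := by
  rw [Submodule.topologicalClosure_eq_top_iff, Submodule.eq_bot_iff]
  intro F hF
  rw [Submodule.mem_orthogonal] at hF
  exact eq_zero_of_inner_coherentLp fun u V hu => hF _ (Submodule.subset_span ⟨⟨(u, V), hu⟩, rfl⟩)

set_option maxHeartbeats 800000 in
/-- The isometric isomorphism of the space of the integral model onto the Fock space: it takes the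
coherent section of `u = f₀ + v` to the multiple `e^{⟨f₀, v⟩} EXP v` of an exponential vector. -/
theorem exists_intertwiner : ∃ J : IntSpace 𝕜 h (coneMeasure m) ≃ₗᵢ[𝕜]
    Fock 𝕜 (Lp (SpecialSpace H) 2 m), ∀ (u : X × PosReal → H) (V : Lp (SpecialSpace H) 2 m)
      (hu : IsAdmissible 𝕜 h u V), J hu.coherentLp =
        NormedSpace.exp (vacuumPairing 𝕜 h m fun z => u z - expSection (𝕜 := 𝕜) h z.2) •
          expVec 𝕜 V := by
  have h1 := span_smul_eq_top (c := fun q : CoherentIndex 𝕜 h m => NormedSpace.exp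
    (vacuumPairing 𝕜 h m fun z => q.1.1 z - expSection (𝕜 := 𝕜) h z.2))
    (fun q => RCLike.exp_ne_zero _) (span_expVec (denseRange_coherentIndex h m))
  have h2 : ∀ q q' : CoherentIndex 𝕜 h m,
      inner 𝕜 (NormedSpace.exp (vacuumPairing 𝕜 h m fun z =>
        q.1.1 z - expSection (𝕜 := 𝕜) h z.2) • expVec 𝕜 q.1.2)
        (NormedSpace.exp (vacuumPairing 𝕜 h m fun z =>
          q'.1.1 z - expSection (𝕜 := 𝕜) h z.2) • expVec 𝕜 q'.1.2)
      = inner 𝕜 q.2.coherentLp q'.2.coherentLp := fun q q' =>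
    (inner_exp_smul_expVec _ _ _ _).trans (q.2.inner_coherentLp q'.2).symm
  have h3 := exists_linearIsometryEquiv_of_gram (span_coherentLp (𝕜 := 𝕜) h m) h1 h2
  obtain ⟨J, hJ⟩ := h3
  exact ⟨J, fun u V hu => hJ ⟨(u, V), hu⟩⟩

end Intertwiner

/-! ### The action of a current on coherent sections -/

section CurrentMotion

variable {𝕜 : Type*} [RCLike 𝕜] {P₀ : Type*} [Group P₀] [TopologicalSpace P₀]
  [IsTopologicalGroup P₀] {φ : PosReal →* MulAut P₀} [IsContinuousAction φ]
  {H : Type*} [NormedAddCommGroup H] [InnerProductSpace 𝕜 H] {T : P₀ →* (H ≃ₗᵢ[𝕜] H)}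
  {X : Type*} [MeasurableSpace X] {m : Measure X} [IsProbabilityMeasure m]

theorem currentAct_mul (p q : CurrentGroup φ X) (u : X × PosReal → H) :
    currentAct T (p * q) u = currentAct T p (currentAct T q u) := by
  funext z
  exact congrFun (specialAct_mul (T := T) (p.1 z.1) (q.1 z.1) fun r => u (z.1, r)) z.2

theorem currentAct_one (u : X × PosReal → H) : currentAct T (1 : CurrentGroup φ X) u = u := by
  funext z
  change T (φ z.2 1) (u (z.1, 1 * z.2)) = u z
  rw [map_one, map_one, one_mul]
  rfl

theorem currentAct_sub (p : CurrentGroup φ X) (u v : X × PosReal → H) (z : X × PosReal) :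
    currentAct T p (fun z => u z - v z) z = currentAct T p u z - currentAct T p v z :=
  map_sub (T (φ z.2 (p.1 z.1).left)) _ _

theorem inner_currentAct (p : CurrentGroup φ X) (u v : X × PosReal → H) (z : X × PosReal) :
    inner 𝕜 (currentAct T p u z) (currentAct T p v z)
      = inner 𝕜 (u (z.1, (p.1 z.1).right * z.2)) (v (z.1, (p.1 z.1).right * z.2)) :=
  (T (φ z.2 (p.1 z.1).left)).inner_map_map _ _

theorem measurePreserving_current (p : CurrentGroup φ X) :
    MeasurePreserving (fun z : X × PosReal => (z.1, (p.1 z.1).right * z.2))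
      (m.prod posHaar) (m.prod posHaar) := by
  refine (MeasurePreserving.id m).skew_product ?_ (Eventually.of_forall fun x =>
    (measurePreserving_posReal_mul (p.1 x).right).map_eq)
  exact continuous_posReal_mul.measurable.comp
    ((p.2.2.1.measurable.comp measurable_fst).prodMk measurable_snd)

theorem integral_current (p : CurrentGroup φ X) {k : X × PosReal → 𝕜}
    (hk : AEStronglyMeasurable k (m.prod posHaar)) :
    ∫ z, k (z.1, (p.1 z.1).right * z.2) ∂(m.prod posHaar) = ∫ z, k z ∂(m.prod posHaar) := by
  have h1 := measurePreserving_current (m := m) p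
  have h2 := integral_map h1.measurable.aemeasurable (f := k) (by rwa [h1.map_eq])
  rw [h1.map_eq] at h2
  exact h2.symm

variable (m) in
theorem integrable_log_right (p : CurrentGroup φ X) :
    Integrable (fun x => Real.log ((p.1 x).right : ℝ)) m := by
  obtain ⟨β, C, hβ, hβ1, hC, hp⟩ := CurrentGroup.exists_bounds p
  have h1 : Measurable fun x => ((p.1 x).right : ℝ) :=
    measurable_subtype_coe.comp p.2.2.1.measurable
  refine Integrable.of_bound h1.log.aestronglyMeasurable (|Real.log β| + |Real.log C|)
    (Eventually.of_forall fun x => ?_)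
  have h2 := Real.log_le_log hβ (hp x).1
  have h3 := Real.log_le_log (p.1 x).right.2 (hp x).2
  rw [Real.norm_eq_abs, abs_le]
  constructor <;> cases abs_cases (Real.log β) <;> cases abs_cases (Real.log C) <;> linarith

variable (m) in
/-- The mean logarithm of the multiplicative part of a current. -/
def meanLog (p : CurrentGroup φ X) : ℝ := ∫ x, Real.log ((p.1 x).right : ℝ) ∂m

theorem meanLog_one : meanLog m (1 : CurrentGroup φ X) = 0 := by
  have h1 : ∀ x, Real.log (((1 : CurrentGroup φ X).1 x).right : ℝ) = 0 := fun x => Real.log_one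
  simp only [meanLog, h1, integral_zero]

theorem meanLog_mul (p q : CurrentGroup φ X) : meanLog m (p * q) = meanLog m p + meanLog m q := by
  rw [meanLog, meanLog, meanLog,
    ← integral_add (integrable_log_right m p) (integrable_log_right m q)]
  refine integral_congr_ae (Eventually.of_forall fun x => ?_)
  exact Real.log_mul (p.1 x).right.2.ne' (q.1 x).right.2.ne'

variable [CompleteSpace H] [LocallyCompactSpace P₀] (hT : ∀ v : H, Continuous fun g => T g v)
  (h : Metric.sphere (0 : H) 1) (hTh : IsCanonical φ T h) {u : X × PosReal → H}
  {V : Lp (SpecialSpace H) 2 m}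

/-- If `u = f₀ + v`, then `p u = f₀ + (p v + b(p))`: the action of a current on admissible functions
is the affine motion `V ↦ T̃(p) V + b(p)`. -/
theorem IsAdmissible.currentAct (hu : IsAdmissible 𝕜 h u V) (p : CurrentGroup φ X) :
    IsAdmissible 𝕜 h (currentAct T p u)
      (currentRep (𝕜 := 𝕜) hT p V + currentCocycle hT h hTh p) := by
  have h1 := isGood_currentAct hT p (V := V) hu
  have h2 := isGood_currentCocycle (m := m) hT h hTh p
  have h3 : IsGood _ (currentRep (𝕜 := 𝕜) hT p V + currentCocycle hT h hTh p) :=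
    ⟨h1.toIsSlice.add h2.toIsSlice, h1.integrable.add h2.integrable⟩
  rw [IsAdmissible]
  convert h3 using 2 with z
  rw [currentAct_sub, cocycleFun]
  exact (sub_add_sub_cancel _ _ _).symm

variable (𝕜 m) in
/-- The logarithm of the scalar `c(p)` that relates the integral model with the Fock
representation. -/
def phaseExponent (p : CurrentGroup φ X) : 𝕜 :=
  (((1 / 2) * meanLog m p : ℝ) : 𝕜)
    + vacuumPairing 𝕜 h m (fun z => cocycleFun φ T h (p.1 z.1) z.2)
    + (((1 / 2) * ‖currentCocycle (m := m) hT h hTh p‖ ^ 2 : ℝ) : 𝕜)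

/-- Formally `⟨f₀, p v⟩ = ⟨p f₀, p v⟩ - ⟨b(p), p v⟩`, and `p` is isometric. -/
theorem vacuumPairing_currentAct (hu : IsAdmissible 𝕜 h u V) (p : CurrentGroup φ X) :
    vacuumPairing 𝕜 h m (fun z => _root_.currentAct T p u z - expSection (𝕜 := 𝕜) h z.2)
      = vacuumPairing 𝕜 h m (fun z => u z - expSection (𝕜 := 𝕜) h z.2)
        + vacuumPairing 𝕜 h m (fun z => cocycleFun φ T h (p.1 z.1) z.2)
        - inner 𝕜 (currentCocycle hT h hTh p) (currentRep (𝕜 := 𝕜) hT p V) := by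
  set f₀ : X × PosReal → H := fun z => expSection (𝕜 := 𝕜) h z.2 with hf₀
  set v : X × PosReal → H := fun z => u z - f₀ z with hv
  have h1 := isGood_currentAct hT p (V := V) hu
  have h2 := isGood_currentCocycle (m := m) hT h hTh p
  have e1 := h1.integrable_inner_expSection (𝕜 := 𝕜) (h := h)
  have e2 := h2.integrable_inner_expSection (𝕜 := 𝕜) (h := h)
  have e3 := h2.toIsSlice.integrable_inner (𝕜 := 𝕜) h1.toIsSlice
  have e4 := IsGood.integrable_inner_expSection (𝕜 := 𝕜) (h := h) hu
  rw [eq_sub_iff_add_eq, h2.toIsSlice.inner_eq h1.toIsSlice]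
  have h3 : vacuumPairing 𝕜 h m v = ∫ z, (inner 𝕜 (f₀ z) (_root_.currentAct T p v z)
      + inner 𝕜 (cocycleFun φ T h (p.1 z.1) z.2) (_root_.currentAct T p v z))
        ∂(m.prod posHaar) := by
    rw [vacuumPairing, ← integral_current p e4.1]
    refine integral_congr_ae (Eventually.of_forall fun z => ?_)
    have h4 := inner_currentAct (𝕜 := 𝕜) (T := T) p f₀ v z
    simp only
    rw [← inner_add_left]
    refine h4.symm.trans ?_
    congr 1
    exact (add_sub_cancel _ _).symm
  have h5 : vacuumPairing 𝕜 h m (fun z => _root_.currentAct T p u z - f₀ z)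
      = ∫ z, (inner 𝕜 (f₀ z) (_root_.currentAct T p v z)
        + inner 𝕜 (f₀ z) (cocycleFun φ T h (p.1 z.1) z.2)) ∂(m.prod posHaar) := by
    refine integral_congr_ae (Eventually.of_forall fun z => ?_)
    simp only
    rw [← inner_add_right, hv, currentAct_sub, cocycleFun]
    congr 1
    exact (sub_add_sub_cancel _ _ _).symm
  rw [h3, h5, integral_add e1 e3, integral_add e1 e2, vacuumPairing]
  ring

variable [StandardBorelSpace X] [NullSingletonClass m]

/-- The scalars `c(p)` have modulus one: `‖p f₀‖² - ‖f₀‖² = 2 Re ⟨f₀, b(p)⟩ + ‖b(p)‖²`, and the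
integral of the left-hand side, which is `e^{-r₀ r} - e^{-r}`, is that of Frullani. -/
theorem norm_exp_phaseExponent (p : CurrentGroup φ X) :
    ‖NormedSpace.exp (phaseExponent 𝕜 m hT h hTh p)‖ = 1 := by
  rw [RCLike.norm_exp, Real.exp_eq_one_iff, phaseExponent, map_add, map_add, RCLike.ofReal_re,
    RCLike.ofReal_re]
  have h2 := isGood_currentCocycle (m := m) hT h hTh p
  have e2 := h2.integrable_inner_expSection (𝕜 := 𝕜) (h := h)
  have e3 := h2.toIsSlice.integrable_inner (𝕜 := 𝕜) h2.toIsSlice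
  have h1 : Measurable fun x => ((p.1 x).right : ℝ) :=
    measurable_subtype_coe.comp p.2.2.1.measurable
  have h3 := (integral_prod_exp_sub_exp h1 (fun x => (p.1 x).right.2)
    (integrable_log_right m p)).2
  have h4 : ∀ z : X × PosReal, Real.exp (-(((p.1 z.1).right : ℝ) * z.2)) - Real.exp (-(z.2 : ℝ))
      = 2 * RCLike.re (inner 𝕜 (expSection (𝕜 := 𝕜) h z.2) (cocycleFun φ T h (p.1 z.1) z.2))
        + RCLike.re (inner 𝕜 (cocycleFun φ T h (p.1 z.1) z.2)
          (cocycleFun φ T h (p.1 z.1) z.2)) := by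
    intro z
    have h5 := inner_currentAct (𝕜 := 𝕜) (T := T) p
      (fun z => expSection (𝕜 := 𝕜) h z.2) (fun z => expSection (𝕜 := 𝕜) h z.2) z
    have h6 : _root_.currentAct T p (fun z => expSection (𝕜 := 𝕜) h z.2) z
        = expSection (𝕜 := 𝕜) h z.2 + cocycleFun φ T h (p.1 z.1) z.2 :=
      (add_sub_cancel _ _).symm
    rw [h6, inner_expSection_self, inner_add_left, inner_add_right, inner_add_right,
      inner_expSection_self] at h5
    have h7 := congrArg RCLike.re h5
    simp only [map_add, RCLike.ofReal_re] at h7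
    rw [inner_re_symm (cocycleFun φ T h (p.1 z.1) z.2) (expSection (𝕜 := 𝕜) h z.2)] at h7
    have h8 : ((((p.1 z.1).right * z.2 : PosReal) : ℝ)) = ((p.1 z.1).right : ℝ) * z.2 := rfl
    rw [h8] at h7
    linarith
  simp only [h4] at h3
  rw [integral_add (e2.re.const_mul 2) e3.re, integral_const_mul, integral_re e2,
    integral_re e3, ← h2.toIsSlice.inner_eq h2.toIsSlice, ← norm_sq_eq_re_inner] at h3
  rw [vacuumPairing, meanLog]
  linarith

end CurrentMotion

/-! ### The operators of the integral model -/

section IntegralOperators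

variable {𝕜 : Type*} [RCLike 𝕜] {P₀ : Type*} [Group P₀] [TopologicalSpace P₀]
  [IsTopologicalGroup P₀] [LocallyCompactSpace P₀] {φ : PosReal →* MulAut P₀}
  [IsContinuousAction φ] {H : Type*} [NormedAddCommGroup H] [InnerProductSpace 𝕜 H]
  [CompleteSpace H] {T : P₀ →* (H ≃ₗᵢ[𝕜] H)} (hT : ∀ v : H, Continuous fun g => T g v)
  (h : Metric.sphere (0 : H) 1) (hTh : IsCanonical φ T h) {X : Type*} [MeasurableSpace X]
  [StandardBorelSpace X] (m : Measure X) [IsProbabilityMeasure m] [NullSingletonClass m]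

theorem IsAdmissible.coherentLp_congr {m : Measure X} [IsProbabilityMeasure m]
    [NullSingletonClass m] {h : Metric.sphere (0 : H) 1} {u u' : X × PosReal → H}
    {V V' : Lp (SpecialSpace H) 2 m} (hu : IsAdmissible 𝕜 h u V) (hu' : IsAdmissible 𝕜 h u' V')
    (huu' : u = u') : hu.coherentLp = hu'.coherentLp := by
  subst huu'
  rfl

/-- Continuous linear operators that agree on the coherent sections are equal. -/
theorem eq_of_eq_coherentLp {E : Type*} [NormedAddCommGroup E] [InnerProductSpace 𝕜 E]
    [CompleteSpace E] {A B : IntSpace 𝕜 h (coneMeasure m) →ₗᵢ[𝕜] E}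
    (hAB : ∀ (u : X × PosReal → H) (V : Lp (SpecialSpace H) 2 m) (hu : IsAdmissible 𝕜 h u V),
      A hu.coherentLp = B hu.coherentLp) (F : IntSpace 𝕜 h (coneMeasure m)) : A F = B F :=
  eq_of_eqOn_total (span_coherentLp (𝕜 := 𝕜) h m) A.continuous B.continuous
    A.toLinearMap.isLinear B.toLinearMap.isLinear (fun q => hAB q.1.1 q.1.2 q.2) F

/-- Multiplication by a scalar of modulus one. -/
def unitScalar {E : Type*} [NormedAddCommGroup E] [InnerProductSpace 𝕜 E] (c : 𝕜)
    (hc : ‖c‖ = 1) : E →ₗᵢ[𝕜] E where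
  toLinearMap := c • LinearMap.id
  norm_map' x := by simp [norm_smul, hc]

/-- The operators `c(p) J⁻¹ W(p) J`. -/
theorem exists_conjugate {G E F : Type*} [NormedAddCommGroup E] [InnerProductSpace 𝕜 E]
    [NormedAddCommGroup F] [InnerProductSpace 𝕜 F] (J : E ≃ₗᵢ[𝕜] F) (W : G → (F ≃ₗᵢ[𝕜] F))
    {c : G → 𝕜} (hc : ∀ p, ‖c p‖ = 1) :
    ∃ A : G → (E →ₗᵢ[𝕜] E), ∀ p x, J (A p x) = c p • W p (J x) :=
  ⟨fun p => J.symm.toLinearIsometry.comp ((unitScalar (c p) (hc p)).comp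
    ((W p).toLinearIsometry.comp J.toLinearIsometry)), fun _ _ => J.apply_symm_apply _⟩

/-- The action of `c J⁻¹ W J` on a vector that `J` carries to a multiple of an exponential vector.
-/
theorem eq_smul_of_intertwiner {E F : Type*} [NormedAddCommGroup E] [InnerProductSpace 𝕜 E]
    [NormedAddCommGroup F] [InnerProductSpace 𝕜 F] (J : E ≃ₗᵢ[𝕜] F) (W : F ≃ₗᵢ[𝕜] F)
    {x x' y : E} {e e' : F} {c l α α' β : 𝕜} (hy : J y = c • W (J x)) (hx : J x = α • e)
    (hx' : J x' = α' • e') (hW : W e = β • e') (hs : c * α * β = l * α') : y = l • x' := by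
  apply J.injective
  rw [hy, hx, map_smul, map_smul, hW, hx', smul_smul, smul_smul, smul_smul, hs]

set_option maxHeartbeats 1000000 in
/-- The integral model, transferred from the Fock representation: the operators `c(p) J⁻¹ W(p) J`
are multiplicative, because they carry the coherent section of `u` to a multiple of that of
`p u`. -/
theorem exists_integralOperators
    (J : IntSpace 𝕜 h (coneMeasure m) ≃ₗᵢ[𝕜] Fock 𝕜 (Lp (SpecialSpace H) 2 m))
    (hJ : ∀ (u : X × PosReal → H) (V : Lp (SpecialSpace H) 2 m)
      (hu : IsAdmissible 𝕜 h u V), J hu.coherentLp =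
        NormedSpace.exp (vacuumPairing 𝕜 h m fun z => u z - expSection (𝕜 := 𝕜) h z.2) •
          expVec 𝕜 V)
    (W : CurrentGroup φ X → (Fock 𝕜 (Lp (SpecialSpace H) 2 m) ≃ₗᵢ[𝕜]
        Fock 𝕜 (Lp (SpecialSpace H) 2 m)))
    (hW : IsFockRep (φ := φ) (V := SpecialSpace H) (m := m)
      (currentRep (φ := φ) (H := H) (T := T) (m := m) hT)
      (currentCocycle (φ := φ) (H := H) (T := T) (m := m) hT h hTh) W) :
    ∃ U : CurrentGroup φ X →* (IntSpace 𝕜 h (coneMeasure m) ≃ₗᵢ[𝕜]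
        IntSpace 𝕜 h (coneMeasure m)),
      (∀ p F, J (U p F) = NormedSpace.exp (phaseExponent 𝕜 m hT h hTh p) • W p (J F)) ∧
      ∀ (p : CurrentGroup φ X) (u : X × PosReal → H) (V : Lp (SpecialSpace H) 2 m)
        (hu : IsAdmissible 𝕜 h u V), U p hu.coherentLp =
          ((Real.exp ((1 / 2) * meanLog m p) : ℝ) : 𝕜) •
            (hu.currentAct hT h hTh p).coherentLp := by
  obtain ⟨A, hAJ⟩ := exists_conjugate J W (norm_exp_phaseExponent (m := m) hT h hTh)
  have hAc : ∀ (p : CurrentGroup φ X) (u : X × PosReal → H) (V : Lp (SpecialSpace H) 2 m)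
      (hu : IsAdmissible 𝕜 h u V), A p hu.coherentLp =
        ((Real.exp ((1 / 2) * meanLog m p) : ℝ) : 𝕜) •
          (hu.currentAct hT h hTh p).coherentLp := by
    intro p u V hu
    refine eq_smul_of_intertwiner J (W p) (hAJ p _) (hJ u V hu) (hJ _ _ _) (hW p V) ?_
    rw [vacuumPairing_currentAct hT h hTh hu p, ← RCLike.exp_ofReal, ← RCLike.exp_add,
      ← RCLike.exp_add, ← RCLike.exp_add]
    congr 1
    rw [phaseExponent]
    ring
  refine ⟨isometricRep A (fun F => ?_) fun p q F => ?_, hAJ, hAc⟩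
  · refine eq_of_eq_coherentLp h m (B := LinearIsometry.id) (fun u V hu => ?_) F
    rw [hAc, meanLog_one, mul_zero, Real.exp_zero, RCLike.ofReal_one, one_smul]
    exact IsAdmissible.coherentLp_congr _ hu (currentAct_one u)
  · refine eq_of_eq_coherentLp h m (B := (A p).comp (A q)) (fun u V hu => ?_) F
    change A (p * q) hu.coherentLp = A p (A q hu.coherentLp)
    rw [hAc, hAc, map_smul, hAc, smul_smul, ← RCLike.ofReal_mul,
      ← Real.exp_add, meanLog_mul, ← mul_add, add_comm (meanLog m q)]
    congr 1
    exact IsAdmissible.coherentLp_congr _ _ (currentAct_mul p q u)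

end IntegralOperators

/-! ### Coherent sections in the fibres -/

section Fibres

variable {𝕜 : Type*} [RCLike 𝕜] {H : Type*} [NormedAddCommGroup H] [InnerProductSpace 𝕜 H]
  (h : Metric.sphere (0 : H) 1) {X : Type*} [MeasurableSpace X]

open scoped Classical in
/-- The family `x ↦ u(x, ξ{x})` over the atoms of `ξ`, extended by `h` to the other points. -/
def fibreFamily (u : X × PosReal → H) (ξ : AtomicCone X) (x : X) : H :=
  if hx : 0 < ξ.mass x then u (x, ⟨ξ.mass x, hx⟩) else h

theorem extend_atom_toCone [MeasurableSingletonClass X] (u : X × PosReal → H) (z : massSeq X) :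
    Function.extend (toCone z).points (fun k => u ((toCone z).atom k)) (fun _ => (h : H))
      = fibreFamily h u (toCone z) := by
  funext x
  by_cases hx : ∃ k, (toCone z).points k = x
  · obtain ⟨k, rfl⟩ := hx
    have h1 : (toCone z).mass ((toCone z).points k) = (z.1 k).2 := by
      rw [points_toCone, mass_toCone]
    rw [(toCone z).points.injective.extend_apply, fibreFamily,
      dif_pos (by rw [h1]; exact (z.1 k).2.2), AtomicCone.atom]
    rw [dif_pos (by rw [h1]; exact (z.1 k).2.2)]
  · rw [Function.extend_apply' _ _ _ hx, fibreFamily, dif_neg]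
    rw [mass_toCone_eq_zero z fun k hk => hx ⟨k, (points_toCone z k).trans hk⟩]
    exact lt_irrefl 0

theorem summable_extend {ι κ : Type*} (e : ι ↪ κ) {w : ι → H}
    (hw : Summable fun i => ‖w i - h‖) :
    Summable fun j => ‖Function.extend e w (fun _ => (h : H)) j - h‖ := by
  rw [← e.injective.summable_iff fun j hj => ?_]
  · refine hw.congr fun i => ?_
    simp only [Function.comp_apply, e.injective.extend_apply]
  · rw [Function.extend_apply' _ _ _ hj, sub_self, norm_zero]

variable [StandardBorelSpace X] {m : Measure X} [IsProbabilityMeasure m] [NullSingletonClass m]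
  {h} {u : X × PosReal → H} {V : Lp (SpecialSpace H) 2 m}

/-- The value of a coherent section in the fibre over `ξ`, as a tensor over the atoms of `ξ`. -/
theorem IsAdmissible.sectionValue_coherent (hu : IsAdmissible 𝕜 h u V) :
    ∀ᵐ ξ ∂coneMeasure m, (Summable fun x => ‖fibreFamily h u ξ x - h‖) ∧
      sectionValue 𝕜 h (coherent 𝕜 h u) ξ = StabTensor.tensInf 𝕜 h (fibreFamily h u ξ) := by
  rw [ae_coneMeasure_iff]
  filter_upwards [hu.ae_summable] with z h1 hz
  have h2 : Summable fun k => ‖u ((toCone ⟨z, hz⟩).atom k) - h‖ := by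
    simpa only [AtomicCone.atom_toCone] using h1
  rw [← extend_atom_toCone]
  exact ⟨summable_extend h _ h2, StabTensor.reindex_tensInf 𝕜 h _ h2⟩

variable {P₀ : Type*} [Group P₀] [TopologicalSpace P₀] [IsTopologicalGroup P₀]
  {φ : PosReal →* MulAut P₀} [IsContinuousAction φ] {T : P₀ →* (H ≃ₗᵢ[𝕜] H)}

omit [StandardBorelSpace X] in
theorem AtomicCone.mass_scale [MeasurableSingletonClass X] (a : X → PosReal)
    (ha : ∃ C : ℝ, ∀ x, (a x : ℝ) ≤ C) (ξ : AtomicCone X) (x : X) :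
    (ξ.scale a ha).mass x = a x * ξ.mass x := by
  rw [AtomicCone.mass, AtomicCone.scale, AtomicCone.mass,
    withDensity_apply _ (measurableSet_singleton x), lintegral_singleton,
    ENNReal.toReal_mul, ENNReal.toReal_ofReal (a x).2.le]

omit [StandardBorelSpace X] in
/-- The action of a current on the fibres. -/
theorem fibreOp_fibreFamily [MeasurableSingletonClass X] (p : CurrentGroup φ X)
    (u : X × PosReal → H) (ξ : AtomicCone X) (x : X) :
    fibreOp φ T ξ (fun x => (p.1 x).left) x (fibreFamily h u
      (ξ.scale (fun x => (p.1 x).right) (CurrentGroup.right_bounded p)) x)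
      = fibreFamily h (currentAct T p u) ξ x := by
  have h1 := AtomicCone.mass_scale (fun x => (p.1 x).right) (CurrentGroup.right_bounded p) ξ x
  by_cases hx : 0 < ξ.mass x
  · have h2 : 0 < (ξ.scale (fun x => (p.1 x).right) (CurrentGroup.right_bounded p)).mass x := by
      rw [h1]
      exact mul_pos (p.1 x).right.2 hx
    rw [fibreOp, dif_pos hx, fibreFamily, dif_pos h2, fibreFamily, dif_pos hx]
    change _ = T (φ ⟨ξ.mass x, hx⟩ (p.1 x).left) (u (x, (p.1 x).right * ⟨ξ.mass x, hx⟩))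
    congr 3
    exact Subtype.ext h1
  · have h2 : ¬ 0 < (ξ.scale (fun x => (p.1 x).right) (CurrentGroup.right_bounded p)).mass x := by
      rw [h1]
      exact fun h' => hx ((mul_pos_iff_of_pos_left (p.1 x).right.2).1 h')
    rw [fibreOp, dif_neg hx, fibreFamily, dif_neg h2, fibreFamily, dif_neg hx]
    rfl

end Fibres

/-! ### The formula of the integral model -/

section IntegralModel

variable {𝕜 : Type*} [RCLike 𝕜] {P₀ : Type*} [Group P₀] [TopologicalSpace P₀]
  [IsTopologicalGroup P₀] [LocallyCompactSpace P₀] {φ : PosReal →* MulAut P₀}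
  [IsContinuousAction φ] {H : Type*} [NormedAddCommGroup H] [InnerProductSpace 𝕜 H]
  [CompleteSpace H] {T : P₀ →* (H ≃ₗᵢ[𝕜] H)} (hT : ∀ v : H, Continuous fun g => T g v)
  (h : Metric.sphere (0 : H) 1) (hTh : IsCanonical φ T h) {X : Type*} [MeasurableSpace X]
  [StandardBorelSpace X] (m : Measure X) [IsProbabilityMeasure m] [NullSingletonClass m]

theorem quasiMeasurePreserving_scale_current (p : CurrentGroup φ X) :
    Measure.QuasiMeasurePreserving
      (AtomicCone.scale (fun x => (p.1 x).right) (CurrentGroup.right_bounded p))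
      (coneMeasure m) (coneMeasure m) :=
  quasiMeasurePreserving_scale _ _ p.2.2.1.measurable (integrable_log_right m p)

variable (T) {h m} in
/-- The formula of the integral model for a current `p`, an operator `A` and a section `F`. -/
def SatisfiesModel (p : CurrentGroup φ X)
    (A : IntSpace 𝕜 h (coneMeasure m) →ₗᵢ[𝕜] IntSpace 𝕜 h (coneMeasure m))
    (F : IntSpace 𝕜 h (coneMeasure m)) : Prop :=
  ∀ᵐ ξ ∂coneMeasure m, StabTensor.IsTensorImage 𝕜 h (fibreOp φ T ξ fun x => (p.1 x).left)
    (((Real.exp ((1 / 2) * ∫ x, Real.log ((p.1 x).right : ℝ) ∂m) : ℝ) : 𝕜) •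
      sectionValue 𝕜 h F (ξ.scale (fun x => (p.1 x).right) (CurrentGroup.right_bounded p)))
    (sectionValue 𝕜 h (A F) ξ)

variable {h m} {p : CurrentGroup φ X}
  {A : IntSpace 𝕜 h (coneMeasure m) →ₗᵢ[𝕜] IntSpace 𝕜 h (coneMeasure m)}

/-- The formula of the integral model holds on coherent sections. -/
theorem satisfiesModel_coherentLp {u : X × PosReal → H} {V : Lp (SpecialSpace H) 2 m}
    (hu : IsAdmissible 𝕜 h u V)
    (hA : A hu.coherentLp = ((Real.exp ((1 / 2) * meanLog m p) : ℝ) : 𝕜) •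
      (hu.currentAct hT h hTh p).coherentLp) : SatisfiesModel T p A hu.coherentLp := by
  have hqmp := quasiMeasurePreserving_scale_current m p
  have hu' := hu.currentAct hT h hTh p
  filter_upwards [hqmp.ae hu.sectionValue_coherent, hu'.sectionValue_coherent,
    hqmp.ae hu.coeFn_coherentLp, hu'.coeFn_coherentLp, Lp.coeFn_smul
      ((Real.exp ((1 / 2) * meanLog m p) : ℝ) : 𝕜) hu'.coherentLp] with ξ h1 h2 h3 h4 h5
  obtain ⟨h6, h7⟩ := h1
  obtain ⟨h8, h9⟩ := h2
  have h10 := StabTensor.isTensorImage_tensInf 𝕜 h (fibreOp φ T ξ fun x => (p.1 x).left) h6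
    (by simpa only [fibreOp_fibreFamily] using h8)
  simp only [fibreOp_fibreFamily] at h10
  rw [← h7, ← h9] at h10
  have h11 := h10.smul ((Real.exp ((1 / 2) * meanLog m p) : ℝ) : 𝕜)
  have h12 : sectionValue 𝕜 h (A hu.coherentLp) ξ
      = ((Real.exp ((1 / 2) * meanLog m p) : ℝ) : 𝕜)
        • sectionValue 𝕜 h (coherent 𝕜 h (currentAct T p u)) ξ := by
    rw [hA, sectionValue, h5, Pi.smul_apply, h4, map_smul, sectionValue]
  rw [h12, sectionValue, h3]
  exact h11

theorem SatisfiesModel.add {F F' : IntSpace 𝕜 h (coneMeasure m)} (hF : SatisfiesModel T p A F)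
    (hF' : SatisfiesModel T p A F') : SatisfiesModel T p A (F + F') := by
  have hqmp := quasiMeasurePreserving_scale_current m p
  filter_upwards [hF, hF', hqmp.ae (Lp.coeFn_add F F'), Lp.coeFn_add (A F) (A F')]
    with ξ h1 h2 h3 h4
  have h5 := h1.add h2
  rw [map_add, sectionValue, sectionValue, h3, h4, Pi.add_apply, Pi.add_apply, map_add, map_add,
    smul_add]
  exact h5

theorem SatisfiesModel.smul {F : IntSpace 𝕜 h (coneMeasure m)} (hF : SatisfiesModel T p A F)
    (c : 𝕜) : SatisfiesModel T p A (c • F) := by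
  have hqmp := quasiMeasurePreserving_scale_current m p
  filter_upwards [hF, hqmp.ae (Lp.coeFn_smul c F), Lp.coeFn_smul c (A F)] with ξ h1 h3 h4
  have h5 := h1.smul c
  rw [map_smul, sectionValue, sectionValue, h3, h4, Pi.smul_apply, Pi.smul_apply, map_smul,
    map_smul, smul_comm]
  exact h5

/-- The formula of the integral model is preserved by limits, as a subsequence converges almost
everywhere. -/
theorem SatisfiesModel.of_tendsto {F : ℕ → IntSpace 𝕜 h (coneMeasure m)}
    {F₀ : IntSpace 𝕜 h (coneMeasure m)} (hF : ∀ n, SatisfiesModel T p A (F n))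
    (hlim : Tendsto F atTop (𝓝 F₀)) : SatisfiesModel T p A F₀ := by
  have hqmp := quasiMeasurePreserving_scale_current m p
  obtain ⟨ns, hns, hns'⟩ := (tendstoInMeasure_of_tendsto_Lp hlim).exists_seq_tendsto_ae
  obtain ⟨ks, hks, hks'⟩ := (tendstoInMeasure_of_tendsto_Lp
    (((A.continuous.tendsto F₀).comp hlim).comp hns.tendsto_atTop)).exists_seq_tendsto_ae
  filter_upwards [ae_all_iff.2 hF, hqmp.ae hns', hks'] with ξ h1 h2 h3
  refine StabTensor.IsTensorImage.of_tendsto (fun n => h1 (ns (ks n))) ?_ ?_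
  · exact (((StabTensor.reindex 𝕜 h _).continuous.tendsto _).comp
      (h2.comp hks.tendsto_atTop)).const_smul _
  · exact ((StabTensor.reindex 𝕜 h _).continuous.tendsto _).comp h3

theorem satisfiesModel_of_coherentLp
    (hA : ∀ (u : X × PosReal → H) (V : Lp (SpecialSpace H) 2 m) (hu : IsAdmissible 𝕜 h u V),
      A hu.coherentLp = ((Real.exp ((1 / 2) * meanLog m p) : ℝ) : 𝕜) •
        (hu.currentAct hT h hTh p).coherentLp) (F : IntSpace 𝕜 h (coneMeasure m)) :
    SatisfiesModel T p A F := by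
  have h1 : ∀ F ∈ Submodule.span 𝕜 (Set.range fun q : CoherentIndex 𝕜 h m => q.2.coherentLp),
      SatisfiesModel T p A F := by
    intro F hF
    induction hF using Submodule.span_induction with
    | mem F hF =>
      obtain ⟨q, rfl⟩ := hF
      exact satisfiesModel_coherentLp hT hTh q.2 (hA _ _ q.2)
    | zero =>
      have hqmp := quasiMeasurePreserving_scale_current m p
      have h2 := Lp.coeFn_zero (StabTensor 𝕜 ℕ h) 2 (coneMeasure m)
      filter_upwards [hqmp.ae h2, h2] with ξ h3 h4
      rw [map_zero, sectionValue, sectionValue, h3, h4]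
      simp [StabTensor.IsTensorImage]
    | add F F' _ _ hF hF' => exact hF.add hF'
    | smul c F _ hF => exact hF.smul c
  have h2 : F ∈ closure ((Submodule.span 𝕜 (Set.range fun q : CoherentIndex 𝕜 h m =>
      q.2.coherentLp) : Submodule 𝕜 (IntSpace 𝕜 h (coneMeasure m))) :
        Set (IntSpace 𝕜 h (coneMeasure m))) := by
    rw [← Submodule.topologicalClosure_coe, span_coherentLp]
    trivial
  obtain ⟨G, hG, hGF⟩ := mem_closure_iff_seq_limit.1 h2
  exact SatisfiesModel.of_tendsto (fun n => h1 _ (hG n)) hGF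

end IntegralModel

end

set_option maxHeartbeats 800000 in
theorem mainTheorem4 {𝕜 : Type*} [RCLike 𝕜]
    {P₀ : Type*} [Group P₀] [TopologicalSpace P₀] [IsTopologicalGroup P₀] [LocallyCompactSpace P₀]
    (φ : PosReal →* MulAut P₀) [IsContinuousAction φ]
    {H : Type*} [NormedAddCommGroup H] [InnerProductSpace 𝕜 H] [CompleteSpace H]
    (T : P₀ →* (H ≃ₗᵢ[𝕜] H)) (hT : ∀ v : H, Continuous fun g => T g v)
    (h : Metric.sphere (0 : H) 1) (hTh : IsCanonical φ T h)
    {X : Type*} [MeasurableSpace X] [StandardBorelSpace X]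
    (m : Measure X) [IsProbabilityMeasure m] [NullSingletonClass m] :
    ∃ 𝓛 : Measure (AtomicCone X),
      (IsInfDimLebesgue m 𝓛 ∧ ∀ 𝓛', IsInfDimLebesgue m 𝓛' → 𝓛' = 𝓛) ∧
    ∃ T' : (P₀ ⋊[φ] PosReal) →* (SpecialSpace H ≃ₗᵢ[𝕜] SpecialSpace H), IsSpecialRep φ T T' ∧
    ∃ b : P₀ ⋊[φ] PosReal → SpecialSpace H, IsExpCocycle φ T h b ∧
    ∃ TX : CurrentGroup φ X →* (Lp (SpecialSpace H) 2 m ≃ₗᵢ[𝕜] Lp (SpecialSpace H) 2 m),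
      IsCurrentRep m T' TX ∧
    ∃ bX : CurrentGroup φ X → Lp (SpecialSpace H) 2 m, IsCurrentCocycle m b bX ∧
    ∃ U : CurrentGroup φ X →* (IntSpace 𝕜 h 𝓛 ≃ₗᵢ[𝕜] IntSpace 𝕜 h 𝓛),
      IsIntegralModel φ T h m 𝓛 U ∧
    ∃ W : CurrentGroup φ X → (Fock 𝕜 (Lp (SpecialSpace H) 2 m) ≃ₗᵢ[𝕜]
        Fock 𝕜 (Lp (SpecialSpace H) 2 m)),
      IsFockRep TX bX W ∧
    ProjectivelyEquivalent 𝕜 U W := by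
  obtain ⟨J, hJ⟩ := exists_intertwiner (𝕜 := 𝕜) h m
  choose W hW using fun p : CurrentGroup φ X => exists_fockOperator
    (currentRep (𝕜 := 𝕜) (m := m) hT p) (currentCocycle (m := m) hT h hTh p)
  have hU' := exists_integralOperators hT h hTh m J hJ W hW
  obtain ⟨U, hUJ, hU⟩ := hU'
  refine ⟨coneMeasure m, ⟨coneMeasure_isInfDimLebesgue, fun 𝓛' h𝓛' =>
    h𝓛'.unique coneMeasure_isInfDimLebesgue⟩, specialRep hT, isSpecialRep_specialRep hT,
    specialCocycle h hT hTh, isExpCocycle_specialCocycle h hT hTh, currentRep hT,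
    isCurrentRep_currentRep m hT, currentCocycle hT h hTh,
    isCurrentCocycle_currentCocycle m hT h hTh, U, fun p F => ?_, W, hW, J, _,
    norm_exp_phaseExponent hT h hTh, hUJ⟩
  exact satisfiesModel_of_coherentLp (A := (U p).toLinearIsometry) hT hTh (hU p) F
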